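/- **Conventions.** Let $\mathbb K=\mathbb R$ or $\mathbb C$. A *clctvs* is a complete Hausdorff locally convex topological $\mathbb K$-vector space, and $\hat\otimes$ is the completed projective tensor product. A graded clctvs $V$ is a $\mathbb Z$-indexed family $(V^n)$ of clctvs, identified with its total space $\prod_n V^n$ (product topology); $(V\hat\otimes W)^n=\prod_{a+b=n}V^a\hat\otimes W^b$. The shift is $(M[n])^k=M^{k-n}$, with differential multiplied by $(-1)^n$. A *clct dg-algebra* $A$ is a unital dg-algebra in complexes of clctvs (differential of degree $1$, continuous multiplication $A\hat\otimes A\to A$); clct dg-modules are defined in the same way. Put $A^e=A^{op}\hat\otimes A$; a right $A^e$-module $M$ is the same thing as an $A$-bimodule, via $x\cdot(a\otimes b)=(-1)^{|a||x|}axb$. The *contraderived category* $\mathrm D^{ctr}(B)$ of a clct dg-algebra $B$ is the Verdier quotient of the homotopy category $H^0(B\text{-Mod})$ of clct right dg-modules by the smallest thick triangulated subcategory that is closed under products and contains the totalizations of those short sequences $0\to M_1\to M_2\to M_3\to 0$ of closed degree-$0$ maps which split by continuous $\mathbb K$-linear maps of degree $0$. Let $\bar A=A/\mathbb K\cdot 1$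 and let $s\bar A$ be its suspension ($|sa|=|a|-1$). Put $\mathrm{Bar}_n(A)=A\hat\otimes(s\bar A)^{\hat\otimes n}\hat\otimes A$ ($n\ge 0$), and let $\mathrm{Bar}_{red}(A)=\prod_{n\ge 0}\mathrm{Bar}_n(A)$ be the product totalization with the bar differential (internal differentials plus multiplications of neighbouring factors, with Koszul signs). Multiplication on $\mathrm{Bar}_0(A)=A\hat\otimes A$ gives the augmentation $\varepsilon:\mathrm{Bar}_{red}(A)\to A$. The *continuous Hochschild complex* is $$\mathrm{HC}_{cont}(A,A)=\mathrm{Hom}_{A^e}(\mathrm{Bar}_{red}(A),A)[-1],\qquad \mathrm{HC}^N_{cont}(A,A)=\mathrm{Hom}^{N+1}_{A^e}(\mathrm{Bar}_{red}(A),A),$$ where $\mathrm{Hom}^{m}_{A^e}$ is the space of continuous $A^e$-linear maps of degree $m$. Let $\mathrm{HC}^{\Pi}(A,A)$ and $\mathrm{HC}^{\oplus}(A,A)$ be the direct product and direct sum totalizations of the complexes $\mathrm{Hom}_{A^e}(\mathrm{Bar}_n(A),A)[-1]$, $n\ge0$: in degree $N$ they consist of all families, respectively all finite families, $(f_n)_{n\ge0}$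 with $f_n\in\mathrm{Hom}^{N+1}_{A^e}(\mathrm{Bar}_n(A),A)$. Such a family is viewed as a family of multilinear maps by $f(a_1,\dots,a_n)=f_n(1\otimes sa_1\otimes\dots\otimes sa_n\otimes 1)$. A *$B_\infty$-algebra structure* on a graded vector space $V$ (graded as the already shifted space) is a differential of degree $1$ and an associative multiplication of degree $0$ on the tensor coalgebra $T^c(V)=\bigoplus_k V^{\otimes k}$ (deconcatenation coproduct) which, with the usual counit and with unit $1\in V^{\otimes0}$, make it a dg-bialgebra. A degree-$0$ linear map $V\to V'$ is a (strict) *morphism* if the induced map $T^c(V)\to T^c(V')$ is a morphism of dg-bialgebras. For $f,g_1,\dots,g_k$ in $\mathrm{HC}^\Pi(A,A)$ the *brace* is $$f\{g_1,\dots,g_k\}(x)=\sum\pm f(u_0,g_1(v_1),u_1,\dots,g_k(v_k),u_k),$$ where the sum is over all ways to write the word $x$ as a concatenation $u_0v_1u_1\cdots v_ku_k$, and the signs are the Koszul signs for the degrees $|a|-1$ on $A$ and for the degrees of the $g_i$ in $\mathrm{HC}$. The same formula is used with the degree-one operation $b$ given by $b(a)=-da$ and $b(a_1,a_2)=-(-1)^{|a_1|}a_1a_2$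 (all other components being zero) in place of $f$ or of $g_1$. **Theorem.** Let $A$ be a clct dg-algebra over $\mathbb K$. 1. The space $\mathrm{HC}^\Pi(A,A)$ is a $B_\infty$-algebra, in which the components with values in $\mathrm{HC}^\Pi(A,A)$ of the structure maps are as follows. The differential has the components $$f\mapsto b\{f\}-(-1)^{|f|}f\{b\},\qquad f\otimes g\mapsto b\{f,g\},$$ and no components on longer tensors; the multiplication has the components $f\otimes(g_1\otimes\dots\otimes g_k)\mapsto f\{g_1,\dots,g_k\}$, and its components on $V^{\otimes p}\otimes V^{\otimes q}$ ($V=\mathrm{HC}^\Pi(A,A)$) with $p\ge2$, $q\ge1$ vanish. Restriction of maps to the terms $\mathrm{Bar}_n(A)$ defines an injection $\mathrm{HC}_{cont}(A,A)\to\mathrm{HC}^\Pi(A,A)$, and the inclusion of $\mathrm{HC}^\oplus(A,A)$ into $\mathrm{HC}^\Pi(A,A)$ factors through it. The spaces $\mathrm{HC}_{cont}(A,A)$ and $\mathrm{HC}^\oplus(A,A)$ carry $B_\infty$-structures for which both inclusions $$\mathrm{HC}^{\oplus}(A,A)\hookrightarrow\mathrm{HC}_{cont}(A,A)\hookrightarrow\mathrm{HC}^{\Pi}(A,A)$$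 are morphisms of $B_\infty$-algebras. On $\mathrm{HC}_{cont}(A,A)$ the linear component of the differential is the differential of the complex $\mathrm{Hom}_{A^e}(\mathrm{Bar}_{red}(A),A)[-1]$. In particular, $\mathrm{HC}_{cont}(A,A)$ with this differential and with the bracket $[f,g]=f\{g\}-(-1)^{|f||g|}g\{f\}$ is a dg-Lie algebra. 2. The augmentation $\varepsilon$ is an isomorphism in $\mathrm D^{ctr}(A^e)$, and for every $n\in\mathbb Z$ there is a $\mathbb K$-linear isomorphism $$H^{n-1}(\mathrm{HC}_{cont}(A,A))=H^{n}(\mathrm{Hom}_{A^e}(\mathrm{Bar}_{red}(A),A))\;\cong\;\mathrm{Hom}_{\mathrm D^{ctr}(A^e)}(A[n],A),$$ which sends the class of a cocycle $f$, viewed as a closed map $\mathrm{Bar}_{red}(A)[n]\to A$, to $f\circ\varepsilon[n]^{-1}$. -/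

import Mathlib

open Topology Filter UniformSpace
open scoped TensorProduct DirectSum

noncomputable section

set_option linter.unusedSectionVars false

namespace CtrHoch

universe u v

/-! ### Seminorms on locally convex spaces -/

section Seminorms

variable {𝕜 : Type} [RCLike 𝕜]

theorem ball_mem_nhds {E : Type*} [AddCommGroup E] [Module 𝕜 E] [TopologicalSpace E]
    {p : Seminorm 𝕜 E} (hp : Continuous p) {c : ℝ} (hc : 0 < c) : {x | p x < c} ∈ 𝓝 (0 : E) :=
  (isOpen_lt hp continuous_const).mem_nhds (by simpa using hc)

variable (𝕜) in
theorem exists_seminorm {E : Type*} [AddCommGroup E] [Module 𝕜 E] [TopologicalSpace E]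
    [PolynormableSpace 𝕜 E] {U : Set E} (hU : U ∈ 𝓝 (0 : E)) :
    ∃ p : Seminorm 𝕜 E, Continuous p ∧ ∀ x, p x < 1 → x ∈ U := by
  have hw := PolynormableSpace.withSeminorms 𝕜 E
  have := hw.topologicalAddGroup
  have := hw.continuousSMul
  obtain ⟨⟨s, r⟩, hr, h⟩ := hw.hasBasis_zero_ball.mem_iff.1 hU
  simp only at hr h
  let P : SeminormFamily 𝕜 E {p : Seminorm 𝕜 E // Continuous p} := fun p => p.1
  set p₀ : Seminorm 𝕜 E := s.sup P with hp₀
  have hc : Continuous p₀ := by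
    refine Seminorm.continuous (r := r) ?_
    exact hw.hasBasis_zero_ball.mem_of_mem (i := (s, r)) hr
  let c : NNReal := ⟨r⁻¹, (inv_pos.2 hr).le⟩
  refine ⟨c • p₀, ?_, fun x hx => h ?_⟩
  · exact (continuous_const.mul hc : Continuous fun x => r⁻¹ * p₀ x)
  · rw [Seminorm.mem_ball_zero]
    change r⁻¹ * p₀ x < 1 at hx
    rwa [inv_mul_lt_iff₀ hr, mul_one] at hx

theorem polynormable_of {E : Type*} [AddCommGroup E] [Module 𝕜 E] [TopologicalSpace E]
    [IsTopologicalAddGroup E]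
    (h : ∀ U ∈ 𝓝 (0 : E), ∃ p : Seminorm 𝕜 E, Continuous p ∧ ∀ x, p x < 1 → x ∈ U) :
    PolynormableSpace 𝕜 E := by
  refine ⟨SeminormFamily.withSeminorms_of_hasBasis _ ⟨fun U => ⟨fun hU => ?_, ?_⟩⟩⟩
  · obtain ⟨p, hp, hpU⟩ := h U hU
    refine ⟨_, SeminormFamily.basisSets_singleton_mem _ (⟨p, hp⟩ : {p : Seminorm 𝕜 E // Continuous p})
      one_pos, fun x hx => hpU x ?_⟩
    simpa [Seminorm.mem_ball_zero] using hx
  · rintro ⟨V, hV, hVU⟩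
    obtain ⟨s, r, hr, rfl⟩ := (SeminormFamily.basisSets_iff _).1 hV
    refine mem_of_superset ?_ hVU
    rw [id, Seminorm.ball_finset_sup_eq_iInter _ _ _ hr]
    refine (biInter_finset_mem s).2 fun i _ => mem_of_superset (ball_mem_nhds i.2 hr) ?_
    intro x hx
    simpa [Seminorm.mem_ball_zero] using hx

theorem norm_inv_smul {E : Type*} [AddCommGroup E] [Module 𝕜 E] (p : Seminorm 𝕜 E) {s : ℝ}
    (hs : 0 < s) (x : E) : p (((s⁻¹ : ℝ) : 𝕜) • x) = s⁻¹ * p x := by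
  rw [map_smul_eq_mul, RCLike.norm_ofReal, abs_of_pos (inv_pos.2 hs)]

theorem seminorm_eq_zero {E F : Type*} [AddCommGroup E] [Module 𝕜 E] [AddCommGroup F] [Module 𝕜 F]
    (r : Seminorm 𝕜 F) (T : E →ₗ[𝕜] F) (h : ∀ x, r (T x) < 1) (x : E) : r (T x) = 0 := by
  by_contra hne
  have hpos : 0 < r (T x) := lt_of_le_of_ne (apply_nonneg r _) (Ne.symm hne)
  have h2 := h ((((r (T x))⁻¹ : ℝ) : 𝕜) • x)
  rw [map_smul, norm_inv_smul r hpos, inv_mul_cancel₀ hne] at h2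
  exact lt_irrefl _ h2

theorem seminorm_sum_apply {E ι : Type*} [AddCommGroup E] [Module 𝕜 E] (p : ι → Seminorm 𝕜 E)
    (s : Finset ι) (x : E) : (∑ i ∈ s, p i) x = ∑ i ∈ s, p i x := by
  simp

variable {V W Z : Type*} [AddCommGroup V] [Module 𝕜 V] [TopologicalSpace V]
  [PolynormableSpace 𝕜 V] [AddCommGroup W] [Module 𝕜 W] [TopologicalSpace W]
  [PolynormableSpace 𝕜 W] [AddCommGroup Z] [Module 𝕜 Z] [TopologicalSpace Z]

theorem bilin_bound (f : V →ₗ[𝕜] W →ₗ[𝕜] Z) (hf : Continuous fun x : V × W => f x.1 x.2)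
    (r : Seminorm 𝕜 Z) (hr : Continuous r) :
    ∃ (p : Seminorm 𝕜 V) (q : Seminorm 𝕜 W), Continuous p ∧ Continuous q ∧
      ∀ v w, r (f v w) ≤ p v * q w := by
  have hU : {x : V × W | r (f x.1 x.2) < 1} ∈ 𝓝 ((0 : V), (0 : W)) :=
    (isOpen_lt (hr.comp hf) continuous_const).mem_nhds (by simp)
  rw [nhds_prod_eq, mem_prod_iff] at hU
  obtain ⟨U₁, h₁, U₂, h₂, hsub⟩ := hU
  obtain ⟨p, hp, hpU⟩ := exists_seminorm 𝕜 h₁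
  obtain ⟨q, hq, hqU⟩ := exists_seminorm 𝕜 h₂
  refine ⟨p, q, hp, hq, fun v w => ?_⟩
  refine le_of_forall_gt_imp_ge_of_dense fun c hc => ?_
  obtain ⟨s, hs, t, ht, hst⟩ : ∃ s, p v < s ∧ ∃ t, q w < t ∧ s * t ≤ c := by
    have hcont : Tendsto (fun e : ℝ => (p v + e) * (q w + e)) (𝓝[>] 0) (𝓝 (p v * q w)) := by
      have : Continuous fun e : ℝ => (p v + e) * (q w + e) := by fun_prop
      simpa using (this.tendsto 0).mono_left nhdsWithin_le_nhds
    obtain ⟨e, he, hpos⟩ := ((hcont.eventually (gt_mem_nhds hc)).and self_mem_nhdsWithin).exists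
    exact ⟨p v + e, by simpa using hpos, q w + e, by simpa using hpos, he.le⟩
  have hs0 : 0 < s := (apply_nonneg p v).trans_lt hs
  have ht0 : 0 < t := (apply_nonneg q w).trans_lt ht
  have key : r (f (((s⁻¹ : ℝ) : 𝕜) • v) (((t⁻¹ : ℝ) : 𝕜) • w)) < 1 := by
    refine @hsub (_, _) ⟨hpU _ ?_, hqU _ ?_⟩
    · rw [norm_inv_smul p hs0, inv_mul_lt_iff₀ hs0]
      simpa using hs
    · rw [norm_inv_smul q ht0, inv_mul_lt_iff₀ ht0]
      simpa using ht
  rw [map_smul f, LinearMap.smul_apply, map_smul (f v), smul_comm, norm_inv_smul r ht0, norm_inv_smul r hs0,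
    ← mul_assoc, ← mul_inv, inv_mul_lt_iff₀ (mul_pos ht0 hs0), mul_one, mul_comm t s] at key
  exact key.le.trans hst

theorem linear_cont [IsTopologicalAddGroup V] [IsTopologicalAddGroup Z] [PolynormableSpace 𝕜 Z]
    (f : V →ₗ[𝕜] Z)
    (h : ∀ r : Seminorm 𝕜 Z, Continuous r → ∃ p : Seminorm 𝕜 V, Continuous p ∧
      ∀ v, r (f v) ≤ p v) : Continuous f := by
  refine continuous_of_continuousAt_zero f ?_
  rw [ContinuousAt, map_zero]
  intro U hU
  obtain ⟨r, hr, hrU⟩ := exists_seminorm 𝕜 hU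
  obtain ⟨p, hp, hb⟩ := h r hr
  exact mem_map.2 <| mem_of_superset (ball_mem_nhds hp one_pos) fun v hv => hrU _ ((hb v).trans_lt hv)

theorem bilin_cont [IsTopologicalAddGroup V] [IsTopologicalAddGroup W] [IsTopologicalAddGroup Z]
    [PolynormableSpace 𝕜 Z] (f : V →ₗ[𝕜] W →ₗ[𝕜] Z)
    (h : ∀ r : Seminorm 𝕜 Z, Continuous r → ∃ (p : Seminorm 𝕜 V) (q : Seminorm 𝕜 W),
      Continuous p ∧ Continuous q ∧ ∀ v w, r (f v w) ≤ p v * q w) :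
    Continuous fun x : V × W => f x.1 x.2 := by
  rw [continuous_iff_continuousAt]
  rintro ⟨v₀, w₀⟩
  rw [ContinuousAt, ← tendsto_sub_nhds_zero_iff]
  intro U hU
  obtain ⟨r, hr, hrU⟩ := exists_seminorm 𝕜 hU
  obtain ⟨p, q, hp, hq, hb⟩ := h r hr
  have hc : Continuous fun x : V × W =>
      p (x.1 - v₀) * q x.2 + p v₀ * q (x.2 - w₀) := by fun_prop
  have : {x : V × W | p (x.1 - v₀) * q x.2 + p v₀ * q (x.2 - w₀) < 1} ∈ 𝓝 (v₀, w₀) :=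
    (isOpen_lt hc continuous_const).mem_nhds (by simp)
  refine mem_map.2 <| mem_of_superset this fun x hx => hrU _ (lt_of_le_of_lt ?_ hx)
  have e : f x.1 x.2 - f v₀ w₀ = f (x.1 - v₀) x.2 + f v₀ (x.2 - w₀) := by simp
  change r (f x.1 x.2 - f v₀ w₀) ≤ _
  rw [e]
  exact (map_add_le_add r _ _).trans (add_le_add (hb _ _) (hb _ _))

end Seminorms

/-! ### The completed projective tensor product -/

section CompletedTensor

variable {𝕜 : Type} [RCLike 𝕜]

/-- The underlying seminorm `‖t‖ = inf {∑ p vᵢ * q wᵢ | t = ∑ vᵢ ⊗ wᵢ}`. -/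
def projFun {V W : Type*} [AddCommGroup V] [Module 𝕜 V] [AddCommGroup W] [Module 𝕜 W]
    (p : Seminorm 𝕜 V) (q : Seminorm 𝕜 W) (t : V ⊗[𝕜] W) : ℝ :=
  sInf {c : ℝ | ∃ l : List (V × W), (l.map fun x => x.1 ⊗ₜ[𝕜] x.2).sum = t ∧
    c = (l.map fun x => p x.1 * q x.2).sum}

section

variable {V W : Type*} [AddCommGroup V] [Module 𝕜 V] [AddCommGroup W] [Module 𝕜 W]
  (p : Seminorm 𝕜 V) (q : Seminorm 𝕜 W)

theorem list_sum_nonneg (l : List (V × W)) : 0 ≤ (l.map fun x => p x.1 * q x.2).sum :=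
  List.sum_nonneg fun y hy => by
    obtain ⟨x, -, rfl⟩ := List.mem_map.1 hy
    exact mul_nonneg (apply_nonneg _ _) (apply_nonneg _ _)

theorem projFun_le (l : List (V × W)) :
    projFun p q (l.map fun x => x.1 ⊗ₜ[𝕜] x.2).sum ≤ (l.map fun x => p x.1 * q x.2).sum :=
  csInf_le ⟨0, by rintro c ⟨l, -, rfl⟩; exact list_sum_nonneg p q l⟩ ⟨l, rfl, rfl⟩

theorem exists_list (t : V ⊗[𝕜] W) :
    ∃ l : List (V × W), (l.map fun x => x.1 ⊗ₜ[𝕜] x.2).sum = t := by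
  induction t with
  | zero => exact ⟨[], rfl⟩
  | tmul v w => exact ⟨[(v, w)], by simp⟩
  | add x y hx hy =>
    obtain ⟨l, rfl⟩ := hx
    obtain ⟨m, rfl⟩ := hy
    exact ⟨l ++ m, by simp⟩

theorem le_projFun {t : V ⊗[𝕜] W} {c : ℝ}
    (h : ∀ l : List (V × W), (l.map fun x => x.1 ⊗ₜ[𝕜] x.2).sum = t →
      c ≤ (l.map fun x => p x.1 * q x.2).sum) : c ≤ projFun p q t := by
  obtain ⟨l, hl⟩ := exists_list t
  exact le_csInf ⟨_, l, hl, rfl⟩ (by rintro _ ⟨l, hl, rfl⟩; exact h l hl)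

/-- The projective tensor product of two seminorms. -/
def projSeminorm : Seminorm 𝕜 (V ⊗[𝕜] W) :=
  Seminorm.ofSMulLE (projFun p q)
    (le_antisymm (by simpa using projFun_le p q []) (le_projFun p q fun l _ => list_sum_nonneg p q l))
    (fun x y => by
      rw [← sub_le_iff_le_add]
      refine le_projFun p q fun m hm => ?_
      rw [sub_le_comm]
      refine le_projFun p q fun l hl => ?_
      rw [sub_le_iff_le_add, ← hm, ← hl]
      simpa [add_comm] using projFun_le p q (m ++ l))
    (fun r x => by
      by_cases hr : r = 0
      · subst hr
        simpa using projFun_le p q []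
      have hr' : 0 < ‖r‖ := norm_pos_iff.2 hr
      rw [← div_le_iff₀' hr']
      refine le_projFun p q fun l hl => ?_
      rw [div_le_iff₀' hr']
      have := projFun_le p q (l.map fun x => (r • x.1, x.2))
      rw [List.map_map, List.map_map] at this
      have e₁ : r • x = (l.map ((fun x => x.1 ⊗ₜ[𝕜] x.2) ∘ fun x => (r • x.1, x.2))).sum := by
        rw [← hl, List.smul_sum, List.map_map]
        rfl
      have e₂ : ‖r‖ * (l.map fun x => p x.1 * q x.2).sum =
          (l.map ((fun x => p x.1 * q x.2) ∘ fun x => (r • x.1, x.2))).sum := by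
        rw [← List.sum_map_mul_left]
        congr 1
        refine List.map_congr_left fun x _ => ?_
        simp [map_smul_eq_mul, mul_assoc]
      rw [e₁, e₂]
      exact this)

theorem projSeminorm_tmul_le (v : V) (w : W) : projSeminorm p q (v ⊗ₜ w) ≤ p v * q w := by
  have : projFun p q (v ⊗ₜ w) ≤ p v * q w := by simpa using projFun_le p q [(v, w)]
  exact this

theorem le_projSeminorm {Z : Type*} [AddCommGroup Z] [Module 𝕜 Z] (r : Seminorm 𝕜 Z)
    (f : V ⊗[𝕜] W →ₗ[𝕜] Z) {C : ℝ} (hC : 0 ≤ C) (h : ∀ v w, r (f (v ⊗ₜ w)) ≤ C * (p v * q w))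
    (t : V ⊗[𝕜] W) : r (f t) ≤ C * projSeminorm p q t := by
  have key : ∀ l : List (V × W), r (f (l.map fun x => x.1 ⊗ₜ[𝕜] x.2).sum) ≤
      C * (l.map fun x => p x.1 * q x.2).sum := by
    intro l
    induction l with
    | nil => simp
    | cons x l ih =>
      simp only [List.map_cons, List.sum_cons, map_add, mul_add]
      exact (map_add_le_add r _ _).trans (add_le_add (h _ _) ih)
  rcases hC.eq_or_lt with rfl | hC
  · obtain ⟨l, rfl⟩ := exists_list t
    simpa using key l
  rw [← div_le_iff₀' hC]
  refine le_projFun p q fun l hl => ?_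
  rw [div_le_iff₀' hC, ← hl]
  exact key l

end

variable (𝕜) (V W : Type u) [AddCommGroup V] [Module 𝕜 V] [TopologicalSpace V]
  [AddCommGroup W] [Module 𝕜 W] [TopologicalSpace W]

/-- The algebraic tensor product, to be endowed with the projective topology. -/
def PT : Type u := V ⊗[𝕜] W

instance : AddCommGroup (PT 𝕜 V W) := inferInstanceAs (AddCommGroup (V ⊗[𝕜] W))
instance : Module 𝕜 (PT 𝕜 V W) := inferInstanceAs (Module 𝕜 (V ⊗[𝕜] W))

/-- The seminorms defining the projective topology: `p ⊗ q` for continuous seminorms `p`, `q`. -/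
def ptFamily : SeminormFamily 𝕜 (PT 𝕜 V W)
    ({p : Seminorm 𝕜 V // Continuous p} × {q : Seminorm 𝕜 W // Continuous q}) :=
  fun x => projSeminorm x.1.1 x.2.1

instance : TopologicalSpace (PT 𝕜 V W) := (ptFamily 𝕜 V W).moduleFilterBasis.topology

theorem pt_withSeminorms : WithSeminorms (ptFamily 𝕜 V W) := ⟨rfl⟩

instance : IsTopologicalAddGroup (PT 𝕜 V W) := (pt_withSeminorms 𝕜 V W).topologicalAddGroup
instance : ContinuousSMul 𝕜 (PT 𝕜 V W) := (pt_withSeminorms 𝕜 V W).continuousSMul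
instance : PolynormableSpace 𝕜 (PT 𝕜 V W) := (pt_withSeminorms 𝕜 V W).toPolynormableSpace
instance : UniformSpace (PT 𝕜 V W) := IsTopologicalAddGroup.rightUniformSpace _
instance : IsUniformAddGroup (PT 𝕜 V W) := isUniformAddGroup_of_addCommGroup
instance : UniformContinuousConstSMul 𝕜 (PT 𝕜 V W) :=
  uniformContinuousConstSMul_of_continuousConstSMul 𝕜 (PT 𝕜 V W)

/-- The completed projective tensor product `V ⊗̂ W`. -/
def CT : Type u := Completion (PT 𝕜 V W)

instance : AddCommGroup (CT 𝕜 V W) := inferInstanceAs (AddCommGroup (Completion (PT 𝕜 V W)))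
instance : UniformSpace (CT 𝕜 V W) := inferInstanceAs (UniformSpace (Completion (PT 𝕜 V W)))
instance : IsUniformAddGroup (CT 𝕜 V W) := inferInstanceAs (IsUniformAddGroup (Completion (PT 𝕜 V W)))
instance : Module 𝕜 (CT 𝕜 V W) := inferInstanceAs (Module 𝕜 (Completion (PT 𝕜 V W)))
instance : CompleteSpace (CT 𝕜 V W) := inferInstanceAs (CompleteSpace (Completion (PT 𝕜 V W)))
instance : T2Space (CT 𝕜 V W) := inferInstanceAs (T2Space (Completion (PT 𝕜 V W)))
instance : ContinuousConstSMul 𝕜 (CT 𝕜 V W) :=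
  inferInstanceAs (ContinuousConstSMul 𝕜 (Completion (PT 𝕜 V W)))

/-- The canonical map into the completion. -/
def toCT : PT 𝕜 V W →L[𝕜] CT 𝕜 V W where
  toFun t := (t : Completion (PT 𝕜 V W))
  map_add' x y := Completion.coe_add x y
  map_smul' c x := Completion.coe_smul c x
  cont := Completion.continuous_coe _

theorem toCT_dense : DenseRange (toCT 𝕜 V W) := Completion.denseRange_coe

theorem toCT_inducing : IsUniformInducing (toCT 𝕜 V W) := Completion.isUniformInducing_coe _

variable {𝕜 V W}

/-- A continuous seminorm extends to the completion. -/
theorem exists_extension (r : Seminorm 𝕜 (PT 𝕜 V W)) (hr : Continuous r) :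
    ∃ R : Seminorm 𝕜 (CT 𝕜 V W), Continuous R ∧ ∀ t, R (toCT 𝕜 V W t) = r t := by
  have hu : UniformContinuous r := Seminorm.uniformContinuous_of_continuousAt_zero hr.continuousAt
  let F : CT 𝕜 V W → ℝ := Completion.extension r
  have hF : Continuous F := Completion.continuous_extension
  have hc : ∀ t, F (toCT 𝕜 V W t) = r t := Completion.extension_coe hu
  have hd := toCT_dense 𝕜 V W
  refine ⟨Seminorm.of F ?_ ?_, hF, hc⟩
  · intro x y
    refine hd.induction_on₂ (p := fun x y => F (x + y) ≤ F x + F y)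
      (isClosed_le (hF.comp continuous_add)
        ((hF.comp continuous_fst).add (hF.comp continuous_snd))) (fun a b => ?_) x y
    rw [← (toCT 𝕜 V W).map_add, hc, hc, hc]
    exact map_add_le_add r a b
  · intro c x
    refine hd.induction_on (p := fun x => F (c • x) = ‖c‖ * F x) x
      (isClosed_eq (hF.comp (continuous_const_smul c)) (continuous_const.mul hF)) (fun a => ?_)
    rw [← (toCT 𝕜 V W).map_smul, hc, hc, map_smul_eq_mul]

instance : PolynormableSpace 𝕜 (CT 𝕜 V W) := by
  refine polynormable_of fun U hU => ?_
  obtain ⟨U', hU', hcl, hsub⟩ := exists_mem_nhds_isClosed_subset hU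
  have h0 : (toCT 𝕜 V W) ⁻¹' U' ∈ 𝓝 (0 : PT 𝕜 V W) :=
    (toCT 𝕜 V W).continuous.continuousAt.preimage_mem_nhds (by simpa using hU')
  obtain ⟨p, hp, hpU⟩ := exists_seminorm 𝕜 h0
  obtain ⟨R, hR, hRp⟩ := exists_extension p hp
  refine ⟨R, hR, fun x hx => hsub ?_⟩
  have hx' : x ∈ closure ({y | R y < 1} ∩ Set.range (toCT 𝕜 V W)) :=
    (toCT_dense 𝕜 V W).open_subset_closure_inter (isOpen_lt hR continuous_const) hx
  refine closure_minimal ?_ hcl hx'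
  rintro _ ⟨hy, t, rfl⟩
  exact hpU t (by rw [← hRp]; exact hy)

instance : ContinuousSMul 𝕜 (CT 𝕜 V W) := (PolynormableSpace.withSeminorms 𝕜 _).continuousSMul

/-- The completed tensor `p ⊗ q` of continuous seminorms, as a continuous seminorm. -/
theorem exists_ctSeminorm (p : Seminorm 𝕜 V) (hp : Continuous p) (q : Seminorm 𝕜 W)
    (hq : Continuous q) : ∃ R : Seminorm 𝕜 (CT 𝕜 V W), Continuous R ∧
      ∀ t : V ⊗[𝕜] W, R (toCT 𝕜 V W t) = projSeminorm p q t :=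
  exists_extension (projSeminorm p q : Seminorm 𝕜 (PT 𝕜 V W))
    ((pt_withSeminorms 𝕜 V W).continuous_seminorm (⟨p, hp⟩, ⟨q, hq⟩))

variable (𝕜) in
/-- The pure tensor `v ⊗ w` in `V ⊗̂ W`, as a bilinear map. -/
def tmₗ : V →ₗ[𝕜] W →ₗ[𝕜] CT 𝕜 V W :=
  (TensorProduct.mk 𝕜 V W).compr₂ ((toCT 𝕜 V W).toLinearMap : V ⊗[𝕜] W →ₗ[𝕜] CT 𝕜 V W)

variable (𝕜) in
/-- The pure tensor `v ⊗ w` in `V ⊗̂ W`. -/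
def tm (v : V) (w : W) : CT 𝕜 V W := tmₗ 𝕜 v w

variable [PolynormableSpace 𝕜 V] [PolynormableSpace 𝕜 W] [IsTopologicalAddGroup V]
  [IsTopologicalAddGroup W]

theorem tm_continuous : Continuous fun x : V × W => tm 𝕜 x.1 x.2 := by
  refine bilin_cont (tmₗ 𝕜) fun r hr => ?_
  obtain ⟨s, C, hC, hb⟩ := Seminorm.bound_of_continuous (pt_withSeminorms 𝕜 V W)
    (r.comp (toCT 𝕜 V W).toLinearMap) (hr.comp (toCT 𝕜 V W).continuous)
  let P : Seminorm 𝕜 V := C • ∑ i ∈ s, i.1.1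
  let Q : Seminorm 𝕜 W := ∑ i ∈ s, i.2.1
  have hP : ∀ v, P v = C * ∑ i ∈ s, i.1.1 v := fun v => by
    simp [P, NNReal.smul_def]
  have hQ : ∀ w, Q w = ∑ i ∈ s, i.2.1 w := fun w => by simp [Q]
  refine ⟨P, Q, ?_, ?_, fun v w => ?_⟩
  · have : (P : V → ℝ) = fun v => C * ∑ i ∈ s, i.1.1 v := funext hP
    rw [this]
    exact continuous_const.mul (continuous_finsetSum _ fun i _ => i.1.2)
  · have : (Q : W → ℝ) = fun w => ∑ i ∈ s, i.2.1 w := funext hQ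
    rw [this]
    exact continuous_finsetSum _ fun i _ => i.2.2
  · refine (hb (v ⊗ₜ[𝕜] w)).trans ?_
    rw [hP, hQ, mul_assoc]
    refine mul_le_mul_of_nonneg_left (a := (C : ℝ)) ?_ C.2
    refine (Seminorm.finset_sup_le_sum (ptFamily 𝕜 V W) s (v ⊗ₜ[𝕜] w)).trans ?_
    refine (seminorm_sum_apply (ptFamily 𝕜 V W) s (v ⊗ₜ[𝕜] w)).trans_le ?_
    rw [Finset.sum_mul]
    refine Finset.sum_le_sum fun i hi => (projSeminorm_tmul_le i.1.1 i.2.1 v w).trans ?_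
    exact mul_le_mul_of_nonneg_left (Finset.single_le_sum (f := fun i => i.2.1 w)
      (fun j _ => apply_nonneg _ _) hi) (apply_nonneg _ _)

/-- Two continuous maps that agree and are additive agree if they do so on pure tensors. -/
theorem ct_ext {Z : Type*} [AddCommGroup Z] [Module 𝕜 Z] [TopologicalSpace Z] [T2Space Z]
    {f g : CT 𝕜 V W →L[𝕜] Z} (h : ∀ v w, f (tm 𝕜 v w) = g (tm 𝕜 v w)) : f = g := by
  ext x
  refine (toCT_dense 𝕜 V W).induction_on (p := fun x => f x = g x) x
    (isClosed_eq f.continuous g.continuous) (fun t => ?_)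
  have : (f.toLinearMap ∘ₗ (toCT 𝕜 V W).toLinearMap : V ⊗[𝕜] W →ₗ[𝕜] Z) =
      g.toLinearMap ∘ₗ (toCT 𝕜 V W).toLinearMap := TensorProduct.ext' h
  exact LinearMap.congr_fun this t

theorem ct_ext_apply {Z : Type*} [AddCommGroup Z] [Module 𝕜 Z] [TopologicalSpace Z] [T2Space Z]
    (f g : CT 𝕜 V W →L[𝕜] Z) (h : ∀ v w, f (tm 𝕜 v w) = g (tm 𝕜 v w)) (x : CT 𝕜 V W) :
    f x = g x := by
  rw [ct_ext h]

section Lift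

variable {Z : Type*} [AddCommGroup Z] [Module 𝕜 Z] [UniformSpace Z] [IsUniformAddGroup Z]
  [ContinuousSMul 𝕜 Z] [PolynormableSpace 𝕜 Z] [CompleteSpace Z] [T2Space Z]

theorem lift_exists (f : V →ₗ[𝕜] W →ₗ[𝕜] Z) (hf : Continuous fun x : V × W => f x.1 x.2) :
    ∃ F : CT 𝕜 V W →L[𝕜] Z, ∀ v w, F (tm 𝕜 v w) = f v w := by
  let g : PT 𝕜 V W →ₗ[𝕜] Z := TensorProduct.lift f
  have hg : Continuous g := by
    refine linear_cont g fun r hr => ?_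
    obtain ⟨p, q, hp, hq, hb⟩ := bilin_bound f hf r hr
    refine ⟨projSeminorm p q, (pt_withSeminorms 𝕜 V W).continuous_seminorm (⟨p, hp⟩, ⟨q, hq⟩),
      fun t => ?_⟩
    have := le_projSeminorm p q r (TensorProduct.lift f) zero_le_one
      (fun v w => by simpa using hb v w) t
    exact this.trans_eq (one_mul _)
  let G : PT 𝕜 V W →L[𝕜] Z := ⟨g, hg⟩
  refine ⟨G.extend (toCT 𝕜 V W), fun v w => ?_⟩
  have := G.extend_eq (toCT_dense 𝕜 V W) (toCT_inducing 𝕜 V W) (v ⊗ₜ[𝕜] w : V ⊗[𝕜] W)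
  exact this.trans (TensorProduct.lift.tmul v w)

/-- The continuous linear map `V ⊗̂ W → Z` induced by a jointly continuous bilinear map. -/
def ctLift (f : V →ₗ[𝕜] W →ₗ[𝕜] Z) (hf : Continuous fun x : V × W => f x.1 x.2) :
    CT 𝕜 V W →L[𝕜] Z := (lift_exists f hf).choose

@[simp] theorem ctLift_tm (f : V →ₗ[𝕜] W →ₗ[𝕜] Z) (hf : Continuous fun x : V × W => f x.1 x.2)
    (v : V) (w : W) : ctLift f hf (tm 𝕜 v w) = f v w := (lift_exists f hf).choose_spec v w

theorem ct_bound (F : CT 𝕜 V W →L[𝕜] Z) (r : Seminorm 𝕜 Z) (hr : Continuous r)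
    (p : Seminorm 𝕜 V) (q : Seminorm 𝕜 W) {R : Seminorm 𝕜 (CT 𝕜 V W)} (hR : Continuous R)
    (hRt : ∀ t : V ⊗[𝕜] W, R (toCT 𝕜 V W t) = projSeminorm p q t) {C : ℝ} (hC : 0 ≤ C)
    (h : ∀ v w, r (F (tm 𝕜 v w)) ≤ C * (p v * q w)) (x : CT 𝕜 V W) : r (F x) ≤ C * R x := by
  refine (toCT_dense 𝕜 V W).induction_on (p := fun x => r (F x) ≤ C * R x) x
    (isClosed_le (hr.comp F.continuous) (continuous_const.mul hR)) (fun t => ?_)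
  have := le_projSeminorm p q r (F.toLinearMap ∘ₗ (toCT 𝕜 V W).toLinearMap : V ⊗[𝕜] W →ₗ[𝕜] Z)
    hC h t
  exact this.trans_eq (congrArg (C * ·) (hRt t).symm)

end Lift

theorem tm_add_left (v v' : V) (w : W) : tm 𝕜 (v + v') w = tm 𝕜 v w + tm 𝕜 v' w := by simp [tm]
theorem tm_add_right (v : V) (w w' : W) : tm 𝕜 v (w + w') = tm 𝕜 v w + tm 𝕜 v w' := by simp [tm]
@[simp] theorem tm_smul_left (c : 𝕜) (v : V) (w : W) : tm 𝕜 (c • v) w = c • tm 𝕜 v w := by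
  simp [tm]
@[simp] theorem tm_smul_right (c : 𝕜) (v : V) (w : W) : tm 𝕜 v (c • w) = c • tm 𝕜 v w := by
  simp [tm]
@[simp] theorem tm_zero_left (w : W) : tm 𝕜 (0 : V) w = 0 := by simp [tm]
@[simp] theorem tm_zero_right (v : V) : tm 𝕜 v (0 : W) = 0 := by simp [tm]
@[simp] theorem tm_neg_left (v : V) (w : W) : tm 𝕜 (-v) w = -tm 𝕜 v w := by simp [tm]
@[simp] theorem tm_neg_right (v : V) (w : W) : tm 𝕜 v (-w) = -tm 𝕜 v w := by simp [tm]
theorem tm_sub_left (v v' : V) (w : W) : tm 𝕜 (v - v') w = tm 𝕜 v w - tm 𝕜 v' w := by simp [tm]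
theorem tm_sub_right (v : V) (w w' : W) : tm 𝕜 v (w - w') = tm 𝕜 v w - tm 𝕜 v w' := by simp [tm]

variable (W) in
/-- `w ↦ v ⊗ w`. -/
def tmL (v : V) : W →L[𝕜] CT 𝕜 V W :=
  ⟨tmₗ 𝕜 v, tm_continuous.comp (Continuous.prodMk_right v)⟩

variable (V) in
/-- `v ↦ v ⊗ w`. -/
def tmR (w : W) : V →L[𝕜] CT 𝕜 V W :=
  ⟨(tmₗ 𝕜).flip w, tm_continuous.comp (Continuous.prodMk_left w)⟩

@[simp] theorem tmL_apply (v : V) (w : W) : tmL (𝕜 := 𝕜) W v w = tm 𝕜 v w := rfl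
@[simp] theorem tmR_apply (v : V) (w : W) : tmR (𝕜 := 𝕜) V w v = tm 𝕜 v w := rfl

section Functoriality

variable {V' W' U : Type u} [AddCommGroup V'] [Module 𝕜 V'] [TopologicalSpace V']
  [PolynormableSpace 𝕜 V'] [IsTopologicalAddGroup V']
  [AddCommGroup W'] [Module 𝕜 W'] [TopologicalSpace W']
  [PolynormableSpace 𝕜 W'] [IsTopologicalAddGroup W']
  [AddCommGroup U] [Module 𝕜 U] [TopologicalSpace U]
  [PolynormableSpace 𝕜 U] [IsTopologicalAddGroup U]

/-- Functoriality of `⊗̂`. -/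
def ctMap (f : V →L[𝕜] V') (g : W →L[𝕜] W') : CT 𝕜 V W →L[𝕜] CT 𝕜 V' W' :=
  ctLift ((tmₗ 𝕜).compl₁₂ f.toLinearMap g.toLinearMap)
    (tm_continuous.comp ((f.continuous.comp continuous_fst).prodMk
      (g.continuous.comp continuous_snd)))

@[simp] theorem ctMap_tm (f : V →L[𝕜] V') (g : W →L[𝕜] W') (v : V) (w : W) :
    ctMap f g (tm 𝕜 v w) = tm 𝕜 (f v) (g w) := ctLift_tm _ _ _ _

variable (𝕜 V W) in
/-- The flip `v ⊗ w ↦ w ⊗ v` (without sign). -/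
def ctComm : CT 𝕜 V W →L[𝕜] CT 𝕜 W V :=
  ctLift (tmₗ 𝕜).flip (tm_continuous.comp continuous_swap)

@[simp] theorem ctComm_tm (v : V) (w : W) : ctComm 𝕜 V W (tm 𝕜 v w) = tm 𝕜 w v :=
  ctLift_tm _ _ _ _

/-- The bilinear map `(V ⊗̂ W) × U → V ⊗̂ (W ⊗̂ U)`. -/
def assocₗ : CT 𝕜 V W →ₗ[𝕜] U →ₗ[𝕜] CT 𝕜 V (CT 𝕜 W U) :=
  LinearMap.mk₂ 𝕜 (fun x u => ctMap (ContinuousLinearMap.id 𝕜 V) (tmR W u) x)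
    (fun x y u => map_add _ x y) (fun c x u => map_smul _ c x)
    (fun x u u' => by
      refine ct_ext_apply (ctMap (ContinuousLinearMap.id 𝕜 V) (tmR W (u + u')))
        (ctMap (ContinuousLinearMap.id 𝕜 V) (tmR W u) +
          ctMap (ContinuousLinearMap.id 𝕜 V) (tmR W u')) (fun v w => ?_) x
      simp [tm_add_right])
    (fun c x u => by
      refine ct_ext_apply (ctMap (ContinuousLinearMap.id 𝕜 V) (tmR W (c • u)))
        (c • ctMap (ContinuousLinearMap.id 𝕜 V) (tmR W u)) (fun v w => ?_) x
      simp)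

variable (𝕜 V W U) in
/-- The associativity isomorphism `(V ⊗̂ W) ⊗̂ U → V ⊗̂ (W ⊗̂ U)`. -/
def ctAssoc : CT 𝕜 (CT 𝕜 V W) U →L[𝕜] CT 𝕜 V (CT 𝕜 W U) :=
  ctLift assocₗ <| bilin_cont _ fun r hr => by
    obtain ⟨p, q, hp, hq, hb⟩ := bilin_bound (tmₗ 𝕜 (V := V) (W := CT 𝕜 W U)) tm_continuous r hr
    obtain ⟨q₁, q₂, hq₁, hq₂, hb'⟩ := bilin_bound (tmₗ 𝕜 (V := W) (W := U)) tm_continuous q hq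
    obtain ⟨R, hR, hRt⟩ := exists_ctSeminorm p hp q₁ hq₁
    refine ⟨R, q₂, hR, hq₂, fun x u => ?_⟩
    rw [mul_comm]
    refine ct_bound (ctMap (ContinuousLinearMap.id 𝕜 V) (tmR W u)) r hr p q₁ hR hRt
      (apply_nonneg q₂ u) (fun v w => ?_) x
    rw [ctMap_tm]
    refine (hb v (tm 𝕜 w u)).trans ?_
    calc p v * q (tm 𝕜 w u) ≤ p v * (q₁ w * q₂ u) :=
          mul_le_mul_of_nonneg_left (hb' w u) (apply_nonneg p v)
      _ = q₂ u * (p v * q₁ w) := by ring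

@[simp] theorem ctAssoc_tm (v : V) (w : W) (u : U) :
    ctAssoc 𝕜 V W U (tm 𝕜 (tm 𝕜 v w) u) = tm 𝕜 v (tm 𝕜 w u) := by
  refine (ctLift_tm _ _ _ _).trans ?_
  exact ctMap_tm _ _ _ _

variable (𝕜 V W U) in
/-- The inverse associativity isomorphism `V ⊗̂ (W ⊗̂ U) → (V ⊗̂ W) ⊗̂ U`. -/
def ctAssocInv : CT 𝕜 V (CT 𝕜 W U) →L[𝕜] CT 𝕜 (CT 𝕜 V W) U :=
  ctComm 𝕜 U (CT 𝕜 V W) ∘L ctMap (ContinuousLinearMap.id 𝕜 U) (ctComm 𝕜 W V) ∘L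
    ctAssoc 𝕜 U W V ∘L ctMap (ctComm 𝕜 W U) (ContinuousLinearMap.id 𝕜 V) ∘L
      ctComm 𝕜 V (CT 𝕜 W U)

@[simp] theorem ctAssocInv_tm (v : V) (w : W) (u : U) :
    ctAssocInv 𝕜 V W U (tm 𝕜 v (tm 𝕜 w u)) = tm 𝕜 (tm 𝕜 v w) u := by
  simp [ctAssocInv]

end Functoriality

end CompletedTensor

/-! ### Graded complete locally convex spaces -/

section SumCLM

variable {𝕜 : Type} [RCLike 𝕜] {E F ι : Type*} [AddCommGroup E] [Module 𝕜 E] [TopologicalSpace E]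
  [IsTopologicalAddGroup E]
  [AddCommGroup F] [Module 𝕜 F] [UniformSpace F] [IsUniformAddGroup F] [ContinuousSMul 𝕜 F]
  [PolynormableSpace 𝕜 F] [CompleteSpace F] [T2Space F]

/-- The family `T` tends to zero uniformly along the cofinite filter. -/
def Small (T : ι → E →L[𝕜] F) : Prop :=
  ∀ U ∈ 𝓝 (0 : F), ∀ᶠ i in cofinite, ∀ x, T i x ∈ U

theorem small_iff (T : ι → E →L[𝕜] F) : Small T ↔
    ∀ r : Seminorm 𝕜 F, Continuous r → ∃ s : Finset ι, ∀ i ∉ s, ∀ x, r (T i x) = 0 := by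
  constructor
  · intro h r hr
    have := h _ (ball_mem_nhds hr one_pos)
    rw [Filter.eventually_cofinite] at this
    refine ⟨this.toFinset, fun i hi x => seminorm_eq_zero r (T i).toLinearMap (fun x => ?_) x⟩
    rw [Set.Finite.mem_toFinset, Set.mem_ofPred_eq, not_not] at hi
    exact hi x
  · intro h U hU
    obtain ⟨r, hr, hrU⟩ := exists_seminorm 𝕜 hU
    obtain ⟨s, hs⟩ := h r hr
    rw [Filter.eventually_cofinite]
    refine s.finite_toSet.subset fun i hi => ?_
    by_contra hi'
    exact hi fun x => hrU _ (by rw [hs i hi' x]; exact one_pos)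

theorem seminorm_sum_eq_zero (r : Seminorm 𝕜 F) (t : Finset ι) (f : ι → F)
    (h : ∀ i ∈ t, r (f i) = 0) : r (∑ i ∈ t, f i) = 0 := by
  classical
  refine le_antisymm ?_ (apply_nonneg _ _)
  induction t using Finset.induction_on with
  | empty => simp
  | insert a t ha ih =>
    rw [Finset.sum_insert ha]
    refine (map_add_le_add r _ _).trans ?_
    rw [h a (Finset.mem_insert_self _ _), zero_add]
    exact ih fun i hi => h i (Finset.mem_insert_of_mem hi)

theorem small_summable {T : ι → E →L[𝕜] F} (h : Small T) (x : E) :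
    Summable fun i => T i x := by
  rw [summable_iff_vanishing]
  intro U hU
  obtain ⟨r, hr, hrU⟩ := exists_seminorm 𝕜 hU
  obtain ⟨s, hs⟩ := (small_iff T).1 h r hr
  refine ⟨s, fun t ht => hrU _ ?_⟩
  rw [seminorm_sum_eq_zero r t _ fun i hi => hs i (Finset.disjoint_left.1 ht hi) x]
  exact one_pos

theorem small_tail {T : ι → E →L[𝕜] F} (h : Small T) {r : Seminorm 𝕜 F} (hr : Continuous r)
    {s : Finset ι} (hs : ∀ i ∉ s, ∀ x, r (T i x) = 0) (x : E) :
    r ((∑' i, T i x) - ∑ i ∈ s, T i x) = 0 := by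
  classical
  have h1 : Tendsto (fun t : Finset ι => r (∑ i ∈ t, T i x - ∑ i ∈ s, T i x)) atTop
      (𝓝 (r ((∑' i, T i x) - ∑ i ∈ s, T i x))) :=
    (hr.tendsto _).comp ((small_summable h x).hasSum.sub_const _)
  refine tendsto_nhds_unique h1 (tendsto_const_nhds.congr' ?_)
  filter_upwards [eventually_ge_atTop s] with t ht
  rw [← Finset.sum_sdiff ht, add_sub_cancel_right]
  exact (seminorm_sum_eq_zero r _ _ fun i hi => hs i (Finset.mem_sdiff.1 hi).2 x).symm

/-- The sum of a small family of continuous linear maps. -/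
def sumCLM (T : ι → E →L[𝕜] F) (h : Small T) : E →L[𝕜] F where
  toFun x := ∑' i, T i x
  map_add' x y := by
    simp only [map_add]
    exact (small_summable h x).tsum_add (small_summable h y)
  map_smul' c x := by
    simp only [map_smul, RingHom.id_apply]
    exact (small_summable h x).tsum_const_smul c
  cont := by
    let S : E →ₗ[𝕜] F :=
      { toFun := fun x => ∑' i, T i x
        map_add' := fun x y => by
          simp only [map_add]
          exact (small_summable h x).tsum_add (small_summable h y)
        map_smul' := fun c x => by
          simp only [map_smul, RingHom.id_apply]
          exact (small_summable h x).tsum_const_smul c }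
    change Continuous S
    refine continuous_of_continuousAt_zero S ?_
    rw [ContinuousAt, map_zero]
    intro U hU
    obtain ⟨r, hr, hrU⟩ := exists_seminorm 𝕜 hU
    obtain ⟨s, hs⟩ := (small_iff T).1 h r hr
    have hc : Continuous fun x => r (∑ i ∈ s, T i x) := hr.comp (by fun_prop)
    refine mem_map.2 <| mem_of_superset
      ((isOpen_lt hc continuous_const).mem_nhds (show (0 : E) ∈ {x | _ < (1 : ℝ)} by simp))
      fun x hx => hrU _ ?_
    have e : S x = ((∑' i, T i x) - ∑ i ∈ s, T i x) + ∑ i ∈ s, T i x := by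
      simp [S]
    rw [e]
    refine (map_add_le_add r _ _).trans_lt ?_
    rw [small_tail h hr hs x, zero_add]
    exact hx

theorem sumCLM_hasSum (T : ι → E →L[𝕜] F) (h : Small T) (x : E) :
    HasSum (fun i => T i x) (sumCLM T h x) := (small_summable h x).hasSum

end SumCLM

/-- A graded complete Hausdorff locally convex space, presented by its total space
`V = ∏ n, Vⁿ` with the product topology, where `Vⁿ` is the range of the continuous projection
`proj n`: the projections are orthogonal idempotents, they separate points, and they
tend to zero uniformly (that is, every neighbourhood of zero contains almost all of the `Vⁿ`). -/
structure GrSp (𝕜 : Type) [RCLike 𝕜] : Type (u + 1) where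
  carrier : Type u
  [grp : AddCommGroup carrier]
  [mod : Module 𝕜 carrier]
  [unif : UniformSpace carrier]
  [uag : IsUniformAddGroup carrier]
  [csm : ContinuousSMul 𝕜 carrier]
  [lc : PolynormableSpace 𝕜 carrier]
  [complete : CompleteSpace carrier]
  [t2 : T2Space carrier]
  proj : ℤ → carrier →L[𝕜] carrier
  proj_proj : ∀ m n x, proj m (proj n x) = if m = n then proj n x else 0
  proj_small : ∀ U ∈ 𝓝 (0 : carrier), ∀ᶠ n in cofinite, ∀ x, proj n x ∈ U
  proj_sep : ∀ x, (∀ n, proj n x = 0) → x = 0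

attribute [instance] GrSp.grp GrSp.mod GrSp.unif GrSp.uag GrSp.csm GrSp.lc GrSp.complete GrSp.t2

namespace GrSp

variable {𝕜 : Type} [RCLike 𝕜]

instance : CoeSort (GrSp.{u} 𝕜) (Type u) := ⟨carrier⟩

variable (V W : GrSp.{u} 𝕜)

/-- `x` is homogeneous of degree `n`. -/
def Deg (n : ℤ) (x : V) : Prop := V.proj n x = x

variable {V W}

theorem Deg.eq {n : ℤ} {x : V} (h : V.Deg n x) : V.proj n x = x := h

theorem deg_proj (n : ℤ) (x : V) : V.Deg n (V.proj n x) := by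
  simp [Deg, V.proj_proj]

theorem Deg.proj_eq {n : ℤ} {x : V} (h : V.Deg n x) (m : ℤ) :
    V.proj m x = if m = n then x else 0 := by
  conv_lhs => rw [← h]
  rw [V.proj_proj, h]

theorem Deg.zero (n : ℤ) : V.Deg n 0 := map_zero _

theorem Deg.add {n : ℤ} {x y : V} (hx : V.Deg n x) (hy : V.Deg n y) : V.Deg n (x + y) := by
  rw [Deg, map_add, hx, hy]

theorem Deg.neg {n : ℤ} {x : V} (hx : V.Deg n x) : V.Deg n (-x) := by
  rw [Deg, map_neg, hx]

theorem Deg.sub {n : ℤ} {x y : V} (hx : V.Deg n x) (hy : V.Deg n y) : V.Deg n (x - y) := by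
  rw [Deg, map_sub, hx, hy]

theorem Deg.smul {n : ℤ} {x : V} (hx : V.Deg n x) (c : 𝕜) : V.Deg n (c • x) := by
  rw [Deg, map_smul, hx]

variable (V) in
theorem proj_smallT : Small V.proj := V.proj_small

theorem sum_proj (x : V) : sumCLM V.proj V.proj_smallT x = x := by
  rw [← sub_eq_zero]
  refine V.proj_sep _ fun m => ?_
  rw [map_sub, sub_eq_zero]
  have h := (sumCLM_hasSum V.proj V.proj_smallT x).mapL (V.proj m)
  refine h.unique ?_
  have : (fun i => V.proj m (V.proj i x)) = fun i => if i = m then V.proj m x else 0 := by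
    funext i
    rw [V.proj_proj]
    by_cases h : m = i
    · subst h; simp
    · rw [if_neg h, if_neg (Ne.symm h)]
  rw [this]
  exact hasSum_ite_eq m _

theorem hasSum_proj (x : V) : HasSum (fun n => V.proj n x) x := by
  have := sumCLM_hasSum V.proj V.proj_smallT x
  rwa [sum_proj] at this

theorem ext_homog {Z : Type*} [AddCommGroup Z] [Module 𝕜 Z] [TopologicalSpace Z] [T2Space Z]
    {f g : V →L[𝕜] Z} (h : ∀ n x, V.Deg n x → f x = g x) : f = g := by
  ext x
  refine ((hasSum_proj x).mapL f).unique ?_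
  simp_rw [h _ _ (deg_proj _ x)]
  exact (hasSum_proj x).mapL g

/-- Constructor from a family of homogeneous elements detecting equality of continuous maps. -/
abbrev ofHomog (E : Type u) [AddCommGroup E] [Module 𝕜 E] [UniformSpace E] [IsUniformAddGroup E]
    [ContinuousSMul 𝕜 E] [PolynormableSpace 𝕜 E] [CompleteSpace E] [T2Space E]
    (proj : ℤ → E →L[𝕜] E) (small : Small proj) (D : Set E)
    (hD : ∀ x ∈ D, ∃ k, ∀ n, proj n x = if n = k then x else 0)
    (hext : ∀ f g : E →L[𝕜] E, (∀ x ∈ D, f x = g x) → f = g) : GrSp 𝕜 where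
  carrier := E
  proj := proj
  proj_proj m n x := by
    have : proj m ∘L proj n = if m = n then proj n else 0 := by
      refine hext _ _ fun x hx => ?_
      obtain ⟨k, hk⟩ := hD x hx
      rw [ContinuousLinearMap.comp_apply, hk n]
      split_ifs with h1 h2 h2 <;> simp_all
    have h2 := congrArg (fun f : E →L[𝕜] E => f x) this
    simp only [ContinuousLinearMap.comp_apply] at h2
    rw [h2]
    split_ifs <;> rfl
  proj_small := small
  proj_sep x hx := by
    have : sumCLM proj small = ContinuousLinearMap.id 𝕜 E := by
      refine hext _ _ fun x hx => ?_
      obtain ⟨k, hk⟩ := hD x hx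
      refine (sumCLM_hasSum proj small x).unique ?_
      simp_rw [hk]
      exact hasSum_ite_eq k x
    have h2 := congrArg (fun f : E →L[𝕜] E => f x) this
    refine h2.symm.trans ((sumCLM_hasSum proj small x).unique ?_)
    simp_rw [hx]
    exact hasSum_zero

variable (V) in
theorem sgn_small : Small fun n : ℤ => ((-1 : 𝕜) ^ n) • V.proj n := by
  rw [small_iff]
  intro r hr
  obtain ⟨s, hs⟩ := (small_iff V.proj).1 V.proj_smallT r hr
  exact ⟨s, fun i hi x => by simp [map_smul_eq_mul, hs i hi x]⟩

variable (V) in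
/-- The parity operator `x ↦ (-1)^|x| x`. -/
def sgn : V →L[𝕜] V := sumCLM (fun n : ℤ => ((-1 : 𝕜) ^ n) • V.proj n) V.sgn_small

theorem Deg.sgn {n : ℤ} {x : V} (h : V.Deg n x) : V.sgn x = ((-1 : 𝕜) ^ n) • x := by
  refine (sumCLM_hasSum _ V.sgn_small x).unique ?_
  have : (fun i : ℤ => (((-1 : 𝕜) ^ i) • V.proj i) x) =
      fun i => if i = n then ((-1 : 𝕜) ^ n) • x else 0 := by
    funext i
    simp only [smul_apply, h.proj_eq]
    split_ifs with hi <;> simp [hi]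
  rw [this]
  exact hasSum_ite_eq n _

theorem neg_one_zpow_mul_self (n : ℤ) : ((-1 : 𝕜) ^ n) * (-1 : 𝕜) ^ n = 1 := by
  rw [← mul_zpow]; simp

@[simp] theorem sgn_sgn (x : V) : V.sgn (V.sgn x) = x := by
  have : V.sgn ∘L V.sgn = ContinuousLinearMap.id 𝕜 V := ext_homog fun n x hx => by
    simp [hx.sgn, smul_smul, neg_one_zpow_mul_self]
  exact congrArg (fun f : V →L[𝕜] V => f x) this

/-- The map `f` is homogeneous of degree `k`. -/
def HasDeg (k : ℤ) (f : V →L[𝕜] W) : Prop := ∀ n x, V.Deg n x → W.Deg (n + k) (f x)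

theorem HasDeg.sgn {k : ℤ} {f : V →L[𝕜] W} (h : HasDeg k f) (x : V) :
    W.sgn (f x) = ((-1 : 𝕜) ^ k) • f (V.sgn x) := by
  have : W.sgn ∘L f = ((-1 : 𝕜) ^ k) • f ∘L V.sgn := ext_homog fun n x hx => by
    simp [hx.sgn, (h n x hx).sgn, smul_smul, zpow_add₀, mul_comm]
  exact congrArg (fun f : V →L[𝕜] W => f x) this

theorem HasDeg.sgn_zero {f : V →L[𝕜] W} (h : HasDeg 0 f) (x : V) : W.sgn (f x) = f (V.sgn x) := by
  simpa using h.sgn x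

theorem HasDeg.sgn_one {f : V →L[𝕜] W} (h : HasDeg 1 f) (x : V) :
    W.sgn (f x) = -f (V.sgn x) := by simpa using h.sgn x

theorem sgn_deg : HasDeg 0 V.sgn := fun n x hx => by
  rw [hx.sgn, add_zero]; exact hx.smul _

theorem Deg.of_tendsto {n : ℤ} {ι : Type*} {f : ι → V} {x : V} (h : HasSum f x)
    (hf : ∀ i, V.Deg n (f i)) : V.Deg n x := by
  refine (h.mapL (V.proj n)).unique ?_
  simpa only [show ∀ i, V.proj n (f i) = f i from hf] using h

/-! ### Tensor products -/

theorem ct_seminorm_zero {Z : Type*} [AddCommGroup Z] [Module 𝕜 Z] [UniformSpace Z]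
    [IsUniformAddGroup Z] [ContinuousSMul 𝕜 Z] [PolynormableSpace 𝕜 Z] [CompleteSpace Z]
    [T2Space Z] (f : CT 𝕜 V W →L[𝕜] Z) (r : Seminorm 𝕜 Z) (hr : Continuous r)
    (h : ∀ v w, r (f (tm 𝕜 v w)) = 0) (x : CT 𝕜 V W) : r (f x) = 0 := by
  obtain ⟨R, hR, hRt⟩ := exists_ctSeminorm (0 : Seminorm 𝕜 V) continuous_zero
    (0 : Seminorm 𝕜 W) continuous_zero
  have := ct_bound f r hr 0 0 hR hRt le_rfl (fun v w => by simp [h v w]) x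
  exact le_antisymm (by simpa using this) (apply_nonneg _ _)

theorem exists_finite (r : Seminorm 𝕜 (CT 𝕜 V W)) (hr : Continuous r) :
    ∃ s t : Finset ℤ, ∀ a b, (a ∉ s ∨ b ∉ t) →
      ∀ x, r (ctMap (V.proj a) (W.proj b) x) = 0 := by
  obtain ⟨p, q, hp, hq, hb⟩ := bilin_bound (tmₗ 𝕜 (V := V) (W := W)) tm_continuous r hr
  obtain ⟨s, hs⟩ := (small_iff _).1 V.proj_smallT p hp
  obtain ⟨t, ht⟩ := (small_iff _).1 W.proj_smallT q hq
  refine ⟨s, t, fun a b hab => ct_seminorm_zero _ r hr fun v w => ?_⟩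
  rw [ctMap_tm]
  refine le_antisymm ((hb _ _).trans_eq ?_) (apply_nonneg _ _)
  rcases hab with h | h
  · rw [hs a h, zero_mul]
  · rw [ht b h, mul_zero]

theorem tens_small (n : ℤ) : Small fun a : ℤ => ctMap (V.proj a) (W.proj (n - a)) := by
  rw [small_iff]
  intro r hr
  obtain ⟨s, t, h⟩ := exists_finite r hr
  exact ⟨s, fun i hi => h i _ (Or.inl hi)⟩

variable (V W) in
/-- The projection of `V ⊗̂ W` onto its part `∏ (a + b = n), Vᵃ ⊗̂ Wᵇ` of degree `n`. -/
def tensProj (n : ℤ) : CT 𝕜 V W →L[𝕜] CT 𝕜 V W :=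
  sumCLM (fun a : ℤ => ctMap (V.proj a) (W.proj (n - a))) (tens_small n)

theorem tensProj_small : Small (tensProj V W) := by
  classical
  rw [small_iff]
  intro r hr
  obtain ⟨s, t, h⟩ := exists_finite r hr
  refine ⟨(s ×ˢ t).image fun x => x.1 + x.2, fun n hn x => ?_⟩
  have : ∀ a : ℤ, ∀ x, r (ctMap (V.proj a) (W.proj (n - a)) x) = 0 := by
    intro a
    refine h _ _ ?_
    by_contra hcon
    push Not at hcon
    exact hn (Finset.mem_image.2 ⟨(a, n - a), Finset.mem_product.2 hcon, by simp⟩)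
  have h2 := small_tail (tens_small n) hr (s := ∅) (fun i _ => this i) x
  rw [Finset.sum_empty, sub_zero] at h2
  exact h2

theorem tensProj_tm {a b : ℤ} {v : V} {w : W} (hv : V.Deg a v) (hw : W.Deg b w) (n : ℤ) :
    tensProj V W n (tm 𝕜 v w) = if n = a + b then tm 𝕜 v w else 0 := by
  refine (sumCLM_hasSum _ (tens_small n) (tm 𝕜 v w)).unique ?_
  have : (fun i : ℤ => ctMap (V.proj i) (W.proj (n - i)) (tm 𝕜 v w)) =
      fun i => if i = a then (if n = a + b then tm 𝕜 v w else 0) else 0 := by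
    funext i
    rw [ctMap_tm, hv.proj_eq, hw.proj_eq]
    split_ifs <;> first | rfl | (exfalso; omega) | simp
  rw [this]
  exact hasSum_ite_eq a _

theorem tens_ext {Z : Type*} [AddCommGroup Z] [Module 𝕜 Z] [TopologicalSpace Z] [T2Space Z]
    {f g : CT 𝕜 V W →L[𝕜] Z}
    (h : ∀ a b v w, V.Deg a v → W.Deg b w → f (tm 𝕜 v w) = g (tm 𝕜 v w)) : f = g := by
  refine ct_ext fun v w => ?_
  have h1 : f ∘L tmL W v = g ∘L tmL W v := ext_homog fun b w hw => by
    have h2 : f ∘L tmR V w = g ∘L tmR V w := ext_homog fun a v hv => h a b v w hv hw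
    exact congrArg (fun F : V →L[𝕜] Z => F v) h2
  exact congrArg (fun F : W →L[𝕜] Z => F w) h1

variable (V W) in
/-- The completed tensor product of graded spaces,
`(V ⊗̂ W)ⁿ = ∏ (a + b = n), Vᵃ ⊗̂ Wᵇ`; its total space is the completed projective
tensor product of the total spaces. -/
abbrev tens : GrSp.{u} 𝕜 :=
  ofHomog (CT 𝕜 V W) (tensProj V W) tensProj_small
    {x | ∃ a b v w, V.Deg a v ∧ W.Deg b w ∧ x = tm 𝕜 v w}
    (by
      rintro x ⟨a, b, v, w, hv, hw, rfl⟩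
      exact ⟨a + b, tensProj_tm hv hw⟩)
    (fun f g h => tens_ext fun a b v w hv hw => h _ ⟨a, b, v, w, hv, hw, rfl⟩)

theorem Deg.tm {a b : ℤ} {v : V} {w : W} (hv : V.Deg a v) (hw : W.Deg b w) :
    (tens V W).Deg (a + b) (tm 𝕜 v w) := by
  refine (tensProj_tm hv hw (a + b)).trans ?_
  simp

theorem tens_hasDeg {Z : GrSp.{u} 𝕜} {k : ℤ} {f : CT 𝕜 V W →L[𝕜] Z}
    (h : ∀ a b v w, V.Deg a v → W.Deg b w → Z.Deg (a + b + k) (f (CtrHoch.tm 𝕜 v w))) :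
    HasDeg (V := tens V W) k f := by
  intro n x hx
  have : Z.proj (n + k) ∘L f ∘L tensProj V W n = f ∘L tensProj V W n := by
    refine tens_ext fun a b v w hv hw => ?_
    simp only [ContinuousLinearMap.comp_apply, tensProj_tm hv hw]
    split_ifs with hn
    · subst hn; exact h a b v w hv hw
    · simp
  have h2 := congrArg (fun F : CT 𝕜 V W →L[𝕜] Z => F x) this
  simp only [ContinuousLinearMap.comp_apply] at h2
  have hx' : tensProj V W n x = x := hx
  rwa [hx'] at h2

theorem sgn_tm (v : V) (w : W) :
    (tens V W).sgn (tm 𝕜 v w) = tm 𝕜 (V.sgn v) (W.sgn w) := by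
  have : ((tens V W).sgn : CT 𝕜 V W →L[𝕜] CT 𝕜 V W) = ctMap V.sgn W.sgn :=
    tens_ext fun a b v w hv hw => by
      have := (hv.tm hw).sgn
      refine this.trans ?_
      rw [ctMap_tm, hv.sgn, hw.sgn, tm_smul_left, tm_smul_right, smul_smul,
        zpow_add₀ (by simp)]
  refine (congrArg (fun F : CT 𝕜 V W →L[𝕜] CT 𝕜 V W => F (CtrHoch.tm 𝕜 v w)) this).trans ?_
  exact ctMap_tm _ _ _ _

end GrSp

section Complexes

/-! ### Complexes, dg-algebras and dg-modules -/

variable {𝕜 : Type} [RCLike 𝕜]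

theorem polynormable_pi {K : Type*} (E : K → Type*) [∀ k, AddCommGroup (E k)]
    [∀ k, Module 𝕜 (E k)] [∀ k, TopologicalSpace (E k)] [∀ k, IsTopologicalAddGroup (E k)]
    [∀ k, PolynormableSpace 𝕜 (E k)] : PolynormableSpace 𝕜 (∀ k, E k) := by
  refine polynormable_of fun U hU => ?_
  rw [nhds_pi, Filter.mem_pi] at hU
  obtain ⟨I, hI, t, ht, hsub⟩ := hU
  choose p hp hpt using fun k => exists_seminorm 𝕜 (ht k)
  refine ⟨∑ k ∈ hI.toFinset, (p k).comp (LinearMap.proj k), ?_, fun x hx => hsub fun k hk => ?_⟩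
  · have : (⇑(∑ k ∈ hI.toFinset, (p k).comp (LinearMap.proj k)) : (∀ k, E k) → ℝ) =
        fun x => ∑ k ∈ hI.toFinset, p k (x k) := by
      funext x; simp
    rw [this]
    exact continuous_finsetSum _ fun k _ => (hp k).comp (continuous_apply k)
  · refine hpt k _ (lt_of_le_of_lt ?_ hx)
    rw [seminorm_sum_apply]
    exact Finset.single_le_sum (f := fun k => ((p k).comp (LinearMap.proj k)) x)
      (fun j _ => apply_nonneg _ _) (hI.mem_toFinset.2 hk)

instance {K : Type*} (E : K → Type*) [∀ k, AddCommGroup (E k)]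
    [∀ k, Module 𝕜 (E k)] [∀ k, TopologicalSpace (E k)] [∀ k, IsTopologicalAddGroup (E k)]
    [∀ k, PolynormableSpace 𝕜 (E k)] : PolynormableSpace 𝕜 (∀ k, E k) := polynormable_pi E

instance {E F : Type*} [AddCommGroup E] [Module 𝕜 E] [TopologicalSpace E] [IsTopologicalAddGroup E]
    [PolynormableSpace 𝕜 E] [AddCommGroup F] [Module 𝕜 F] [TopologicalSpace F]
    [IsTopologicalAddGroup F] [PolynormableSpace 𝕜 F] : PolynormableSpace 𝕜 (E × F) := by
  refine polynormable_of fun U hU => ?_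
  rw [show (0 : E × F) = (0, 0) from rfl, nhds_prod_eq, mem_prod_iff] at hU
  obtain ⟨s, hs, t, ht, hsub⟩ := hU
  obtain ⟨p, hp, hps⟩ := exists_seminorm 𝕜 hs
  obtain ⟨q, hq, hqt⟩ := exists_seminorm 𝕜 ht
  refine ⟨p.comp (LinearMap.fst 𝕜 E F) + q.comp (LinearMap.snd 𝕜 E F),
    (hp.comp continuous_fst).add (hq.comp continuous_snd), fun x hx => hsub ⟨hps _ ?_, hqt _ ?_⟩⟩
  · exact lt_of_le_of_lt (le_add_of_nonneg_right (apply_nonneg q x.2)) hx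
  · exact lt_of_le_of_lt (le_add_of_nonneg_left (apply_nonneg p x.1)) hx

namespace GrSp

/-- The product of a family of graded spaces, formed degreewise. -/
abbrev pi {K : Type v} (M : K → GrSp.{u} 𝕜) : GrSp.{max u v} 𝕜 where
  carrier := ∀ k, M k
  proj n := ContinuousLinearMap.pi fun k => (M k).proj n ∘L ContinuousLinearMap.proj k
  proj_proj m n x := by
    ext k
    have := (M k).proj_proj m n (x k)
    split_ifs at this ⊢ <;> simpa using this
  proj_small U hU := by
    rw [nhds_pi, Filter.mem_pi] at hU
    obtain ⟨I, hI, t, ht, hsub⟩ := hU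
    have := (Filter.eventually_all_finite hI).2 fun k _ => (M k).proj_small (t k) (ht k)
    filter_upwards [this] with n hn x
    exact hsub fun k hk => hn k hk (x k)
  proj_sep x hx := by
    ext k
    exact (M k).proj_sep _ fun n => congrFun (hx n) k

/-- The shift `(M[n])ᵏ = Mᵏ⁻ⁿ`. -/
abbrev shift (M : GrSp.{u} 𝕜) (n : ℤ) : GrSp.{u} 𝕜 where
  carrier := M
  proj k := M.proj (k - n)
  proj_proj k l x := by simp [M.proj_proj]
  proj_small U hU := by
    have := M.proj_small U hU
    rw [Filter.eventually_cofinite] at this ⊢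
    refine (this.preimage ((Equiv.subRight n).injective.injOn)).subset fun k hk => hk
  proj_sep x hx := M.proj_sep x fun k => by simpa using hx (k + n)

/-- The underlying graded space of a mapping cone, `(y, x) ∈ Nᵏ × Mᵏ⁺¹` in degree `k`. -/
abbrev coneSp (M N : GrSp.{u} 𝕜) : GrSp.{u} 𝕜 where
  carrier := N × M
  proj k := (N.proj k).prodMap (M.proj (k + 1))
  proj_proj k l x := by
    have h1 := N.proj_proj k l x.1
    have h2 := M.proj_proj (k + 1) (l + 1) x.2
    by_cases h : k = l
    · subst h; ext <;> simp [N.proj_proj, M.proj_proj]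
    · rw [if_neg h] at h1 ⊢
      rw [if_neg (by omega)] at h2
      ext
      · exact h1
      · exact h2
  proj_small U hU := by
    rw [show (0 : N × M) = (0, 0) from rfl, nhds_prod_eq, mem_prod_iff] at hU
    obtain ⟨s, hs, t, ht, hsub⟩ := hU
    have h2 := M.proj_small t ht
    have h2' : ∀ᶠ k : ℤ in cofinite, ∀ x, M.proj (k + 1) x ∈ t := by
      rw [Filter.eventually_cofinite] at h2 ⊢
      exact (h2.preimage ((Equiv.addRight (1 : ℤ)).injective.injOn)).subset fun k hk => hk
    filter_upwards [N.proj_small s hs, h2'] with k h1 h2 x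
    exact hsub ⟨h1 _, h2 _⟩
  proj_sep x hx := by
    refine Prod.ext (N.proj_sep _ fun k => congrArg Prod.fst (hx k)) (M.proj_sep _ fun k => ?_)
    have := congrArg Prod.snd (hx (k - 1))
    simpa using this

theorem sgn_eq {V : GrSp.{u} 𝕜} {f : V →L[𝕜] V}
    (h : ∀ n x, V.Deg n x → f x = ((-1 : 𝕜) ^ n) • x) (x : V) : V.sgn x = f x := by
  have : V.sgn = f := ext_homog fun n x hx => by rw [hx.sgn, h n x hx]
  rw [this]

theorem sgn_pi {K : Type v} (M : K → GrSp.{u} 𝕜) (x : pi M) (k : K) :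
    (pi M).sgn x k = (M k).sgn (x k) := by
  have := sgn_eq (V := pi M)
    (f := ContinuousLinearMap.pi fun k => (M k).sgn ∘L ContinuousLinearMap.proj k)
    (fun n x hx => by
      ext k
      exact Deg.sgn (V := M k) (congrFun hx k)) x
  exact congrFun this k

theorem sgn_shift (M : GrSp.{u} 𝕜) (n : ℤ) (x : M) :
    (M.shift n).sgn x = ((-1 : 𝕜) ^ n) • M.sgn x := by
  refine sgn_eq (V := M.shift n) (f := ((-1 : 𝕜) ^ n) • M.sgn) (fun k x hx => ?_) x
  have : M.sgn x = ((-1 : 𝕜) ^ (k - n)) • x := Deg.sgn (V := M) hx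
  simp only [smul_apply, this, smul_smul]
  rw [← zpow_add₀ (by simp)]; congr 2; omega

theorem sgn_cone (M N : GrSp.{u} 𝕜) (x : coneSp M N) :
    (coneSp M N).sgn x = (N.sgn x.1, -M.sgn x.2) := by
  refine sgn_eq (V := coneSp M N) (f := N.sgn.prodMap (-M.sgn)) (fun k x hx => ?_) x
  have h1 : N.sgn x.1 = _ := Deg.sgn (V := N) (n := k) (congrArg Prod.fst hx)
  have h2 : M.sgn x.2 = _ := Deg.sgn (V := M) (n := k + 1) (congrArg Prod.snd hx)
  ext
  · exact h1
  · simp [h2, zpow_add₀]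

end GrSp

/-- A cochain complex of complete Hausdorff locally convex spaces. -/
structure Cpx (𝕜 : Type) [RCLike 𝕜] extends GrSp.{u} 𝕜 where
  d : carrier →L[𝕜] carrier
  d_deg : GrSp.HasDeg (V := toGrSp) (W := toGrSp) 1 d
  d_d : ∀ x, d (d x) = 0

instance : CoeSort (Cpx.{u} 𝕜) (Type u) := ⟨fun M => M.carrier⟩

namespace Cpx

/-- The completed tensor product of complexes, `d (v ⊗ w) = dv ⊗ w + (-1)^|v| v ⊗ dw`. -/
abbrev tens (V W : Cpx.{u} 𝕜) : Cpx.{u} 𝕜 where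
  toGrSp := GrSp.tens V.toGrSp W.toGrSp
  d := ctMap V.d (ContinuousLinearMap.id 𝕜 W) + ctMap V.sgn W.d
  d_deg := GrSp.tens_hasDeg fun a b v w hv hw => by
    have h1 := (V.d_deg a v hv).tm hw
    have h2 := (GrSp.sgn_deg a v hv).tm (W.d_deg b w hw)
    rw [show a + 1 + b = a + b + 1 by ring] at h1
    rw [show a + 0 + (b + 1) = a + b + 1 by ring] at h2
    simpa using h1.add h2
  d_d := ct_ext_apply
    (((ctMap V.d (ContinuousLinearMap.id 𝕜 W) + ctMap V.sgn W.d) ∘L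
      (ctMap V.d (ContinuousLinearMap.id 𝕜 W) + ctMap V.sgn W.d) : CT 𝕜 V W →L[𝕜] CT 𝕜 V W)) 0
    fun v w => by simp [V.d_d, W.d_d, V.d_deg.sgn_one]

theorem tens_d (V W : Cpx.{u} 𝕜) (v : V) (w : W) :
    (tens V W).d (tm 𝕜 v w) = tm 𝕜 (V.d v) w + tm 𝕜 (V.sgn v) (W.d w) := by
  simp

end Cpx

/-- A complete locally convex dg-algebra. -/
structure DGAlg (𝕜 : Type) [RCLike 𝕜] extends Cpx.{u} 𝕜 where
  mul : CT 𝕜 carrier carrier →L[𝕜] carrier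
  one : carrier
  one_deg : toGrSp.Deg 0 one
  mul_deg : ∀ m n a b, toGrSp.Deg m a → toGrSp.Deg n b → toGrSp.Deg (m + n) (mul (tm 𝕜 a b))
  mul_assoc : ∀ a b c, mul (tm 𝕜 (mul (tm 𝕜 a b)) c) = mul (tm 𝕜 a (mul (tm 𝕜 b c)))
  one_mul : ∀ a, mul (tm 𝕜 one a) = a
  mul_one : ∀ a, mul (tm 𝕜 a one) = a
  d_mul : ∀ a b, d (mul (tm 𝕜 a b)) = mul (tm 𝕜 (d a) b) + mul (tm 𝕜 (toGrSp.sgn a) (d b))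

instance : CoeSort (DGAlg.{u} 𝕜) (Type u) := ⟨fun A => A.carrier⟩

/-- A complete locally convex right dg-module over the dg-algebra `B`. -/
structure DGMod (B : DGAlg.{u} 𝕜) extends Cpx.{u} 𝕜 where
  act : CT 𝕜 carrier B →L[𝕜] carrier
  act_deg : ∀ m n x b, toGrSp.Deg m x → B.Deg n b → toGrSp.Deg (m + n) (act (tm 𝕜 x b))
  act_mul : ∀ x b c, act (tm 𝕜 (act (tm 𝕜 x b)) c) = act (tm 𝕜 x (B.mul (tm 𝕜 b c)))
  act_one : ∀ x, act (tm 𝕜 x B.one) = x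
  d_act : ∀ x b, d (act (tm 𝕜 x b)) = act (tm 𝕜 (d x) b) + act (tm 𝕜 (toGrSp.sgn x) (B.d b))

instance (B : DGAlg.{u} 𝕜) : CoeSort (DGMod B) (Type u) := ⟨fun M => M.carrier⟩

namespace DGMod

variable {B : DGAlg.{u} 𝕜}

/-- The product of a family of dg-modules. -/
abbrev pi {K : Type u} (M : K → DGMod B) : DGMod B where
  toGrSp := GrSp.pi fun k => (M k).toGrSp
  d := ContinuousLinearMap.pi fun k => (M k).d ∘L ContinuousLinearMap.proj k
  d_deg n x hx := funext fun k => (M k).d_deg n _ (congrFun hx k)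
  d_d x := funext fun k => (M k).d_d _
  act := ContinuousLinearMap.pi fun k => (M k).act ∘L
    ctMap (ContinuousLinearMap.proj k : (∀ k, (M k).carrier) →L[𝕜] _) (ContinuousLinearMap.id 𝕜 B)
  act_deg m n x b hx hb := funext fun k => by
    have := (M k).act_deg m n _ b (congrFun hx k) hb
    simpa using GrSp.Deg.eq this
  act_mul x b c := funext fun k => by simpa using (M k).act_mul (x k) b c
  act_one x := funext fun k => by simpa using (M k).act_one (x k)
  d_act x b := funext fun k => by
    have := (M k).d_act (x k) b
    rw [← GrSp.sgn_pi (fun k => (M k).toGrSp) x k] at this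
    simpa using this

/-- The shift `(M[n])ᵏ = Mᵏ⁻ⁿ`, with differential `(-1)ⁿ d`. -/
abbrev shift (M : DGMod B) (n : ℤ) : DGMod B where
  toGrSp := M.toGrSp.shift n
  d := ((-1 : 𝕜) ^ n) • M.d
  d_deg k x hx := by
    have := (M.d_deg (k - n) x hx).smul ((-1 : 𝕜) ^ n)
    rwa [show k - n + 1 = k + 1 - n by ring] at this
  d_d x := by simp [M.d_d]
  act := M.act
  act_deg m k x b hx hb := by
    have := M.act_deg (m - n) k x b hx hb
    rwa [show m - n + k = m + k - n by ring] at this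
  act_mul := M.act_mul
  act_one := M.act_one
  d_act x b := by
    rw [GrSp.sgn_shift]
    simp [M.d_act]

end DGMod

end Complexes

section Contraderived

/-! ### The dg-category of dg-modules and the contraderived category -/

open CategoryTheory

variable {𝕜 : Type} [RCLike 𝕜]

section HomComplex

variable {B : DGAlg.{u} 𝕜} (M N : DGMod B)

/-- `Homⁿ_B(M, N)`: continuous `B`-linear maps of degree `n`. -/
def HomDeg (n : ℤ) : Submodule 𝕜 (M.carrier →L[𝕜] N.carrier) where
  carrier := {f | GrSp.HasDeg (V := M.toGrSp) (W := N.toGrSp) n f ∧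
    ∀ x b, f (M.act (tm 𝕜 x b)) = N.act (tm 𝕜 (f x) b)}
  add_mem' {f g} hf hg := ⟨fun k x hx => (hf.1 k x hx).add (hg.1 k x hx), fun x b => by
    simp [hf.2, hg.2, tm_add_left]⟩
  zero_mem' := ⟨fun k x _ => GrSp.Deg.zero _, fun x b => by simp⟩
  smul_mem' c f hf := ⟨fun k x hx => (hf.1 k x hx).smul c, fun x b => by simp [hf.2]⟩

variable {M N} in
theorem hom_d {n : ℤ} (f : M.carrier →L[𝕜] N.carrier) (hf : f ∈ HomDeg M N n) :
    N.d ∘L f - ((-1 : 𝕜) ^ n) • (f ∘L M.d) ∈ HomDeg M N (n + 1) := by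
  refine ⟨fun k x hx => ?_, fun x b => ?_⟩
  · have h1 := N.d_deg _ _ (hf.1 k x hx)
    have h2 := (hf.1 _ _ (M.d_deg k x hx)).smul ((-1 : 𝕜) ^ n)
    rw [show k + n + 1 = k + (n + 1) by ring] at h1
    rw [show k + 1 + n = k + (n + 1) by ring] at h2
    exact h1.sub h2
  · have := GrSp.HasDeg.sgn hf.1 x
    simp only [sub_apply, smul_apply, ContinuousLinearMap.comp_apply, hf.2, N.d_act,
      M.d_act, map_add, this, tm_sub_left, map_sub, tm_smul_left, map_smul, smul_add]
    abel

/-- The differential `f ↦ d ∘ f - (-1)ⁿ f ∘ d` of the complex `Hom_B(M, N)`. -/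
def homD (n : ℤ) : HomDeg M N n →ₗ[𝕜] HomDeg M N (n + 1) where
  toFun f := ⟨N.d ∘L f.1 - ((-1 : 𝕜) ^ n) • (f.1 ∘L M.d), hom_d f.1 f.2⟩
  map_add' f g := by
    ext x; simp; abel
  map_smul' c f := by
    ext x; simp [smul_sub, smul_smul, mul_comm]

/-- The cocycles of `Hom_B(M, N)` of degree `n`. -/
def HomZ (n : ℤ) : Submodule 𝕜 (M.carrier →L[𝕜] N.carrier) :=
  (LinearMap.ker (homD M N n)).map (HomDeg M N n).subtype

variable {M N} in
theorem mem_HomZ {n : ℤ} {f : M.carrier →L[𝕜] N.carrier} :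
    f ∈ HomZ M N n ↔ f ∈ HomDeg M N n ∧ ∀ x, N.d (f x) = ((-1 : 𝕜) ^ n) • f (M.d x) := by
  constructor
  · rintro ⟨g, hg, rfl⟩
    refine ⟨g.2, fun x => ?_⟩
    have := congrArg (fun h => h.1 x) (LinearMap.mem_ker.1 hg)
    simpa [homD, sub_eq_zero] using this
  · rintro ⟨h1, h2⟩
    refine ⟨⟨f, h1⟩, LinearMap.mem_ker.2 (Subtype.ext (ContinuousLinearMap.ext fun x => ?_)), rfl⟩
    simpa [homD, sub_eq_zero] using h2 x

/-- The coboundaries of `Hom_B(M, N)` of degree `n`. -/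
def HomB (n : ℤ) : Submodule 𝕜 (M.carrier →L[𝕜] N.carrier) :=
  (LinearMap.range (homD M N (n - 1))).map (HomDeg M N (n - 1 + 1)).subtype

/-- The cohomology `Hⁿ(Hom_B(M, N))`. -/
abbrev HomH (n : ℤ) : Type u := HomZ M N n ⧸ (HomB M N n).submoduleOf (HomZ M N n)

end HomComplex

section Categories

variable {B : DGAlg.{u} 𝕜}

theorem comp_mem_HomDeg {M N P : DGMod B} {m n : ℤ} {f : M.carrier →L[𝕜] N.carrier}
    {g : N.carrier →L[𝕜] P.carrier} (hf : f ∈ HomDeg M N m) (hg : g ∈ HomDeg N P n) :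
    g ∘L f ∈ HomDeg M P (m + n) :=
  ⟨fun k x hx => by
      have := hg.1 _ _ (hf.1 k x hx)
      rwa [add_assoc] at this,
    fun x b => by simp [hf.2, hg.2]⟩

/-- The category `Z⁰` of dg-modules and closed maps of degree zero. -/
instance : Category (DGMod B) where
  Hom M N := HomZ M N 0
  id M := ⟨ContinuousLinearMap.id 𝕜 M.carrier, mem_HomZ.2
    ⟨⟨fun k x hx => by simpa using hx, fun _ _ => rfl⟩, fun x => by simp⟩⟩
  comp f g := ⟨g.1 ∘L f.1, mem_HomZ.2
    ⟨by simpa using comp_mem_HomDeg (mem_HomZ.1 f.2).1 (mem_HomZ.1 g.2).1, fun x => by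
      have h1 := (mem_HomZ.1 f.2).2 x
      have h2 := (mem_HomZ.1 g.2).2 (f.1 x)
      simp only [zpow_zero, one_smul] at h1 h2 ⊢
      simp [h1, h2]⟩⟩

instance : Preadditive (DGMod B) where
  homGroup M N := inferInstanceAs (AddCommGroup (HomZ M N 0))
  add_comp _ _ _ f f' g := Subtype.ext (ContinuousLinearMap.comp_add g.1 f.1 f'.1)
  comp_add _ _ _ f g g' := Subtype.ext (ContinuousLinearMap.add_comp g.1 g'.1 f.1)

instance : Linear 𝕜 (DGMod B) where
  homModule M N := inferInstanceAs (Module 𝕜 (HomZ M N 0))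
  smul_comp _ _ _ r f g := Subtype.ext (ContinuousLinearMap.comp_smul g.1 r f.1)
  comp_smul _ _ _ f r g := Subtype.ext (ContinuousLinearMap.smul_comp r g.1 f.1)

variable (B) in
/-- Homotopy of closed maps of degree zero. -/
def homotopyRel : HomRel (DGMod B) := fun M N f g => f.1 - g.1 ∈ HomB M N 0

theorem mem_HomB {M N : DGMod B} {f : M.carrier →L[𝕜] N.carrier} :
    f ∈ HomB M N 0 ↔ ∃ h ∈ HomDeg M N (-1), f = N.d ∘L h + h ∘L M.d := by
  constructor
  · rintro ⟨_, ⟨h, rfl⟩, rfl⟩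
    exact ⟨h.1, h.2, by ext x; simp [homD]⟩
  · rintro ⟨h, hh, rfl⟩
    exact ⟨_, ⟨⟨h, by simpa using hh⟩, rfl⟩, by ext x; simp [homD]⟩

theorem closed_zero {M N : DGMod B} (f : M ⟶ N) (x : M) : N.d (f.1 x) = f.1 (M.d x) := by
  simpa using (mem_HomZ.1 f.2).2 x

instance : Congruence (homotopyRel B) where
  equivalence :=
    { refl := fun f => by
        change f.1 - f.1 ∈ _
        rw [sub_self]; exact zero_mem _
      symm := fun {f g} h => by
        change g.1 - f.1 ∈ _
        rw [← neg_sub]; exact neg_mem h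
      trans := fun {f g k} h h' => by
        change f.1 - k.1 ∈ _
        rw [← sub_add_sub_cancel f.1 g.1 k.1]; exact add_mem h h' }
  comp_left {X Y Z} f g g' h := by
    obtain ⟨k, hk, e⟩ := mem_HomB.1 h
    refine mem_HomB.2 ⟨k ∘L f.1, by simpa using comp_mem_HomDeg (mem_HomZ.1 f.2).1 hk, ?_⟩
    ext x
    have := congrArg (fun F => F (f.1 x)) e
    simp only [sub_apply, add_apply, ContinuousLinearMap.comp_apply] at this
    change g.1 (f.1 x) - g'.1 (f.1 x) = _
    rw [this, closed_zero]; rfl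
  comp_right {X Y Z f f'} g h := by
    obtain ⟨k, hk, e⟩ := mem_HomB.1 h
    refine mem_HomB.2 ⟨g.1 ∘L k, by simpa using comp_mem_HomDeg hk (mem_HomZ.1 g.2).1, ?_⟩
    ext x
    have := congrArg (fun F => g.1 (F x)) e
    simp only [sub_apply, add_apply, ContinuousLinearMap.comp_apply, map_add, map_sub,
      ← closed_zero] at this
    exact this

variable (B) in
/-- The homotopy category `H⁰` of dg-modules. -/
abbrev H0 : Type (u + 1) := Quotient (homotopyRel B)

instance : Preadditive (H0 B) := Quotient.preadditive _ fun _ _ f₁ f₂ g₁ g₂ h h' => by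
  change (f₁.1 + g₁.1) - (f₂.1 + g₂.1) ∈ _
  rw [add_sub_add_comm]
  exact add_mem h h'

instance : (Quotient.functor (homotopyRel B)).Additive := ⟨rfl⟩

instance : Linear 𝕜 (H0 B) := Quotient.linear 𝕜 _ fun c _ _ f g h => by
  change c • f.1 - c • g.1 ∈ _
  rw [← smul_sub]
  exact Submodule.smul_mem _ c h

variable (B) in
/-- The functor from `Z⁰` to `H⁰`. -/
abbrev toH0 : DGMod B ⥤ H0 B := Quotient.functor (homotopyRel B)

/-- The mapping cone of a closed map `f : M → N` of degree zero: `(y, x) ∈ Nᵏ × Mᵏ⁺¹` in degree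
`k`, with `d (y, x) = (dy + f x, -dx)`. -/
def cone {M N : DGMod B} (f : M ⟶ N) : DGMod B where
  toGrSp := GrSp.coneSp M.toGrSp N.toGrSp
  d := (N.d ∘L ContinuousLinearMap.fst 𝕜 N.carrier M.carrier +
    f.1 ∘L ContinuousLinearMap.snd 𝕜 N.carrier M.carrier).prod
      (-(M.d ∘L ContinuousLinearMap.snd 𝕜 N.carrier M.carrier))
  d_deg k x hx := by
    have h1 := N.d_deg k x.1 (congrArg Prod.fst hx)
    have hx2 : M.Deg (k + 1) x.2 := congrArg Prod.snd hx
    have h2 := (mem_HomZ.1 f.2).1.1 (k + 1) x.2 hx2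
    have h3 := (M.d_deg (k + 1) x.2 hx2).neg
    rw [add_zero] at h2
    exact Prod.ext (h1.add h2) h3
  d_d x := by
    have := closed_zero f x.2
    ext <;> simp [N.d_d, M.d_d, this]
  act := (N.act ∘L ctMap (ContinuousLinearMap.fst 𝕜 N.carrier M.carrier)
      (ContinuousLinearMap.id 𝕜 B)).prod
    (M.act ∘L ctMap (ContinuousLinearMap.snd 𝕜 N.carrier M.carrier) (ContinuousLinearMap.id 𝕜 B))
  act_deg m n x b hx hb := by
    have h1 := N.act_deg m n x.1 b (congrArg Prod.fst hx) hb
    have h2 := M.act_deg (m + 1) n x.2 b (congrArg Prod.snd hx) hb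
    rw [show m + 1 + n = m + n + 1 by ring] at h2
    have e1 := h1.eq
    have e2 := h2.eq
    exact Prod.ext (by simpa using e1) (by simpa using e2)
  act_mul x b c := by
    ext
    · simpa using N.act_mul x.1 b c
    · simpa using M.act_mul x.2 b c
  act_one x := by
    ext
    · simpa using N.act_one x.1
    · simpa using M.act_one x.2
  d_act x b := by
    have h1 := N.d_act x.1 b
    have h2 := M.d_act x.2 b
    have h3 := (mem_HomZ.1 f.2).1.2 x.2 b
    rw [GrSp.sgn_cone]
    ext
    · simp [h1, h3, tm_add_left]; abel
    · simp [h2]; abel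

/-- `0 → M₁ → M₂ → M₃ → 0` is exact: it has a continuous linear contracting homotopy of degree
zero. -/
def SplitExact {M₁ M₂ M₃ : DGMod B} (i : M₁ ⟶ M₂) (p : M₂ ⟶ M₃) : Prop :=
  ∃ (r : M₂.carrier →L[𝕜] M₁.carrier) (s : M₃.carrier →L[𝕜] M₂.carrier),
    GrSp.HasDeg (V := M₂.toGrSp) (W := M₁.toGrSp) 0 r ∧
    GrSp.HasDeg (V := M₃.toGrSp) (W := M₂.toGrSp) 0 s ∧
    (∀ x, r (i.1 x) = x) ∧ (∀ x, p.1 (s x) = x) ∧ ∀ x, i.1 (r x) + s (p.1 x) = x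

/-- Contraacyclic dg-modules: the smallest class containing the totalizations of the exact
sequences in `Z⁰` that is closed under cones, shifts, products, and direct summands in `H⁰`
(in particular under isomorphisms in `H⁰`). -/
inductive Contraacyclic : DGMod B → Prop
  | tot {M₁ M₂ M₃ : DGMod B} (i : M₁ ⟶ M₂) (p : M₂ ⟶ M₃) (h : SplitExact i p)
      (q : cone i ⟶ M₃) (hq : ∀ (y : M₂) (x : M₁), q.1 (y, x) = p.1 y) : Contraacyclic (cone q)
  | cone {M N : DGMod B} (f : M ⟶ N) : Contraacyclic M → Contraacyclic N → Contraacyclic (cone f)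
  | shift {M : DGMod B} (n : ℤ) : Contraacyclic M → Contraacyclic (M.shift n)
  | pi {K : Type u} (M : K → DGMod B) : (∀ k, Contraacyclic (M k)) → Contraacyclic (DGMod.pi M)
  | retract {M N : DGMod B} (a : (toH0 B).obj M ⟶ (toH0 B).obj N)
      (b : (toH0 B).obj N ⟶ (toH0 B).obj M) : a ≫ b = 𝟙 _ → Contraacyclic N → Contraacyclic M

variable (B) in
/-- The maps in `H⁰` whose cone is contraacyclic. -/
def contraIso : MorphismProperty (H0 B) := fun X Y f =>
  ∃ g : X.as ⟶ Y.as, (toH0 B).map g = f ∧ Contraacyclic (cone g)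

variable (B) in
/-- The contraderived category: the Verdier quotient of `H⁰` by the contraacyclic modules. -/
abbrev Dctr := (contraIso B).Localization

variable (B) in
/-- The localization functor from `Z⁰` to the contraderived category. -/
abbrev toDctr : DGMod B ⥤ Dctr B := toH0 B ⋙ (contraIso B).Q

/-- A cocycle of degree `n` in `Hom_B(M, N)`, as a closed map `M[n] → N` of degree zero. -/
def ofCocycle {M N : DGMod B} {n : ℤ} (f : HomZ M N n) : M.shift n ⟶ N :=
  ⟨f.1, mem_HomZ.2 ⟨⟨fun k x hx => by
      have := (mem_HomZ.1 f.2).1.1 (k - n) x hx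
      rwa [show k - n + n = k + 0 by ring] at this, (mem_HomZ.1 f.2).1.2⟩, fun x => by
    have := (mem_HomZ.1 f.2).2 x
    simpa using this⟩⟩

/-- The shift functor on morphisms of `Z⁰`. -/
def shiftMap {M N : DGMod B} (f : M ⟶ N) (n : ℤ) : M.shift n ⟶ N.shift n :=
  ⟨f.1, mem_HomZ.2 ⟨⟨fun k x hx => by
      have := (mem_HomZ.1 f.2).1.1 (k - n) x hx
      rwa [show k - n + 0 = k + 0 - n by ring] at this, (mem_HomZ.1 f.2).1.2⟩, fun x => by
    simp [closed_zero f x]⟩⟩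

end Categories

end Contraderived

/-! ### Dg-bimodules and the enveloping algebra -/

section Bimodules

variable {𝕜 : Type} [RCLike 𝕜]

theorem homog_ext_apply {V : GrSp.{u} 𝕜} {Z : Type*} [AddCommGroup Z] [Module 𝕜 Z]
    [TopologicalSpace Z] [T2Space Z] (f g : V →L[𝕜] Z) (h : ∀ n x, V.Deg n x → f x = g x)
    (x : V) : f x = g x := by
  rw [GrSp.ext_homog h]

theorem tens_ext_apply {V W : GrSp.{u} 𝕜} {Z : Type*} [AddCommGroup Z] [Module 𝕜 Z]
    [TopologicalSpace Z] [T2Space Z] (f g : CT 𝕜 V W →L[𝕜] Z)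
    (h : ∀ a b v w, V.Deg a v → W.Deg b w → f (tm 𝕜 v w) = g (tm 𝕜 v w)) (x : CT 𝕜 V W) :
    f x = g x := by
  rw [GrSp.tens_ext h]

/-- A complete locally convex left dg-module over the dg-algebra `A`. -/
structure LMod (A : DGAlg.{u} 𝕜) extends Cpx.{u} 𝕜 where
  L : CT 𝕜 A carrier →L[𝕜] carrier
  L_deg : ∀ m n a x, A.Deg m a → toGrSp.Deg n x → toGrSp.Deg (m + n) (L (tm 𝕜 a x))
  L_mul : ∀ a b x, L (tm 𝕜 a (L (tm 𝕜 b x))) = L (tm 𝕜 (A.mul (tm 𝕜 a b)) x)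
  L_one : ∀ x, L (tm 𝕜 A.one x) = x
  d_L : ∀ a x, d (L (tm 𝕜 a x)) = L (tm 𝕜 (A.d a) x) + L (tm 𝕜 (A.sgn a) (d x))

/-- A complete locally convex dg-bimodule over the dg-algebra `A`. -/
structure Bimod (A : DGAlg.{u} 𝕜) extends LMod.{u} A where
  R : CT 𝕜 carrier A →L[𝕜] carrier
  R_deg : ∀ m n x a, toGrSp.Deg m x → A.Deg n a → toGrSp.Deg (m + n) (R (tm 𝕜 x a))
  R_mul : ∀ x a b, R (tm 𝕜 (R (tm 𝕜 x a)) b) = R (tm 𝕜 x (A.mul (tm 𝕜 a b)))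
  R_one : ∀ x, R (tm 𝕜 x A.one) = x
  d_R : ∀ x a, d (R (tm 𝕜 x a)) = R (tm 𝕜 (d x) a) + R (tm 𝕜 (toGrSp.sgn x) (A.d a))
  L_R : ∀ a x b, R (tm 𝕜 (L (tm 𝕜 a x)) b) = L (tm 𝕜 a (R (tm 𝕜 x b)))

variable {A : DGAlg.{u} 𝕜}

namespace LMod

variable (A) in
/-- `A` as a left module over itself. -/
abbrev self : LMod A where
  toCpx := A.toCpx
  L := A.mul
  L_deg := A.mul_deg
  L_mul a b x := (A.mul_assoc a b x).symm
  L_one := A.one_mul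
  d_L := A.d_mul

/-- The left module `P ⊗̂ Y` for a left module `P` and a complex `Y`. -/
abbrev tens (P : LMod A) (Y : Cpx.{u} 𝕜) : LMod A where
  toCpx := P.toCpx.tens Y
  L := ctMap P.L (ContinuousLinearMap.id 𝕜 Y) ∘L ctAssocInv 𝕜 A P.carrier Y
  L_deg m n a x ha hx := by
    have : GrSp.HasDeg (V := GrSp.tens P.toGrSp Y.toGrSp) (W := GrSp.tens P.toGrSp Y.toGrSp) m
        (ctMap P.L (ContinuousLinearMap.id 𝕜 Y) ∘L ctAssocInv 𝕜 A P.carrier Y ∘L tmL _ a) :=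
      GrSp.tens_hasDeg fun k l v w hv hw => by
        have := (P.L_deg m k a v ha hv).tm hw
        rw [show m + k + l = k + l + m by ring] at this
        simpa using this
    have h := this n x hx
    rw [add_comm n m] at h
    exact h
  L_mul a b x := ct_ext_apply
    (ctMap P.L (ContinuousLinearMap.id 𝕜 Y) ∘L ctAssocInv 𝕜 A P.carrier Y ∘L tmL _ a ∘L
      ctMap P.L (ContinuousLinearMap.id 𝕜 Y) ∘L ctAssocInv 𝕜 A P.carrier Y ∘L tmL _ b)
    (ctMap P.L (ContinuousLinearMap.id 𝕜 Y) ∘L ctAssocInv 𝕜 A P.carrier Y ∘L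
      tmL _ (A.mul (tm 𝕜 a b))) (fun v w => by simp [P.L_mul]) x
  L_one x := ct_ext_apply
    (ctMap P.L (ContinuousLinearMap.id 𝕜 Y) ∘L ctAssocInv 𝕜 A P.carrier Y ∘L tmL _ A.one)
    (ContinuousLinearMap.id 𝕜 _) (fun v w => by simp [P.L_one]) x
  d_L a x := ct_ext_apply
    ((ctMap P.d (ContinuousLinearMap.id 𝕜 Y) + ctMap P.sgn Y.d) ∘L
      ctMap P.L (ContinuousLinearMap.id 𝕜 Y) ∘L ctAssocInv 𝕜 A P.carrier Y ∘L tmL _ a)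
    (ctMap P.L (ContinuousLinearMap.id 𝕜 Y) ∘L ctAssocInv 𝕜 A P.carrier Y ∘L tmL _ (A.d a) +
      ctMap P.L (ContinuousLinearMap.id 𝕜 Y) ∘L ctAssocInv 𝕜 A P.carrier Y ∘L
        tmL _ (A.sgn a) ∘L (ctMap P.d (ContinuousLinearMap.id 𝕜 Y) + ctMap P.sgn Y.d))
    (fun v w => by
      have : P.sgn (P.L (tm 𝕜 a v)) = P.L (tm 𝕜 (A.sgn a) (P.sgn v)) := by
        refine homog_ext_apply (V := A.toGrSp) (P.sgn ∘L P.L ∘L tmR _ v)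
          (P.L ∘L tmR _ (P.sgn v) ∘L A.sgn) (fun m a ha => ?_) a
        refine homog_ext_apply (V := P.toGrSp) (P.sgn ∘L P.L ∘L tmL _ a)
          (P.L ∘L tmL _ (A.sgn a) ∘L P.sgn) (fun n v hv => ?_) v
        simp [(P.L_deg m n a v ha hv).sgn, ha.sgn, hv.sgn, smul_smul, zpow_add₀, mul_comm]
      simp [P.d_L, this, tm_add_left, add_assoc]) x

end LMod

namespace Bimod

/-- The bimodule `P ⊗̂ A` for a left module `P`. -/
abbrev ofLMod (P : LMod A) : Bimod A where
  toLMod := P.tens A.toCpx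
  R := ctMap (ContinuousLinearMap.id 𝕜 P.carrier) A.mul ∘L ctAssoc 𝕜 P.carrier A A
  R_deg m n x a hx ha := by
    have : GrSp.HasDeg (V := GrSp.tens P.toGrSp A.toGrSp) (W := GrSp.tens P.toGrSp A.toGrSp) n
        (ctMap (ContinuousLinearMap.id 𝕜 P.carrier) A.mul ∘L ctAssoc 𝕜 P.carrier A A ∘L
          tmR _ a) :=
      GrSp.tens_hasDeg fun k l v w hv hw => by
        have := hv.tm (A.mul_deg l n w a hw ha)
        rw [show k + (l + n) = k + l + n by ring] at this
        simpa using this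
    exact this m x hx
  R_mul x a b := ct_ext_apply
    (ctMap (ContinuousLinearMap.id 𝕜 P.carrier) A.mul ∘L ctAssoc 𝕜 P.carrier A A ∘L tmR _ b ∘L
      ctMap (ContinuousLinearMap.id 𝕜 P.carrier) A.mul ∘L ctAssoc 𝕜 P.carrier A A ∘L tmR _ a)
    (ctMap (ContinuousLinearMap.id 𝕜 P.carrier) A.mul ∘L ctAssoc 𝕜 P.carrier A A ∘L
      tmR _ (A.mul (tm 𝕜 a b))) (fun v w => by simp [A.mul_assoc]) x
  R_one x := ct_ext_apply
    (ctMap (ContinuousLinearMap.id 𝕜 P.carrier) A.mul ∘L ctAssoc 𝕜 P.carrier A A ∘L tmR _ A.one)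
    (ContinuousLinearMap.id 𝕜 _) (fun v w => by simp [A.mul_one]) x
  d_R x a := by
    refine ct_ext_apply
      ((ctMap P.d (ContinuousLinearMap.id 𝕜 A) + ctMap P.sgn A.d) ∘L
        ctMap (ContinuousLinearMap.id 𝕜 P.carrier) A.mul ∘L ctAssoc 𝕜 P.carrier A A ∘L tmR _ a)
      (ctMap (ContinuousLinearMap.id 𝕜 P.carrier) A.mul ∘L ctAssoc 𝕜 P.carrier A A ∘L tmR _ a ∘L
          (ctMap P.d (ContinuousLinearMap.id 𝕜 A) + ctMap P.sgn A.d) +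
        ctMap (ContinuousLinearMap.id 𝕜 P.carrier) A.mul ∘L ctAssoc 𝕜 P.carrier A A ∘L
          tmR _ (A.d a) ∘L (GrSp.tens P.toGrSp A.toGrSp).sgn) (fun v w => ?_) x
    have := GrSp.sgn_tm (V := P.toGrSp) (W := A.toGrSp) v w
    simp [A.d_mul, this, tm_add_right, add_assoc]
  L_R a x b := ct_ext_apply
    (ctMap (ContinuousLinearMap.id 𝕜 P.carrier) A.mul ∘L ctAssoc 𝕜 P.carrier A A ∘L tmR _ b ∘L
      ctMap P.L (ContinuousLinearMap.id 𝕜 A) ∘L ctAssocInv 𝕜 A P.carrier A ∘L tmL _ a)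
    (ctMap P.L (ContinuousLinearMap.id 𝕜 A) ∘L ctAssocInv 𝕜 A P.carrier A ∘L tmL _ a ∘L
      ctMap (ContinuousLinearMap.id 𝕜 P.carrier) A.mul ∘L ctAssoc 𝕜 P.carrier A A ∘L tmR _ b)
    (fun v w => by simp) x

variable (A) in
/-- The bimodule `A`. -/
abbrev self : Bimod A where
  toLMod := LMod.self A
  R := A.mul
  R_deg := A.mul_deg
  R_mul := A.mul_assoc
  R_one := A.mul_one
  d_R := A.d_mul
  L_R := A.mul_assoc

variable (M : Bimod A)

/-- The map `x ⊗ a ↦ (-1)^(|a||x|) a x`. -/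
def signedL : CT 𝕜 M.carrier A →L[𝕜] M.carrier :=
  M.L ∘L ctComm 𝕜 M.carrier A ∘L
    (ctMap (ContinuousLinearMap.id 𝕜 M.carrier)
        ((2⁻¹ : 𝕜) • (ContinuousLinearMap.id 𝕜 A.carrier + A.sgn)) +
      ctMap M.sgn ((2⁻¹ : 𝕜) • (ContinuousLinearMap.id 𝕜 A.carrier - A.sgn)))

/-- The right action of `Aᵒᵖ ⊗̂ A` on a bimodule, `x · (a ⊗ b) = (-1)^(|a||x|) a x b`. -/
def envAct : CT 𝕜 M.carrier (CT 𝕜 A A) →L[𝕜] M.carrier :=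
  M.R ∘L ctMap M.signedL (ContinuousLinearMap.id 𝕜 A.carrier) ∘L ctAssocInv 𝕜 M.carrier A A

theorem koszul_sign (m n : ℤ) : (2⁻¹ : 𝕜) * (1 + (-1) ^ m) + (2⁻¹ : 𝕜) * (1 - (-1) ^ m) * (-1) ^ n =
    (-1) ^ (m * n) := by
  rcases Int.even_or_odd m with h | h
  · rw [h.neg_one_zpow, (h.mul_right n).neg_one_zpow]; norm_num
  · rw [h.neg_one_zpow]
    rcases Int.even_or_odd n with h' | h'
    · rw [h'.neg_one_zpow, (h'.mul_left m).neg_one_zpow]; norm_num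
    · rw [h'.neg_one_zpow, (h.mul h').neg_one_zpow]; norm_num

theorem signedL_tm {m n : ℤ} {a : A} {x : M.carrier} (ha : A.Deg m a) (hx : M.Deg n x) :
    M.signedL (tm 𝕜 x a) = ((-1 : 𝕜) ^ (m * n)) • M.L (tm 𝕜 a x) := by
  rw [← koszul_sign]
  simp only [signedL, add_apply, sub_apply, smul_apply, ContinuousLinearMap.comp_apply, ctMap_tm,
    ContinuousLinearMap.id_apply, ha.sgn, hx.sgn, tm_smul_left, tm_smul_right, map_add, map_sub,
    map_smul, ctComm_tm, tm_add_right, tm_sub_right]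
  module

theorem envAct_tm {m n : ℤ} {a b : A} {x : M.carrier} (ha : A.Deg m a) (hx : M.Deg n x) :
    M.envAct (tm 𝕜 x (tm 𝕜 a b)) =
      ((-1 : 𝕜) ^ (m * n)) • M.R (tm 𝕜 (M.L (tm 𝕜 a x)) b) := by
  simp [envAct, signedL_tm M ha hx]

theorem neg_one_zpow_congr {m n : ℤ} (h : Even (m - n)) : (-1 : 𝕜) ^ m = (-1) ^ n := by
  rw [← sub_add_cancel m n, zpow_add₀ (by simp), h.neg_one_zpow, one_mul]

theorem envAct_mul (x : M.carrier) (s t : CT 𝕜 A A) :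
    M.envAct (tm 𝕜 (M.envAct (tm 𝕜 x s)) t) =
      M.envAct (tm 𝕜 x ((ofLMod (LMod.self A)).envAct (tm 𝕜 s t))) := by
  refine tens_ext_apply (V := A.toGrSp) (W := A.toGrSp) (M.envAct ∘L tmL _ (M.envAct (tm 𝕜 x s)))
    (M.envAct ∘L tmL _ x ∘L (ofLMod (LMod.self A)).envAct ∘L tmL _ s) (fun k l c e hc he => ?_) t
  refine tens_ext_apply (V := A.toGrSp) (W := A.toGrSp)
    (M.envAct ∘L tmR _ (tm 𝕜 c e) ∘L M.envAct ∘L tmL _ x)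
    (M.envAct ∘L tmL _ x ∘L (ofLMod (LMod.self A)).envAct ∘L tmR _ (tm 𝕜 c e))
    (fun i j a b ha hb => ?_) s
  refine homog_ext_apply (V := M.toGrSp)
    (M.envAct ∘L tmR _ (tm 𝕜 c e) ∘L M.envAct ∘L tmR _ (tm 𝕜 a b))
    (M.envAct ∘L tmR _ ((ofLMod (LMod.self A)).envAct (tm 𝕜 (tm 𝕜 a b) (tm 𝕜 c e))))
    (fun n x hx => ?_) x
  have h1 := M.R_deg _ _ _ _ (M.L_deg _ _ _ _ ha hx) hb
  have h2 := A.mul_deg _ _ _ _ hc ha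
  have h3 := envAct_tm (ofLMod (LMod.self A)) (b := e) hc (ha.tm hb)
  simp only [ContinuousLinearMap.comp_apply, tmR_apply, envAct_tm M ha hx,
    map_smul, envAct_tm M hc h1, h3, tm_smul_right, ctAssocInv_tm, ctMap_tm,
    ctAssoc_tm, ContinuousLinearMap.id_apply, envAct_tm M h2 hx, smul_smul]
  rw [← zpow_add₀ (by simp), ← zpow_add₀ (by simp)]
  congr 1
  · refine neg_one_zpow_congr ⟨0, by ring⟩
  · rw [← M.L_R, M.L_mul, M.R_mul]

theorem envAct_one (x : M.carrier) : M.envAct (tm 𝕜 x (tm 𝕜 A.one A.one)) = x := by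
  refine homog_ext_apply (V := M.toGrSp) (M.envAct ∘L tmR _ (tm 𝕜 A.one A.one))
    (ContinuousLinearMap.id 𝕜 _) (fun n x hx => ?_) x
  simp [envAct_tm M A.one_deg hx, M.L_one, M.R_one]

theorem envAct_deg (m n : ℤ) (x : M.carrier) (s : CT 𝕜 A A) (hx : M.Deg m x)
    (hs : (GrSp.tens A.toGrSp A.toGrSp).Deg n s) : M.Deg (m + n) (M.envAct (tm 𝕜 x s)) := by
  have : GrSp.HasDeg (V := GrSp.tens A.toGrSp A.toGrSp) (W := M.toGrSp) m
      (M.envAct ∘L tmL _ x) := GrSp.tens_hasDeg fun k l a b ha hb => by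
    have h := (M.R_deg _ _ _ _ (M.L_deg _ _ _ _ ha hx) hb).smul ((-1 : 𝕜) ^ (k * m))
    rw [← envAct_tm M ha hx, show k + m + l = k + l + m by ring] at h
    exact h
  have h := this n s hs
  rw [add_comm] at h
  exact h

theorem d_envAct (x : M.carrier) (s : CT 𝕜 A A) : M.d (M.envAct (tm 𝕜 x s)) =
    M.envAct (tm 𝕜 (M.d x) s) + M.envAct (tm 𝕜 (M.sgn x) ((A.toCpx.tens A.toCpx).d s)) := by
  refine tens_ext_apply (V := A.toGrSp) (W := A.toGrSp) (M.d ∘L M.envAct ∘L tmL _ x)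
    (M.envAct ∘L tmL _ (M.d x) +
      M.envAct ∘L tmL _ (M.sgn x) ∘L (A.toCpx.tens A.toCpx).d) (fun k l a b ha hb => ?_) s
  refine homog_ext_apply (V := M.toGrSp) (M.d ∘L M.envAct ∘L tmR _ (tm 𝕜 a b))
    (M.envAct ∘L tmR _ (tm 𝕜 a b) ∘L M.d +
      M.envAct ∘L tmR _ ((A.toCpx.tens A.toCpx).d (tm 𝕜 a b)) ∘L M.sgn) (fun n x hx => ?_) x
  have h1 := M.d_deg n x hx
  have h2 := A.d_deg k a ha
  have h3 := M.L_deg _ _ _ _ ha hx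
  simp only [ContinuousLinearMap.comp_apply, tmR_apply, add_apply, ctMap_tm, ContinuousLinearMap.id_apply,
    envAct_tm M ha hx, map_smul, M.d_R, M.d_L, h3.sgn, tm_add_left, map_add, tm_add_right,
    envAct_tm M ha h1, hx.sgn, ha.sgn, tm_smul_left, tm_smul_right, envAct_tm M h2 hx,
    smul_add, smul_smul]
  have e : ∀ m n : ℤ, (-1 : 𝕜) ^ m * (-1) ^ n = (-1) ^ (m + n) := fun m n =>
    (zpow_add₀ (by simp) m n).symm
  rw [e, e, e, e, e, neg_one_zpow_congr (m := n + (k + 1) * n) (n := k * n) ⟨n, by ring⟩,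
    neg_one_zpow_congr (m := k * n + k) (n := k * (n + 1)) ⟨0, by ring⟩,
    neg_one_zpow_congr (m := k * n + (k + n)) (n := n + k + k * n) ⟨0, by ring⟩]
  abel

end Bimod

variable (A) in
/-- The enveloping algebra `Aᵉ = Aᵒᵖ ⊗̂ A`, with
`(a ⊗ b) (c ⊗ e) = (-1)^((|a| + |b|) |c|) ca ⊗ be`. -/
def env : DGAlg.{u} 𝕜 where
  toCpx := A.toCpx.tens A.toCpx
  mul := (Bimod.ofLMod (LMod.self A)).envAct
  one := tm 𝕜 A.one A.one
  one_deg := by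
    have := A.one_deg.tm A.one_deg
    rw [add_zero] at this
    exact this
  mul_deg := Bimod.envAct_deg (Bimod.ofLMod (LMod.self A))
  mul_assoc := Bimod.envAct_mul (Bimod.ofLMod (LMod.self A))
  one_mul s := tens_ext_apply (V := A.toGrSp) (W := A.toGrSp)
    ((Bimod.ofLMod (LMod.self A)).envAct ∘L tmL _ (tm 𝕜 A.one A.one))
    (ContinuousLinearMap.id 𝕜 _) (fun k l a b ha hb => by
      have := Bimod.envAct_tm (Bimod.ofLMod (LMod.self A)) (b := b) ha (A.one_deg.tm A.one_deg)
      simp [this, A.one_mul, A.mul_one]) s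
  mul_one := Bimod.envAct_one (Bimod.ofLMod (LMod.self A))
  d_mul := Bimod.d_envAct (Bimod.ofLMod (LMod.self A))

theorem env_mul_tm {i j k : ℤ} {a b c e : A} (ha : A.Deg i a) (hb : A.Deg j b) (hc : A.Deg k c) :
    (env A).mul (tm 𝕜 (tm 𝕜 a b) (tm 𝕜 c e)) =
      ((-1 : 𝕜) ^ (k * (i + j))) • tm 𝕜 (A.mul (tm 𝕜 c a)) (A.mul (tm 𝕜 b e)) := by
  refine (Bimod.envAct_tm (Bimod.ofLMod (LMod.self A)) (b := e) hc (ha.tm hb)).trans ?_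
  simp

/-- A dg-bimodule over `A`, as a right dg-module over `Aᵉ`. -/
def Bimod.toMod (M : Bimod A) : DGMod (env A) where
  toCpx := M.toCpx
  act := M.envAct
  act_deg := M.envAct_deg
  act_mul := M.envAct_mul
  act_one := M.envAct_one
  d_act := M.d_envAct

end Bimodules

/-! ### The reduced algebra and the reduced bar construction -/

section Bar

variable {𝕜 : Type} [RCLike 𝕜] (A : DGAlg.{u} 𝕜)

/-- The space `Ā = A / 𝕜·1`. -/
def Red : Type u := A.carrier ⧸ (𝕜 ∙ A.one)

instance : AddCommGroup (Red A) := inferInstanceAs (AddCommGroup (A.carrier ⧸ (𝕜 ∙ A.one)))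
instance : Module 𝕜 (Red A) := inferInstanceAs (Module 𝕜 (A.carrier ⧸ (𝕜 ∙ A.one)))
instance : TopologicalSpace (Red A) :=
  inferInstanceAs (TopologicalSpace (A.carrier ⧸ (𝕜 ∙ A.one)))
instance : IsTopologicalAddGroup (Red A) :=
  inferInstanceAs (IsTopologicalAddGroup (A.carrier ⧸ (𝕜 ∙ A.one)))
instance : ContinuousSMul 𝕜 (Red A) :=
  inferInstanceAs (ContinuousSMul 𝕜 (A.carrier ⧸ (𝕜 ∙ A.one)))
instance : UniformSpace (Red A) := IsTopologicalAddGroup.rightUniformSpace _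
instance : IsUniformAddGroup (Red A) := isUniformAddGroup_of_addCommGroup

/-- The projection `A → Ā`. -/
def redQ : A.carrier →L[𝕜] Red A := ⟨(𝕜 ∙ A.one).mkQ, (𝕜 ∙ A.one).continuous_mkQ⟩

theorem redQ_surjective : Function.Surjective (redQ A) := (𝕜 ∙ A.one).mkQ_surjective

theorem redQ_eq_zero {a : A} : redQ A a = 0 ↔ ∃ c : 𝕜, c • A.one = a :=
  (Submodule.Quotient.mk_eq_zero (𝕜 ∙ A.one)).trans Submodule.mem_span_singleton

theorem redQ_one : redQ A A.one = 0 := (redQ_eq_zero A).2 ⟨1, one_smul _ _⟩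

theorem exists_redSec : ∃ s : Red A →L[𝕜] A.carrier, ∀ x, redQ A (s x) = x := by
  obtain ⟨p, hp⟩ := Submodule.ClosedComplemented.of_finiteDimensional (𝕜 := 𝕜) (𝕜 ∙ A.one)
  let f : A.carrier →ₗ[𝕜] A.carrier := LinearMap.id - (𝕜 ∙ A.one).subtype ∘ₗ p.toLinearMap
  have hf : (𝕜 ∙ A.one) ≤ LinearMap.ker f := fun x hx => by
    simp [f, hp ⟨x, hx⟩]
  have hc : Continuous ((𝕜 ∙ A.one).liftQ f hf) := by
    rw [(𝕜 ∙ A.one).isQuotientMap_mkQ.continuous_iff]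
    exact continuous_id.sub (continuous_subtype_val.comp p.continuous)
  refine ⟨⟨(𝕜 ∙ A.one).liftQ f hf, hc⟩, fun x => ?_⟩
  obtain ⟨a, rfl⟩ := redQ_surjective A x
  change redQ A (a - (p a : A.carrier)) = redQ A a
  rw [map_sub, (redQ_eq_zero A).2 (Submodule.mem_span_singleton.1 (p a).2), sub_zero]

/-- A continuous linear section of `A → Ā`. The constructions below do not depend on it. -/
def redSec : Red A →L[𝕜] A.carrier := (exists_redSec A).choose

@[simp] theorem redQ_redSec (x : Red A) : redQ A (redSec A x) = x := (exists_redSec A).choose_spec x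

theorem redSec_redQ (a : A) : ∃ c : 𝕜, redSec A (redQ A a) = a + c • A.one := by
  have : redQ A (redSec A (redQ A a) - a) = 0 := by simp
  obtain ⟨c, hc⟩ := (redQ_eq_zero A).1 this
  exact ⟨c, by rw [hc]; abel⟩

theorem redSec_closed : IsClosedEmbedding (redSec A) :=
  Function.LeftInverse.isClosedEmbedding (redQ_redSec A) (redQ A).continuous (redSec A).continuous

instance : T2Space (Red A) := (redSec_closed A).isEmbedding.t2Space

instance : CompleteSpace (Red A) :=
  (AddMonoidHom.isUniformInducing_of_isInducing (redSec_closed A).isInducing).completeSpace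
    (redSec_closed A).isClosed_range.isComplete

instance : PolynormableSpace 𝕜 (Red A) := polynormable_of fun U hU => by
  have : (redQ A) ⁻¹' U ∈ 𝓝 (0 : A.carrier) :=
    (redQ A).continuous.continuousAt.preimage_mem_nhds (by simpa using hU)
  obtain ⟨p, hp, hpU⟩ := exists_seminorm 𝕜 this
  exact ⟨p.comp (redSec A).toLinearMap, hp.comp (redSec A).continuous, fun x hx => by
    simpa using hpU _ hx⟩

theorem red_ext {f g : Red A →L[𝕜] Red A} (h : ∀ a, f (redQ A a) = g (redQ A a)) : f = g := by
  ext x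
  obtain ⟨a, rfl⟩ := redQ_surjective A x
  exact h a

/-- The map induced on `Ā` by an endomorphism of `A`. -/
def redMap (f : A.carrier →L[𝕜] A.carrier) : Red A →L[𝕜] Red A := redQ A ∘L f ∘L redSec A

theorem redMap_redQ {f : A.carrier →L[𝕜] A.carrier} (hf : redQ A (f A.one) = 0) (a : A) :
    redMap A f (redQ A a) = redQ A (f a) := by
  obtain ⟨c, hc⟩ := redSec_redQ A a
  simp [redMap, hc, hf]

theorem redQ_proj_one (n : ℤ) : redQ A (A.proj n A.one) = 0 := by
  rw [A.one_deg.proj_eq]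
  split_ifs
  · exact redQ_one A
  · simp

theorem sgn_one : A.sgn A.one = A.one := by simpa using A.one_deg.sgn

theorem d_one : A.d A.one = 0 := by
  have := A.d_mul A.one A.one
  rwa [A.one_mul, A.mul_one, sgn_one, A.one_mul, left_eq_add] at this

/-- The suspension `sĀ`, in which `sā` has degree `|a| - 1`. -/
def susp : Cpx.{u} 𝕜 where
  carrier := Red A
  proj n := redMap A (A.proj (n + 1))
  proj_proj m n x := by
    obtain ⟨a, rfl⟩ := redQ_surjective A x
    rw [redMap_redQ A (redQ_proj_one A _), redMap_redQ A (redQ_proj_one A _), A.proj_proj]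
    by_cases h : m = n
    · simp [h]
    · rw [if_neg h, if_neg (by omega), map_zero]
  proj_small U hU := by
    have : (redQ A) ⁻¹' U ∈ 𝓝 (0 : A.carrier) :=
      (redQ A).continuous.continuousAt.preimage_mem_nhds (by simpa using hU)
    have h2 := A.proj_small _ this
    rw [Filter.eventually_cofinite] at h2 ⊢
    refine (h2.preimage ((Equiv.addRight (1 : ℤ)).injective.injOn)).subset fun k hk hk' => ?_
    exact hk fun x => hk' _
  proj_sep x hx := by
    rw [← redQ_redSec A x]
    have h := ((GrSp.hasSum_proj (V := A.toGrSp) (redSec A x)).mapL (redQ A))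
    refine h.unique ?_
    have : (fun n => redQ A (A.proj n (redSec A x))) = fun _ => 0 := by
      funext n
      have := hx (n - 1)
      rwa [sub_add_cancel] at this
    rw [this]
    exact hasSum_zero
  d := -redMap A A.d
  d_deg n x hx := by
    obtain ⟨a, rfl⟩ := redQ_surjective A x
    have hd : redQ A (A.d A.one) = 0 := by simp [d_one]
    have hx' : redQ A (A.proj (n + 1) a) = redQ A a := by
      rw [← redMap_redQ A (redQ_proj_one A _)]; exact hx
    have e : redMap A A.d (redQ A a) = redQ A (A.d (A.proj (n + 1) a)) := by
      rw [← hx', redMap_redQ A hd]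
    change redMap A _ (-(redMap A A.d (redQ A a))) = -(redMap A A.d (redQ A a))
    rw [map_neg, e, redMap_redQ A (redQ_proj_one A _)]
    have := A.d_deg _ _ (GrSp.deg_proj (V := A.toGrSp) (n + 1) a)
    rw [this.eq]
  d_d x := by
    obtain ⟨a, rfl⟩ := redQ_surjective A x
    have hd : redQ A (A.d A.one) = 0 := by simp [d_one]
    simp [redMap_redQ A hd, A.d_d]

/-- The map `a ↦ sā`. -/
def sq : A.carrier →L[𝕜] (susp A).carrier := redQ A

/-- The chosen section of `sq`. -/
def sec : (susp A).carrier →L[𝕜] A.carrier := redSec A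

theorem sq_surjective : Function.Surjective (sq A) := redQ_surjective A

theorem sq_one : sq A A.one = 0 := redQ_one A

theorem sec_sq (a : A) : ∃ c : 𝕜, sec A (sq A a) = a + c • A.one := redSec_redQ A a

theorem susp_d (a : A) : (susp A).d (sq A a) = -sq A (A.d a) := by
  change -(redMap A A.d (redQ A a)) = -redQ A (A.d a)
  rw [redMap_redQ A (by simp [d_one])]

theorem susp_deg {n : ℤ} {a : A} (ha : A.Deg (n + 1) a) : (susp A).Deg n (sq A a) := by
  change redMap A _ (redQ A a) = redQ A a
  rw [redMap_redQ A (redQ_proj_one A _), ha.eq]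

theorem susp_sgn (a : A) : (susp A).sgn (sq A a) = -sq A (A.sgn a) := by
  refine homog_ext_apply (V := A.toGrSp) ((susp A).sgn ∘L sq A) (-(sq A ∘L A.sgn))
    (fun n a ha => ?_) a
  rw [show n = (n - 1) + 1 by ring] at ha
  have h := (susp_deg A ha).sgn
  change (susp A).sgn (sq A a) = -(sq A (A.sgn a))
  rw [h, ha.sgn, zpow_add₀ (by simp)]
  simp

variable {A} in
theorem susp_cases {n : ℤ} {x : (susp A).carrier} (hx : (susp A).Deg n x) :
    ∃ a : A, A.Deg (n + 1) a ∧ sq A a = x := by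
  refine ⟨A.proj (n + 1) (redSec A x), GrSp.deg_proj _ _, ?_⟩
  exact hx

end Bar

section BarConstruction

variable {𝕜 : Type} [RCLike 𝕜]

/-- A left module `P = A ⊗̂ (sĀ)^⊗̂n` together with the map `fold : P ⊗̂ A → P` given by
`a₀ ⊗ ā₁ ⊗ ⋯ ⊗ āₙ ⊗ a ↦ ∑ ± a₀ ⊗ ⋯ ⊗ (product of two neighbours) ⊗ ⋯ ⊗ ā`, and with those of
its properties that are needed to continue the recursion. -/
structure BarStep (A : DGAlg.{u} 𝕜) where
  P : LMod A
  fold : CT 𝕜 P.carrier A.carrier →L[𝕜] P.carrier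
  fold_deg : ∀ m n y a, P.Deg m y → A.Deg n a → P.Deg (m + n) (fold (tm 𝕜 y a))
  fold_one : ∀ y, fold (tm 𝕜 y A.one) = P.sgn y
  fold_fold : ∀ y a b, fold (tm 𝕜 (fold (tm 𝕜 y a)) b) =
    fold (tm 𝕜 (P.sgn y) (A.mul (tm 𝕜 (A.sgn a) b)))
  d_fold : ∀ y a, P.d (fold (tm 𝕜 y a)) = -fold (tm 𝕜 (P.d y) a) + fold (tm 𝕜 (P.sgn y) (A.d a))
  fold_L : ∀ a y b, fold (tm 𝕜 (P.L (tm 𝕜 a y)) b) = P.L (tm 𝕜 (A.sgn a) (fold (tm 𝕜 y b)))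

variable {A : DGAlg.{u} 𝕜}

theorem sgn_mul (a b : A) : A.sgn (A.mul (tm 𝕜 a b)) = A.mul (tm 𝕜 (A.sgn a) (A.sgn b)) := by
  refine homog_ext_apply (V := A.toGrSp) (A.sgn ∘L A.mul ∘L tmR _ b)
    (A.mul ∘L tmR _ (A.sgn b) ∘L A.sgn) (fun m a ha => ?_) a
  refine homog_ext_apply (V := A.toGrSp) (A.sgn ∘L A.mul ∘L tmL _ a)
    (A.mul ∘L tmL _ (A.sgn a) ∘L A.sgn) (fun n b hb => ?_) b
  simp [(A.mul_deg m n a b ha hb).sgn, ha.sgn, hb.sgn, smul_smul, zpow_add₀, mul_comm]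

theorem sgn_d (V : Cpx.{u} 𝕜) (x : V) : V.sgn (V.d x) = -V.d (V.sgn x) := V.d_deg.sgn_one x

namespace BarStep

variable (T : BarStep A)

theorem sgn_fold (y : T.P.carrier) (a : A) :
    T.P.sgn (T.fold (tm 𝕜 y a)) = T.fold (tm 𝕜 (T.P.sgn y) (A.sgn a)) := by
  refine homog_ext_apply (V := A.toGrSp) (T.P.sgn ∘L T.fold ∘L tmL _ y)
    (T.fold ∘L tmL _ (T.P.sgn y) ∘L A.sgn) (fun m a ha => ?_) a
  refine homog_ext_apply (V := T.P.toGrSp) (T.P.sgn ∘L T.fold ∘L tmR _ a)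
    (T.fold ∘L tmR _ (A.sgn a) ∘L T.P.sgn) (fun n y hy => ?_) y
  simp [(T.fold_deg n m y a hy ha).sgn, ha.sgn, hy.sgn, smul_smul, zpow_add₀, mul_comm]

/-- `z ⊗ c̄ ⊗ a ↦ fold (z ⊗ c) ⊗ q a - (-1)^|z| z ⊗ q (g c · a)`, for a map `q` on `A` and an
endomorphism `g` of `A` that preserves the unit. -/
def foldWith {Y : Cpx.{u} 𝕜} (q : A.carrier →L[𝕜] Y.carrier) (g : A.carrier →L[𝕜] A.carrier) :
    CT 𝕜 (CT 𝕜 T.P.carrier (susp A).carrier) A.carrier →L[𝕜] CT 𝕜 T.P.carrier Y.carrier :=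
  ctMap (T.fold ∘L ctMap (ContinuousLinearMap.id 𝕜 T.P.carrier) (sec A)) q -
    ctMap T.P.sgn (q ∘L A.mul ∘L ctMap (g ∘L sec A) (ContinuousLinearMap.id 𝕜 A.carrier)) ∘L
      ctAssoc 𝕜 T.P.carrier (susp A).carrier A.carrier

theorem foldWith_tm {Y : Cpx.{u} 𝕜} (q : A.carrier →L[𝕜] Y.carrier)
    {g : A.carrier →L[𝕜] A.carrier} (hg : g A.one = A.one) (z : T.P.carrier) (c a : A) :
    T.foldWith q g (tm 𝕜 (tm 𝕜 z (sq A c)) a) =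
      tm 𝕜 (T.fold (tm 𝕜 z c)) (q a) - tm 𝕜 (T.P.sgn z) (q (A.mul (tm 𝕜 (g c) a))) := by
  obtain ⟨r, hr⟩ := sec_sq A c
  simp [foldWith, hr, tm_add_left, tm_add_right, T.fold_one, hg, A.one_mul]

theorem red_tm_ext {W : GrSp.{u} 𝕜} {Z : Type*} [AddCommGroup Z] [Module 𝕜 Z] [TopologicalSpace Z]
    [T2Space Z] (f g : CT 𝕜 W.carrier (susp A).carrier →L[𝕜] Z)
    (h : ∀ w c, f (tm 𝕜 w (sq A c)) = g (tm 𝕜 w (sq A c)))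
    (x : CT 𝕜 W.carrier (susp A).carrier) : f x = g x :=
  ct_ext_apply f g (fun w y => by
    obtain ⟨c, rfl⟩ := sq_surjective A y
    exact h w c) x

variable (A) in
/-- `A`, with `fold (b ⊗ a) = (-1)^|b| b a`. -/
abbrev zero : BarStep A where
  P := LMod.self A
  fold := A.mul ∘L ctMap A.sgn (ContinuousLinearMap.id 𝕜 A.carrier)
  fold_deg m n y a hy ha := by
    have := (A.mul_deg m n y a hy ha).smul ((-1 : 𝕜) ^ m)
    simpa [hy.sgn] using this
  fold_one y := by simp [A.mul_one]
  fold_fold y a b := by simp [sgn_mul, A.mul_assoc]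
  d_fold y a := by simp [A.d_mul, sgn_d]
  fold_L a y b := by simp [sgn_mul, A.mul_assoc]

/-- The step from `P` to `P ⊗̂ sĀ`, with
`fold (z ⊗ c̄ ⊗ a) = fold (z ⊗ c) ⊗ ā - (-1)^|z| z ⊗ (-1)^|c| (c a)‾`. -/
abbrev next : BarStep A where
  P := T.P.tens (susp A)
  fold := T.foldWith (Y := susp A) (sq A) A.sgn
  fold_deg m n y a hy ha := by
    refine GrSp.tens_hasDeg (V := T.P.toGrSp) (W := (susp A).toGrSp)
      (Z := GrSp.tens T.P.toGrSp (susp A).toGrSp) (k := n)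
      (f := T.foldWith (Y := susp A) (sq A) A.sgn ∘L tmR _ a) (fun i j z x hz hx => ?_) m y hy
    obtain ⟨c, hc, rfl⟩ := susp_cases hx
    have e := T.foldWith_tm (Y := susp A) (sq A) (sgn_one A) z c a
    rw [ContinuousLinearMap.comp_apply, tmR_apply, e]
    refine GrSp.Deg.sub ?_ ?_
    · have h := (T.fold_deg _ _ z c hz hc).tm (susp_deg A (n := n - 1) (by simpa using ha))
      rwa [show i + (j + 1) + (n - 1) = i + j + n by ring] at h
    · have h1 := A.mul_deg _ _ _ a (GrSp.sgn_deg _ _ hc) ha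
      have h := (GrSp.sgn_deg _ _ hz).tm (susp_deg A (n := j + n)
        (by rwa [show j + 1 + 0 + n = j + n + 1 by ring] at h1))
      rwa [show i + 0 + (j + n) = i + j + n by ring] at h
  fold_one y := red_tm_ext (W := T.P.toGrSp)
    (T.foldWith (Y := susp A) (sq A) A.sgn ∘L tmR _ A.one) (GrSp.tens T.P.toGrSp (susp A).toGrSp).sgn
    (fun z c => by
      have e := T.foldWith_tm (Y := susp A) (sq A) (sgn_one A) z c A.one
      rw [ContinuousLinearMap.comp_apply, tmR_apply, e, sq_one, A.mul_one, GrSp.sgn_tm, susp_sgn]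
      simp) y
  fold_fold y a b := red_tm_ext (W := T.P.toGrSp)
    (T.foldWith (Y := susp A) (sq A) A.sgn ∘L tmR _ b ∘L T.foldWith (Y := susp A) (sq A) A.sgn ∘L tmR _ a)
    (T.foldWith (Y := susp A) (sq A) A.sgn ∘L tmR _ (A.mul (tm 𝕜 (A.sgn a) b)) ∘L
      (GrSp.tens T.P.toGrSp (susp A).toGrSp).sgn)
    (fun z c => by
      have e := T.foldWith_tm (Y := susp A) (sq A) (sgn_one A)
      have e3 := GrSp.sgn_tm (V := T.P.toGrSp) (W := (susp A).toGrSp) z (sq A c)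
      simp only [ContinuousLinearMap.comp_apply, tmR_apply]
      rw [e3]
      simp only [susp_sgn, tm_neg_right, tm_neg_left, map_neg, tm_sub_left, map_sub, e,
        T.fold_fold, T.sgn_fold, sgn_mul, GrSp.sgn_sgn, A.mul_assoc]
      abel) y
  d_fold y a := red_tm_ext (W := T.P.toGrSp)
    ((T.P.toCpx.tens (susp A)).d ∘L T.foldWith (Y := susp A) (sq A) A.sgn ∘L tmR _ a)
    (-(T.foldWith (Y := susp A) (sq A) A.sgn ∘L tmR _ a ∘L (T.P.toCpx.tens (susp A)).d) +
      T.foldWith (Y := susp A) (sq A) A.sgn ∘L tmR _ (A.d a) ∘L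
        (GrSp.tens T.P.toGrSp (susp A).toGrSp).sgn)
    (fun z c => by
      have e := T.foldWith_tm (Y := susp A) (sq A) (sgn_one A)
      have e3 := GrSp.sgn_tm (V := T.P.toGrSp) (W := (susp A).toGrSp) z (sq A c)
      simp only [ContinuousLinearMap.comp_apply, tmR_apply, add_apply, neg_apply]
      rw [e3]
      simp only [susp_sgn, tm_neg_right, tm_neg_left, map_neg, map_sub, e, ctMap_tm, ContinuousLinearMap.id_apply, susp_d, T.d_fold, GrSp.sgn_sgn,
        tm_add_left, map_add, tm_add_right, A.d_mul, sgn_d, T.sgn_fold]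
      abel) y
  fold_L a y b := red_tm_ext (W := T.P.toGrSp)
    (T.foldWith (Y := susp A) (sq A) A.sgn ∘L tmR _ b ∘L (T.P.tens (susp A)).L ∘L tmL _ a)
    ((T.P.tens (susp A)).L ∘L tmL _ (A.sgn a) ∘L T.foldWith (Y := susp A) (sq A) A.sgn ∘L tmR _ b)
    (fun z c => by
      have e := T.foldWith_tm (Y := susp A) (sq A) (sgn_one A)
      have h : T.P.sgn (T.P.L (tm 𝕜 a z)) = T.P.L (tm 𝕜 (A.sgn a) (T.P.sgn z)) := by
        have := T.fold_L a z A.one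
        rwa [T.fold_one, T.fold_one] at this
      simp [e, T.fold_L, tm_sub_right, h]) y

/-- The bimodule `P ⊗̂ A`. -/
abbrev bim : Bimod A := Bimod.ofLMod T.P

/-- The part `(y ⊗ ā) ⊗ b ↦ fold (y ⊗ a) ⊗ b - (-1)^|y| y ⊗ a b` of the differential of
the bar construction, from `(P ⊗̂ sĀ) ⊗̂ A` to `P ⊗̂ A`. -/
def del : T.next.bim.carrier →L[𝕜] T.bim.carrier :=
  T.foldWith (Y := A.toCpx) (ContinuousLinearMap.id 𝕜 A.carrier)
    (ContinuousLinearMap.id 𝕜 A.carrier)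

theorem del_tm (y : T.P.carrier) (a b : A) : T.del (tm 𝕜 (tm 𝕜 y (sq A a)) b) =
    tm 𝕜 (T.fold (tm 𝕜 y a)) b - tm 𝕜 (T.P.sgn y) (A.mul (tm 𝕜 a b)) :=
  T.foldWith_tm (Y := A.toCpx) (ContinuousLinearMap.id 𝕜 A.carrier)
    (g := ContinuousLinearMap.id 𝕜 A.carrier) rfl y a b

theorem bim_ext {Z : Type*} [AddCommGroup Z] [Module 𝕜 Z] [TopologicalSpace Z] [T2Space Z]
    (f g : T.next.bim.carrier →L[𝕜] Z)
    (h : ∀ y a b, f (tm 𝕜 (tm 𝕜 y (sq A a)) b) = g (tm 𝕜 (tm 𝕜 y (sq A a)) b))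
    (x : T.next.bim.carrier) : f x = g x :=
  ct_ext_apply (V := CT 𝕜 T.P.carrier (susp A).carrier) (W := A.carrier) f g (fun w b =>
    red_tm_ext (W := T.P.toGrSp) (f ∘L tmR _ b) (g ∘L tmR _ b) (fun y a => h y a b) w) x

theorem del_deg : GrSp.HasDeg (V := T.next.bim.toGrSp) (W := T.bim.toGrSp) 1 T.del :=
  GrSp.tens_hasDeg (V := GrSp.tens T.P.toGrSp (susp A).toGrSp) (W := A.toGrSp)
    (Z := GrSp.tens T.P.toGrSp A.toGrSp) fun m n w b hw hb => by
    refine GrSp.tens_hasDeg (V := T.P.toGrSp) (W := (susp A).toGrSp)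
      (Z := GrSp.tens T.P.toGrSp A.toGrSp) (k := n + 1) (f := T.del ∘L tmR _ b)
      (fun i j z x hz hx => ?_) m w hw |> fun h => by rwa [← add_assoc] at h
    obtain ⟨c, hc, rfl⟩ := susp_cases hx
    rw [ContinuousLinearMap.comp_apply, tmR_apply]
    erw [T.del_tm]
    refine GrSp.Deg.sub ?_ ?_
    · have h := (T.fold_deg _ _ z c hz hc).tm hb
      rwa [show i + (j + 1) + n = i + j + (n + 1) by ring] at h
    · have h := (GrSp.sgn_deg _ _ hz).tm (A.mul_deg _ _ _ b hc hb)
      rwa [show i + 0 + (j + 1 + n) = i + j + (n + 1) by ring] at h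

theorem d_del (x : T.next.bim.carrier) : T.bim.d (T.del x) = -T.del (T.next.bim.d x) :=
  T.bim_ext (T.bim.d ∘L T.del) (-(T.del ∘L T.next.bim.d)) (fun y a b => by
    have e3 := GrSp.sgn_tm (V := T.P.toGrSp) (W := (susp A).toGrSp) y (sq A a)
    have e4 := Cpx.tens_d (T.P.toCpx.tens (susp A)) A.toCpx (tm 𝕜 y (sq A a)) b
    rw [e3] at e4
    have e5 := Cpx.tens_d T.P.toCpx (susp A) y (sq A a)
    rw [e5] at e4
    change T.bim.d (T.del (tm 𝕜 (tm 𝕜 y (sq A a)) b)) =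
      -T.del (((T.P.toCpx.tens (susp A)).tens A.toCpx).d (tm 𝕜 (tm 𝕜 y (sq A a)) b))
    rw [e4]
    have e := T.del_tm
    simp only [susp_sgn, susp_d, tm_neg_right, tm_neg_left, map_neg, map_sub, e, tm_add_left,
      map_add, add_apply, ctMap_tm, ContinuousLinearMap.id_apply, T.d_fold, A.d_mul, sgn_d,
      T.sgn_fold, tm_add_right, GrSp.sgn_sgn]
    abel) x

theorem del_del (x : T.next.next.bim.carrier) : T.del (T.next.del x) = 0 :=
  T.next.bim_ext (T.del ∘L T.next.del) 0 (fun y a b => by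
    refine red_tm_ext (W := T.P.toGrSp)
      (T.del ∘L T.next.del ∘L tmR _ b ∘L tmR _ (sq A a)) 0 (fun z c => ?_) y
    have e := T.del_tm
    have e1 := T.next.del_tm (tm 𝕜 z (sq A c)) a b
    have e2 : T.next.fold (tm 𝕜 (tm 𝕜 z (sq A c)) a) = _ :=
      T.foldWith_tm (Y := susp A) (sq A) (sgn_one A) z c a
    have e3 : T.next.P.sgn (tm 𝕜 z (sq A c)) = _ :=
      GrSp.sgn_tm (V := T.P.toGrSp) (W := (susp A).toGrSp) z (sq A c)
    rw [e2, e3] at e1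
    simp only [ContinuousLinearMap.comp_apply, tmR_apply, zero_apply]
    erw [e1]
    simp only [susp_sgn, tm_neg_right, tm_neg_left, tm_sub_left, map_neg, map_sub, e, T.fold_fold, T.sgn_fold,
      GrSp.sgn_sgn, A.mul_assoc]
    abel) x

theorem del_L (a : A) (x : T.next.bim.carrier) :
    T.del (T.next.bim.L (tm 𝕜 a x)) = T.bim.L (tm 𝕜 (A.sgn a) (T.del x)) :=
  T.bim_ext (T.del ∘L T.next.bim.L ∘L tmL _ a) (T.bim.L ∘L tmL _ (A.sgn a) ∘L T.del)
    (fun y c b => by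
      have e := T.del_tm
      have h : T.P.sgn (T.P.L (tm 𝕜 a y)) = T.P.L (tm 𝕜 (A.sgn a) (T.P.sgn y)) := by
        have := T.fold_L a y A.one
        rwa [T.fold_one, T.fold_one] at this
      have e1 : T.next.bim.L (tm 𝕜 a (tm 𝕜 (tm 𝕜 y (sq A c)) b)) =
          tm 𝕜 (tm 𝕜 (T.P.L (tm 𝕜 a y)) (sq A c)) b := by
        simp [next]
      change T.del (T.next.bim.L (tm 𝕜 a (tm 𝕜 (tm 𝕜 y (sq A c)) b))) =
        T.bim.L (tm 𝕜 (A.sgn a) (T.del (tm 𝕜 (tm 𝕜 y (sq A c)) b)))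
      rw [e1, e, e]
      simp [tm_sub_right, T.fold_L, h]) x

theorem del_R (a : A) (x : T.next.bim.carrier) :
    T.del (T.next.bim.R (tm 𝕜 x a)) = T.bim.R (tm 𝕜 (T.del x) a) :=
  T.bim_ext (T.del ∘L T.next.bim.R ∘L tmR _ a) (T.bim.R ∘L tmR _ a ∘L T.del)
    (fun y c b => by
      have e := T.del_tm
      have e1 : T.next.bim.R (tm 𝕜 (tm 𝕜 (tm 𝕜 y (sq A c)) b) a) =
          tm 𝕜 (tm 𝕜 y (sq A c)) (A.mul (tm 𝕜 b a)) := by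
        simp [next]
      change T.del (T.next.bim.R (tm 𝕜 (tm 𝕜 (tm 𝕜 y (sq A c)) b) a)) =
        T.bim.R (tm 𝕜 (T.del (tm 𝕜 (tm 𝕜 y (sq A c)) b)) a)
      rw [e1, e, e]
      simp [tm_sub_left, A.mul_assoc]) x

end BarStep

end BarConstruction

section Bar

variable {𝕜 : Type} [RCLike 𝕜]

/-- The product totalization of a complex `⋯ → B 2 → B 1 → B 0` of bimodules, where the maps `δ`
have degree one and anticommute with the internal differentials. -/
def Bimod.tot {A : DGAlg.{u} 𝕜} (B : ℕ → Bimod A) (δ : ∀ n, (B (n + 1)).carrier →L[𝕜] (B n).carrier)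
    (δ_deg : ∀ n, GrSp.HasDeg (V := (B (n + 1)).toGrSp) (W := (B n).toGrSp) 1 (δ n))
    (d_δ : ∀ n x, (B n).d (δ n x) = -δ n ((B (n + 1)).d x))
    (δ_δ : ∀ n x, δ n (δ (n + 1) x) = 0)
    (δ_L : ∀ n a x, δ n ((B (n + 1)).L (tm 𝕜 a x)) = (B n).L (tm 𝕜 (A.sgn a) (δ n x)))
    (δ_R : ∀ n x a, δ n ((B (n + 1)).R (tm 𝕜 x a)) = (B n).R (tm 𝕜 (δ n x) a)) : Bimod A where
  toGrSp := GrSp.pi fun n : ℕ => (B n).toGrSp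
  d := ContinuousLinearMap.pi fun n =>
    (B n).d ∘L (ContinuousLinearMap.proj n : (∀ n, (B n).carrier) →L[𝕜] (B n).carrier) +
      δ n ∘L (ContinuousLinearMap.proj (n + 1) : (∀ n, (B n).carrier) →L[𝕜] (B (n + 1)).carrier)
  d_deg k x hx := funext fun n =>
    ((B n).d_deg k (x n) (congrFun hx n)).add (δ_deg n k (x (n + 1)) (congrFun hx (n + 1)))
  d_d x := funext fun n => by
    have h1 := (B n).d_d (x n)
    simp [h1, d_δ, δ_δ]
    rfl
  L := ContinuousLinearMap.pi fun n => (B n).L ∘L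
    ctMap (ContinuousLinearMap.id 𝕜 A.carrier)
      (ContinuousLinearMap.proj n : (∀ n, (B n).carrier) →L[𝕜] _)
  L_deg m k a x ha hx := funext fun n => by
    have := ((B n).L_deg m k a (x n) ha (congrFun hx n)).eq
    simpa using this
  L_mul a b x := funext fun n => by simpa using (B n).L_mul a b (x n)
  L_one x := funext fun n => by simpa using (B n).L_one (x n)
  d_L a x := funext fun n => by
    have h1 := (B n).d_L a (x n)
    simp [h1, δ_L, tm_add_right]
    abel
  R := ContinuousLinearMap.pi fun n => (B n).R ∘L
    ctMap (ContinuousLinearMap.proj n : (∀ n, (B n).carrier) →L[𝕜] _)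
      (ContinuousLinearMap.id 𝕜 A.carrier)
  R_deg m k x a hx ha := funext fun n => by
    have := ((B n).R_deg m k (x n) a (congrFun hx n) ha).eq
    simpa using this
  R_mul x a b := funext fun n => by simpa using (B n).R_mul (x n) a b
  R_one x := funext fun n => by simpa using (B n).R_one (x n)
  d_R x a := funext fun n => by
    have h1 := (B n).d_R (x n) a
    have h3 := GrSp.sgn_pi (fun n : ℕ => (B n).toGrSp) x n
    rw [← h3] at h1
    simp [h1, δ_R, tm_add_left]
    abel
  L_R a x b := funext fun n => by simpa using (B n).L_R a (x n) b

variable (A : DGAlg.{u} 𝕜)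

/-- The left modules `A ⊗̂ (sĀ)^⊗̂n`, as iterated tensor products. -/
def step : ℕ → BarStep A
  | 0 => BarStep.zero A
  | n + 1 => (step n).next

/-- The reduced bar construction: the product totalization `∏ n, A ⊗̂ (sĀ)^⊗̂n ⊗̂ A`. -/
def barBimod : Bimod A :=
  Bimod.tot (fun n => (step A n).bim) (fun n => (step A n).del) (fun n => (step A n).del_deg)
    (fun n => (step A n).d_del) (fun n => (step A n).del_del) (fun n => (step A n).del_L)
    (fun n x a => (step A n).del_R a x)

/-- The reduced bar construction as a right `Aᵉ`-module. -/
def Bar : DGMod (env A) := (barBimod A).toMod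

/-- `A` as a right `Aᵉ`-module. -/
def selfMod : DGMod (env A) := (Bimod.self A).toMod

theorem toMod_hom {M N : Bimod A} (f : M.carrier →L[𝕜] N.carrier)
    (hdeg : GrSp.HasDeg (V := M.toGrSp) (W := N.toGrSp) 0 f)
    (hL : ∀ a x, f (M.L (tm 𝕜 a x)) = N.L (tm 𝕜 a (f x)))
    (hR : ∀ x a, f (M.R (tm 𝕜 x a)) = N.R (tm 𝕜 (f x) a)) : f ∈ HomDeg M.toMod N.toMod 0 := by
  refine ⟨hdeg, fun x s => ?_⟩
  refine tens_ext_apply (V := A.toGrSp) (W := A.toGrSp) (f ∘L M.envAct ∘L tmL _ x)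
    (N.envAct ∘L tmL _ (f x)) (fun k l a b ha hb => ?_) s
  refine homog_ext_apply (V := M.toGrSp) (f ∘L M.envAct ∘L tmR _ (tm 𝕜 a b))
    (N.envAct ∘L tmR _ (tm 𝕜 a b) ∘L f) (fun n y hy => ?_) x
  have h := hdeg n y hy
  rw [add_zero] at h
  simp [M.envAct_tm ha hy, N.envAct_tm ha h, hL, hR]

/-- The augmentation `Bar → A`, given by the multiplication `A ⊗̂ A → A` on the zeroth term. -/
def aug : Bar A ⟶ selfMod A :=
  ⟨A.mul ∘L (ContinuousLinearMap.proj 0 :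
      (∀ n : ℕ, (step A n).bim.carrier) →L[𝕜] CT 𝕜 A.carrier A.carrier), by
    refine mem_HomZ.2 ⟨toMod_hom A (M := barBimod A) (N := Bimod.self A) _ ?_ ?_ ?_, fun x => ?_⟩
    · intro n x hx
      have hx0 : (GrSp.tens A.toGrSp A.toGrSp).Deg n (x 0) := congrFun hx 0
      exact GrSp.tens_hasDeg (f := A.mul) (fun i j a b ha hb => by
        simpa using A.mul_deg i j a b ha hb) n (x 0) hx0
    · intro a x
      have e : (barBimod A).L (tm 𝕜 a x) 0 = (step A 0).bim.L (tm 𝕜 a (x 0)) :=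
        congrArg (step A 0).bim.L (ctMap_tm _ _ _ _)
      have h := ct_ext_apply
        (A.mul ∘L ctMap A.mul (ContinuousLinearMap.id 𝕜 A.carrier) ∘L
          ctAssocInv 𝕜 A.carrier A.carrier A.carrier ∘L tmL _ a)
        (A.mul ∘L tmL _ a ∘L A.mul) (fun b c => by simp [A.mul_assoc]) (x 0)
      exact (congrArg A.mul e).trans h
    · intro x a
      have e : (barBimod A).R (tm 𝕜 x a) 0 = (step A 0).bim.R (tm 𝕜 (x 0) a) :=
        congrArg (step A 0).bim.R (ctMap_tm _ _ _ _)
      have h := ct_ext_apply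
        (A.mul ∘L ctMap (ContinuousLinearMap.id 𝕜 A.carrier) A.mul ∘L
          ctAssoc 𝕜 A.carrier A.carrier A.carrier ∘L tmR _ a)
        (A.mul ∘L tmR _ a ∘L A.mul) (fun b c => by simp [A.mul_assoc]) (x 0)
      exact (congrArg A.mul e).trans h
    · rw [zpow_zero, one_smul]
      have h1 := ct_ext_apply (A.d ∘L A.mul) (A.mul ∘L (A.toCpx.tens A.toCpx).d)
        (fun b c => by simp [A.d_mul]) (x 0)
      have h2 := (BarStep.zero A).bim_ext (A.mul ∘L (BarStep.zero A).del) 0 (fun y a b => by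
        have e := (BarStep.zero A).del_tm y a b
        have e2 := congrArg A.mul e
        refine e2.trans ?_
        simp [A.mul_assoc]) (x 1)
      have h3 : A.mul ((A.toCpx.tens A.toCpx).d (x 0) + (BarStep.zero A).del (x 1)) =
          A.mul ((A.toCpx.tens A.toCpx).d (x 0)) := by
        rw [map_add]
        exact (congrArg _ h2).trans (add_zero _)
      exact h1.trans h3.symm⟩

end Bar

/-! ### The three Hochschild complexes -/

section Hochschild

variable {𝕜 : Type} [RCLike 𝕜] (A : DGAlg.{u} 𝕜)

/-- Degree `N` of the continuous Hochschild complex `Hom_{Aᵉ}(Bar, A)[-1]`. -/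
def hcCont (N : ℤ) : Submodule 𝕜 ((Bar A).carrier →L[𝕜] (selfMod A).carrier) :=
  HomDeg (Bar A) (selfMod A) (N + 1)

/-- The term `Bar_n = A ⊗̂ (sĀ)^⊗̂n ⊗̂ A` as a right `Aᵉ`-module. -/
abbrev barTerm (n : ℕ) : DGMod (env A) := (step A n).bim.toMod

/-- Degree `N` of the direct product totalization of the complexes `Hom_{Aᵉ}(Bar_n, A)[-1]`. -/
def hcPi (N : ℤ) :
    Submodule 𝕜 (∀ n : ℕ, (barTerm A n).carrier →L[𝕜] (selfMod A).carrier) :=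
  Submodule.pi Set.univ fun n => HomDeg (barTerm A n) (selfMod A) (N + 1)

/-- Degree `N` of the direct sum totalization of the complexes `Hom_{Aᵉ}(Bar_n, A)[-1]`. -/
def hcSum (N : ℤ) :
    Submodule 𝕜 (∀ n : ℕ, (barTerm A n).carrier →L[𝕜] (selfMod A).carrier) where
  carrier := {f | f ∈ hcPi A N ∧ ∀ᶠ n in Filter.cofinite, f n = 0}
  add_mem' {f g} hf hg := ⟨add_mem hf.1 hg.1, by
    filter_upwards [hf.2, hg.2] with n h1 h2
    simp [h1, h2]⟩
  zero_mem' := ⟨zero_mem _, by simp⟩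
  smul_mem' c f hf := ⟨Submodule.smul_mem _ c hf.1, by
    filter_upwards [hf.2] with n h1
    simp [h1]⟩

/-- The graded space underlying the continuous Hochschild complex. -/
abbrev HCCont (N : ℤ) : Type u := hcCont A N

/-- The graded space underlying the direct product totalization. -/
abbrev HCPi (N : ℤ) : Type u := hcPi A N

/-- The graded space underlying the direct sum totalization. -/
abbrev HCSum (N : ℤ) : Type u := hcSum A N

/-- The inclusion of the `n`-th term into the bar construction (as graded `Aᵉ`-modules). -/
def barIncl (n : ℕ) : (barTerm A n).carrier →L[𝕜] (Bar A).carrier :=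
  (ContinuousLinearMap.single 𝕜 (fun n : ℕ => (step A n).bim.carrier) n :
    (step A n).bim.carrier →L[𝕜] ∀ n, (step A n).bim.carrier)

theorem barIncl_same (n : ℕ) (x : (step A n).bim.carrier) :
    (barIncl A n x : ∀ n, (step A n).bim.carrier) n = x :=
  Pi.single_eq_same (M := fun n => (step A n).bim.carrier) n x

theorem barIncl_ne {m n : ℕ} (h : m ≠ n) (x : (step A n).bim.carrier) :
    (barIncl A n x : ∀ n, (step A n).bim.carrier) m = 0 :=
  Pi.single_eq_of_ne (M := fun n => (step A n).bim.carrier) h x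

theorem barIncl_mem (n : ℕ) : barIncl A n ∈ HomDeg (barTerm A n) (Bar A) 0 := by
  refine toMod_hom A (M := (step A n).bim) (N := barBimod A) (barIncl A n) ?_ ?_ ?_
  · intro k x hx
    rw [add_zero]
    funext m
    change (step A m).bim.proj k ((barIncl A n x : ∀ n, (step A n).bim.carrier) m) =
      (barIncl A n x : ∀ n, (step A n).bim.carrier) m
    by_cases h : m = n
    · subst h
      rw [barIncl_same]
      exact hx
    · rw [barIncl_ne A h, map_zero]
  · intro a x
    funext m
    refine Eq.trans ?_ (congrArg (step A m).bim.L (ctMap_tm _ _ _ _)).symm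
    change (barIncl A n ((step A n).bim.L (tm 𝕜 a x)) : ∀ n, (step A n).bim.carrier) m =
      (step A m).bim.L (tm 𝕜 a ((barIncl A n x : ∀ n, (step A n).bim.carrier) m))
    by_cases h : m = n
    · subst h
      rw [barIncl_same, barIncl_same]
    · rw [barIncl_ne A h, barIncl_ne A h, tm_zero_right, map_zero]
  · intro x a
    funext m
    refine Eq.trans ?_ (congrArg (step A m).bim.R (ctMap_tm _ _ _ _)).symm
    change (barIncl A n ((step A n).bim.R (tm 𝕜 x a)) : ∀ n, (step A n).bim.carrier) m =
      (step A m).bim.R (tm 𝕜 ((barIncl A n x : ∀ n, (step A n).bim.carrier) m) a)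
    by_cases h : m = n
    · subst h
      rw [barIncl_same, barIncl_same]
    · rw [barIncl_ne A h, barIncl_ne A h, tm_zero_left, map_zero]

/-- The map from the continuous Hochschild complex to the product totalization that restricts a
map on the bar construction to its terms. -/
def hcIncl (N : ℤ) : HCCont A N →ₗ[𝕜] HCPi A N where
  toFun f := ⟨fun n => f.1 ∘L barIncl A n, fun n _ => by
    have := comp_mem_HomDeg (barIncl_mem A n) f.2
    rwa [zero_add] at this⟩
  map_add' f g := Subtype.ext (funext fun n => ContinuousLinearMap.add_comp f.1 g.1 _)
  map_smul' c f := Subtype.ext (funext fun n => ContinuousLinearMap.smul_comp c f.1 _)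

/-- The element `1 ⊗ a₁ ⊗ ⋯ ⊗ aₙ` of `A ⊗̂ (sĀ)^⊗̂n`. -/
def halfWord : ∀ n : ℕ, (Fin n → A.carrier) → (step A n).P.carrier
  | 0, _ => A.one
  | n + 1, a => (tm 𝕜 (halfWord n (Fin.init a)) (sq A (a (Fin.last n))) :
      CT 𝕜 (step A n).P.carrier (susp A).carrier)

variable {A} in
/-- A cochain as a collection of multilinear maps:
`f(a₁, …, aₙ) = fₙ(1 ⊗ a₁ ⊗ ⋯ ⊗ aₙ ⊗ 1)`. -/
def evalCochain {N : ℤ} (f : HCPi A N) (l : List A.carrier) : A.carrier :=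
  f.1 l.length (tm 𝕜 (halfWord A l.length l.get) A.one)

/-- The Koszul sign `(-1)^(R (|a| - 1))` for an operation of degree `R` passing `sa`. -/
def twist (R : ℤ) (a : A.carrier) : A.carrier := if Even R then a else -A.sgn a

/-- The brace operation on multilinear operations of given degrees: `brace f pre [g₁, …, gₖ] x`
is the sum of `± f (pre, u₀, g₁ v₁, u₁, …, gₖ vₖ, uₖ)` over all ways of writing `x` as a
concatenation of `u₀, v₁, u₁, …, vₖ, uₖ`, with the Koszul signs for the degrees `|a| - 1`. -/
def brace (f : List A.carrier → A.carrier) (pre : List A.carrier) :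
    List (ℤ × (List A.carrier → A.carrier)) → List A.carrier → A.carrier
  | [], x => f (pre ++ x)
  | (N, g) :: G, x => ∑ i ∈ Finset.range (x.length + 1), ∑ j ∈ Finset.range (x.length - i + 1),
      brace f (pre ++ (x.take i).map (twist A (N + (G.map Prod.fst).sum)) ++
        [g (((x.drop i).take j).map (twist A (G.map Prod.fst).sum))]) G ((x.drop i).drop j)

/-- The structure of `A` as an operation of degree one: `b(a) = -da` and
`b(a₁, a₂) = -(-1)^|a₁| a₁ a₂`. -/
def structureOp : List A.carrier → A.carrier
  | [a] => -A.d a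
  | [a, b] => -A.mul (tm 𝕜 (A.sgn a) b)
  | _ => 0

end Hochschild

/-! ### `B_∞`-algebras -/

section BInfinity

variable (𝕜 : Type) [RCLike 𝕜] (V : ℤ → Type u) [∀ n, AddCommGroup (V n)] [∀ n, Module 𝕜 (V n)]

/-- The tensor space `T(V) = ⨁ k, V^⊗k` of a graded space `V`. -/
abbrev TS : Type u := TensorAlgebra 𝕜 (⨁ n, V n)

namespace TS

variable {V} in
/-- A homogeneous element of `V`, as a word of length one. -/
def of {n : ℤ} (v : V n) : TS 𝕜 V := TensorAlgebra.ι 𝕜 (DirectSum.lof 𝕜 ℤ V n v)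

variable {V} in
/-- The word `v₁ ⊗ ⋯ ⊗ vₖ`. -/
def word (l : List (Σ n, V n)) : TS 𝕜 V := (l.map fun v => of 𝕜 v.2).prod

/-- The part of total degree `n` of `T(V)`. -/
def deg (n : ℤ) : Submodule 𝕜 (TS 𝕜 V) :=
  Submodule.span 𝕜 {x | ∃ l : List (Σ n, V n), (l.map Sigma.fst).sum = n ∧ word 𝕜 l = x}

/-- The parity operator `x ↦ (-1)^|x| x`. -/
def sgn : TS 𝕜 V →ₐ[𝕜] TS 𝕜 V :=
  TensorAlgebra.lift 𝕜 (TensorAlgebra.ι 𝕜 ∘ₗ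
    DirectSum.lmap fun n : ℤ => ((-1 : 𝕜) ^ n) • (LinearMap.id : V n →ₗ[𝕜] V n))

/-- The operator `x ⊗ y ↦ v x ⊗ y + ε(x) 1 ⊗ v y`. -/
def deconcatStep : (⨁ n, V n) →ₗ[𝕜] Module.End 𝕜 (TS 𝕜 V ⊗[𝕜] TS 𝕜 V) :=
  (LinearMap.rTensorHom (TS 𝕜 V) + LinearMap.mulLeft 𝕜 (LinearMap.rTensor (TS 𝕜 V)
      (Algebra.linearMap 𝕜 (TS 𝕜 V) ∘ₗ TensorAlgebra.algebraMapInv.toLinearMap) :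
        Module.End 𝕜 (TS 𝕜 V ⊗[𝕜] TS 𝕜 V)) ∘ₗ LinearMap.lTensorHom (TS 𝕜 V)) ∘ₗ
    LinearMap.mul 𝕜 (TS 𝕜 V) ∘ₗ TensorAlgebra.ι 𝕜

/-- Deconcatenation `v₁ ⋯ vₖ ↦ ∑ i, v₁ ⋯ vᵢ ⊗ vᵢ₊₁ ⋯ vₖ`. -/
def deconcat : TS 𝕜 V →ₗ[𝕜] TS 𝕜 V ⊗[𝕜] TS 𝕜 V :=
  LinearMap.applyₗ (1 ⊗ₜ[𝕜] 1) ∘ₗ (TensorAlgebra.lift 𝕜 (deconcatStep 𝕜 V)).toLinearMap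

variable {V} in
theorem deconcatStep_tmul {n : ℤ} (v : V n) (x y : TS 𝕜 V) :
    deconcatStep 𝕜 V (DirectSum.lof 𝕜 ℤ V n v) (x ⊗ₜ y) = (of 𝕜 v * x) ⊗ₜ y +
      (algebraMap 𝕜 (TS 𝕜 V) (TensorAlgebra.algebraMapInv x)) ⊗ₜ (of 𝕜 v * y) := by
  simp [deconcatStep, of]

variable {V} in
theorem deconcat_cons {n : ℤ} (v : V n) (t : TS 𝕜 V) : deconcat 𝕜 V (of 𝕜 v * t) =
    deconcatStep 𝕜 V (DirectSum.lof 𝕜 ℤ V n v) (deconcat 𝕜 V t) := by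
  simp [deconcat, of]

variable {V} in
theorem deconcat_word (l : List (Σ n, V n)) : deconcat 𝕜 V (word 𝕜 l) =
    ∑ i ∈ Finset.range (l.length + 1), word 𝕜 (l.take i) ⊗ₜ[𝕜] word 𝕜 (l.drop i) := by
  have hw : ∀ (v : Σ n, V n) (l : List (Σ n, V n)), word 𝕜 (v :: l) = of 𝕜 v.2 * word 𝕜 l :=
    fun v l => by simp [word]
  induction l with
  | nil => simp [word, deconcat]
  | cons v l ih =>
    rw [hw, deconcat_cons, ih, map_sum, List.length_cons, Finset.sum_range_succ' _ (l.length + 1)]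
    simp only [deconcatStep_tmul, List.take_succ_cons, List.drop_succ_cons, hw,
      Finset.sum_add_distrib, List.take_zero, List.drop_zero]
    congr 1
    rw [Finset.sum_eq_single 0]
    · simp [word]
    · intro i hi hi0
      obtain ⟨w, l', h⟩ : ∃ w l', l.take i = w :: l' := by
        cases l with
        | nil => simp at hi; omega
        | cons w l =>
          obtain ⟨i, rfl⟩ := Nat.exists_eq_succ_of_ne_zero hi0
          exact ⟨w, _, rfl⟩
      rw [h, hw]
      simp [of, TensorAlgebra.algebraMapInv]
    · simp

/-- The signed middle exchange
`(x₁ ⊗ x₂) ⊗ (y₁ ⊗ y₂) ↦ (-1)^(|x₂||y₁|) (x₁ ⊗ y₁) ⊗ (x₂ ⊗ y₂)`. -/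
def exchange : (TS 𝕜 V ⊗[𝕜] TS 𝕜 V) ⊗[𝕜] (TS 𝕜 V ⊗[𝕜] TS 𝕜 V) →ₗ[𝕜]
    (TS 𝕜 V ⊗[𝕜] TS 𝕜 V) ⊗[𝕜] (TS 𝕜 V ⊗[𝕜] TS 𝕜 V) :=
  (TensorProduct.tensorTensorTensorComm 𝕜 _ _ _ _).toLinearMap ∘ₗ
    (TensorProduct.map (TensorProduct.map LinearMap.id
        ((2⁻¹ : 𝕜) • (LinearMap.id + (sgn 𝕜 V).toLinearMap))) LinearMap.id +
      TensorProduct.map (TensorProduct.map LinearMap.id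
        ((2⁻¹ : 𝕜) • (LinearMap.id - (sgn 𝕜 V).toLinearMap)))
        (TensorProduct.map (sgn 𝕜 V).toLinearMap LinearMap.id))

variable {V} in
/-- The map of tensor spaces induced by a graded linear map. -/
def map {V' : ℤ → Type u} [∀ n, AddCommGroup (V' n)] [∀ n, Module 𝕜 (V' n)]
    (f : ∀ n, V n →ₗ[𝕜] V' n) : TS 𝕜 V →ₐ[𝕜] TS 𝕜 V' :=
  TensorAlgebra.lift 𝕜 (TensorAlgebra.ι 𝕜 ∘ₗ DirectSum.lmap f)

end TS

/-- A `B_∞`-algebra structure on a graded space `V` (graded so that the structure maps of its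
tensor coalgebra have the degrees below, that is, `V` is the shift of the space that often carries
this name): a structure of dg-bialgebra on the tensor space `T(V)` with the deconcatenation
coproduct, the counit `T(V) → 𝕜` and the unit `1`. -/
structure BInf where
  D : TS 𝕜 V →ₗ[𝕜] TS 𝕜 V
  mul : TS 𝕜 V ⊗[𝕜] TS 𝕜 V →ₗ[𝕜] TS 𝕜 V
  D_deg : ∀ n, ∀ x ∈ TS.deg 𝕜 V n, D x ∈ TS.deg 𝕜 V (n + 1)
  D_D : ∀ x, D (D x) = 0
  D_one : D 1 = 0
  counit_D : ∀ x, TensorAlgebra.algebraMapInv (D x) = (0 : 𝕜)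
  deconcat_D : ∀ x, TS.deconcat 𝕜 V (D x) =
    TensorProduct.map D LinearMap.id (TS.deconcat 𝕜 V x) +
      TensorProduct.map (TS.sgn 𝕜 V).toLinearMap D (TS.deconcat 𝕜 V x)
  mul_deg : ∀ m n, ∀ x ∈ TS.deg 𝕜 V m, ∀ y ∈ TS.deg 𝕜 V n, mul (x ⊗ₜ y) ∈ TS.deg 𝕜 V (m + n)
  mul_assoc : ∀ x y z, mul (mul (x ⊗ₜ y) ⊗ₜ z) = mul (x ⊗ₜ mul (y ⊗ₜ z))
  one_mul : ∀ x, mul (1 ⊗ₜ x) = x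
  mul_one : ∀ x, mul (x ⊗ₜ 1) = x
  counit_mul : ∀ x y, TensorAlgebra.algebraMapInv (mul (x ⊗ₜ y)) =
    (TensorAlgebra.algebraMapInv x * TensorAlgebra.algebraMapInv y : 𝕜)
  deconcat_mul : ∀ x y, TS.deconcat 𝕜 V (mul (x ⊗ₜ y)) =
    TensorProduct.map mul mul
      (TS.exchange 𝕜 V (TS.deconcat 𝕜 V x ⊗ₜ TS.deconcat 𝕜 V y))
  D_mul : ∀ x y, D (mul (x ⊗ₜ y)) = mul (D x ⊗ₜ y) + mul (TS.sgn 𝕜 V x ⊗ₜ D y)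

variable {𝕜 V} in
/-- The component `T(V) → V` of the differential. -/
def BInf.d (b : BInf 𝕜 V) (x : TS 𝕜 V) : ⨁ n, V n := TensorAlgebra.ιInv (b.D x)

variable {𝕜 V} in
/-- The component `T(V) ⊗ T(V) → V` of the multiplication. -/
def BInf.m (b : BInf 𝕜 V) (x y : TS 𝕜 V) : ⨁ n, V n := TensorAlgebra.ιInv (b.mul (x ⊗ₜ y))

variable {𝕜 V} in
/-- The graded map `f` is a (strict) morphism of `B_∞`-algebras: the induced map of tensor
coalgebras is a morphism of dg-bialgebras. -/
def BInf.IsHom {V' : ℤ → Type u} [∀ n, AddCommGroup (V' n)] [∀ n, Module 𝕜 (V' n)]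
    (b : BInf 𝕜 V) (b' : BInf 𝕜 V') (f : ∀ n, V n →ₗ[𝕜] V' n) : Prop :=
  (∀ x, TS.map 𝕜 f (b.D x) =
      b'.D (TS.map 𝕜 f x)) ∧
    ∀ x y, TS.map 𝕜 f (b.mul (x ⊗ₜ y)) =
      b'.mul (TS.map 𝕜 f x ⊗ₜ TS.map 𝕜 f y)

/-- A dg-Lie algebra structure on a graded space. The identities are stated in `⨁ n, V n`. -/
structure DGLie where
  d : ∀ n, V n →ₗ[𝕜] V (n + 1)
  brk : ∀ m n, V m →ₗ[𝕜] V n →ₗ[𝕜] V (m + n)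
  d_d : ∀ n x, d (n + 1) (d n x) = 0
  antisymm : ∀ m n x y, DirectSum.lof 𝕜 ℤ V _ (brk m n x y) =
    -((-1 : 𝕜) ^ (m * n)) • DirectSum.lof 𝕜 ℤ V _ (brk n m y x)
  jacobi : ∀ l m n x y z, DirectSum.lof 𝕜 ℤ V _ (brk l (m + n) x (brk m n y z)) =
    DirectSum.lof 𝕜 ℤ V _ (brk (l + m) n (brk l m x y) z) +
      ((-1 : 𝕜) ^ (l * m)) • DirectSum.lof 𝕜 ℤ V _ (brk m (l + n) y (brk l n x z))
  leibniz : ∀ m n x y, DirectSum.lof 𝕜 ℤ V _ (d (m + n) (brk m n x y)) =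
    DirectSum.lof 𝕜 ℤ V _ (brk (m + 1) n (d m x) y) +
      ((-1 : 𝕜) ^ m) • DirectSum.lof 𝕜 ℤ V _ (brk m (n + 1) x (d n y))

end BInfinity

section Braces

variable {𝕜 : Type} [RCLike 𝕜] (A : DGAlg.{u} 𝕜)

variable {A} in
/-- `x` is a single cochain of degree `N`, and as a collection of multilinear maps it is `F`. -/
def IsCochain (N : ℤ) (x : ⨁ n, HCPi A n) (F : List A.carrier → A.carrier) : Prop :=
  ∃ h : HCPi A N, x = DirectSum.lof 𝕜 ℤ (HCPi A) N h ∧ ∀ l, evalCochain h l = F l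

variable {A} in
/-- The `B_∞`-structure `b` on the product totalization is given by the usual formulas: the
differential `b{f} - (-1)^|f| f{b}`, the cup product `b{f, g}` and the braces `f{g₁, …, gₖ}`,
where `b` is the structure of `A`; all other components vanish. -/
def IsBraceStructure (b : BInf 𝕜 (HCPi A)) : Prop :=
  (∀ (m : ℤ) (f : HCPi A m), IsCochain (m + 1) (b.d (TS.of 𝕜 (V := HCPi A) f)) fun l =>
      brace A (structureOp A) [] [(m, evalCochain f)] l -
        ((-1 : 𝕜) ^ m) • brace A (evalCochain f) [] [(1, structureOp A)] l) ∧
    (∀ (m n : ℤ) (f : HCPi A m) (g : HCPi A n),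
      IsCochain (m + n + 1) (b.d (TS.word 𝕜 (V := HCPi A) [⟨m, f⟩, ⟨n, g⟩]))
        (brace A (structureOp A) [] [(m, evalCochain f), (n, evalCochain g)])) ∧
    (∀ l : List (Σ n, HCPi A n), 2 < l.length → b.d (TS.word 𝕜 l) = 0) ∧
    (∀ (m : ℤ) (f : HCPi A m) (l : List (Σ n, HCPi A n)),
      IsCochain (m + (l.map Sigma.fst).sum)
        (b.m (TS.of 𝕜 (V := HCPi A) f) (TS.word 𝕜 l))
        (brace A (evalCochain f) [] (l.map fun g => (g.1, evalCochain g.2)))) ∧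
    ∀ k l : List (Σ n, HCPi A n), 1 < k.length → 0 < l.length →
      b.m (TS.word 𝕜 k) (TS.word 𝕜 l) = 0

end Braces

/-- The cohomology `Hᴺ` of the continuous Hochschild complex, that is, `Hᴺ⁺¹` of
`Hom_{Aᵉ}(Bar, A)`. -/
abbrev hcH {𝕜 : Type} [RCLike 𝕜] (A : DGAlg.{u} 𝕜) (N : ℤ) : Type u :=
  HomH (Bar A) (selfMod A) (N + 1)

/-- The differential of the continuous Hochschild complex `Hom_{Aᵉ}(Bar, A)[-1]`. -/
def hcD {𝕜 : Type} [RCLike 𝕜] (A : DGAlg.{u} 𝕜) (N : ℤ) : HCCont A N →ₗ[𝕜] HCCont A (N + 1) :=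
  -homD (Bar A) (selfMod A) (N + 1)

end CtrHoch

end

open CategoryTheory CtrHoch

open Topology Filter UniformSpace
open scoped TensorProduct DirectSum

noncomputable section

namespace CtrHoch

universe u v

/-! ### Sums over the splittings of a word -/

section Splittings

variable {α β M N : Type*} [AddCommMonoid M] [AddCommMonoid N]

/-- The sum of `F u v` over all ways to write `l` as a concatenation `u ++ v`. -/
def sp : List α → (List α → List α → M) → M
  | [], F => F [] []
  | a :: l, F => F [] (a :: l) + sp l fun u v => F (a :: u) v

@[simp] theorem sp_nil (F : List α → List α → M) : sp [] F = F [] [] := rfl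

theorem sp_cons (a : α) (l : List α) (F : List α → List α → M) :
    sp (a :: l) F = F [] (a :: l) + sp l fun u v => F (a :: u) v := rfl

theorem sp_congr {l : List α} {F G : List α → List α → M} (h : ∀ u v, l = u ++ v → F u v = G u v) :
    sp l F = sp l G := by
  induction l generalizing F G with
  | nil => exact h _ _ rfl
  | cons a l ih =>
    rw [sp_cons, sp_cons, h [] _ rfl, ih]
    rintro u v rfl
    exact h _ _ rfl

theorem map_sp {G : Type*} [FunLike G M N] [AddMonoidHomClass G M N] (g : G) (l : List α)
    (F : List α → List α → M) : g (sp l F) = sp l fun u v => g (F u v) := by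
  induction l generalizing F with
  | nil => rfl
  | cons a l ih => rw [sp_cons, sp_cons, map_add, ih]

theorem sp_add (l : List α) (F G : List α → List α → M) :
    (sp l fun u v => F u v + G u v) = sp l F + sp l G := by
  induction l generalizing F G with
  | nil => rfl
  | cons a l ih => rw [sp_cons, sp_cons, sp_cons, ih]; abel

theorem sp_zero (l : List α) : (sp l fun _ _ => (0 : M)) = 0 := by
  induction l with
  | nil => rfl
  | cons a l ih => rw [sp_cons, ih, add_zero]

theorem sp_comm (l : List α) (k : List β) (F : List α → List α → List β → List β → M) :
    (sp l fun u v => sp k fun x y => F u v x y) = sp k fun x y => sp l fun u v => F u v x y := by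
  induction l generalizing F with
  | nil => rfl
  | cons a l ih => rw [sp_cons, ih, ← sp_add]; rfl

theorem sp_map (f : α → β) (l : List α) (F : List β → List β → M) :
    sp (l.map f) F = sp l fun u v => F (u.map f) (v.map f) := by
  induction l generalizing F with
  | nil => rfl
  | cons a l ih => rw [List.map_cons, sp_cons, sp_cons, ih]; rfl

theorem sp_assoc (l : List α) (F : List α → List α → List α → M) :
    (sp l fun u w => sp u fun x y => F x y w) = sp l fun u w => sp w fun x y => F u x y := by
  induction l generalizing F with
  | nil => rfl
  | cons a l ih =>
    simp only [sp_cons, sp_nil, sp_add, ih]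
    abel

theorem sum_range_take_drop (l : List α) (F : List α → List α → M) :
    ∑ i ∈ Finset.range (l.length + 1), F (l.take i) (l.drop i) = sp l F := by
  induction l generalizing F with
  | nil => simp
  | cons a l ih =>
    rw [List.length_cons, Finset.sum_range_succ', sp_cons, ← ih, add_comm]
    simp

theorem sp_mul_right {R : Type*} [NonUnitalNonAssocSemiring R] (l : List α) (F : List α → List α → R) (r : R) :
    sp l F * r = sp l fun u v => F u v * r := map_sp (AddMonoidHom.mulRight r) l F

theorem sp_mul_left {R : Type*} [NonUnitalNonAssocSemiring R] (l : List α) (F : List α → List α → R) (r : R) :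
    r * sp l F = sp l fun u v => r * F u v := map_sp (AddMonoidHom.mulLeft r) l F

end Splittings

/-! ### Deconcatenation and convolution on the tensor algebra -/

section Convolution

variable (𝕜 : Type) [RCLike 𝕜] {U : Type*} [AddCommGroup U] [Module 𝕜 U]

/-- The word `u₁ ⊗ ⋯ ⊗ uₖ`. -/
def wd (l : List U) : TensorAlgebra 𝕜 U := (l.map (TensorAlgebra.ι 𝕜)).prod

@[simp] theorem wd_nil : wd 𝕜 ([] : List U) = 1 := rfl

theorem wd_cons (a : U) (l : List U) : wd 𝕜 (a :: l) = TensorAlgebra.ι 𝕜 a * wd 𝕜 l := by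
  simp [wd]

theorem wd_append (l k : List U) : wd 𝕜 (l ++ k) = wd 𝕜 l * wd 𝕜 k := by
  simp [wd]

theorem wd_singleton (a : U) : wd 𝕜 [a] = TensorAlgebra.ι 𝕜 a := by simp [wd]

theorem span_wd : Submodule.span 𝕜 (Set.range (wd 𝕜 : List U → TensorAlgebra 𝕜 U)) = ⊤ := by
  refine eq_top_iff.2 fun x _ => ?_
  have hmul : ∀ x ∈ Submodule.span 𝕜 (Set.range (wd 𝕜 : List U → TensorAlgebra 𝕜 U)),
      ∀ y ∈ Submodule.span 𝕜 (Set.range (wd 𝕜 : List U → TensorAlgebra 𝕜 U)),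
      x * y ∈ Submodule.span 𝕜 (Set.range (wd 𝕜 : List U → TensorAlgebra 𝕜 U)) := by
    intro x hx y hy
    have := Submodule.mul_mem_mul hx hy
    rw [Submodule.span_mul_span] at this
    refine Submodule.span_mono ?_ this
    rintro _ ⟨_, ⟨l, rfl⟩, _, ⟨k, rfl⟩, rfl⟩
    exact ⟨l ++ k, wd_append 𝕜 l k⟩
  refine TensorAlgebra.induction (C := fun x => x ∈ Submodule.span 𝕜 (Set.range (wd 𝕜)))
    (fun r => ?_) (fun x => Submodule.subset_span ⟨[x], wd_singleton 𝕜 x⟩)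
    (fun x y hx hy => hmul x hx y hy) (fun x y hx hy => add_mem hx hy) x
  rw [Algebra.algebraMap_eq_smul_one]
  exact Submodule.smul_mem _ _ (Submodule.subset_span ⟨[], rfl⟩)

variable {𝕜}

theorem wd_ext {M : Type*} [AddCommGroup M] [Module 𝕜 M] {f g : TensorAlgebra 𝕜 U →ₗ[𝕜] M}
    (h : ∀ l, f (wd 𝕜 l) = g (wd 𝕜 l)) : f = g :=
  LinearMap.ext_on_range (span_wd 𝕜) h

variable (𝕜 U) in
/-- The operator `(t, z) ↦ (u t, (u ⊗ 1) z + 1 ⊗ u t)`. -/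
def dcStep : U →ₗ[𝕜] Module.End 𝕜 (TensorAlgebra 𝕜 U × (TensorAlgebra 𝕜 U ⊗[𝕜] TensorAlgebra 𝕜 U)) :=
  LinearMap.mk₂ 𝕜 (fun u p => (TensorAlgebra.ι 𝕜 u * p.1,
      (TensorAlgebra.ι 𝕜 u ⊗ₜ 1) * p.2 + 1 ⊗ₜ (TensorAlgebra.ι 𝕜 u * p.1)))
    (fun u v p => by
      ext <;> simp [add_mul, TensorProduct.add_tmul, TensorProduct.tmul_add]; abel)
    (fun c u p => by
      ext <;> simp [← TensorProduct.smul_tmul'])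
    (fun u p q => by
      ext <;> simp [mul_add, TensorProduct.tmul_add]; abel)
    (fun c u p => by
      ext <;> simp)

variable (𝕜 U) in
/-- Deconcatenation on the tensor algebra. -/
def dc : TensorAlgebra 𝕜 U →ₗ[𝕜] TensorAlgebra 𝕜 U ⊗[𝕜] TensorAlgebra 𝕜 U :=
  LinearMap.snd 𝕜 _ _ ∘ₗ LinearMap.applyₗ (1, 1 ⊗ₜ[𝕜] 1) ∘ₗ
    (TensorAlgebra.lift 𝕜 (dcStep 𝕜 U)).toLinearMap

theorem dc_one : dc 𝕜 U 1 = 1 ⊗ₜ 1 := by simp [dc]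

theorem dcStep_fst (t : TensorAlgebra 𝕜 U) :
    (TensorAlgebra.lift 𝕜 (dcStep 𝕜 U) t (1, 1 ⊗ₜ[𝕜] 1)).1 = t := by
  have : LinearMap.fst 𝕜 _ _ ∘ₗ LinearMap.applyₗ (1, 1 ⊗ₜ[𝕜] 1) ∘ₗ
      (TensorAlgebra.lift 𝕜 (dcStep 𝕜 U)).toLinearMap = LinearMap.id := by
    refine wd_ext fun l => ?_
    induction l with
    | nil => simp
    | cons a l ih =>
      simp only [LinearMap.comp_apply, AlgHom.toLinearMap_apply, LinearMap.applyₗ_apply_apply,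
        LinearMap.fst_apply, LinearMap.id_apply] at ih
      rw [wd_cons]
      simp only [LinearMap.comp_apply, AlgHom.toLinearMap_apply, LinearMap.applyₗ_apply_apply,
        LinearMap.fst_apply, LinearMap.id_apply, map_mul, TensorAlgebra.lift_ι_apply,
        Module.End.mul_apply]
      exact congrArg (TensorAlgebra.ι 𝕜 a * ·) ih
  exact LinearMap.congr_fun this t

theorem dc_ι_mul (a : U) (t : TensorAlgebra 𝕜 U) : dc 𝕜 U (TensorAlgebra.ι 𝕜 a * t) =
    (TensorAlgebra.ι 𝕜 a ⊗ₜ 1) * dc 𝕜 U t + 1 ⊗ₜ (TensorAlgebra.ι 𝕜 a * t) := by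
  have := dcStep_fst (𝕜 := 𝕜) t
  simp only [dc, LinearMap.comp_apply, AlgHom.toLinearMap_apply, LinearMap.applyₗ_apply_apply,
    map_mul, TensorAlgebra.lift_ι_apply, Module.End.mul_apply]
  simp only [dcStep, LinearMap.mk₂_apply, LinearMap.snd_apply] at this ⊢
  rw [this]

theorem dc_wd (l : List U) : dc 𝕜 U (wd 𝕜 l) = sp l fun u v => wd 𝕜 u ⊗ₜ[𝕜] wd 𝕜 v := by
  induction l with
  | nil => simp [dc_one]
  | cons a l ih =>
    rw [wd_cons, dc_ι_mul, ih, sp_cons, sp_mul_left, add_comm]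
    simp [wd_cons]

theorem dc_wd_mul (l : List U) (t : TensorAlgebra 𝕜 U) (a : U) :
    dc 𝕜 U (wd 𝕜 l * (TensorAlgebra.ι 𝕜 a * t)) =
      (sp l fun u v => wd 𝕜 u ⊗ₜ[𝕜] (wd 𝕜 v * (TensorAlgebra.ι 𝕜 a * t))) +
        ((wd 𝕜 l * TensorAlgebra.ι 𝕜 a) ⊗ₜ 1) * dc 𝕜 U t := by
  induction l with
  | nil => simp [dc_ι_mul, add_comm]
  | cons b l ih =>
    rw [wd_cons, mul_assoc, dc_ι_mul, ih, sp_cons, mul_add, sp_mul_left, ← mul_assoc]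
    simp only [Algebra.TensorProduct.tmul_mul_tmul, one_mul, wd_cons, wd_nil, mul_assoc]
    abel

variable {R : Type*} [Ring R] [Algebra 𝕜 R]

/-- The (unsigned) convolution product. -/
def cv : (TensorAlgebra 𝕜 U →ₗ[𝕜] R) →ₗ[𝕜] (TensorAlgebra 𝕜 U →ₗ[𝕜] R) →ₗ[𝕜]
    TensorAlgebra 𝕜 U →ₗ[𝕜] R :=
  LinearMap.mk₂ 𝕜 (fun φ ψ => LinearMap.mul' 𝕜 R ∘ₗ TensorProduct.map φ ψ ∘ₗ dc 𝕜 U)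
    (fun _ _ _ => by simp [TensorProduct.map_add_left, LinearMap.add_comp, LinearMap.comp_add])
    (fun _ _ _ => by simp [TensorProduct.map_smul_left, LinearMap.smul_comp, LinearMap.comp_smul])
    (fun _ _ _ => by simp [TensorProduct.map_add_right, LinearMap.add_comp, LinearMap.comp_add])
    (fun _ _ _ => by simp [TensorProduct.map_smul_right, LinearMap.smul_comp, LinearMap.comp_smul])

theorem cv_def (φ ψ : TensorAlgebra 𝕜 U →ₗ[𝕜] R) :
    cv φ ψ = LinearMap.mul' 𝕜 R ∘ₗ TensorProduct.map φ ψ ∘ₗ dc 𝕜 U := rfl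

theorem cv_wd (φ ψ : TensorAlgebra 𝕜 U →ₗ[𝕜] R) (l : List U) :
    cv φ ψ (wd 𝕜 l) = sp l fun u v => φ (wd 𝕜 u) * ψ (wd 𝕜 v) := by
  rw [cv_def, LinearMap.comp_apply, LinearMap.comp_apply, dc_wd, map_sp, map_sp]
  simp

theorem cv_assoc (φ ψ χ : TensorAlgebra 𝕜 U →ₗ[𝕜] R) : cv (cv φ ψ) χ = cv φ (cv ψ χ) := by
  refine wd_ext fun l => ?_
  simp only [cv_wd, sp_mul_right, sp_mul_left, mul_assoc]
  exact sp_assoc l fun x y z => φ (wd 𝕜 x) * (ψ (wd 𝕜 y) * χ (wd 𝕜 z))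

end Convolution

/-! ### Braces as operators on a tensor algebra -/

section Words

section

variable {E : ℤ → Type*}

/-- The total degree of a word. -/
def dg (X : List (Σ n, E n)) : ℤ := (X.map Sigma.fst).sum

@[simp] theorem dg_nil : dg ([] : List (Σ n, E n)) = 0 := rfl
@[simp] theorem dg_cons (f : Σ n, E n) (X : List (Σ n, E n)) : dg (f :: X) = f.1 + dg X := by simp [dg]
@[simp] theorem dg_append (X Y : List (Σ n, E n)) : dg (X ++ Y) = dg X + dg Y := by simp [dg]

end

variable {𝕜 : Type} [RCLike 𝕜] {E : ℤ → Type*} [∀ n, AddCommGroup (E n)] [∀ n, Module 𝕜 (E n)]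

@[simp] theorem word_nil : TS.word 𝕜 ([] : List (Σ n, E n)) = 1 := rfl
theorem word_cons (f : Σ n, E n) (X : List (Σ n, E n)) :
    TS.word 𝕜 (f :: X) = TS.of 𝕜 f.2 * TS.word 𝕜 X := by simp [TS.word]
theorem word_append (X Y : List (Σ n, E n)) :
    TS.word 𝕜 (X ++ Y) = TS.word 𝕜 X * TS.word 𝕜 Y := by simp [TS.word]

variable (𝕜) in
/-- A letter, as an element of the total space. -/
def lf (f : Σ n, E n) : ⨁ n, E n := DirectSum.lof 𝕜 ℤ E f.1 f.2

theorem word_eq_wd (X : List (Σ n, E n)) : TS.word 𝕜 X = wd 𝕜 (X.map (lf 𝕜)) := by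
  simp [TS.word, wd, lf, TS.of, Function.comp_def]

theorem word_mem_deg (X : List (Σ n, E n)) : TS.word 𝕜 X ∈ TS.deg 𝕜 E (dg X) :=
  Submodule.subset_span ⟨X, rfl, rfl⟩

theorem mul_mem_deg {m n : ℤ} {x y : TS 𝕜 E} (hx : x ∈ TS.deg 𝕜 E m) (hy : y ∈ TS.deg 𝕜 E n) :
    x * y ∈ TS.deg 𝕜 E (m + n) := by
  have := Submodule.mul_mem_mul hx hy
  rw [TS.deg, TS.deg, Submodule.span_mul_span] at this
  refine Submodule.span_mono ?_ this
  rintro _ ⟨_, ⟨l, rfl, rfl⟩, _, ⟨k, rfl, rfl⟩, rfl⟩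
  exact ⟨l ++ k, by simp, word_append l k⟩

theorem of_mem_deg {n : ℤ} (e : E n) : TS.of 𝕜 e ∈ TS.deg 𝕜 E n := by
  simpa [TS.word] using word_mem_deg (𝕜 := 𝕜) [⟨n, e⟩]

variable (𝕜 E) in
theorem span_word : Submodule.span 𝕜 (Set.range (TS.word 𝕜 : List (Σ n, E n) → TS 𝕜 E)) = ⊤ := by
  refine eq_top_iff.2 fun x _ => ?_
  have hmul : ∀ x ∈ Submodule.span 𝕜 (Set.range (TS.word 𝕜 : List (Σ n, E n) → TS 𝕜 E)),
      ∀ y ∈ Submodule.span 𝕜 (Set.range (TS.word 𝕜 : List (Σ n, E n) → TS 𝕜 E)),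
      x * y ∈ Submodule.span 𝕜 (Set.range (TS.word 𝕜 : List (Σ n, E n) → TS 𝕜 E)) := by
    intro x hx y hy
    have := Submodule.mul_mem_mul hx hy
    rw [Submodule.span_mul_span] at this
    refine Submodule.span_mono ?_ this
    rintro _ ⟨_, ⟨l, rfl⟩, _, ⟨k, rfl⟩, rfl⟩
    exact ⟨l ++ k, word_append l k⟩
  refine TensorAlgebra.induction
    (C := fun x => x ∈ Submodule.span 𝕜 (Set.range (TS.word 𝕜 : List (Σ n, E n) → TS 𝕜 E)))
    (fun r => ?_) (fun x => ?_) (fun x y hx hy => hmul x hx y hy) (fun x y hx hy => add_mem hx hy) x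
  · rw [Algebra.algebraMap_eq_smul_one]
    exact Submodule.smul_mem _ _ (Submodule.subset_span ⟨[], rfl⟩)
  · induction x using DirectSum.induction_on with
    | zero => rw [map_zero]; exact zero_mem _
    | of n e => exact Submodule.subset_span ⟨[⟨n, e⟩], by simp [TS.word, TS.of]; rfl⟩
    | add x y hx hy => rw [map_add]; exact add_mem hx hy

theorem word_ext {M : Type*} [AddCommGroup M] [Module 𝕜 M] {f g : TS 𝕜 E →ₗ[𝕜] M}
    (h : ∀ X, f (TS.word 𝕜 X) = g (TS.word 𝕜 X)) : f = g :=
  LinearMap.ext_on_range (span_word 𝕜 E) h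

end Words

section Parity

variable {𝕜 : Type} [RCLike 𝕜] {U : Type*} [AddCommGroup U] [Module 𝕜 U] (s : U →ₗ[𝕜] U)

/-- The `n`-th power of an involution. -/
def tau (n : ℤ) : U →ₗ[𝕜] U := if Even n then LinearMap.id else s

/-- The `n`-th power of the induced involution on the tensor algebra. -/
def sgp (n : ℤ) : TensorAlgebra 𝕜 U →ₐ[𝕜] TensorAlgebra 𝕜 U :=
  TensorAlgebra.lift 𝕜 (TensorAlgebra.ι 𝕜 ∘ₗ tau s n)

@[simp] theorem sgp_ι (n : ℤ) (u : U) :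
    sgp s n (TensorAlgebra.ι 𝕜 u) = TensorAlgebra.ι 𝕜 (tau s n u) := by simp [sgp]

theorem sgp_wd (n : ℤ) (l : List U) : sgp s n (wd 𝕜 l) = wd 𝕜 (l.map (tau s n)) := by
  simp [wd, map_list_prod, Function.comp_def]

variable {s}

theorem tau_add (hs : ∀ u, s (s u) = u) (m n : ℤ) (u : U) : tau s (m + n) u = tau s m (tau s n u) := by
  by_cases hm : Even m <;> by_cases hn : Even n <;> simp [tau, hm, hn, Int.even_add, hs]

theorem sgp_add (hs : ∀ u, s (s u) = u) (m n : ℤ) (x : TensorAlgebra 𝕜 U) : sgp s (m + n) x = sgp s m (sgp s n x) := by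
  have : sgp s (m + n) = (sgp s m).comp (sgp s n) :=
    TensorAlgebra.hom_ext (LinearMap.ext fun u => by simp [tau_add hs])
  exact congrArg (fun f : TensorAlgebra 𝕜 U →ₐ[𝕜] TensorAlgebra 𝕜 U => f x) this

end Parity

theorem sgp_cv {𝕜 : Type} [RCLike 𝕜] {U : Type*} [AddCommGroup U] [Module 𝕜 U] (s : U →ₗ[𝕜] U)
    (n : ℤ) (φ ψ : TensorAlgebra 𝕜 U →ₗ[𝕜] TensorAlgebra 𝕜 U) :
    (sgp s n).toLinearMap ∘ₗ cv φ ψ = cv ((sgp s n).toLinearMap ∘ₗ φ) ((sgp s n).toLinearMap ∘ₗ ψ) := by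
  refine wd_ext fun l => ?_
  simp [cv_wd, map_sp]

theorem cv_sgp {𝕜 : Type} [RCLike 𝕜] {U : Type*} [AddCommGroup U] [Module 𝕜 U] (s : U →ₗ[𝕜] U)
    (n : ℤ) (φ ψ : TensorAlgebra 𝕜 U →ₗ[𝕜] TensorAlgebra 𝕜 U) :
    cv φ ψ ∘ₗ (sgp s n).toLinearMap = cv (φ ∘ₗ (sgp s n).toLinearMap) (ψ ∘ₗ (sgp s n).toLinearMap) := by
  refine wd_ext fun l => ?_
  simp [cv_wd, sgp_wd, sp_map]

/-- A graded space `E` acting by operations `T(U) → U` on a space `U` with involution. -/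
structure OpRep (𝕜 : Type) [RCLike 𝕜] (U : Type*) [AddCommGroup U] [Module 𝕜 U] (E : ℤ → Type*)
    [∀ n, AddCommGroup (E n)] [∀ n, Module 𝕜 (E n)] where
  s : U →ₗ[𝕜] U
  s_s : ∀ u, s (s u) = u
  hat : ∀ n, E n →ₗ[𝕜] TensorAlgebra 𝕜 U →ₗ[𝕜] U
  hat_s : ∀ n e x, hat n e (sgp s 1 x) = ((-1 : 𝕜) ^ n) • s (hat n e x)

namespace OpRep

variable {𝕜 : Type} [RCLike 𝕜] {U : Type*} [AddCommGroup U] [Module 𝕜 U] {E : ℤ → Type*}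
  [∀ n, AddCommGroup (E n)] [∀ n, Module 𝕜 (E n)] (P : OpRep 𝕜 U E)

/-- The `n`-th power of the involution of `T(U)`. -/
def sg (n : ℤ) : TensorAlgebra 𝕜 U →ₗ[𝕜] TensorAlgebra 𝕜 U := (sgp P.s n).toLinearMap

theorem sg_add (m n : ℤ) : P.sg (m + n) = P.sg m ∘ₗ P.sg n :=
  LinearMap.ext fun x => sgp_add P.s_s m n x

theorem sg_zero : P.sg 0 = LinearMap.id := by
  refine wd_ext fun l => ?_
  simp [sg, sgp_wd, tau]

theorem sg_wd (n : ℤ) (l : List U) : P.sg n (wd 𝕜 l) = wd 𝕜 (l.map (tau P.s n)) := sgp_wd _ _ _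

theorem cv_sg (n : ℤ) (φ ψ : TensorAlgebra 𝕜 U →ₗ[𝕜] TensorAlgebra 𝕜 U) :
    cv φ ψ ∘ₗ P.sg n = cv (φ ∘ₗ P.sg n) (ψ ∘ₗ P.sg n) := cv_sgp _ _ _ _

theorem sg_cv (n : ℤ) (φ ψ : TensorAlgebra 𝕜 U →ₗ[𝕜] TensorAlgebra 𝕜 U) :
    P.sg n ∘ₗ cv φ ψ = cv (P.sg n ∘ₗ φ) (P.sg n ∘ₗ ψ) := sgp_cv _ _ _ _

theorem sg_congr {m n : ℤ} (h : Even (m - n)) : P.sg m = P.sg n := by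
  have : Even m ↔ Even n := by rwa [Int.even_sub] at h
  have : tau P.s m = tau P.s n := by simp [tau, this]
  simp [sg, sgp, this]

/-- The operation of `e`, with values in `T(U)`. -/
def op (n : ℤ) : E n →ₗ[𝕜] TensorAlgebra 𝕜 U →ₗ[𝕜] TensorAlgebra 𝕜 U :=
  (P.hat n).compr₂ (TensorAlgebra.ι 𝕜)

theorem op_apply (n : ℤ) (e : E n) (x) : P.op n e x = TensorAlgebra.ι 𝕜 (P.hat n e x) := rfl

theorem op_sg (n : ℤ) (e : E n) (k : ℤ) :
    P.op n e ∘ₗ P.sg k = ((-1 : 𝕜) ^ (n * k)) • P.sg k ∘ₗ P.op n e := by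
  rcases Int.even_or_odd k with hk | hk
  · rw [P.sg_congr (m := k) (n := 0) (by simpa using hk), sg_zero, (hk.mul_left n).neg_one_zpow]
    simp
  · rw [P.sg_congr (m := k) (n := 1) (by simpa using hk.sub_odd odd_one)]
    have : (-1 : 𝕜) ^ (n * k) = (-1) ^ n := by
      obtain ⟨j, rfl⟩ := hk
      exact Bimod.neg_one_zpow_congr ⟨n * j, by ring⟩
    rw [this]
    ext x
    simp [op_apply, sg, P.hat_s, tau]

/-- The part `u v ↦ ± u e(v)` of the action of a word whose other letters have total degree `k`. -/
def pre (n k : ℤ) : E n →ₗ[𝕜] TensorAlgebra 𝕜 U →ₗ[𝕜] TensorAlgebra 𝕜 U :=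
  cv (P.sg (n + k)) ∘ₗ (LinearMap.lcomp 𝕜 _ (P.sg k)) ∘ₗ P.op n

theorem pre_apply (n k : ℤ) (e : E n) : P.pre n k e = cv (P.sg (n + k)) (P.op n e ∘ₗ P.sg k) := rfl

/-- The action of a word `f₁ ⋯ fₖ` on `T(U)`: `x ↦ ∑ ± u₀ f₁(v₁) u₁ ⋯ fₖ(vₖ) uₖ`. -/
def rho : List (Σ n, E n) → TensorAlgebra 𝕜 U →ₗ[𝕜] TensorAlgebra 𝕜 U
  | [] => LinearMap.id
  | f :: X => cv (P.pre f.1 (dg X) f.2) (rho X)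

@[simp] theorem rho_nil : P.rho [] = LinearMap.id := rfl
theorem rho_cons (f : Σ n, E n) (X : List (Σ n, E n)) :
    P.rho (f :: X) = cv (P.pre f.1 (dg X) f.2) (P.rho X) := rfl

theorem sg_comm (j k : ℤ) : P.sg j ∘ₗ P.sg k = P.sg k ∘ₗ P.sg j := by
  rw [← sg_add, ← sg_add, add_comm]

theorem pre_sg (n k : ℤ) (e : E n) (j : ℤ) :
    P.pre n k e ∘ₗ P.sg j = ((-1 : 𝕜) ^ (n * j)) • P.sg j ∘ₗ P.pre n k e := by
  rw [pre_apply, cv_sg, sg_cv, LinearMap.comp_assoc, P.sg_comm k j, ← LinearMap.comp_assoc, op_sg,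
    LinearMap.smul_comp, map_smul, P.sg_comm _ j]
  rfl

theorem rho_sg (X : List (Σ n, E n)) (j : ℤ) :
    P.rho X ∘ₗ P.sg j = ((-1 : 𝕜) ^ (dg X * j)) • P.sg j ∘ₗ P.rho X := by
  induction X with
  | nil => simp
  | cons f X ih =>
    rw [rho_cons, cv_sg, sg_cv, pre_sg, ih, map_smul, map_smul, LinearMap.smul_apply, smul_smul,
      dg_cons, add_mul, zpow_add₀ (by simp), mul_comm]

/-- `rho`, linearly extended, with values tagged by their degree. -/
def rhoG : TS 𝕜 E →ₗ[𝕜] ⨁ _ : ℤ, (TensorAlgebra 𝕜 U →ₗ[𝕜] TensorAlgebra 𝕜 U) :=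
  LinearMap.applyₗ (DirectSum.lof 𝕜 ℤ (fun _ => TensorAlgebra 𝕜 U →ₗ[𝕜] TensorAlgebra 𝕜 U) 0
      LinearMap.id) ∘ₗ
    (TensorAlgebra.lift 𝕜 (DirectSum.toModule 𝕜 ℤ
      (Module.End 𝕜 (⨁ _ : ℤ, (TensorAlgebra 𝕜 U →ₗ[𝕜] TensorAlgebra 𝕜 U))) fun n : ℤ =>
      LinearMap.flip (DirectSum.toModule 𝕜 ℤ _ fun N : ℤ =>
        ((cv ∘ₗ P.pre n N).compr₂ (DirectSum.lof 𝕜 ℤ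
          (fun _ => TensorAlgebra 𝕜 U →ₗ[𝕜] TensorAlgebra 𝕜 U) (n + N))).flip))).toLinearMap

theorem rhoG_word (X : List (Σ n, E n)) : P.rhoG (TS.word 𝕜 X) =
    DirectSum.lof 𝕜 ℤ (fun _ => TensorAlgebra 𝕜 U →ₗ[𝕜] TensorAlgebra 𝕜 U) (dg X) (P.rho X) := by
  induction X with
  | nil => simp [rhoG]
  | cons f X ih =>
    simp only [rhoG, LinearMap.comp_apply, AlgHom.toLinearMap_apply,
      LinearMap.applyₗ_apply_apply] at ih
    rw [word_cons]
    simp only [rhoG, LinearMap.comp_apply, AlgHom.toLinearMap_apply, LinearMap.applyₗ_apply_apply,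
      map_mul, Module.End.mul_apply, ih, TS.of, TensorAlgebra.lift_ι_apply, DirectSum.toModule_lof,
      LinearMap.flip_apply, LinearMap.compr₂_apply, dg_cons, rho_cons]

/-- `rho`, linearly extended. -/
def rhoL : TS 𝕜 E →ₗ[𝕜] TensorAlgebra 𝕜 U →ₗ[𝕜] TensorAlgebra 𝕜 U :=
  DirectSum.toModule 𝕜 ℤ _ (fun _ => LinearMap.id) ∘ₗ P.rhoG

@[simp] theorem rhoL_word (X : List (Σ n, E n)) : P.rhoL (TS.word 𝕜 X) = P.rho X := by
  rw [rhoL, LinearMap.comp_apply, rhoG_word, DirectSum.toModule_lof, LinearMap.id_apply]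

/-- The action is a measuring. -/
theorem dc_rho (Y : List (Σ n, E n)) : dc 𝕜 U ∘ₗ P.rho Y = sp Y fun Y₁ Y₂ =>
    TensorProduct.map (P.rho Y₁ ∘ₗ P.sg (dg Y₂)) (P.rho Y₂) ∘ₗ dc 𝕜 U := by
  induction Y with
  | nil => simp [sg_zero]
  | cons f Y ih =>
    have ih' : ∀ x, dc 𝕜 U (P.rho Y x) = sp Y fun Y₁ Y₂ =>
        TensorProduct.map (P.rho Y₁ ∘ₗ P.sg (dg Y₂)) (P.rho Y₂) (dc 𝕜 U x) := fun x => by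
      have := LinearMap.congr_fun ih x
      rw [LinearMap.comp_apply] at this
      rw [this]
      exact map_sp (LinearMap.applyₗ x) Y _
    refine wd_ext fun l => ?_
    have e : ∀ Y₁ Y₂, Y = Y₁ ++ Y₂ → P.pre f.1 (dg Y) f.2 = P.pre f.1 (dg Y₁) f.2 ∘ₗ P.sg (dg Y₂) := by
      rintro Y₁ Y₂ rfl
      rw [pre_apply, pre_apply, cv_sg, LinearMap.comp_assoc, ← sg_add, ← sg_add, dg_append, add_assoc]
    have lhs : dc 𝕜 U (P.rho (f :: Y) (wd 𝕜 l)) =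
        (sp l fun x w => wd 𝕜 (x.map (tau P.s (f.1 + dg Y))) ⊗ₜ[𝕜] P.rho (f :: Y) (wd 𝕜 w)) +
        sp l fun u w => (P.pre f.1 (dg Y) f.2 (wd 𝕜 u) ⊗ₜ[𝕜] 1) * dc 𝕜 U (P.rho Y (wd 𝕜 w)) := by
      have h1 : ∀ u, P.pre f.1 (dg Y) f.2 (wd 𝕜 u) = sp u fun x v =>
          wd 𝕜 (x.map (tau P.s (f.1 + dg Y))) * P.op f.1 f.2 (P.sg (dg Y) (wd 𝕜 v)) := fun u => by
        rw [pre_apply, cv_wd]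
        simp only [P.sg_wd, LinearMap.comp_apply]
      simp only [rho_cons, cv_wd, h1, map_sp, op_apply, sp_mul_right, mul_assoc, dc_wd_mul, sp_add]
      have h2 : ∀ u (t : TensorAlgebra 𝕜 U ⊗[𝕜] TensorAlgebra 𝕜 U) F,
          ((sp u F : TensorAlgebra 𝕜 U) ⊗ₜ[𝕜] (1 : TensorAlgebra 𝕜 U)) * t =
            sp (α := U) u fun x v => (F x v ⊗ₜ[𝕜] 1) * t := fun u t F =>
        map_sp (LinearMap.mulRight 𝕜 t ∘ₗ (TensorProduct.mk 𝕜 _ _).flip 1) u F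
      have h3 : ∀ (a : TensorAlgebra 𝕜 U) (w : List U) F,
          a ⊗ₜ[𝕜] (sp w F : TensorAlgebra 𝕜 U) = sp w fun x v => a ⊗ₜ[𝕜] F x v := fun a w F =>
        map_sp (TensorProduct.mk 𝕜 _ _ a) w F
      congr 1
      · simp only [sp_map, h3]
        rw [← sp_assoc l fun x u w => sp u fun v y => wd 𝕜 (x.map (tau P.s (f.1 + dg Y))) ⊗ₜ[𝕜]
          (wd 𝕜 (v.map (tau P.s (f.1 + dg Y))) *
            (TensorAlgebra.ι 𝕜 (P.hat f.1 f.2 (P.sg (dg Y) (wd 𝕜 y))) * P.rho Y (wd 𝕜 w)))]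
        refine sp_congr fun u w _ => ?_
        exact sp_assoc u fun x v y => wd 𝕜 (x.map (tau P.s (f.1 + dg Y))) ⊗ₜ[𝕜]
          (wd 𝕜 (v.map (tau P.s (f.1 + dg Y))) *
            (TensorAlgebra.ι 𝕜 (P.hat f.1 f.2 (P.sg (dg Y) (wd 𝕜 y))) * P.rho Y (wd 𝕜 w)))
      · simp only [h2]
    have apply_sp : ∀ (Y : List (Σ n, E n)) (F : List (Σ n, E n) → List (Σ n, E n) →
        (TensorAlgebra 𝕜 U →ₗ[𝕜] TensorAlgebra 𝕜 U ⊗[𝕜] TensorAlgebra 𝕜 U)) x,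
        (sp Y F) x = sp Y fun a b => F a b x := fun Y F x => map_sp (LinearMap.applyₗ x) Y F
    rw [LinearMap.comp_apply, lhs, sp_cons, LinearMap.add_apply, apply_sp]
    congr 1
    · simp only [rho_nil, LinearMap.comp_apply, dc_wd, map_sp, TensorProduct.map_tmul,
        LinearMap.id_apply, P.sg_wd, dg_cons]
    · simp only [ih', sp_mul_left, map_sp, dc_wd, LinearMap.comp_apply, TensorProduct.map_tmul,
        Algebra.TensorProduct.tmul_mul_tmul, one_mul]
      have h4 : ∀ (a : TensorAlgebra 𝕜 U ⊗[𝕜] TensorAlgebra 𝕜 U) (w : List (Σ n, E n)) F,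
          a * sp w F = sp w fun x v => a * F x v := fun a w F => sp_mul_left w F a
      rw [← sp_comm]
      refine sp_congr fun Y₁ Y₂ hY => ?_
      have h5 : ∀ u, P.rho (f :: Y₁) (P.sg (dg Y₂) (wd 𝕜 u)) = sp u fun x y =>
          P.pre f.1 (dg Y) f.2 (wd 𝕜 x) * P.rho Y₁ (P.sg (dg Y₂) (wd 𝕜 y)) := fun u => by
        rw [← LinearMap.comp_apply, rho_cons, cv_sg, ← e Y₁ Y₂ hY, cv_wd]
        rfl
      have h6 : ∀ (a : TensorAlgebra 𝕜 U) (w : List U) F,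
          (sp w F : TensorAlgebra 𝕜 U) ⊗ₜ[𝕜] a = sp w fun x v => F x v ⊗ₜ[𝕜] a := fun a w F =>
        map_sp ((TensorProduct.mk 𝕜 _ _).flip a) w F
      simp only [h5, h6]
      exact (sp_assoc l fun u x y => (P.pre f.1 (dg Y) f.2 (wd 𝕜 u) *
        P.rho Y₁ (P.sg (dg Y₂) (wd 𝕜 x))) ⊗ₜ[𝕜] P.rho Y₂ (wd 𝕜 y)).symm

theorem cv_rho (φ ψ : TensorAlgebra 𝕜 U →ₗ[𝕜] TensorAlgebra 𝕜 U) (Y : List (Σ n, E n)) :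
    cv φ ψ ∘ₗ P.rho Y = sp Y fun Y₁ Y₂ => cv (φ ∘ₗ P.rho Y₁ ∘ₗ P.sg (dg Y₂)) (ψ ∘ₗ P.rho Y₂) := by
  rw [cv_def, LinearMap.comp_assoc, LinearMap.comp_assoc, dc_rho]
  refine (map_sp (LinearMap.compRight 𝕜 (LinearMap.mul' 𝕜 (TensorAlgebra 𝕜 U) ∘ₗ
    TensorProduct.map φ ψ)) Y _).trans ?_
  refine sp_congr fun Y₁ Y₂ _ => ?_
  rw [cv_def, TensorProduct.map_comp]
  rfl

end OpRep

namespace OpRep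

variable {𝕜 : Type} [RCLike 𝕜] {U : Type*} [AddCommGroup U] [Module 𝕜 U] {E : ℤ → Type*}
  [∀ n, AddCommGroup (E n)] [∀ n, Module 𝕜 (E n)] (P : OpRep 𝕜 U E)

theorem sg_rho (X : List (Σ n, E n)) (j : ℤ) :
    P.sg j ∘ₗ P.rho X = ((-1 : 𝕜) ^ (dg X * j)) • P.rho X ∘ₗ P.sg j := by
  rw [rho_sg, smul_smul, GrSp.neg_one_zpow_mul_self, one_smul]

theorem rho_append_cons (Y : List (Σ n, E n)) (g : Σ n, E n) (X : List (Σ n, E n)) :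
    P.rho (Y ++ g :: X) = cv (cv (P.rho Y ∘ₗ P.sg (g.1 + dg X)) (P.op g.1 g.2 ∘ₗ P.sg (dg X)))
      (P.rho X) := by
  induction Y with
  | nil => rfl
  | cons h Y ih =>
    have e : P.pre h.1 (dg (Y ++ g :: X)) h.2 = P.pre h.1 (dg Y) h.2 ∘ₗ P.sg (g.1 + dg X) := by
      rw [pre_apply, pre_apply, cv_sg, LinearMap.comp_assoc, ← sg_add, ← sg_add, dg_append, dg_cons,
        add_assoc]
    rw [List.cons_append, rho_cons, ih, e, rho_cons, cv_sg, cv_assoc, cv_assoc, cv_assoc]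

theorem rhoL_mul_of_mul (Y : List (Σ n, E n)) (g : Σ n, E n) {p : ℤ} {t : TS 𝕜 E}
    (ht : t ∈ TS.deg 𝕜 E p) :
    P.rhoL (TS.word 𝕜 Y * (TS.of 𝕜 g.2 * t)) =
      cv (cv (P.rho Y ∘ₗ P.sg (g.1 + p)) (P.op g.1 g.2 ∘ₗ P.sg p)) (P.rhoL t) := by
  induction ht using Submodule.span_induction with
  | mem x h =>
    obtain ⟨X, rfl, rfl⟩ := h
    rw [← word_cons, ← word_append, rhoL_word, rhoL_word, rho_append_cons]
    rfl
  | zero => simp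
  | add x y _ _ h1 h2 => rw [mul_add, mul_add, map_add, map_add, map_add, h1, h2]
  | smul c x _ h => rw [mul_smul_comm, mul_smul_comm, map_smul, map_smul, map_smul, h]

end OpRep

/-- The parity operator of the total space. -/
def parity (𝕜 : Type) [RCLike 𝕜] (E : ℤ → Type*) [∀ n, AddCommGroup (E n)] [∀ n, Module 𝕜 (E n)] :
    (⨁ n, E n) →ₗ[𝕜] ⨁ n, E n :=
  DirectSum.lmap fun n : ℤ => ((-1 : 𝕜) ^ n) • (LinearMap.id : E n →ₗ[𝕜] E n)

section ParityLemmas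

variable {𝕜 : Type} [RCLike 𝕜] {E : ℤ → Type*} [∀ n, AddCommGroup (E n)] [∀ n, Module 𝕜 (E n)]

theorem parity_lof (n : ℤ) (e : E n) : parity 𝕜 E (DirectSum.lof 𝕜 ℤ E n e) =
    ((-1 : 𝕜) ^ n) • DirectSum.lof 𝕜 ℤ E n e := by
  simp [parity]

theorem parity_parity (x : ⨁ n, E n) : parity 𝕜 E (parity 𝕜 E x) = x := by
  induction x using DirectSum.induction_on with
  | zero => simp
  | of n e =>
    change parity 𝕜 E (parity 𝕜 E (DirectSum.lof 𝕜 ℤ E n e)) = DirectSum.lof 𝕜 ℤ E n e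
    rw [parity_lof, map_smul, parity_lof, smul_smul, GrSp.neg_one_zpow_mul_self, one_smul]
  | add x y hx hy => rw [map_add, map_add, hx, hy]

theorem sgn_eq_sgp : TS.sgn 𝕜 E = sgp (parity 𝕜 E) 1 := by
  simp [sgp, tau, TS.sgn, parity]

theorem sgp_word (k : ℤ) (X : List (Σ n, E n)) :
    sgp (parity 𝕜 E) k (TS.word 𝕜 X) = ((-1 : 𝕜) ^ (k * dg X)) • TS.word 𝕜 X := by
  induction X with
  | nil => simp
  | cons f X ih =>
    have : tau (parity 𝕜 E) k (DirectSum.lof 𝕜 ℤ E f.1 f.2) =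
        ((-1 : 𝕜) ^ (k * f.1)) • DirectSum.lof 𝕜 ℤ E f.1 f.2 := by
      rcases Int.even_or_odd k with hk | hk
      · simp [tau, hk, (hk.mul_right f.1).neg_one_zpow]
      · have h : (-1 : 𝕜) ^ (k * f.1) = (-1) ^ f.1 := by
          obtain ⟨j, rfl⟩ := hk
          exact Bimod.neg_one_zpow_congr ⟨f.1 * j, by ring⟩
        rw [tau, if_neg (by simpa using hk), parity_lof, h]
    rw [word_cons, map_mul, ih, TS.of, sgp_ι, this, map_smul, smul_mul_smul_comm,
      ← zpow_add₀ (by simp), dg_cons, mul_add]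

theorem sgp_of_mem_deg (k : ℤ) {p : ℤ} {t : TS 𝕜 E} (ht : t ∈ TS.deg 𝕜 E p) :
    sgp (parity 𝕜 E) k t = ((-1 : 𝕜) ^ (k * p)) • t := by
  induction ht using Submodule.span_induction with
  | mem x h => obtain ⟨X, rfl, rfl⟩ := h; exact sgp_word k X
  | zero => simp
  | add x y _ _ h1 h2 => rw [map_add, h1, h2, smul_add]
  | smul c x _ h => rw [map_smul, h, smul_comm]

theorem sgn_word (X : List (Σ n, E n)) :
    TS.sgn 𝕜 E (TS.word 𝕜 X) = ((-1 : 𝕜) ^ dg X) • TS.word 𝕜 X := by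
  rw [sgn_eq_sgp, sgp_word, one_mul]

theorem deconcat_eq_dc : TS.deconcat 𝕜 E = dc 𝕜 (⨁ n, E n) := by
  refine word_ext fun X => ?_
  rw [TS.deconcat_word, sum_range_take_drop X fun u v => TS.word 𝕜 u ⊗ₜ[𝕜] TS.word 𝕜 v,
    word_eq_wd, dc_wd, sp_map]
  simp only [word_eq_wd]

end ParityLemmas

/-- A representation by operations that is closed under the brace operations
`e{z₁, …, zₖ} = e ∘ (z₁ ⋯ zₖ)`. -/
structure BraceRep (𝕜 : Type) [RCLike 𝕜] (U : Type*) [AddCommGroup U] [Module 𝕜 U] (E : ℤ → Type*)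
    [∀ n, AddCommGroup (E n)] [∀ n, Module 𝕜 (E n)] extends OpRep 𝕜 U E where
  m : ∀ n, E n →ₗ[𝕜] TS 𝕜 E →ₗ[𝕜] ⨁ n, E n
  m_one : ∀ n e, m n e 1 = DirectSum.lof 𝕜 ℤ E n e
  m_word : ∀ n e Z, ∃ g : E (n + dg Z), m n e (TS.word 𝕜 Z) = DirectSum.lof 𝕜 ℤ E _ g ∧
    hat _ g = hat n e ∘ₗ toOpRep.rho Z
  hat_injective : ∀ n, Function.Injective (hat n)

namespace BraceRep

variable {𝕜 : Type} [RCLike 𝕜] {U : Type*} [AddCommGroup U] [Module 𝕜 U] {E : ℤ → Type*}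
  [∀ n, AddCommGroup (E n)] [∀ n, Module 𝕜 (E n)] (P : BraceRep 𝕜 U E)

/-- The action of `E` on its own total space by the braces. -/
def W : OpRep 𝕜 (⨁ n, E n) E where
  s := parity 𝕜 E
  s_s := parity_parity
  hat := P.m
  hat_s n e x := by
    have : P.m n e ∘ₗ (sgp (parity 𝕜 E) 1).toLinearMap =
        ((-1 : 𝕜) ^ n) • parity 𝕜 E ∘ₗ P.m n e := word_ext fun X => by
      obtain ⟨g, hg, -⟩ := P.m_word n e X
      simp only [LinearMap.comp_apply, AlgHom.toLinearMap_apply, LinearMap.smul_apply, hg, sgp_word,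
        map_smul, parity_lof, smul_smul]
      rw [← zpow_add₀ (by simp)]
      congr 1
      exact Bimod.neg_one_zpow_congr ⟨-n, by ring⟩
    exact LinearMap.congr_fun this x

theorem W_sg_word (k : ℤ) (X : List (Σ n, E n)) :
    P.W.sg k (TS.word 𝕜 X) = ((-1 : 𝕜) ^ (k * dg X)) • TS.word 𝕜 X := sgp_word k X

theorem W_cv_word (φ ψ : TS 𝕜 E →ₗ[𝕜] TS 𝕜 E) (X : List (Σ n, E n)) :
    cv φ ψ (TS.word 𝕜 X) = sp X fun u v => φ (TS.word 𝕜 u) * ψ (TS.word 𝕜 v) := by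
  rw [word_eq_wd, cv_wd, sp_map]
  simp only [word_eq_wd]

theorem m_mem (n : ℤ) (e : E n) {p : ℤ} {t : TS 𝕜 E} (ht : t ∈ TS.deg 𝕜 E p) :
    ∃ g : E (n + p), P.m n e t = DirectSum.lof 𝕜 ℤ E _ g ∧ P.hat _ g = P.hat n e ∘ₗ P.rhoL t := by
  induction ht using Submodule.span_induction with
  | mem x h => obtain ⟨X, rfl, rfl⟩ := h; rw [OpRep.rhoL_word]; exact P.m_word n e X
  | zero => exact ⟨0, by simp, by simp⟩
  | add x y _ _ h1 h2 =>
    obtain ⟨g, h1, h1'⟩ := h1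
    obtain ⟨g', h2, h2'⟩ := h2
    exact ⟨g + g', by simp [h1, h2], by simp [h1', h2', LinearMap.comp_add]⟩
  | smul c x _ h =>
    obtain ⟨g, h, h'⟩ := h
    exact ⟨c • g, by simp [h], by simp [h', LinearMap.comp_smul]⟩

theorem sp_mem {α : Type*} {M : Type*} [AddCommMonoid M] [Module 𝕜 M] (S : Submodule 𝕜 M) (l : List α)
    (F : List α → List α → M) (h : ∀ u v, l = u ++ v → F u v ∈ S) : sp l F ∈ S := by
  induction l generalizing F with
  | nil => exact h _ _ rfl
  | cons a l ih =>
    rw [sp_cons]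
    exact add_mem (h _ _ rfl) (ih _ fun u v e => h _ _ (by rw [e]; rfl))

theorem W_pre_word (f : Σ n, E n) (k : ℤ) (Y : List (Σ n, E n)) :
    P.W.pre f.1 k f.2 (TS.word 𝕜 Y) = sp Y fun Y₀ Z =>
      ((-1 : 𝕜) ^ ((f.1 + k) * dg Y₀ + k * dg Z)) •
        (TS.word 𝕜 Y₀ * TensorAlgebra.ι 𝕜 (P.m f.1 f.2 (TS.word 𝕜 Z))) := by
  rw [OpRep.pre_apply, W_cv_word]
  refine sp_congr fun Y₀ Z _ => ?_
  rw [LinearMap.comp_apply, W_sg_word, W_sg_word, map_smul, smul_mul_smul_comm,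
    ← zpow_add₀ (by simp)]
  rfl

theorem W_rho_cons_word (f : Σ n, E n) (X Y : List (Σ n, E n)) :
    P.W.rho (f :: X) (TS.word 𝕜 Y) = sp Y fun Y₁ Y₂ => sp Y₁ fun Y₀ Z =>
      ((-1 : 𝕜) ^ ((f.1 + dg X) * dg Y₀ + dg X * dg Z)) •
        (TS.word 𝕜 Y₀ * (TensorAlgebra.ι 𝕜 (P.m f.1 f.2 (TS.word 𝕜 Z)) *
          P.W.rho X (TS.word 𝕜 Y₂))) := by
  rw [OpRep.rho_cons, W_cv_word]
  refine sp_congr fun Y₁ Y₂ _ => ?_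
  rw [W_pre_word, sp_mul_right]
  refine sp_congr fun Y₀ Z _ => ?_
  rw [smul_mul_assoc, mul_assoc]

theorem W_rho_mem (X Y : List (Σ n, E n)) :
    P.W.rho X (TS.word 𝕜 Y) ∈ TS.deg 𝕜 E (dg X + dg Y) := by
  induction X generalizing Y with
  | nil => simpa using word_mem_deg Y
  | cons f X ih =>
    rw [W_rho_cons_word]
    refine sp_mem _ _ _ fun Y₁ Y₂ h => sp_mem _ _ _ fun Y₀ Z h' => Submodule.smul_mem _ _ ?_
    obtain ⟨g, hg, -⟩ := P.m_word f.1 f.2 Z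
    rw [hg]
    have := mul_mem_deg (word_mem_deg (𝕜 := 𝕜) Y₀) (mul_mem_deg (of_mem_deg (𝕜 := 𝕜) g) (ih Y₂))
    rwa [show dg Y₀ + (f.1 + dg Z + (dg X + dg Y₂)) = dg (f :: X) + dg Y by
      rw [h, h', dg_cons, dg_append, dg_append]; ring] at this

/-- The action of a product of words is the composition of their actions. -/
theorem rho_comp_rho (X Y : List (Σ n, E n)) :
    P.rho X ∘ₗ P.rho Y = P.rhoL (P.W.rho X (TS.word 𝕜 Y)) := by
  induction X generalizing Y with
  | nil => simp
  | cons f X ih =>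
    rw [W_rho_cons_word, map_sp, OpRep.rho_cons, OpRep.cv_rho]
    refine sp_congr fun Y₁ Y₂ _ => ?_
    rw [OpRep.pre_apply, ← LinearMap.comp_assoc, OpRep.cv_rho, map_sp, ih]
    have h1 := map_sp (LinearMap.lcomp 𝕜 (TensorAlgebra 𝕜 U) (P.sg (dg Y₂))) Y₁ fun Y₀ Z =>
      cv (P.sg (f.1 + dg X) ∘ₗ P.rho Y₀ ∘ₗ P.sg (dg Z)) ((P.op f.1 f.2 ∘ₗ P.sg (dg X)) ∘ₗ P.rho Z)
    rw [LinearMap.lcomp_apply'] at h1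
    rw [h1, map_sp cv, ← LinearMap.applyₗ_apply_apply, map_sp]
    refine sp_congr fun Y₀ Z _ => ?_
    obtain ⟨g, hg, hg'⟩ := P.m_word f.1 f.2 Z
    have h2 := P.rhoL_mul_of_mul Y₀ ⟨_, g⟩ (P.W_rho_mem X Y₂)
    have h3 : P.op _ g = P.op f.1 f.2 ∘ₗ P.rho Z := LinearMap.ext fun x =>
      congrArg (TensorAlgebra.ι 𝕜) (LinearMap.congr_fun hg' x)
    rw [LinearMap.applyₗ_apply_apply, LinearMap.lcomp_apply', OpRep.cv_sg, ← LinearMap.comp_assoc, P.sg_rho,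
      LinearMap.comp_assoc (P.rho Z), P.sg_rho, hg, map_smul]
    refine Eq.trans ?_ (congrArg (((-1 : 𝕜) ^ ((f.1 + dg X) * dg Y₀ + dg X * dg Z)) • ·) h2.symm)
    rw [h3]
    simp only [LinearMap.smul_comp, LinearMap.comp_smul, map_smul, LinearMap.smul_apply, smul_smul]
    rw [← zpow_add₀ (by simp)]
    congr 1
    · exact Bimod.neg_one_zpow_congr ⟨0, by ring⟩
    · simp only [LinearMap.comp_assoc, ← OpRep.sg_add]
      congr 6
      ring

theorem lof_eq_of_hat_eq {i j : ℤ} (h : i = j) {g : E i} {g' : E j} (hg : P.hat i g = P.hat j g') :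
    DirectSum.lof 𝕜 ℤ E i g = DirectSum.lof 𝕜 ℤ E j g' := by
  subst h
  rw [P.hat_injective _ hg]

/-- The brace algebra `E`, acting on its own total space. -/
def WB : BraceRep 𝕜 (⨁ n, E n) E where
  toOpRep := P.W
  m := P.m
  m_one := P.m_one
  m_word n e Z := by
    obtain ⟨g, hg, hg'⟩ := P.m_word n e Z
    refine ⟨g, hg, word_ext fun V => ?_⟩
    obtain ⟨g₁, h₁, h₁'⟩ := P.m_mem n e (P.W_rho_mem Z V)
    obtain ⟨g₂, h₂, h₂'⟩ := P.m_word _ g V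
    change P.m _ g (TS.word 𝕜 V) = P.m n e (P.W.rho Z (TS.word 𝕜 V))
    rw [h₁, h₂]
    refine P.lof_eq_of_hat_eq (by ring) ?_
    rw [h₁', h₂', hg', ← rho_comp_rho]
    rfl
  hat_injective n x y h := by
    have := LinearMap.congr_fun h 1
    change P.m n x 1 = P.m n y 1 at this
    rw [P.m_one, P.m_one] at this
    exact DirectSum.of_injective n this

/-- The product on `T(E)` determined by the braces. -/
def mul : TS 𝕜 E →ₗ[𝕜] TS 𝕜 E →ₗ[𝕜] TS 𝕜 E := P.W.rhoL

theorem mul_word (X Y : List (Σ n, E n)) : P.mul (TS.word 𝕜 X) (TS.word 𝕜 Y) =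
    P.W.rho X (TS.word 𝕜 Y) := by rw [mul, OpRep.rhoL_word]

theorem one_mul (x : TS 𝕜 E) : P.mul 1 x = x := by
  have := P.W.rhoL_word []
  rw [word_nil] at this
  rw [mul, this]; rfl

theorem mul_one (x : TS 𝕜 E) : P.mul x 1 = x := by
  have : LinearMap.flip P.mul 1 = LinearMap.id := word_ext fun X => by
    rw [LinearMap.flip_apply, ← word_nil, mul_word]
    induction X with
    | nil => rfl
    | cons f X ih =>
      rw [W_rho_cons_word]
      simp only [sp_nil]
      rw [ih, word_nil, P.m_one]
      simp [word_cons, TS.of]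
  exact LinearMap.congr_fun this x

theorem mul_assoc (x y z : TS 𝕜 E) : P.mul (P.mul x y) z = P.mul x (P.mul y z) := by
  have key : ∀ X Y : List (Σ n, E n), P.mul (P.mul (TS.word 𝕜 X) (TS.word 𝕜 Y)) =
      P.mul (TS.word 𝕜 X) ∘ₗ P.mul (TS.word 𝕜 Y) := fun X Y => by
    have := P.WB.rho_comp_rho X Y
    rw [mul_word, mul, OpRep.rhoL_word, OpRep.rhoL_word]
    exact this.symm
  have h2 : P.mul.compr₂ P.mul = ((LinearMap.llcomp 𝕜 _ _ _).compl₁₂ P.mul P.mul) := by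
    refine word_ext fun X => word_ext fun Y => ?_
    exact key X Y
  exact LinearMap.congr_fun (LinearMap.congr_fun (LinearMap.congr_fun h2 x) y) z

theorem mul_mem {m n : ℤ} {x y : TS 𝕜 E} (hx : x ∈ TS.deg 𝕜 E m) (hy : y ∈ TS.deg 𝕜 E n) :
    P.mul x y ∈ TS.deg 𝕜 E (m + n) := by
  induction hx using Submodule.span_induction with
  | mem x h =>
    obtain ⟨X, rfl, rfl⟩ := h
    induction hy using Submodule.span_induction with
    | mem y h => obtain ⟨Y, rfl, rfl⟩ := h; rw [mul_word]; exact P.W_rho_mem X Y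
    | zero => rw [map_zero]; exact zero_mem _
    | add x y _ _ h1 h2 => rw [map_add]; exact add_mem h1 h2
    | smul c x _ h => rw [map_smul]; exact Submodule.smul_mem _ _ h
  | zero => rw [map_zero]; exact zero_mem _
  | add x y _ _ h1 h2 => rw [map_add]; exact add_mem h1 h2
  | smul c x _ h => rw [map_smul]; exact Submodule.smul_mem _ _ h

theorem sgn_mul (x y : TS 𝕜 E) :
    TS.sgn 𝕜 E (P.mul x y) = P.mul (TS.sgn 𝕜 E x) (TS.sgn 𝕜 E y) := by
  have : P.mul.compr₂ (TS.sgn 𝕜 E).toLinearMap =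
      P.mul.compl₁₂ (TS.sgn 𝕜 E).toLinearMap (TS.sgn 𝕜 E).toLinearMap := by
    refine word_ext fun X => word_ext fun Y => ?_
    simp only [LinearMap.compr₂_apply, LinearMap.compl₁₂_apply, AlgHom.toLinearMap_apply, sgn_word]
    rw [mul_word, sgn_eq_sgp, sgp_of_mem_deg 1 (P.W_rho_mem X Y)]
    simp [mul_word, smul_smul, zpow_add₀, mul_comm]
  exact LinearMap.congr_fun (LinearMap.congr_fun this x) y

theorem counit_mul (x y : TS 𝕜 E) : TensorAlgebra.algebraMapInv (P.mul x y) =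
    (TensorAlgebra.algebraMapInv x * TensorAlgebra.algebraMapInv y : 𝕜) := by
  have : P.mul.compr₂ (TensorAlgebra.algebraMapInv : TS 𝕜 E →ₐ[𝕜] 𝕜).toLinearMap =
      (LinearMap.mul 𝕜 𝕜).compl₁₂ (TensorAlgebra.algebraMapInv : TS 𝕜 E →ₐ[𝕜] 𝕜).toLinearMap
        (TensorAlgebra.algebraMapInv : TS 𝕜 E →ₐ[𝕜] 𝕜).toLinearMap := by
    refine word_ext fun X => word_ext fun Y => ?_
    simp only [LinearMap.compr₂_apply, LinearMap.compl₁₂_apply, AlgHom.toLinearMap_apply, mul_word]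
    have hι : ∀ a : ⨁ n, E n, TensorAlgebra.algebraMapInv (TensorAlgebra.ι 𝕜 a) = (0 : 𝕜) := by
      intro a; simp [TensorAlgebra.algebraMapInv]
    cases X with
    | nil => simp
    | cons f X =>
      rw [W_rho_cons_word, map_sp, word_cons, map_mul, TS.of, hι]
      simp only [map_sp, map_smul, map_mul, hι, zero_mul, mul_zero, smul_zero, sp_zero]
      simp
  exact LinearMap.congr_fun (LinearMap.congr_fun this x) y

theorem deconcat_mul_word (X Y : List (Σ n, E n)) :
    TS.deconcat 𝕜 E (P.mul (TS.word 𝕜 X) (TS.word 𝕜 Y)) = sp X fun X₁ X₂ => sp Y fun Y₁ Y₂ =>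
      ((-1 : 𝕜) ^ (dg X₂ * dg Y₁)) • (P.mul (TS.word 𝕜 X₁) (TS.word 𝕜 Y₁) ⊗ₜ[𝕜]
        P.mul (TS.word 𝕜 X₂) (TS.word 𝕜 Y₂)) := by
  rw [mul_word, deconcat_eq_dc, ← LinearMap.comp_apply, OpRep.dc_rho]
  rw [show ∀ F : List (Σ n, E n) → List (Σ n, E n) → TS 𝕜 E →ₗ[𝕜] TS 𝕜 E ⊗[𝕜] TS 𝕜 E,
    (sp X F) (TS.word 𝕜 Y) = sp X fun a b => F a b (TS.word 𝕜 Y) from fun F =>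
      map_sp (LinearMap.applyₗ (TS.word 𝕜 Y)) X F]
  refine sp_congr fun X₁ X₂ _ => ?_
  rw [word_eq_wd, LinearMap.comp_apply, dc_wd, sp_map, map_sp]
  refine sp_congr fun Y₁ Y₂ _ => ?_
  rw [← word_eq_wd, ← word_eq_wd, TensorProduct.map_tmul, LinearMap.comp_apply, W_sg_word, map_smul,
    mul_word, mul_word, TensorProduct.smul_tmul']

theorem deconcat_word_sp (X : List (Σ n, E n)) : TS.deconcat 𝕜 E (TS.word 𝕜 X) =
    sp X fun u v => TS.word 𝕜 u ⊗ₜ[𝕜] TS.word 𝕜 v := by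
  rw [TS.deconcat_word, sum_range_take_drop X fun u v => TS.word 𝕜 u ⊗ₜ[𝕜] TS.word 𝕜 v]

theorem exchange_word (X₁ X₂ Y₁ Y₂ : List (Σ n, E n)) :
    TS.exchange 𝕜 E ((TS.word 𝕜 X₁ ⊗ₜ TS.word 𝕜 X₂) ⊗ₜ (TS.word 𝕜 Y₁ ⊗ₜ TS.word 𝕜 Y₂)) =
      ((-1 : 𝕜) ^ (dg X₂ * dg Y₁)) •
        ((TS.word 𝕜 X₁ ⊗ₜ TS.word 𝕜 Y₁) ⊗ₜ (TS.word 𝕜 X₂ ⊗ₜ TS.word 𝕜 Y₂)) := by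
  have h : (TS.sgn 𝕜 E).toLinearMap (TS.word 𝕜 X₂) = ((-1 : 𝕜) ^ dg X₂) • TS.word 𝕜 X₂ := sgn_word X₂
  have h' : (TS.sgn 𝕜 E).toLinearMap (TS.word 𝕜 Y₁) = ((-1 : 𝕜) ^ dg Y₁) • TS.word 𝕜 Y₁ := sgn_word Y₁
  rw [← Bimod.koszul_sign]
  simp only [TS.exchange, LinearMap.comp_apply, LinearMap.add_apply, TensorProduct.map_tmul,
    LinearMap.id_apply, LinearMap.smul_apply, LinearMap.sub_apply, h, h',
    LinearEquiv.coe_coe, TensorProduct.tmul_smul, ← TensorProduct.smul_tmul', map_add, map_sub,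
    map_smul, TensorProduct.add_tmul, TensorProduct.sub_tmul, TensorProduct.tmul_add, TensorProduct.tmul_sub,
    TensorProduct.tensorTensorTensorComm_tmul]
  generalize (TS.word 𝕜 X₁ ⊗ₜ[𝕜] TS.word 𝕜 Y₁) ⊗ₜ[𝕜] (TS.word 𝕜 X₂ ⊗ₜ[𝕜] TS.word 𝕜 Y₂) = t
  simp only [smul_smul, smul_sub, smul_add]
  module

end BraceRep

section IotaInv

variable {𝕜 : Type} [RCLike 𝕜] {M : Type*} [AddCommGroup M] [Module 𝕜 M]

theorem counit_ι (a : M) : TensorAlgebra.algebraMapInv (TensorAlgebra.ι 𝕜 a) = (0 : 𝕜) := by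
  simp [TensorAlgebra.algebraMapInv]

theorem fst_toTrivSqZeroExt [Module 𝕜ᵐᵒᵖ M] [IsCentralScalar 𝕜 M] (x : TensorAlgebra 𝕜 M) :
    (TensorAlgebra.toTrivSqZeroExt x : TrivSqZeroExt 𝕜 M).fst = TensorAlgebra.algebraMapInv x := by
  have : (TrivSqZeroExt.fstHom 𝕜 𝕜 M).comp TensorAlgebra.toTrivSqZeroExt =
      (TensorAlgebra.algebraMapInv : TensorAlgebra 𝕜 M →ₐ[𝕜] 𝕜) := by
    ext a
    simp [counit_ι]
  exact DFunLike.congr_fun this x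

theorem ιInv_ι (a : M) : TensorAlgebra.ιInv (TensorAlgebra.ι 𝕜 a) = a := TensorAlgebra.ι_leftInverse a

theorem ιInv_one : TensorAlgebra.ιInv (1 : TensorAlgebra 𝕜 M) = 0 := by
  let _ : Module 𝕜ᵐᵒᵖ M := Module.compHom _ ((RingHom.id 𝕜).fromOpposite mul_comm)
  have _ : IsCentralScalar 𝕜 M := ⟨fun r m => rfl⟩
  simp [TensorAlgebra.ιInv]

theorem ιInv_mul (x y : TensorAlgebra 𝕜 M) : TensorAlgebra.ιInv (x * y) =
    (TensorAlgebra.algebraMapInv x : 𝕜) • TensorAlgebra.ιInv y +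
      (TensorAlgebra.algebraMapInv y : 𝕜) • TensorAlgebra.ιInv x := by
  let _ : Module 𝕜ᵐᵒᵖ M := Module.compHom _ ((RingHom.id 𝕜).fromOpposite mul_comm)
  have _ : IsCentralScalar 𝕜 M := ⟨fun r m => rfl⟩
  simp [TensorAlgebra.ιInv, fst_toTrivSqZeroExt]

end IotaInv

section

variable {𝕜 : Type} [RCLike 𝕜] {E : ℤ → Type*} [∀ n, AddCommGroup (E n)] [∀ n, Module 𝕜 (E n)]

theorem counit_word_of_ne_nil {X : List (Σ n, E n)} (h : X ≠ []) :
    TensorAlgebra.algebraMapInv (TS.word 𝕜 X) = (0 : 𝕜) := by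
  cases X with
  | nil => exact absurd rfl h
  | cons f X => rw [word_cons, map_mul, TS.of, counit_ι, zero_mul]

theorem word_singleton (f : Σ n, E n) : TS.word 𝕜 [f] = TS.of 𝕜 f.2 := by
  rw [word_cons, word_nil, mul_one]

theorem ιInv_mem {p : ℤ} {t : TS 𝕜 E} (ht : t ∈ TS.deg 𝕜 E p) :
    ∃ g : E p, TensorAlgebra.ιInv t = DirectSum.lof 𝕜 ℤ E p g := by
  induction ht using Submodule.span_induction with
  | mem x h =>
    obtain ⟨X, rfl, rfl⟩ := h
    cases X with
    | nil => exact ⟨0, by rw [word_nil, ιInv_one, map_zero]⟩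
    | cons f X =>
      rcases eq_or_ne X [] with rfl | hX
      · refine ⟨cast (by simp) f.2, ?_⟩
        rw [word_singleton, TS.of, ιInv_ι]
        have : ∀ (i j : ℤ) (h : i = j) (x : E i), DirectSum.lof 𝕜 ℤ E i x =
          DirectSum.lof 𝕜 ℤ E j (cast (by rw [h]) x) := by rintro i _ rfl x; rfl
        exact this _ _ (by simp) _
      · refine ⟨0, ?_⟩
        rw [word_cons, ιInv_mul, counit_word_of_ne_nil hX, TS.of, counit_ι, zero_smul, zero_smul,
          add_zero, map_zero]
  | zero => exact ⟨0, by simp⟩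
  | add x y _ _ h1 h2 =>
    obtain ⟨g, h1⟩ := h1
    obtain ⟨g', h2⟩ := h2
    exact ⟨g + g', by rw [map_add, h1, h2, map_add]⟩
  | smul c x _ h =>
    obtain ⟨g, h⟩ := h
    exact ⟨c • g, by rw [map_smul, h, map_smul]⟩

theorem sp_apply {α M N : Type*} [AddCommMonoid M] [Module 𝕜 M] [AddCommMonoid N] [Module 𝕜 N]
    (l : List α) (F : List α → List α → M →ₗ[𝕜] N) (x : M) :
    sp l F x = sp l fun u v => F u v x := map_sp (LinearMap.applyₗ x) l F

theorem sp_eq_left_nil {α M : Type*} [AddCommMonoid M] (l : List α) (F : List α → List α → M)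
    (h : ∀ u v, u ≠ [] → F u v = 0) : sp l F = F [] l := by
  cases l with
  | nil => rfl
  | cons a l =>
    rw [sp_cons, sp_congr (G := fun _ _ => 0), sp_zero, add_zero]
    exact fun u v _ => h _ _ (by simp)

theorem sp_eq_right_nil {α M : Type*} [AddCommMonoid M] (l : List α) (F : List α → List α → M)
    (h : ∀ u v, v ≠ [] → F u v = 0) : sp l F = F l [] := by
  induction l generalizing F with
  | nil => rfl
  | cons a l ih =>
    rw [sp_cons, h [] (a :: l) (by simp), zero_add, ih _ fun u v hv => h _ _ hv]

end

namespace BraceRep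

variable {𝕜 : Type} [RCLike 𝕜] {U : Type*} [AddCommGroup U] [Module 𝕜 U] {E : ℤ → Type u}
  [∀ n, AddCommGroup (E n)] [∀ n, Module 𝕜 (E n)] (P : BraceRep 𝕜 U E)

theorem ιInv_mul_of {n : ℤ} (f : E n) (t : TS 𝕜 E) :
    TensorAlgebra.ιInv (P.mul (TS.of 𝕜 f) t) = P.m n f t := by
  have : TensorAlgebra.ιInv ∘ₗ P.mul (TS.of 𝕜 f) = P.m n f := word_ext fun Y => by
    rw [LinearMap.comp_apply, ← word_singleton ⟨n, f⟩, mul_word, W_rho_cons_word, map_sp,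
      sp_eq_right_nil]
    · rw [map_sp, sp_eq_left_nil]
      · simp only [word_nil, OpRep.rho_nil, LinearMap.id_apply]
        simp [ιInv_ι]
      · intro u v hu
        rw [map_smul, ιInv_mul, counit_word_of_ne_nil hu]
        simp [counit_ι]
    · intro u v hv
      rw [map_sp, ← sp_zero (M := ⨁ n, E n) u]
      refine sp_congr fun Y₀ Z _ => ?_
      rw [map_smul, OpRep.rho_nil, LinearMap.id_apply, ιInv_mul, ιInv_mul, map_mul,
        counit_word_of_ne_nil hv, counit_ι]
      simp
  exact LinearMap.congr_fun this t

theorem ιInv_mul_word (X Y : List (Σ n, E n)) (hX : 1 < X.length) :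
    TensorAlgebra.ιInv (P.mul (TS.word 𝕜 X) (TS.word 𝕜 Y)) = 0 := by
  obtain _ | ⟨f, _ | ⟨g, X⟩⟩ := X
  · simp at hX
  · simp at hX
  rw [mul_word, W_rho_cons_word, map_sp, ← sp_zero (M := ⨁ n, E n) Y]
  refine sp_congr fun Y₁ Y₂ _ => ?_
  rw [map_sp, ← sp_zero (M := ⨁ n, E n) Y₁]
  refine sp_congr fun Y₀ Z _ => ?_
  have : TensorAlgebra.algebraMapInv (P.W.rho (g :: X) (TS.word 𝕜 Y₂)) = (0 : 𝕜) := by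
    rw [← mul_word, counit_mul, counit_word_of_ne_nil (by simp), zero_mul]
  rw [map_smul, ιInv_mul, ιInv_mul, map_mul, this, counit_ι]
  simp

theorem mul_of_of {m n : ℤ} (f : E m) (g : E n) : P.mul (TS.of 𝕜 f) (TS.of 𝕜 g) =
    TS.of 𝕜 f * TS.of 𝕜 g + TensorAlgebra.ι 𝕜 (P.m m f (TS.of 𝕜 g)) +
      ((-1 : 𝕜) ^ (m * n)) • (TS.of 𝕜 g * TS.of 𝕜 f) := by
  rw [← word_singleton ⟨m, f⟩, ← word_singleton ⟨n, g⟩, mul_word, W_rho_cons_word]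
  simp only [sp_cons, sp_nil, OpRep.rho_nil, LinearMap.id_apply]
  simp [word_cons, P.m_one, TS.of, add_assoc]

theorem mul_of_word {n : ℤ} (b : E n) (Y : List (Σ n, E n)) :
    P.mul (TS.of 𝕜 b) (TS.word 𝕜 Y) = sp Y fun Y₁ Y₂ => sp Y₁ fun Y₀ Z =>
      ((-1 : 𝕜) ^ (n * dg Y₀)) •
        (TS.word 𝕜 Y₀ * (TensorAlgebra.ι 𝕜 (P.m n b (TS.word 𝕜 Z)) * TS.word 𝕜 Y₂)) := by
  rw [← word_singleton ⟨n, b⟩, mul_word, W_rho_cons_word]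
  simp only [dg_nil, add_zero, zero_mul, OpRep.rho_nil, LinearMap.id_apply]

theorem mul_of_cons {n : ℤ} (b : E n) (f : Σ n, E n) (X : List (Σ n, E n)) :
    P.mul (TS.of 𝕜 b) (TS.word 𝕜 (f :: X)) =
      ((-1 : 𝕜) ^ (n * f.1)) • (TS.of 𝕜 f.2 * P.mul (TS.of 𝕜 b) (TS.word 𝕜 X)) +
      sp (f :: X) fun Z Y => TensorAlgebra.ι 𝕜 (P.m n b (TS.word 𝕜 Z)) * TS.word 𝕜 Y := by
  let L : TS 𝕜 E →ₗ[𝕜] TS 𝕜 E := ((-1 : 𝕜) ^ (n * f.1)) • LinearMap.mulLeft 𝕜 (TS.of 𝕜 f.2)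
  change _ = L _ + _
  rw [mul_of_word, mul_of_word, map_sp, sp_cons, sp_cons, add_left_comm, ← sp_add]
  congr 1
  · simp
  · refine sp_congr fun Y₁ Y₂ _ => ?_
    rw [sp_cons, map_sp, add_comm]
    congr 1
    · refine sp_congr fun Y₀ Z _ => ?_
      simp only [L, LinearMap.smul_apply, LinearMap.mulLeft_apply, mul_smul_comm, smul_smul]
      rw [← zpow_add₀ (by simp), word_cons, _root_.mul_assoc, dg_cons, mul_add]
    · simp

theorem mul_cons_of {n : ℤ} (b : E n) (f : Σ n, E n) (X : List (Σ n, E n)) :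
    P.mul (TS.word 𝕜 (f :: X)) (TS.of 𝕜 b) = TS.of 𝕜 f.2 * P.mul (TS.word 𝕜 X) (TS.of 𝕜 b) +
      ((-1 : 𝕜) ^ (n * dg X)) • (TensorAlgebra.ι 𝕜 (P.m f.1 f.2 (TS.of 𝕜 b)) * TS.word 𝕜 X) +
      ((-1 : 𝕜) ^ (n * dg (f :: X))) • (TS.of 𝕜 b * TS.word 𝕜 (f :: X)) := by
  have h1 : P.W.rho X 1 = TS.word 𝕜 X := by rw [← word_nil, ← mul_word, word_nil, P.mul_one]
  rw [← word_singleton ⟨n, b⟩, mul_word, mul_word, W_rho_cons_word]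
  simp only [sp_cons, sp_nil]
  simp only [word_nil, h1, P.m_one, word_cons f, word_singleton]
  simp [TS.of, add_assoc, mul_comm n]

variable (b : E 1)

/-- The graded commutator with an element of degree one. -/
def ad : TS 𝕜 E →ₗ[𝕜] TS 𝕜 E :=
  P.mul (TS.of 𝕜 b) - P.mul.flip (TS.of 𝕜 b) ∘ₗ (TS.sgn 𝕜 E).toLinearMap

theorem ad_apply (x : TS 𝕜 E) :
    P.ad b x = P.mul (TS.of 𝕜 b) x - P.mul (TS.sgn 𝕜 E x) (TS.of 𝕜 b) := rfl

theorem ad_cons (f : Σ n, E n) (X : List (Σ n, E n)) : P.ad b (TS.word 𝕜 (f :: X)) =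
    ((-1 : 𝕜) ^ f.1) • (TS.of 𝕜 f.2 * P.ad b (TS.word 𝕜 X)) +
      TensorAlgebra.ι 𝕜 (P.m 1 b (TS.of 𝕜 f.2) - ((-1 : 𝕜) ^ f.1) • P.m f.1 f.2 (TS.of 𝕜 b)) *
        TS.word 𝕜 X +
      (sp X fun Z Y => TensorAlgebra.ι 𝕜 (P.m 1 b (TS.word 𝕜 (f :: Z))) * TS.word 𝕜 Y) -
      TensorAlgebra.ι 𝕜 (P.m 1 b (TS.of 𝕜 f.2)) * TS.word 𝕜 X := by
  rw [ad_apply, ad_apply, sgn_word, sgn_word, mul_of_cons, map_smul, map_smul, LinearMap.smul_apply,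
    LinearMap.smul_apply, mul_cons_of, sp_cons, word_nil, P.m_one, dg_cons, zpow_add₀ (by simp)]
  simp only [mul_sub, mul_smul_comm, map_sub, map_smul, sub_mul, smul_mul_assoc, smul_add, smul_sub,
    smul_smul, _root_.one_mul]
  rw [show ((-1 : 𝕜) ^ f.1 * (-1) ^ dg X) * (-1) ^ dg X = (-1) ^ f.1 by
      rw [_root_.mul_assoc, GrSp.neg_one_zpow_mul_self, _root_.mul_one],
    show ((-1 : 𝕜) ^ f.1 * (-1) ^ dg X) * (-1) ^ (f.1 + dg X) = 1 by
      rw [← zpow_add₀ (by simp), GrSp.neg_one_zpow_mul_self], one_smul]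
  rw [show TS.of 𝕜 b = TensorAlgebra.ι 𝕜 (DirectSum.lof 𝕜 ℤ E 1 b) from rfl]
  abel


theorem sgn_of {n : ℤ} (f : E n) : TS.sgn 𝕜 E (TS.of 𝕜 f) = ((-1 : 𝕜) ^ n) • TS.of 𝕜 f := by
  have := sgn_word (𝕜 := 𝕜) [(⟨n, f⟩ : Σ n, E n)]
  rwa [word_singleton, dg_cons, dg_nil, add_zero] at this

theorem sgn_sgn (x : TS 𝕜 E) : TS.sgn 𝕜 E (TS.sgn 𝕜 E x) = x := by
  have : (TS.sgn 𝕜 E).toLinearMap ∘ₗ (TS.sgn 𝕜 E).toLinearMap = LinearMap.id := word_ext fun X => by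
    simp only [LinearMap.comp_apply, AlgHom.toLinearMap_apply, sgn_word, map_smul, smul_smul,
      GrSp.neg_one_zpow_mul_self, one_smul, LinearMap.id_apply]
  exact LinearMap.congr_fun this x

theorem mul_of_self {b : E 1} (hb : P.m 1 b (TS.of 𝕜 b) = 0) :
    P.mul (TS.of 𝕜 b) (TS.of 𝕜 b) = 0 := by
  rw [mul_of_of, hb]
  simp

theorem deconcat_of_mul {n : ℤ} (f : E n) (X : List (Σ n, E n)) :
    TS.deconcat 𝕜 E (P.mul (TS.of 𝕜 f) (TS.word 𝕜 X)) = sp X fun u v =>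
      P.mul (TS.of 𝕜 f) (TS.word 𝕜 u) ⊗ₜ[𝕜] TS.word 𝕜 v +
        ((-1 : 𝕜) ^ (n * dg u)) • (TS.word 𝕜 u ⊗ₜ[𝕜] P.mul (TS.of 𝕜 f) (TS.word 𝕜 v)) := by
  rw [← word_singleton ⟨n, f⟩, deconcat_mul_word, sp_add, sp_cons, sp_nil, add_comm]
  simp [P.one_mul]

theorem deconcat_mul_of {n : ℤ} (f : E n) (X : List (Σ n, E n)) :
    TS.deconcat 𝕜 E (P.mul (TS.word 𝕜 X) (TS.of 𝕜 f)) = sp X fun u v =>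
      TS.word 𝕜 u ⊗ₜ[𝕜] P.mul (TS.word 𝕜 v) (TS.of 𝕜 f) +
        ((-1 : 𝕜) ^ (n * dg v)) • (P.mul (TS.word 𝕜 u) (TS.of 𝕜 f) ⊗ₜ[𝕜] TS.word 𝕜 v) := by
  rw [← word_singleton ⟨n, f⟩, deconcat_mul_word]
  simp [sp_cons, P.mul_one, mul_comm n]

/-- The `B_∞`-structure on a brace algebra with an element `b` of degree one such that
`b{b} = 0`. -/
def toBInf (b : E 1) (hb : P.m 1 b (TS.of 𝕜 b) = 0) : BInf 𝕜 E where
  D := P.ad b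
  mul := TensorProduct.lift P.mul
  D_deg n x hx := by
    have h1 := of_mem_deg (𝕜 := 𝕜) b
    rw [ad_apply, sgn_eq_sgp, sgp_of_mem_deg 1 hx, map_smul, LinearMap.smul_apply]
    refine sub_mem ?_ (Submodule.smul_mem _ _ (P.mul_mem hx h1))
    rw [add_comm]
    exact P.mul_mem h1 hx
  D_D x := by
    simp only [ad_apply, map_sub, sgn_mul, sgn_sgn, sgn_of, zpow_one, neg_smul,
      one_smul, map_neg, LinearMap.neg_apply, P.mul_assoc, P.mul_of_self hb, map_zero]
    rw [← P.mul_assoc (TS.of 𝕜 b) (TS.of 𝕜 b), P.mul_of_self hb]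
    simp
  D_one := by rw [ad_apply, map_one (TS.sgn 𝕜 E), P.mul_one, P.one_mul, sub_self]
  counit_D x := by rw [ad_apply, map_sub, counit_mul, counit_mul, TS.of, counit_ι]; simp
  deconcat_D x := by
    have : TS.deconcat 𝕜 E ∘ₗ P.ad b = (TensorProduct.map (P.ad b) LinearMap.id +
        TensorProduct.map (TS.sgn 𝕜 E).toLinearMap (P.ad b)) ∘ₗ TS.deconcat 𝕜 E := by
      refine word_ext fun X => ?_
      rw [LinearMap.comp_apply, LinearMap.comp_apply, deconcat_word_sp, map_sp, ad_apply, sgn_word,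
        map_smul, LinearMap.smul_apply, map_sub, map_smul, deconcat_of_mul, deconcat_mul_of]
      rw [show ∀ (c : 𝕜) (F : List (Σ n, E n) → List (Σ n, E n) → TS 𝕜 E ⊗[𝕜] TS 𝕜 E),
        c • sp X F = sp X fun u v => c • F u v from fun c F => map_sp (LinearMap.lsmul 𝕜 _ c) X F,
        sub_eq_iff_eq_add, ← sp_add]
      refine sp_congr fun u v h => ?_
      subst h
      simp only [LinearMap.add_apply, TensorProduct.map_tmul, LinearMap.id_apply,
        AlgHom.toLinearMap_apply, ad_apply, sgn_word, map_smul, LinearMap.smul_apply,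
        TensorProduct.sub_tmul, TensorProduct.tmul_sub, TensorProduct.tmul_smul,
        ← TensorProduct.smul_tmul', smul_add, smul_smul, dg_append, _root_.one_mul]
      rw [zpow_add₀ (by simp), _root_.mul_assoc, GrSp.neg_one_zpow_mul_self, _root_.mul_one,
        _root_.mul_comm ((-1 : 𝕜) ^ dg v)]
      abel
    exact LinearMap.congr_fun this x
  mul_deg m n x hx y hy := P.mul_mem hx hy
  mul_assoc := P.mul_assoc
  one_mul := P.one_mul
  mul_one := P.mul_one
  counit_mul := P.counit_mul
  deconcat_mul x y := by
    have : P.mul.compr₂ (TS.deconcat 𝕜 E) = ((TensorProduct.mk 𝕜 _ _).compl₁₂ (TS.deconcat 𝕜 E)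
        (TS.deconcat 𝕜 E)).compr₂ (TensorProduct.map (TensorProduct.lift P.mul)
          (TensorProduct.lift P.mul) ∘ₗ TS.exchange 𝕜 E) := by
      refine word_ext fun X => word_ext fun Y => ?_
      simp only [LinearMap.compr₂_apply, LinearMap.compl₁₂_apply, deconcat_mul_word, deconcat_word_sp,
        LinearMap.comp_apply]
      rw [map_sp (TensorProduct.mk 𝕜 _ _) X, sp_apply, map_sp, map_sp]
      refine sp_congr fun X₁ X₂ _ => ?_
      rw [map_sp, map_sp, map_sp]
      refine sp_congr fun Y₁ Y₂ _ => ?_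
      rw [TensorProduct.mk_apply, exchange_word, map_smul]
      rfl
    exact LinearMap.congr_fun (LinearMap.congr_fun this x) y
  D_mul x y := by
    simp only [TensorProduct.lift.tmul, ad_apply, sgn_mul, map_sub, LinearMap.sub_apply, P.mul_assoc]
    abel

variable {b} (hb : P.m 1 b (TS.of 𝕜 b) = 0)

theorem toBInf_m_of {n : ℤ} (f : E n) (x : TS 𝕜 E) :
    (P.toBInf b hb).m (TS.of 𝕜 f) x = P.m n f x := P.ιInv_mul_of f x

theorem toBInf_m_word (X Y : List (Σ n, E n)) (hX : 1 < X.length) :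
    (P.toBInf b hb).m (TS.word 𝕜 X) (TS.word 𝕜 Y) = 0 := P.ιInv_mul_word X Y hX

theorem toBInf_D_of {n : ℤ} (f : E n) : (P.toBInf b hb).D (TS.of 𝕜 f) =
    TensorAlgebra.ι 𝕜 (P.m 1 b (TS.of 𝕜 f) - ((-1 : 𝕜) ^ n) • P.m n f (TS.of 𝕜 b)) := by
  change P.ad b _ = _
  have h : (-1 : 𝕜) ^ n * (-1) ^ n = 1 := GrSp.neg_one_zpow_mul_self n
  rw [ad_apply, sgn_of, map_smul, LinearMap.smul_apply, mul_of_of, mul_of_of, map_sub, map_smul]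
  simp only [_root_.mul_one, _root_.one_mul, smul_add, smul_smul, h, one_smul]
  abel

theorem toBInf_d_of {n : ℤ} (f : E n) : (P.toBInf b hb).d (TS.of 𝕜 f) =
    P.m 1 b (TS.of 𝕜 f) - ((-1 : 𝕜) ^ n) • P.m n f (TS.of 𝕜 b) := by
  rw [BInf.d, toBInf_D_of, ιInv_ι]

theorem toBInf_d_word (X : List (Σ n, E n)) (hX : 1 < X.length) :
    (P.toBInf b hb).d (TS.word 𝕜 X) = P.m 1 b (TS.word 𝕜 X) := by
  change TensorAlgebra.ιInv (P.ad b _) = _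
  rw [ad_apply, sgn_word, map_smul, LinearMap.smul_apply, map_sub, map_smul, ιInv_mul_of,
    ← word_singleton ⟨1, b⟩, ιInv_mul_word _ _ _ hX, smul_zero, sub_zero]

end BraceRep

theorem neg_one_zpow_eq_or {𝕜 : Type} [RCLike 𝕜] (n : ℤ) : (-1 : 𝕜) ^ n = 1 ∨ (-1 : 𝕜) ^ n = -1 :=
  (Int.even_or_odd n).imp Even.neg_one_zpow Odd.neg_one_zpow

section Functoriality

variable {𝕜 : Type} [RCLike 𝕜] {V V' : ℤ → Type u} [∀ n, AddCommGroup (V n)] [∀ n, Module 𝕜 (V n)]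
  [∀ n, AddCommGroup (V' n)] [∀ n, Module 𝕜 (V' n)] (i : ∀ n, V' n →ₗ[𝕜] V n)

/-- Letterwise image of a word. -/
def mapWord (X : List (Σ n, V' n)) : List (Σ n, V n) := X.map fun f => ⟨f.1, i f.1 f.2⟩

theorem dg_mapWord (X : List (Σ n, V' n)) : dg (mapWord i X) = dg X := by
  simp [dg, mapWord, Function.comp_def]

theorem map_of {n : ℤ} (f : V' n) : TS.map 𝕜 i (TS.of 𝕜 f) = TS.of 𝕜 (i n f) := by
  simp [TS.map, TS.of]

theorem map_word (X : List (Σ n, V' n)) : TS.map 𝕜 i (TS.word 𝕜 X) = TS.word 𝕜 (mapWord i X) := by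
  induction X with
  | nil => simp [mapWord]
  | cons f X ih => rw [word_cons, map_mul, ih, map_of]; rfl

theorem map_mem_deg {p : ℤ} {x : TS 𝕜 V'} (hx : x ∈ TS.deg 𝕜 V' p) :
    TS.map 𝕜 i x ∈ TS.deg 𝕜 V p := by
  induction hx using Submodule.span_induction with
  | mem x h =>
    obtain ⟨X, rfl, rfl⟩ := h
    rw [map_word]
    have := word_mem_deg (𝕜 := 𝕜) (mapWord i X)
    rwa [dg_mapWord] at this
  | zero => rw [map_zero]; exact zero_mem _
  | add x y _ _ h1 h2 => rw [map_add]; exact add_mem h1 h2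
  | smul c x _ h => rw [map_smul]; exact Submodule.smul_mem _ _ h

theorem map_sgn (x : TS 𝕜 V') : TS.map 𝕜 i (TS.sgn 𝕜 V' x) = TS.sgn 𝕜 V (TS.map 𝕜 i x) := by
  have : (TS.map 𝕜 i).toLinearMap ∘ₗ (TS.sgn 𝕜 V').toLinearMap =
      (TS.sgn 𝕜 V).toLinearMap ∘ₗ (TS.map 𝕜 i).toLinearMap := word_ext fun X => by
    simp [sgn_word, map_word, dg_mapWord]
  exact LinearMap.congr_fun this x

theorem counit_map (x : TS 𝕜 V') : TensorAlgebra.algebraMapInv (TS.map 𝕜 i x) =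
    (TensorAlgebra.algebraMapInv x : 𝕜) := by
  have : (TensorAlgebra.algebraMapInv : TS 𝕜 V →ₐ[𝕜] 𝕜).toLinearMap ∘ₗ (TS.map 𝕜 i).toLinearMap =
      (TensorAlgebra.algebraMapInv : TS 𝕜 V' →ₐ[𝕜] 𝕜).toLinearMap := word_ext fun X => by
    rw [LinearMap.comp_apply, AlgHom.toLinearMap_apply, AlgHom.toLinearMap_apply, map_word]
    cases X with
    | nil => simp [mapWord]
    | cons f X => rw [counit_word_of_ne_nil (by simp [mapWord]),
        AlgHom.toLinearMap_apply, counit_word_of_ne_nil (by simp)]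
  exact LinearMap.congr_fun this x

theorem map_ι (x : ⨁ n, V' n) : TS.map 𝕜 i (TensorAlgebra.ι 𝕜 x) =
    TensorAlgebra.ι 𝕜 (DirectSum.lmap i x) := by
  simp [TS.map]

theorem ιInv_map (x : TS 𝕜 V') :
    TensorAlgebra.ιInv (TS.map 𝕜 i x) = DirectSum.lmap i (TensorAlgebra.ιInv x) := by
  have : TensorAlgebra.ιInv ∘ₗ (TS.map 𝕜 i).toLinearMap =
      DirectSum.lmap i ∘ₗ TensorAlgebra.ιInv := word_ext fun X => by
    cases X with
    | nil => simp [ιInv_one]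
    | cons f X => simp [word_cons, ιInv_mul, TS.of, map_ι, ιInv_ι, counit_ι, counit_map]
  exact LinearMap.congr_fun this x

theorem deconcat_map (x : TS 𝕜 V') : TS.deconcat 𝕜 V (TS.map 𝕜 i x) =
    TensorProduct.map (TS.map 𝕜 i).toLinearMap (TS.map 𝕜 i).toLinearMap (TS.deconcat 𝕜 V' x) := by
  have : TS.deconcat 𝕜 V ∘ₗ (TS.map 𝕜 i).toLinearMap =
      TensorProduct.map (TS.map 𝕜 i).toLinearMap (TS.map 𝕜 i).toLinearMap ∘ₗ
        TS.deconcat 𝕜 V' := word_ext fun X => by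
    simp only [LinearMap.comp_apply, AlgHom.toLinearMap_apply, map_word, BraceRep.deconcat_word_sp]
    rw [map_sp, mapWord, sp_map]
    refine sp_congr fun u v _ => ?_
    rw [TensorProduct.map_tmul, AlgHom.toLinearMap_apply, AlgHom.toLinearMap_apply, map_word,
      map_word]
    rfl
  exact LinearMap.congr_fun this x

theorem exchange_map (x : (TS 𝕜 V' ⊗[𝕜] TS 𝕜 V') ⊗[𝕜] (TS 𝕜 V' ⊗[𝕜] TS 𝕜 V')) :
    TS.exchange 𝕜 V (TensorProduct.map
        (TensorProduct.map (TS.map 𝕜 i).toLinearMap (TS.map 𝕜 i).toLinearMap)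
        (TensorProduct.map (TS.map 𝕜 i).toLinearMap (TS.map 𝕜 i).toLinearMap) x) =
      TensorProduct.map
        (TensorProduct.map (TS.map 𝕜 i).toLinearMap (TS.map 𝕜 i).toLinearMap)
        (TensorProduct.map (TS.map 𝕜 i).toLinearMap (TS.map 𝕜 i).toLinearMap)
        (TS.exchange 𝕜 V' x) := by
  have : TS.exchange 𝕜 V ∘ₗ (TensorProduct.map
        (TensorProduct.map (TS.map 𝕜 i).toLinearMap (TS.map 𝕜 i).toLinearMap)
        (TensorProduct.map (TS.map 𝕜 i).toLinearMap (TS.map 𝕜 i).toLinearMap)) =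
      TensorProduct.map
        (TensorProduct.map (TS.map 𝕜 i).toLinearMap (TS.map 𝕜 i).toLinearMap)
        (TensorProduct.map (TS.map 𝕜 i).toLinearMap (TS.map 𝕜 i).toLinearMap) ∘ₗ
        TS.exchange 𝕜 V' := by
    refine TensorProduct.ext_fourfold' fun x y z w => ?_
    simp only [TS.exchange, LinearMap.comp_apply, LinearMap.add_apply, TensorProduct.map_tmul,
      LinearMap.id_apply, LinearMap.smul_apply, LinearMap.sub_apply, AlgHom.toLinearMap_apply,
      LinearEquiv.coe_coe, map_add, TensorProduct.tensorTensorTensorComm_tmul, map_smul, map_sub,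
      map_sgn]
  exact LinearMap.congr_fun this x

theorem exists_map_leftInverse (hi : ∀ n, Function.Injective (i n)) :
    ∃ r : ∀ n, V n →ₗ[𝕜] V' n, ∀ x, TS.map 𝕜 r (TS.map 𝕜 i x) = x := by
  choose r hr using fun n => LinearMap.exists_leftInverse_of_injective (i n)
    (LinearMap.ker_eq_bot.2 (hi n))
  refine ⟨r, fun x => ?_⟩
  have : (TS.map 𝕜 r).toLinearMap ∘ₗ (TS.map 𝕜 i).toLinearMap = LinearMap.id := word_ext fun X => by
    simp only [LinearMap.comp_apply, AlgHom.toLinearMap_apply, map_word, LinearMap.id_apply, mapWord,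
      List.map_map]
    congr 1
    refine (List.map_congr_left fun f _ => ?_).trans (List.map_id _)
    exact Sigma.ext rfl (heq_of_eq (LinearMap.congr_fun (hr f.1) f.2))
  exact LinearMap.congr_fun this x

theorem map_injective (hi : ∀ n, Function.Injective (i n)) : Function.Injective (TS.map 𝕜 i) := by
  obtain ⟨r, hr⟩ := exists_map_leftInverse i hi
  exact Function.LeftInverse.injective hr

theorem map_map_injective (hi : ∀ n, Function.Injective (i n)) : Function.Injective
    (TensorProduct.map (TS.map 𝕜 i).toLinearMap (TS.map 𝕜 i).toLinearMap) := by
  obtain ⟨r, hr⟩ := exists_map_leftInverse i hi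
  have hr' : (TS.map 𝕜 r).toLinearMap ∘ₗ (TS.map 𝕜 i).toLinearMap = LinearMap.id := LinearMap.ext hr
  refine Function.LeftInverse.injective (g := TensorProduct.map (TS.map 𝕜 r).toLinearMap
    (TS.map 𝕜 r).toLinearMap) fun x => ?_
  rw [← LinearMap.comp_apply, ← TensorProduct.map_comp, hr', TensorProduct.map_id,
    LinearMap.id_apply]

variable {i}

/-- A `B_∞`-structure restricts to a graded subspace whose tensor space it preserves. -/
theorem BInf.exists_restrict (b : BInf 𝕜 V) (hi : ∀ n, Function.Injective (i n))
    (hD : ∀ x, b.D (TS.map 𝕜 i x) ∈ (TS.map 𝕜 i).range)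
    (hm : ∀ x y, b.mul (TS.map 𝕜 i x ⊗ₜ TS.map 𝕜 i y) ∈ (TS.map 𝕜 i).range) :
    ∃ b' : BInf 𝕜 V', b'.IsHom b i := by
  have inj := map_injective (𝕜 := 𝕜) i hi
  have inj2 := map_map_injective (𝕜 := 𝕜) i hi
  obtain ⟨r, hr⟩ := exists_map_leftInverse i hi
  let T := (TS.map 𝕜 i).toLinearMap
  let R := (TS.map 𝕜 r).toLinearMap
  let D' : TS 𝕜 V' →ₗ[𝕜] TS 𝕜 V' := R ∘ₗ b.D ∘ₗ T
  let mul' : TS 𝕜 V' ⊗[𝕜] TS 𝕜 V' →ₗ[𝕜] TS 𝕜 V' := R ∘ₗ b.mul ∘ₗ TensorProduct.map T T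
  have hD' : ∀ x, TS.map 𝕜 i (D' x) = b.D (TS.map 𝕜 i x) := fun x => by
    obtain ⟨y, hy⟩ := hD x
    have hy : TS.map 𝕜 i y = b.D (TS.map 𝕜 i x) := hy
    change TS.map 𝕜 i (TS.map 𝕜 r (b.D (TS.map 𝕜 i x))) = _
    rw [← hy, hr]
  have hm' : ∀ x y, TS.map 𝕜 i (mul' (x ⊗ₜ y)) = b.mul (TS.map 𝕜 i x ⊗ₜ TS.map 𝕜 i y) := fun x y => by
    obtain ⟨z, hz⟩ := hm x y
    have hz : TS.map 𝕜 i z = b.mul (TS.map 𝕜 i x ⊗ₜ TS.map 𝕜 i y) := hz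
    change TS.map 𝕜 i (TS.map 𝕜 r (b.mul (TensorProduct.map T T (x ⊗ₜ y)))) = _
    rw [TensorProduct.map_tmul]
    change TS.map 𝕜 i (TS.map 𝕜 r (b.mul (TS.map 𝕜 i x ⊗ₜ TS.map 𝕜 i y))) = _
    rw [← hz, hr]
  have hTD : T ∘ₗ D' = b.D ∘ₗ T := LinearMap.ext hD'
  have hTm : T ∘ₗ mul' = b.mul ∘ₗ TensorProduct.map T T := TensorProduct.ext' hm'
  have hTs : T ∘ₗ (TS.sgn 𝕜 V').toLinearMap = (TS.sgn 𝕜 V).toLinearMap ∘ₗ T :=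
    LinearMap.ext (map_sgn i)
  refine ⟨{
      D := D', mul := mul'
      D_deg := ?D_deg, D_D := ?D_D, D_one := ?D_one, counit_D := ?counit_D
      deconcat_D := ?deconcat_D, mul_deg := ?mul_deg, mul_assoc := ?mul_assoc, one_mul := ?one_mul
      mul_one := ?mul_one, counit_mul := ?counit_mul, deconcat_mul := ?deconcat_mul, D_mul := ?D_mul }, hD', hm'⟩
  case D_deg => exact fun n x hx => map_mem_deg r (b.D_deg n _ (map_mem_deg i hx))
  case D_D => exact fun x => inj (by rw [hD', hD', b.D_D, map_zero])
  case D_one => exact inj (by rw [hD', map_one, b.D_one, map_zero])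
  case counit_D => exact fun x => by rw [← counit_map i, hD', b.counit_D]
  case deconcat_D =>
    refine fun x => inj2 ?_
    rw [← deconcat_map, hD', b.deconcat_D, deconcat_map, map_add]
    simp only [TensorProduct.map_map]
    change TensorProduct.map (b.D ∘ₗ T) (LinearMap.id ∘ₗ T) _ +
      TensorProduct.map ((TS.sgn 𝕜 V).toLinearMap ∘ₗ T) (b.D ∘ₗ T) _ =
      TensorProduct.map (T ∘ₗ D') (T ∘ₗ LinearMap.id) _ +
      TensorProduct.map (T ∘ₗ (TS.sgn 𝕜 V').toLinearMap) (T ∘ₗ D') _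
    rw [hTD, hTs]
    rfl
  case mul_deg =>
    refine fun m n x hx y hy => map_mem_deg r ?_
    rw [LinearMap.comp_apply, TensorProduct.map_tmul]
    exact b.mul_deg _ _ _ (map_mem_deg i hx) _ (map_mem_deg i hy)
  case mul_assoc => exact fun x y z => inj (by rw [hm', hm', hm', hm', b.mul_assoc])
  case one_mul => exact fun x => inj (by rw [hm', map_one, b.one_mul])
  case mul_one => exact fun x => inj (by rw [hm', map_one, b.mul_one])
  case counit_mul =>
    exact fun x y => by rw [← counit_map i, hm', b.counit_mul, counit_map, counit_map]
  case deconcat_mul =>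
    refine fun x y => inj2 ?_
    rw [← deconcat_map, hm', b.deconcat_mul, deconcat_map, deconcat_map, ← TensorProduct.map_tmul,
      exchange_map]
    simp only [TensorProduct.map_map]
    change TensorProduct.map (b.mul ∘ₗ TensorProduct.map T T) (b.mul ∘ₗ TensorProduct.map T T) _ =
      TensorProduct.map (T ∘ₗ mul') (T ∘ₗ mul') _
    rw [hTm]
  case D_mul =>
    exact fun x y => inj (by rw [hD', hm', map_add, hm', hm', hD', hD', b.D_mul, map_sgn])

theorem BInf.IsHom.d_map {b' : BInf 𝕜 V'} {b : BInf 𝕜 V} (h : b'.IsHom b i) (x : TS 𝕜 V') :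
    b.d (TS.map 𝕜 i x) = DirectSum.lmap i (b'.d x) := by
  rw [BInf.d, BInf.d, ← ιInv_map, h.1]

theorem BInf.IsHom.m_map {b' : BInf 𝕜 V'} {b : BInf 𝕜 V} (h : b'.IsHom b i) (x y : TS 𝕜 V') :
    b.m (TS.map 𝕜 i x) (TS.map 𝕜 i y) = DirectSum.lmap i (b'.m x y) := by
  rw [BInf.m, BInf.m, ← ιInv_map, h.2]

theorem BInf.IsHom.of_comp {V'' : ℤ → Type u} [∀ n, AddCommGroup (V'' n)] [∀ n, Module 𝕜 (V'' n)]
    {k : ∀ n, V'' n →ₗ[𝕜] V n} {j : ∀ n, V'' n →ₗ[𝕜] V' n} {b'' : BInf 𝕜 V''} {b' : BInf 𝕜 V'}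
    {b : BInf 𝕜 V} (hi : ∀ n, Function.Injective (i n)) (h : b'.IsHom b i) (hk : b''.IsHom b k)
    (e : ∀ n, k n = i n ∘ₗ j n) : b''.IsHom b' j := by
  have hc : ∀ x, TS.map 𝕜 i (TS.map 𝕜 j x) = TS.map 𝕜 k x := fun x => by
    have : (TS.map 𝕜 i).toLinearMap ∘ₗ (TS.map 𝕜 j).toLinearMap = (TS.map 𝕜 k).toLinearMap :=
      word_ext fun X => by
        simp only [LinearMap.comp_apply, AlgHom.toLinearMap_apply, map_word, mapWord, List.map_map, e]
        rfl
    exact LinearMap.congr_fun this x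
  have inj := map_injective (𝕜 := 𝕜) i hi
  exact ⟨fun x => inj (by rw [hc, hk.1, h.1, hc]), fun x y => inj (by rw [hc, hk.2, h.2, hc, hc])⟩

end Functoriality

namespace BraceRep

variable {𝕜 : Type} [RCLike 𝕜] {U : Type*} [AddCommGroup U] [Module 𝕜 U] {E V : ℤ → Type u}
  [∀ n, AddCommGroup (E n)] [∀ n, Module 𝕜 (E n)] [∀ n, AddCommGroup (V n)] [∀ n, Module 𝕜 (V n)]
  (P : BraceRep 𝕜 U E) (i : ∀ n, V n →ₗ[𝕜] E n)

theorem word_mapWord_mem (X : List (Σ n, V n)) : TS.word 𝕜 (mapWord i X) ∈ (TS.map 𝕜 i).range :=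
  ⟨TS.word 𝕜 X, map_word i X⟩

theorem ι_mem {x : ⨁ n, E n} (hx : x ∈ LinearMap.range (DirectSum.lmap i)) :
    TensorAlgebra.ι 𝕜 x ∈ (TS.map 𝕜 i).range := by
  obtain ⟨y, rfl⟩ := hx
  exact ⟨_, map_ι i y⟩

theorem mapWord_eq_append {X : List (Σ n, V n)} {u v : List (Σ n, E n)} (h : mapWord i X = u ++ v) :
    ∃ u' v', u = mapWord i u' ∧ v = mapWord i v' ∧ X = u' ++ v' := by
  obtain ⟨u', v', h1, h2, h3⟩ := List.map_eq_append_iff.1 h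
  exact ⟨u', v', h2.symm, h3.symm, h1⟩

variable {i}

theorem exists_restrict {b : E 1} (hb : P.m 1 b (TS.of 𝕜 b) = 0) (hi : ∀ n, Function.Injective (i n))
    (hm : ∀ n (f : V n) (Z : List (Σ n, V n)),
      P.m n (i n f) (TS.word 𝕜 (mapWord i Z)) ∈ LinearMap.range (DirectSum.lmap i))
    (hd : ∀ n (f : V n), P.m 1 b (TS.of 𝕜 (i n f)) - ((-1 : 𝕜) ^ n) • P.m n (i n f) (TS.of 𝕜 b) ∈
      LinearMap.range (DirectSum.lmap i))
    (hd' : ∀ Z : List (Σ n, V n), 1 < Z.length →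
      P.m 1 b (TS.word 𝕜 (mapWord i Z)) ∈ LinearMap.range (DirectSum.lmap i)) :
    ∃ b' : BInf 𝕜 V, b'.IsHom (P.toBInf b hb) i := by
  have hX : ∀ X, P.ad b (TS.word 𝕜 (mapWord i X)) ∈ (TS.map 𝕜 i).range := by
    intro X
    induction X with
    | nil =>
      rw [mapWord, List.map_nil, word_nil, show P.ad b 1 = 0 from (P.toBInf b hb).D_one]
      exact zero_mem _
    | cons f X ih =>
      have e := P.ad_cons b ⟨f.1, i f.1 f.2⟩ (mapWord i X)
      change P.ad b (TS.word 𝕜 (mapWord i (f :: X))) = _ at e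
      rw [e, add_sub_assoc]
      refine add_mem (add_mem (Subalgebra.smul_mem _ (Subalgebra.mul_mem (TS.map 𝕜 i).range ⟨_, map_of i f.2⟩ ih) _)
        (Subalgebra.mul_mem _ (ι_mem i (hd _ _)) (word_mapWord_mem i X))) ?_
      cases X with
      | nil =>
        rw [mapWord, List.map_nil, sp_nil, word_singleton, sub_self]
        exact zero_mem _
      | cons g X =>
        rw [show mapWord i (g :: X) = (⟨g.1, i g.1 g.2⟩ : Σ n, E n) :: mapWord i X from rfl, sp_cons,
          word_singleton, add_sub_cancel_left]
        refine sp_mem (Subalgebra.toSubmodule (TS.map 𝕜 i).range) _ _ fun u v h => ?_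
        obtain ⟨u, v, rfl, rfl, -⟩ := mapWord_eq_append i h
        exact Subalgebra.mul_mem (TS.map 𝕜 i).range (ι_mem i (hd' (f :: g :: u) (by simp))) (word_mapWord_mem i v)
  have hXY : ∀ X Y, P.W.rho (mapWord i X) (TS.word 𝕜 (mapWord i Y)) ∈ (TS.map 𝕜 i).range := by
    intro X
    induction X with
    | nil => exact fun Y => word_mapWord_mem i Y
    | cons f X ih =>
      intro Y
      have e := P.W_rho_cons_word ⟨f.1, i f.1 f.2⟩ (mapWord i X) (mapWord i Y)
      change P.W.rho (mapWord i (f :: X)) _ = _ at e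
      rw [e]
      refine sp_mem (Subalgebra.toSubmodule (TS.map 𝕜 i).range) _ _ fun u v h => ?_
      obtain ⟨u, v, rfl, rfl, -⟩ := mapWord_eq_append i h
      refine sp_mem (Subalgebra.toSubmodule (TS.map 𝕜 i).range) _ _ fun Y₀ Z h => ?_
      obtain ⟨Y₀, Z, rfl, rfl, -⟩ := mapWord_eq_append i h
      exact Subalgebra.smul_mem _ (Subalgebra.mul_mem _ (word_mapWord_mem i _)
        (Subalgebra.mul_mem _ (ι_mem i (hm _ _ _)) (ih v))) _
  refine (P.toBInf b hb).exists_restrict hi (fun x => ?_) fun x y => ?_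
  · have hx : x ∈ Submodule.span 𝕜 (Set.range (TS.word 𝕜 : List (Σ n, V n) → TS 𝕜 V)) := by
      rw [span_word]; trivial
    induction hx using Submodule.span_induction with
    | mem x h => obtain ⟨X, rfl⟩ := h; rw [map_word]; exact hX X
    | zero => rw [map_zero, map_zero]; exact zero_mem _
    | add x y _ _ h1 h2 => rw [map_add, map_add]; exact add_mem h1 h2
    | smul c x _ h => rw [map_smul, map_smul]; exact Subalgebra.smul_mem _ h _
  · have hx : x ∈ Submodule.span 𝕜 (Set.range (TS.word 𝕜 : List (Σ n, V n) → TS 𝕜 V)) := by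
      rw [span_word]; trivial
    have hy : y ∈ Submodule.span 𝕜 (Set.range (TS.word 𝕜 : List (Σ n, V n) → TS 𝕜 V)) := by
      rw [span_word]; trivial
    change P.mul _ _ ∈ _
    induction hx using Submodule.span_induction with
    | mem x h =>
      obtain ⟨X, rfl⟩ := h
      induction hy using Submodule.span_induction with
      | mem y h => obtain ⟨Y, rfl⟩ := h; rw [map_word, map_word, mul_word]; exact hXY X Y
      | zero => rw [map_zero, map_zero]; exact zero_mem _
      | add x y _ _ h1 h2 => rw [map_add, map_add]; exact add_mem h1 h2
      | smul c x _ h => rw [map_smul, map_smul]; exact Subalgebra.smul_mem _ h _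
    | zero => rw [map_zero, map_zero]; exact zero_mem _
    | add x y _ _ h1 h2 => rw [map_add, map_add]; exact add_mem h1 h2
    | smul c x _ h => rw [map_smul, map_smul]; exact Subalgebra.smul_mem _ h _

end BraceRep

section Lie

variable {𝕜 : Type} [RCLike 𝕜] {V : ℤ → Type u} [∀ n, AddCommGroup (V n)] [∀ n, Module 𝕜 (V n)]

/-- The dg-Lie algebra of primitive elements of a `B_∞`-algebra whose primitive elements form a
dg-Lie subalgebra. -/
theorem BInf.exists_dgLie (b : BInf 𝕜 V) (δ : ∀ n, V n →ₗ[𝕜] V (n + 1))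
    (hδ : ∀ n f, b.D (TS.of 𝕜 f) = TS.of 𝕜 (δ n f))
    (hp : ∀ m n (f : V m) (g : V n), b.mul (TS.of 𝕜 f ⊗ₜ TS.of 𝕜 g) -
      ((-1 : 𝕜) ^ (m * n)) • b.mul (TS.of 𝕜 g ⊗ₜ TS.of 𝕜 f) ∈
        LinearMap.range (TensorAlgebra.ι 𝕜 : (⨁ n, V n) →ₗ[𝕜] TS 𝕜 V)) :
    ∃ g : DGLie 𝕜 V, (∀ n, g.d n = δ n) ∧ ∀ (m n : ℤ) (x : V m) (y : V n),
      DirectSum.lof 𝕜 ℤ V (m + n) (g.brk m n x y) = b.m (TS.of 𝕜 x) (TS.of 𝕜 y) -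
        ((-1 : 𝕜) ^ (m * n)) • b.m (TS.of 𝕜 y) (TS.of 𝕜 x) := by
  let ofL : ∀ n, V n →ₗ[𝕜] TS 𝕜 V := fun n => TensorAlgebra.ι 𝕜 ∘ₗ DirectSum.lof 𝕜 ℤ V n
  let B : TS 𝕜 V →ₗ[𝕜] TS 𝕜 V →ₗ[𝕜] TS 𝕜 V := TensorProduct.curry b.mul
  let brk : ∀ m n, V m →ₗ[𝕜] V n →ₗ[𝕜] V (m + n) := fun m n =>
    (B.compl₁₂ (ofL m) (ofL n) - ((-1 : 𝕜) ^ (m * n)) • (B.compl₁₂ (ofL n) (ofL m)).flip).compr₂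
      (DirectSum.component 𝕜 ℤ V (m + n) ∘ₗ TensorAlgebra.ιInv)
  have hB : ∀ x y z, B (B x y) z = B x (B y z) := b.mul_assoc
  have hlof : ∀ m n (x : V m) (y : V n), DirectSum.lof 𝕜 ℤ V (m + n) (brk m n x y) =
      TensorAlgebra.ιInv (B (TS.of 𝕜 x) (TS.of 𝕜 y) -
        ((-1 : 𝕜) ^ (m * n)) • B (TS.of 𝕜 y) (TS.of 𝕜 x)) := fun m n x y => by
    have h1 := b.mul_deg m n _ (of_mem_deg (𝕜 := 𝕜) x) _ (of_mem_deg (𝕜 := 𝕜) y)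
    have h2 := b.mul_deg n m _ (of_mem_deg (𝕜 := 𝕜) y) _ (of_mem_deg (𝕜 := 𝕜) x)
    rw [add_comm n m] at h2
    obtain ⟨g, hg⟩ := ιInv_mem (sub_mem h1 (Submodule.smul_mem _ ((-1 : 𝕜) ^ (m * n)) h2))
    change DirectSum.lof 𝕜 ℤ V (m + n) (DirectSum.component 𝕜 ℤ V (m + n)
      (TensorAlgebra.ιInv (b.mul (TS.of 𝕜 x ⊗ₜ TS.of 𝕜 y) -
        ((-1 : 𝕜) ^ (m * n)) • b.mul (TS.of 𝕜 y ⊗ₜ TS.of 𝕜 x)))) =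
      TensorAlgebra.ιInv (b.mul (TS.of 𝕜 x ⊗ₜ TS.of 𝕜 y) -
        ((-1 : 𝕜) ^ (m * n)) • b.mul (TS.of 𝕜 y ⊗ₜ TS.of 𝕜 x))
    rw [hg, DirectSum.component.lof_self]
  have hbrk : ∀ m n (x : V m) (y : V n), TS.of 𝕜 (brk m n x y) =
      B (TS.of 𝕜 x) (TS.of 𝕜 y) - ((-1 : 𝕜) ^ (m * n)) • B (TS.of 𝕜 y) (TS.of 𝕜 x) := fun m n x y => by
    rw [TS.of, hlof]
    obtain ⟨z, hz⟩ := hp m n x y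
    change _ = B (TS.of 𝕜 x) (TS.of 𝕜 y) - ((-1 : 𝕜) ^ (m * n)) • B (TS.of 𝕜 y) (TS.of 𝕜 x) at hz
    rw [← hz, ιInv_ι]
  have hDB : ∀ m (x : V m) y, b.D (B (TS.of 𝕜 x) y) =
      B (TS.of 𝕜 (δ m x)) y + ((-1 : 𝕜) ^ m) • B (TS.of 𝕜 x) (b.D y) := fun m x y => by
    refine (b.D_mul (TS.of 𝕜 x) y).trans ?_
    rw [BraceRep.sgn_of, hδ, ← TensorProduct.smul_tmul', map_smul]
    rfl
  have hsm : ∀ (c : 𝕜) n (x : V n), TS.of 𝕜 (c • x) = c • TS.of 𝕜 x := fun c n x => by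
    simp [TS.of]
  have hι : ∀ x y : ⨁ n, V n, TensorAlgebra.ι 𝕜 x = TensorAlgebra.ι 𝕜 y → x = y := fun x y h =>
    TensorAlgebra.ι_leftInverse.injective h
  have hof : ∀ n (x : V n), TensorAlgebra.ι 𝕜 (DirectSum.lof 𝕜 ℤ V n x) = TS.of 𝕜 x :=
    fun n x => rfl
  refine ⟨{ d := δ, brk := brk, d_d := ?d_d, antisymm := ?antisymm, jacobi := ?jacobi, leibniz := ?leibniz }, fun n => rfl, fun m n x y => ?_⟩
  case d_d =>
    intro n x
    refine DirectSum.of_injective (β := V) (n + 1 + 1) (hι _ _ ?_)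
    change TS.of 𝕜 (δ (n + 1) (δ n x)) = TensorAlgebra.ι 𝕜 (DirectSum.lof 𝕜 ℤ V (n + 1 + 1) 0)
    rw [← hδ, ← hδ, b.D_D, map_zero, map_zero]
  case antisymm =>
    intro m n x y
    refine hι _ _ ?_
    rw [map_smul, hof, hof, hbrk, hbrk, mul_comm n m]
    rcases neg_one_zpow_eq_or (𝕜 := 𝕜) (m * n) with h | h <;> rw [h] <;> module
  case jacobi =>
    intro l m n x y z
    refine hι _ _ ?_
    rw [map_add, map_smul, hof, hof, hof, hbrk, hbrk, hbrk, hbrk, hbrk, hbrk]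
    simp only [map_sub, map_smul, LinearMap.sub_apply, LinearMap.smul_apply, hB, mul_add, add_mul]
    rw [zpow_add₀ (by simp), zpow_add₀ (by simp), zpow_add₀ (by simp), mul_comm m l]
    rcases neg_one_zpow_eq_or (𝕜 := 𝕜) (l * m) with h | h <;> rw [h] <;> module
  case leibniz =>
    intro m n x y
    refine hι _ _ ?_
    rw [map_add, map_smul, hof, hof, hof, hbrk, hbrk, ← hδ, hbrk, map_sub, map_smul, hDB, hDB, hδ, hδ,
      mul_add, add_mul, zpow_add₀ (by simp), zpow_add₀ (by simp), _root_.mul_one, _root_.one_mul]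
    rcases neg_one_zpow_eq_or (𝕜 := 𝕜) m with h | h <;> rcases neg_one_zpow_eq_or (𝕜 := 𝕜) n with h' | h' <;>
      rw [h, h'] <;> module
  · change DirectSum.lof 𝕜 ℤ V (m + n) (brk m n x y) = _
    rw [hlof, map_sub, map_smul]
    rfl

end Lie

section ListBounds

variable {𝕜 : Type} [RCLike 𝕜] {V : Type*} [AddCommGroup V] [Module 𝕜 V]

theorem list_prod_nonneg (p : Seminorm 𝕜 V) (l : List V) : 0 ≤ (l.map p).prod :=
  List.prod_nonneg fun x hx => by
    obtain ⟨y, -, rfl⟩ := List.mem_map.1 hx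
    exact apply_nonneg p y

theorem list_prod_mono {p q : Seminorm 𝕜 V} (h : ∀ x, p x ≤ q x) (l : List V) :
    (l.map p).prod ≤ (l.map q).prod := by
  induction l with
  | nil => simp
  | cons a l ih =>
    simp only [List.map_cons, List.prod_cons]
    exact mul_le_mul (h a) ih (list_prod_nonneg p l) (apply_nonneg q a)

theorem seminorm_sp_le {α : Type*} (r : Seminorm 𝕜 V) (l : List α) (F : List α → List α → V) {c : ℝ}
    (h : ∀ u v, l = u ++ v → r (F u v) ≤ c) : r (sp l F) ≤ (l.length + 1) * c := by
  induction l generalizing F with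
  | nil => simpa using h [] [] rfl
  | cons a l ih =>
    rw [sp_cons]
    refine (map_add_le_add r _ _).trans ?_
    have h1 := h [] (a :: l) rfl
    have h2 := ih (fun u v => F (a :: u) v) fun u v e => h _ _ (by rw [e]; rfl)
    push_cast [List.length_cons]
    linarith

theorem seminorm_sp_eq_zero {α : Type*} (r : Seminorm 𝕜 V) (l : List α) (F : List α → List α → V)
    (h : ∀ u v, l = u ++ v → r (F u v) = 0) : r (sp l F) = 0 := by
  have := seminorm_sp_le r l F (c := 0) fun u v e => (h u v e).le
  exact le_antisymm (by simpa using this) (apply_nonneg r _)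

theorem sp_eq_zero {α M : Type*} [AddCommMonoid M] (l : List α) (F : List α → List α → M)
    (h : ∀ u v, l = u ++ v → F u v = 0) : sp l F = 0 := by
  rw [sp_congr (G := fun _ _ => 0) h, sp_zero]

end ListBounds

namespace OpRep

variable {𝕜 : Type} [RCLike 𝕜] {U : Type*} [AddCommGroup U] [Module 𝕜 U] {E : ℤ → Type*}
  [∀ n, AddCommGroup (E n)] [∀ n, Module 𝕜 (E n)] (P : OpRep 𝕜 U E)

/-- The recursion for the operations `φ (l, -) ∘ ρ(Z)`. -/
theorem apply_rho_cons {M : Type*} [AddCommGroup M] [Module 𝕜 M] (φ : TensorAlgebra 𝕜 U →ₗ[𝕜] M)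
    (g : Σ n, E n) (X : List (Σ n, E n)) (l k : List U) :
    φ (wd 𝕜 l * P.rho (g :: X) (wd 𝕜 k)) = sp k fun k₁ k₂ => sp k₁ fun u v =>
      φ (wd 𝕜 (l ++ u.map (tau P.s (g.1 + dg X)) ++
        [P.hat g.1 g.2 (wd 𝕜 (v.map (tau P.s (dg X))))]) * P.rho X (wd 𝕜 k₂)) := by
  rw [rho_cons, cv_wd]
  refine (map_sp (φ ∘ₗ LinearMap.mulLeft 𝕜 (wd 𝕜 l)) k _).trans (sp_congr fun k₁ k₂ _ => ?_)
  rw [pre_apply, cv_wd, LinearMap.comp_apply, LinearMap.mulLeft_apply, sp_mul_right]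
  have := map_sp (φ ∘ₗ LinearMap.mulLeft 𝕜 (wd 𝕜 l)) k₁ fun u v =>
    P.sg (g.1 + dg X) (wd 𝕜 u) * (P.op g.1 g.2 ∘ₗ P.sg (dg X)) (wd 𝕜 v) * P.rho X (wd 𝕜 k₂)
  refine this.trans (sp_congr fun u v _ => ?_)
  rw [LinearMap.comp_apply, LinearMap.comp_apply, op_apply, sg_wd, sg_wd, wd_append, wd_append,
    wd_singleton]
  simp only [LinearMap.mulLeft_apply, mul_assoc]

end OpRep

section Operations

variable {𝕜 : Type} [RCLike 𝕜] (A : DGAlg.{u} 𝕜)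

/-- The parity operator of the suspension of `A`. -/
def sigma : A.carrier →ₗ[𝕜] A.carrier := -A.sgn.toLinearMap

theorem sigma_sigma (a : A) : sigma A (sigma A a) = a := by
  simp [sigma]

theorem tau_sigma (n : ℤ) (a : A) : tau (sigma A) n a = twist A n a := by
  rw [tau, twist]
  split_ifs <;> rfl

variable {A} in
/-- A collection of multilinear operations, each of them continuous. The seminorms in the bounds
are taken invariant under the parity operator. -/
def IsBdd (φ : TensorAlgebra 𝕜 A.carrier →ₗ[𝕜] A.carrier) : Prop :=
  ∀ (n : ℕ) (r : Seminorm 𝕜 A.carrier), Continuous r → ∃ (p : Seminorm 𝕜 A.carrier) (C : ℝ),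
    Continuous p ∧ 0 ≤ C ∧ (∀ a, p (A.sgn a) = p a) ∧
      ∀ l : List A.carrier, l.length = n → r (φ (wd 𝕜 l)) ≤ C * (l.map p).prod

variable {A} in
/-- A collection of multilinear operations that is homogeneous of degree `N` for the degrees
`|a| - 1` on `A`. -/
def IsHomog (N : ℤ) (φ : TensorAlgebra 𝕜 A.carrier →ₗ[𝕜] A.carrier) : Prop :=
  ∀ l : List (ℤ × A.carrier), (∀ x ∈ l, A.Deg (x.1 + 1) x.2) →
    A.Deg ((l.map Prod.fst).sum + N + 1) (φ (wd 𝕜 (l.map Prod.snd)))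

theorem exists_invariant {p : Seminorm 𝕜 A.carrier} (hp : Continuous p) :
    ∃ q : Seminorm 𝕜 A.carrier, Continuous q ∧ (∀ a, q (A.sgn a) = q a) ∧ ∀ a, p a ≤ q a := by
  refine ⟨p + p.comp A.sgn.toLinearMap, hp.add (hp.comp A.sgn.continuous), fun a => ?_, fun a => ?_⟩
  · change p (A.sgn a) + p (A.sgn (A.sgn a)) = p a + p (A.sgn a)
    rw [GrSp.sgn_sgn, add_comm]
  · exact le_add_of_nonneg_right (apply_nonneg p (A.sgn a))

theorem exists_common {ι : Type*} (s : Finset ι) (p : ι → Seminorm 𝕜 A.carrier)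
    (hp : ∀ i, Continuous (p i)) (hinv : ∀ i a, p i (A.sgn a) = p i a) :
    ∃ q : Seminorm 𝕜 A.carrier, Continuous q ∧ (∀ a, q (A.sgn a) = q a) ∧ ∀ i ∈ s, ∀ a, p i a ≤ q a := by
  refine ⟨∑ i ∈ s, p i, ?_, fun a => ?_, fun i hi a => ?_⟩
  · have : (⇑(∑ i ∈ s, p i) : A.carrier → ℝ) = fun x => ∑ i ∈ s, p i x := funext fun x => by
      simp
    rw [this]
    exact continuous_finsetSum _ fun i _ => hp i
  · rw [seminorm_sum_apply, seminorm_sum_apply]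
    exact Finset.sum_congr rfl fun i _ => hinv i a
  · rw [seminorm_sum_apply]
    exact Finset.single_le_sum (f := fun i => p i a) (fun j _ => apply_nonneg _ _) hi

/-- The multilinear operations on `A` of degree `N`. -/
def opsDeg (N : ℤ) : Submodule 𝕜 (TensorAlgebra 𝕜 A.carrier →ₗ[𝕜] A.carrier) where
  carrier := {φ | IsBdd φ ∧ IsHomog N φ ∧
    ∀ x, φ (sgp (sigma A) 1 x) = ((-1 : 𝕜) ^ N) • sigma A (φ x)}
  zero_mem' := ⟨fun _ r _ => ⟨0, 0, continuous_zero, le_rfl, fun _ => rfl, fun l _ => by simp⟩,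
    fun l _ => GrSp.Deg.zero _, fun x => by simp⟩
  add_mem' {φ ψ} hφ hψ := by
    refine ⟨fun n r hr => ?_, fun l hl => (hφ.2.1 l hl).add (hψ.2.1 l hl), fun x => ?_⟩
    · obtain ⟨p, C, hp, hC, hpi, hb⟩ := hφ.1 n r hr
      obtain ⟨q, D, hq, hD, hqi, hb'⟩ := hψ.1 n r hr
      refine ⟨p + q, C + D, hp.add hq, add_nonneg hC hD, fun a => ?_, fun l hl => ?_⟩
      · change p _ + q _ = p _ + q _
        rw [hpi, hqi]
      · refine (map_add_le_add r _ _).trans ?_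
        have h1 := list_prod_mono (q := p + q) (fun x => le_add_of_nonneg_right (apply_nonneg q x) : ∀ x, p x ≤ (p + q) x) l
        have h2 := list_prod_mono (q := p + q) (fun x => le_add_of_nonneg_left (apply_nonneg p x) : ∀ x, q x ≤ (p + q) x) l
        rw [add_mul]
        exact add_le_add ((hb l hl).trans (mul_le_mul_of_nonneg_left h1 hC))
          ((hb' l hl).trans (mul_le_mul_of_nonneg_left h2 hD))
    · rw [LinearMap.add_apply, LinearMap.add_apply, hφ.2.2, hψ.2.2, map_add, smul_add]
  smul_mem' c φ hφ := by
    refine ⟨fun n r hr => ?_, fun l hl => (hφ.2.1 l hl).smul c, fun x => ?_⟩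
    · obtain ⟨p, C, hp, hC, hpi, hb⟩ := hφ.1 n r hr
      refine ⟨p, ‖c‖ * C, hp, mul_nonneg (norm_nonneg _) hC, hpi, fun l hl => ?_⟩
      rw [LinearMap.smul_apply, map_smul_eq_mul, mul_assoc]
      exact mul_le_mul_of_nonneg_left (hb l hl) (norm_nonneg _)
    · rw [LinearMap.smul_apply, LinearMap.smul_apply, hφ.2.2, map_smul, smul_comm]

/-- The graded space of multilinear operations on `A`. -/
abbrev Ops (N : ℤ) : Type u := opsDeg A N

/-- The multilinear operations act on `A`. -/
def opsRep : OpRep 𝕜 A.carrier (Ops A) where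
  s := sigma A
  s_s := sigma_sigma A
  hat n := (opsDeg A n).subtype
  hat_s _ e x := e.2.2.2 x

theorem tau_bound {p : Seminorm 𝕜 A.carrier} (hp : ∀ a, p (A.sgn a) = p a) (n : ℤ) (l : List A.carrier) :
    ((l.map (tau (opsRep A).s n)).map p).prod = (l.map p).prod := by
  rw [List.map_map]
  congr 1
  refine List.map_congr_left fun a _ => ?_
  change p (tau (sigma A) n a) = p a
  rw [tau_sigma, twist]
  split_ifs
  · rfl
  · rw [map_neg_eq_map, hp]

theorem bdd_rho (Z : List (Σ n, Ops A n)) {φ : TensorAlgebra 𝕜 A.carrier →ₗ[𝕜] A.carrier} (hφ : IsBdd φ)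
    (m n : ℕ) (r : Seminorm 𝕜 A.carrier) (hr : Continuous r) :
    ∃ (p : Seminorm 𝕜 A.carrier) (C : ℝ), Continuous p ∧ 0 ≤ C ∧ (∀ a, p (A.sgn a) = p a) ∧
      ∀ l k : List A.carrier, l.length = m → k.length = n →
        r (φ (wd 𝕜 l * (opsRep A).rho Z (wd 𝕜 k))) ≤ C * ((l.map p).prod * (k.map p).prod) := by
  induction Z generalizing m n with
  | nil =>
    obtain ⟨p, C, hp, hC, hpi, hb⟩ := hφ (m + n) r hr
    refine ⟨p, C, hp, hC, hpi, fun l k hl hk => ?_⟩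
    have := hb (l ++ k) (by rw [List.length_append, hl, hk])
    rwa [wd_append, List.map_append, List.prod_append] at this
  | cons g X ih =>
    choose p C hp hC hpi hb using fun x : ℕ × ℕ => ih (m + x.1 + 1) (n - x.1 - x.2)
    choose q D hq hD hqi hb' using fun x : ℕ × ℕ => g.2.2.1 x.2 (p x) (hp x)
    let s := Finset.range (n + 1) ×ˢ Finset.range (n + 1)
    obtain ⟨P, hP, hPi, hPle⟩ := exists_common A s (fun x => p x + q x) (fun x => (hp x).add (hq x))
      (fun x a => by
        change p x _ + q x _ = p x _ + q x _
        rw [hpi, hqi])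
    have hp' : ∀ x ∈ s, ∀ a, p x a ≤ P a := fun x hx a =>
      (le_add_of_nonneg_right (apply_nonneg (q x) a)).trans (hPle x hx a)
    have hq' : ∀ x ∈ s, ∀ a, q x a ≤ P a := fun x hx a =>
      (le_add_of_nonneg_left (apply_nonneg (p x) a)).trans (hPle x hx a)
    let K := ∑ x ∈ s, C x * D x
    have hK : 0 ≤ K := Finset.sum_nonneg fun x _ => mul_nonneg (hC x) (hD x)
    refine ⟨P, (n + 1) * ((n + 1) * K), hP, by positivity, hPi, fun l k hl hk => ?_⟩
    have hnn : 0 ≤ (l.map P).prod * (k.map P).prod :=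
      mul_nonneg (list_prod_nonneg P l) (list_prod_nonneg P k)
    rw [OpRep.apply_rho_cons]
    have key : ∀ u v w, k = u ++ v ++ w → r (φ (wd 𝕜 (l ++ u.map (tau (opsRep A).s (g.1 + dg X)) ++
        [(opsRep A).hat g.1 g.2 (wd 𝕜 (v.map (tau (opsRep A).s (dg X))))]) *
          (opsRep A).rho X (wd 𝕜 w))) ≤ K * ((l.map P).prod * (k.map P).prod) := by
      intro u v w e
      have hlen : u.length + v.length + w.length = n := by
        rw [← hk, e, List.length_append, List.length_append]
      have hx : (u.length, v.length) ∈ s := by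
        simp only [s, Finset.mem_product, Finset.mem_range]
        omega
      set x : ℕ × ℕ := (u.length, v.length) with hxd
      have h1 := hb x (l ++ u.map (tau (opsRep A).s (g.1 + dg X)) ++
        [(opsRep A).hat g.1 g.2 (wd 𝕜 (v.map (tau (opsRep A).s (dg X))))]) w
        (by simp [hl, hxd, add_assoc]) (by simp only [hxd]; omega)
      have h2 := hb' x (v.map (tau (opsRep A).s (dg X))) (by simp [hxd])
      rw [tau_bound A (hqi x)] at h2
      simp only [List.map_append, tau_bound A (hpi x), List.prod_append, List.map_singleton,
        List.prod_singleton] at h1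
      refine h1.trans ?_
      have hCD : C x * D x ≤ K := Finset.single_le_sum (f := fun x => C x * D x)
        (fun y _ => mul_nonneg (hC y) (hD y)) hx
      have n1 := list_prod_nonneg (p x) l
      have n2 := list_prod_nonneg (p x) u
      have n3 := list_prod_nonneg (p x) w
      have n4 := list_prod_nonneg (q x) v
      have m1 := list_prod_mono (hp' x hx) l
      have m2 := list_prod_mono (hp' x hx) u
      have m3 := list_prod_mono (hp' x hx) w
      have m4 := list_prod_mono (hq' x hx) v
      have N1 := list_prod_nonneg P l
      have N2 := list_prod_nonneg P u
      have N3 := list_prod_nonneg P w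
      have N4 := list_prod_nonneg P v
      have hg : p x ((opsRep A).hat g.1 g.2 (wd 𝕜 (v.map (tau (opsRep A).s (dg X))))) ≤
          D x * (v.map P).prod := h2.trans (mul_le_mul_of_nonneg_left m4 (hD x))
      rw [e, List.map_append, List.map_append, List.prod_append, List.prod_append]
      calc C x * ((l.map (p x)).prod * (u.map (p x)).prod *
            p x ((opsRep A).hat g.1 g.2 (wd 𝕜 (v.map (tau (opsRep A).s (dg X))))) * (w.map (p x)).prod)
          ≤ C x * ((l.map P).prod * (u.map P).prod * (D x * (v.map P).prod) * (w.map P).prod) := by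
            refine mul_le_mul_of_nonneg_left ?_ (hC x)
            refine mul_le_mul (mul_le_mul (mul_le_mul m1 m2 n2 N1) hg (apply_nonneg _ _) (by positivity))
              m3 n3 ?_
            have := hD x
            positivity
        _ = (C x * D x) * ((l.map P).prod * ((u.map P).prod * (v.map P).prod * (w.map P).prod)) := by
            ring
        _ ≤ K * ((l.map P).prod * ((u.map P).prod * (v.map P).prod * (w.map P).prod)) :=
            mul_le_mul_of_nonneg_right hCD (by positivity)
    have hKn : 0 ≤ K * ((l.map P).prod * (k.map P).prod) := mul_nonneg hK hnn
    refine (seminorm_sp_le r k _ (c := (n + 1) * (K * ((l.map P).prod * (k.map P).prod)))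
      fun k₁ w e => ?_).trans_eq (by rw [hk]; ring)
    refine (seminorm_sp_le r k₁ _ (c := K * ((l.map P).prod * (k.map P).prod))
      fun u v e' => key u v w (by rw [e, e'])).trans ?_
    refine mul_le_mul_of_nonneg_right ?_ hKn
    have : k₁.length ≤ n := by rw [← hk, e, List.length_append]; omega
    exact_mod_cast Nat.succ_le_succ this

theorem deg_tau {n : ℤ} {a : A} (ha : A.Deg n a) (k : ℤ) : A.Deg n (tau (opsRep A).s k a) := by
  change A.Deg n (tau (sigma A) k a)
  rw [tau_sigma, twist]
  split_ifs
  · exact ha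
  · have := (GrSp.sgn_deg n a ha).neg
    rwa [add_zero] at this

theorem homog_rho (Z : List (Σ n, Ops A n)) {N : ℤ} {φ : TensorAlgebra 𝕜 A.carrier →ₗ[𝕜] A.carrier}
    (hφ : IsHomog N φ) (l k : List (ℤ × A.carrier)) (hl : ∀ x ∈ l, A.Deg (x.1 + 1) x.2)
    (hk : ∀ x ∈ k, A.Deg (x.1 + 1) x.2) : A.Deg ((l.map Prod.fst).sum + (k.map Prod.fst).sum +
      (N + dg Z) + 1) (φ (wd 𝕜 (l.map Prod.snd) * (opsRep A).rho Z (wd 𝕜 (k.map Prod.snd)))) := by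
  induction Z generalizing l k with
  | nil =>
    have := hφ (l ++ k) fun x hx => (List.mem_append.1 hx).elim (hl x) (hk x)
    rw [List.map_append, List.map_append, List.sum_append, wd_append] at this
    simpa using this
  | cons g X ih =>
    let S (n : ℤ) : Submodule 𝕜 A.carrier :=
      { carrier := {a | A.Deg n a}
        zero_mem' := GrSp.Deg.zero n
        add_mem' := fun h h' => h.add h'
        smul_mem' := fun c _ h => h.smul c }
    rw [OpRep.apply_rho_cons, sp_map]
    refine BraceRep.sp_mem (S _) _ _ fun k₁ w e => ?_
    subst e
    rw [sp_map]
    refine BraceRep.sp_mem (S _) _ _ fun u v e => ?_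
    subst e
    have hT : ∀ (n : ℤ) (y : List (ℤ × A.carrier)),
        (y.map Prod.snd).map (tau (opsRep A).s n) =
          (y.map fun x => (x.1, tau (opsRep A).s n x.2)).map Prod.snd := fun n y => by
      simp [Function.comp_def]
    have hT' : ∀ (n : ℤ) (y : List (ℤ × A.carrier)),
        ((y.map fun x => (x.1, tau (opsRep A).s n x.2)).map Prod.fst) = y.map Prod.fst := fun n y => by
      simp [Function.comp_def]
    have hT'' : ∀ (n : ℤ) (y : List (ℤ × A.carrier)), (∀ x ∈ y, A.Deg (x.1 + 1) x.2) →
        ∀ x ∈ y.map fun x => (x.1, tau (opsRep A).s n x.2), A.Deg (x.1 + 1) x.2 := by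
      intro n y hy x hx
      obtain ⟨z, hz, rfl⟩ := List.mem_map.1 hx
      exact deg_tau A (hy z hz) n
    have hv := g.2.2.2.1 (v.map fun x => (x.1, tau (opsRep A).s (dg X) x.2))
      (hT'' _ _ fun x hx => hk x (by simp [hx]))
    rw [hT'] at hv
    rw [hT, hT]
    have := ih (l ++ (u.map fun x => (x.1, tau (opsRep A).s (g.1 + dg X) x.2)) ++
      [((v.map Prod.fst).sum + g.1, (opsRep A).hat g.1 g.2
        (wd 𝕜 ((v.map fun x => (x.1, tau (opsRep A).s (dg X) x.2)).map Prod.snd)))]) w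
      (fun x hx => by
        rw [List.mem_append, List.mem_append, List.mem_singleton] at hx
        rcases hx with (hx | hx) | rfl
        · exact hl x hx
        · exact hT'' _ _ (fun x hx => hk x (by simp [hx])) x hx
        · exact hv) (fun x hx => hk x (by simp [hx]))
    simp only [List.map_append, List.sum_append, hT', List.map_singleton, List.sum_singleton] at this ⊢
    rw [dg_cons]
    change A.Deg _ _
    convert this using 1
    ring

theorem comp_rho_mem {n : ℤ} (e : Ops A n) (Z : List (Σ n, Ops A n)) :
    e.1 ∘ₗ (opsRep A).rho Z ∈ opsDeg A (n + dg Z) := by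
  refine ⟨fun k r hr => ?_, fun l hl => ?_, fun x => ?_⟩
  · obtain ⟨p, C, hp, hC, hpi, hb⟩ := bdd_rho A Z e.2.1 0 k r hr
    refine ⟨p, C, hp, hC, hpi, fun l hl => ?_⟩
    simpa [wd] using hb [] l rfl hl
  · simpa [wd] using homog_rho A Z e.2.2.1 [] l (by simp) hl
  · have h1 := LinearMap.congr_fun ((opsRep A).rho_sg Z 1) x
    have h2 := e.2.2.2 ((opsRep A).rho Z x)
    simp only [LinearMap.comp_apply, LinearMap.smul_apply, mul_one] at h1 ⊢
    change (opsRep A).rho Z (sgp (sigma A) 1 x) = ((-1 : 𝕜) ^ dg Z) • sgp (sigma A) 1 ((opsRep A).rho Z x) at h1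
    rw [h1, map_smul, h2, smul_smul, zpow_add₀ (by simp), mul_comm]

theorem exists_opsRetraction (n : ℤ) : ∃ r : (TensorAlgebra 𝕜 A.carrier →ₗ[𝕜] A.carrier) →ₗ[𝕜] Ops A n,
    r ∘ₗ (opsDeg A n).subtype = LinearMap.id :=
  LinearMap.exists_leftInverse_of_injective _ (Submodule.ker_subtype _)

/-- A linear retraction onto the space of operations of degree `n`. -/
def opsRetraction (n : ℤ) : (TensorAlgebra 𝕜 A.carrier →ₗ[𝕜] A.carrier) →ₗ[𝕜] Ops A n :=
  (exists_opsRetraction A n).choose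

theorem opsRetraction_coe {n : ℤ} (e : Ops A n) : opsRetraction A n e.1 = e :=
  LinearMap.congr_fun (exists_opsRetraction A n).choose_spec e

/-- The brace algebra of multilinear operations on `A`. -/
def opsBrace : BraceRep 𝕜 A.carrier (Ops A) where
  toOpRep := opsRep A
  m n := ((DirectSum.toModule 𝕜 ℤ _ fun N : ℤ =>
      (LinearMap.llcomp 𝕜 (TensorAlgebra 𝕜 A.carrier) (TensorAlgebra 𝕜 A.carrier) A.carrier).flip.compr₂
        (DirectSum.lof 𝕜 ℤ (fun _ => TensorAlgebra 𝕜 A.carrier →ₗ[𝕜] A.carrier) (n + N))).flip.compl₁₂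
      (opsDeg A n).subtype (opsRep A).rhoG).compr₂ (DirectSum.lmap fun k => opsRetraction A k)
  m_one n e := by
    have h := (opsRep A).rhoG_word []
    rw [word_nil] at h
    have h2 : ∀ j, j = n → DirectSum.lof 𝕜 ℤ (Ops A) j (opsRetraction A j e.1) =
        DirectSum.lof 𝕜 ℤ (Ops A) n e := by
      rintro j rfl
      rw [opsRetraction_coe]
    simp only [LinearMap.compr₂_apply, LinearMap.compl₁₂_apply, h, LinearMap.flip_apply,
      DirectSum.toModule_lof, DirectSum.lmap_lof]
    exact h2 _ (by simp)
  m_word n e Z := by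
    refine ⟨⟨_, comp_rho_mem A e Z⟩, ?_, rfl⟩
    simp only [LinearMap.compr₂_apply, LinearMap.compl₁₂_apply, OpRep.rhoG_word, LinearMap.flip_apply,
      DirectSum.toModule_lof, DirectSum.lmap_lof]
    congr 1
    exact opsRetraction_coe A ⟨_, comp_rho_mem A e Z⟩
  hat_injective n := Subtype.val_injective

end Operations

section OfMulti

variable {𝕜 : Type} [RCLike 𝕜] {U M : Type*} [AddCommGroup U] [Module 𝕜 U] [AddCommGroup M] [Module 𝕜 M]

/-- The linear map on the tensor algebra given by a sequence of multilinear maps. -/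
def ofMulti (f : ∀ n, MultilinearMap 𝕜 (fun _ : Fin n => U) M) : TensorAlgebra 𝕜 U →ₗ[𝕜] M :=
  DirectSum.toModule 𝕜 ℕ M (fun n => PiTensorProduct.lift (f n)) ∘ₗ
    (TensorAlgebra.toDirectSum : TensorAlgebra 𝕜 U →ₐ[𝕜] _).toLinearMap

theorem ofMulti_ofFn (f : ∀ n, MultilinearMap 𝕜 (fun _ : Fin n => U) M) {n : ℕ} (a : Fin n → U) :
    ofMulti f (wd 𝕜 (List.ofFn a)) = f n a := by
  have h : wd 𝕜 (List.ofFn a) = TensorAlgebra.tprod 𝕜 U n a := by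
    rw [TensorAlgebra.tprod_apply, wd, List.map_ofFn]
    rfl
  rw [h, ofMulti, LinearMap.comp_apply, AlgHom.toLinearMap_apply,
    TensorAlgebra.toDirectSum_tensorPower_tprod]
  refine (DirectSum.toModule_lof 𝕜 _ _).trans ?_
  exact PiTensorProduct.lift.tprod _

theorem ofMulti_wd (f : ∀ n, MultilinearMap 𝕜 (fun _ : Fin n => U) M) (l : List U) :
    ofMulti f (wd 𝕜 l) = f l.length l.get := by
  conv_lhs => rw [← List.ofFn_get l]
  exact ofMulti_ofFn f _

end OfMulti

section StructureOp

variable {𝕜 : Type} [RCLike 𝕜] (A : DGAlg.{u} 𝕜)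

/-- The components of the structure operation as multilinear maps. -/
def structureMulti : ∀ n : ℕ, MultilinearMap 𝕜 (fun _ : Fin n => A.carrier) A.carrier
  | 1 =>
    { toFun := fun x => -A.d (x 0)
      map_update_add' := fun x i a b => by
        obtain rfl : i = 0 := Subsingleton.elim _ _
        simp [add_comm]
      map_update_smul' := fun x i c a => by
        obtain rfl : i = 0 := Subsingleton.elim _ _
        simp }
  | 2 =>
    { toFun := fun x => -A.mul (tm 𝕜 (A.sgn (x 0)) (x 1))
      map_update_add' := fun x i a b => by
        fin_cases i <;> simp [tm_add_left, tm_add_right, add_comm]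
      map_update_smul' := fun x i c a => by
        fin_cases i <;> simp }
  | _ => 0

/-- The structure operation as a linear map on the tensor algebra. -/
def structureLin : TensorAlgebra 𝕜 A.carrier →ₗ[𝕜] A.carrier := ofMulti (structureMulti A)

theorem structureLin_wd (l : List A.carrier) : structureLin A (wd 𝕜 l) = structureOp A l := by
  rw [structureLin, ofMulti_wd]
  match l with
  | [] => rfl
  | [a] => rfl
  | [a, b] => rfl
  | _ :: _ :: _ :: _ => rfl

theorem structureOp_long {l : List A.carrier} (h : 2 < l.length) : structureOp A l = 0 := by
  match l, h with
  | _ :: _ :: _ :: _, _ => rfl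

theorem structureLin_mem : structureLin A ∈ opsDeg A 1 := by
  refine ⟨fun n r hr => ?_, fun l hl => ?_, fun x => ?_⟩
  · obtain ⟨p, q, hp, hq, hb⟩ := bilin_bound (tmₗ 𝕜 (V := A.carrier) (W := A.carrier)) tm_continuous
      (r.comp A.mul.toLinearMap) (hr.comp A.mul.continuous)
    have hd : Continuous (r.comp A.d.toLinearMap) := hr.comp A.d.continuous
    obtain ⟨P, hP, hPi, hle⟩ := exists_invariant A (p := p + q + r.comp A.d.toLinearMap)
      ((hp.add hq).add hd)
    have hle' : ∀ a, p a + q a + r (A.d a) ≤ P a := hle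
    refine ⟨P, 1, hP, zero_le_one, hPi, fun l hl => ?_⟩
    rw [structureLin_wd, one_mul]
    match l with
    | [] => simp [structureOp]
    | [a] =>
      rw [structureOp, map_neg_eq_map, List.map_singleton, List.prod_singleton]
      exact (le_add_of_nonneg_left (add_nonneg (apply_nonneg p a) (apply_nonneg q a))).trans (hle' a)
    | [a, b] =>
      simp only [structureOp, map_neg_eq_map, List.map_cons, List.map_nil, List.prod_cons, List.prod_nil, mul_one]
      refine (hb (A.sgn a) b).trans ?_
      rw [← hPi a]
      have h1 := hle' (A.sgn a)
      have h2 := hle' b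
      have e1 := apply_nonneg p (A.sgn a)
      have e2 := apply_nonneg q (A.sgn a)
      have e3 := apply_nonneg r (A.d (A.sgn a))
      have e4 := apply_nonneg p b
      have e5 := apply_nonneg q b
      have e6 := apply_nonneg r (A.d b)
      exact mul_le_mul (by linarith) (by linarith) e5 (by linarith)
    | _ :: _ :: _ :: _ => rw [structureOp_long A (by simp), map_zero]; exact list_prod_nonneg P _
  · rw [structureLin_wd]
    match l with
    | [] => exact GrSp.Deg.zero _
    | [a] =>
      have := (A.d_deg _ _ (hl a (by simp))).neg
      simpa [structureOp, add_assoc] using this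
    | [a, b] =>
      have h1 := GrSp.sgn_deg _ _ (hl a (by simp))
      have := (A.mul_deg _ _ _ _ h1 (hl b (by simp))).neg
      simp only [structureOp, List.map_cons, List.map_nil, List.sum_cons, List.sum_nil]
      convert this using 1
      ring
    | _ :: _ :: _ :: _ =>
      rw [structureOp_long A (by simp)]
      exact GrSp.Deg.zero _
  · have : structureLin A ∘ₗ (sgp (sigma A) 1).toLinearMap = -(sigma A ∘ₗ structureLin A) :=
      wd_ext fun l => by
        simp only [LinearMap.comp_apply, AlgHom.toLinearMap_apply, sgp_wd, LinearMap.neg_apply,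
          structureLin_wd]
        have ht : tau (sigma A) 1 = sigma A := by simp [tau]
        rw [ht]
        match l with
        | [] => simp [structureOp]
        | [a] => simp [structureOp, sigma, sgn_d]
        | [a, b] => simp [structureOp, sigma, sgn_mul]
        | _ :: _ :: _ :: _ => simp [structureOp_long]
    have h2 := LinearMap.congr_fun this x
    simpa using h2

/-- The structure operation `b`. -/
def structureElt : Ops A 1 := ⟨structureLin A, structureLin_mem A⟩

theorem structureElt_wd (l : List A.carrier) :
    (structureElt A).1 (wd 𝕜 l) = structureOp A l := structureLin_wd A l

/-- The brace operation, as an application of the operators `rho`. -/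
theorem apply_rho_eq_brace (φ : TensorAlgebra 𝕜 A.carrier →ₗ[𝕜] A.carrier) (Z : List (Σ n, Ops A n))
    (l k : List A.carrier) : φ (wd 𝕜 l * (opsRep A).rho Z (wd 𝕜 k)) =
      brace A (fun x => φ (wd 𝕜 x)) l (Z.map fun g => (g.1, fun x => g.2.1 (wd 𝕜 x))) k := by
  induction Z generalizing l k with
  | nil => simp [brace, wd_append]
  | cons g X ih =>
    have ht : ∀ n, (tau (opsRep A).s n : A.carrier → A.carrier) = twist A n :=
      fun n => funext fun a => tau_sigma A n a
    have hX : ((X.map fun g => ((g.1, fun x => g.2.1 (wd 𝕜 x)) :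
        ℤ × (List A.carrier → A.carrier))).map Prod.fst).sum = dg X := by
      simp [dg, Function.comp_def]
    rw [OpRep.apply_rho_cons, sp_assoc, ← sum_range_take_drop, List.map_cons, brace]
    refine Finset.sum_congr rfl fun i _ => ?_
    rw [← sum_range_take_drop, List.length_drop]
    refine Finset.sum_congr rfl fun j _ => ?_
    rw [ih, ht, ht, hX]
    rfl

theorem mem_span_one_iff (a : A.carrier) : sq A a = 0 ↔ ∃ c : 𝕜, c • A.one = a := redQ_eq_zero A

theorem structure_brace : (opsBrace A).m 1 (structureElt A) (TS.of 𝕜 (structureElt A)) = 0 := by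
  obtain ⟨g, hg, hh⟩ := (opsBrace A).m_word 1 (structureElt A) [⟨1, structureElt A⟩]
  rw [word_singleton] at hg
  rw [hg]
  suffices h : g = 0 by rw [h, map_zero]
  refine (opsBrace A).hat_injective _ ?_
  rw [hh, map_zero]
  refine wd_ext fun l => ?_
  change structureLin A ((opsRep A).rho [⟨1, structureElt A⟩] (wd 𝕜 l)) = 0
  have key := OpRep.apply_rho_cons (opsRep A) (structureLin A) ⟨1, structureElt A⟩ [] [] l
  rw [wd_nil, one_mul] at key
  rw [key]
  have h1 : (tau (opsRep A).s (1 + dg ([] : List (Σ n, Ops A n))) : A.carrier → A.carrier) = fun a => -A.sgn a := by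
    funext a
    change tau (sigma A) _ a = _
    simp [tau, sigma]
  have h0 : (tau (opsRep A).s (dg ([] : List (Σ n, Ops A n))) : A.carrier → A.carrier) = id := by
    funext a
    simp [tau]
  have hh : ∀ x, ((opsRep A).hat 1) (structureElt A) (wd 𝕜 x) = structureOp A x := structureElt_wd A
  simp only [h1, h0, List.map_id, OpRep.rho_nil, LinearMap.id_apply, List.nil_append, ← wd_append,
    structureLin_wd, hh]
  match l with
  | [] => simp [structureOp]
  | [a] => simp [sp_cons, structureOp, A.d_d]
  | [a, b] =>
    simp [sp_cons, structureOp, A.d_mul, sgn_d]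
  | [a, b, c] =>
    simp [sp_cons, structureOp, A.mul_assoc, sgn_mul]
  | a :: b :: c :: e :: k =>
    refine sp_eq_zero _ _ fun k₁ k₂ hk => sp_eq_zero _ _ fun u v hv => ?_
    by_cases h : 2 < v.length
    · rw [structureOp_long A h]
      have hl := congrArg List.length hk
      rw [hv] at hl
      simp only [List.length_cons, List.length_append] at hl
      rcases u with _ | ⟨x, _ | ⟨y, u⟩⟩
      · rcases k₂ with _ | ⟨z, _ | ⟨w, k₂⟩⟩
        · simp [structureOp]
        · simp [structureOp]
        · rw [structureOp_long]; simp
      · rcases k₂ with _ | ⟨z, k₂⟩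
        · simp [structureOp]
        · rw [structureOp_long]; simp
      · rw [structureOp_long]; simp
    · have hl := congrArg List.length hk
      rw [hv] at hl
      simp only [List.length_cons, List.length_append] at hl
      rw [structureOp_long]
      simp only [List.length_append, List.length_map, List.length_singleton]
      omega

end StructureOp

section Normalized

variable {𝕜 : Type} [RCLike 𝕜] {A : DGAlg.{u} 𝕜}

/-- The operations vanish if one of the arguments is a multiple of the unit. -/
def IsNormalized (φ : TensorAlgebra 𝕜 A.carrier →ₗ[𝕜] A.carrier) : Prop :=
  ∀ l : List A.carrier, (∃ x ∈ l, sq A x = 0) → φ (wd 𝕜 l) = 0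

/-- Almost all of the operations vanish. -/
def IsFin (φ : TensorAlgebra 𝕜 A.carrier →ₗ[𝕜] A.carrier) : Prop :=
  ∃ M : ℕ, ∀ l : List A.carrier, M ≤ l.length → φ (wd 𝕜 l) = 0

/-- The operations tend to zero uniformly. -/
def IsSmall (φ : TensorAlgebra 𝕜 A.carrier →ₗ[𝕜] A.carrier) : Prop :=
  ∀ r : Seminorm 𝕜 A.carrier, Continuous r →
    ∃ M : ℕ, ∀ l : List A.carrier, M ≤ l.length → r (φ (wd 𝕜 l)) = 0

theorem IsFin.isSmall {φ : TensorAlgebra 𝕜 A.carrier →ₗ[𝕜] A.carrier} (h : IsFin φ) : IsSmall φ :=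
  fun r _ => h.imp fun M hM l hl => by rw [hM l hl, map_zero]

theorem structureElt_isFin : IsFin (structureElt A).1 :=
  ⟨3, fun l hl => by rw [structureElt_wd]; exact structureOp_long A hl⟩

theorem sq_tau {a : A.carrier} (h : sq A a = 0) (n : ℤ) : sq A (tau (opsRep A).s n a) = 0 := by
  obtain ⟨c, rfl⟩ := (mem_span_one_iff A a).1 h
  change sq A (tau (sigma A) n _) = 0
  rw [tau_sigma, twist]
  split_ifs
  · exact h
  · rw [map_smul, sgn_one, map_neg, h, neg_zero]

theorem exists_tau {l : List A.carrier} (h : ∃ x ∈ l, sq A x = 0) (n : ℤ) :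
    ∃ x ∈ l.map (tau (opsRep A).s n), sq A x = 0 := by
  obtain ⟨x, hx, h⟩ := h
  exact ⟨_, List.mem_map_of_mem hx, sq_tau h n⟩

variable {M : Type*} [AddCommGroup M] [Module 𝕜 M]

theorem apply_zero_word (φ : TensorAlgebra 𝕜 A.carrier →ₗ[𝕜] M) (l : List A.carrier) (y) :
    φ (wd 𝕜 (l ++ [0]) * y) = 0 := by
  simp [wd_append, wd_singleton]

/-- Operations with few arguments vanish on words with many letters. -/
theorem apply_rho_eq_zero_of_length {φ : TensorAlgebra 𝕜 A.carrier →ₗ[𝕜] M} {q : ℕ}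
    (hφ : ∀ l : List A.carrier, q < l.length → φ (wd 𝕜 l) = 0) (Z : List (Σ n, Ops A n))
    (l k : List A.carrier) (h : q < l.length + Z.length) :
    φ (wd 𝕜 l * (opsRep A).rho Z (wd 𝕜 k)) = 0 := by
  induction Z generalizing l k with
  | nil =>
    rw [OpRep.rho_nil, LinearMap.id_apply, ← wd_append]
    refine hφ _ ?_
    rw [List.length_append]
    simp only [List.length_nil] at h
    omega
  | cons g X ih =>
    rw [OpRep.apply_rho_cons]
    refine sp_eq_zero _ _ fun k₁ w _ => sp_eq_zero _ _ fun u v _ => ih _ _ ?_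
    simp only [List.length_append, List.length_map, List.length_cons] at h ⊢
    omega

theorem apply_rho_eq_zero_of_sq {φ : TensorAlgebra 𝕜 A.carrier →ₗ[𝕜] M} {q : ℕ}
    (hφ : ∀ l : List A.carrier, q < l.length → φ (wd 𝕜 l) = 0) (Z : List (Σ n, Ops A n))
    (hZ : ∀ g ∈ Z, IsNormalized g.2.1) (l k : List A.carrier) (h : q ≤ l.length + Z.length)
    (hk : ∃ x ∈ k, sq A x = 0) : φ (wd 𝕜 l * (opsRep A).rho Z (wd 𝕜 k)) = 0 := by
  induction Z generalizing l k with
  | nil =>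
    rw [OpRep.rho_nil, LinearMap.id_apply, ← wd_append]
    refine hφ _ ?_
    obtain ⟨x, hx, -⟩ := hk
    have := List.length_pos_of_mem hx
    rw [List.length_append]
    simp only [List.length_nil] at h
    omega
  | cons g X ih =>
    rw [OpRep.apply_rho_cons]
    refine sp_eq_zero _ _ fun k₁ w e => sp_eq_zero _ _ fun u v e' => ?_
    rw [e, e'] at hk
    simp only [List.length_cons] at h
    rcases u with _ | ⟨a, u⟩
    · obtain ⟨x, hx, hx0⟩ := hk
      rw [List.nil_append, List.mem_append] at hx
      rcases hx with hx | hx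
      · have : (opsRep A).hat g.1 g.2 (wd 𝕜 (v.map (tau (opsRep A).s (dg X)))) = 0 :=
          hZ g (by simp) _ (exists_tau ⟨x, hx, hx0⟩ _)
        rw [this]
        exact apply_zero_word φ _ _
      · refine ih (fun g hg => hZ g (by simp [hg])) _ _ ?_ ⟨x, hx, hx0⟩
        simp only [List.length_append, List.map_nil, List.length_nil, List.length_singleton]
        omega
    · refine apply_rho_eq_zero_of_length hφ X _ _ ?_
      simp only [List.length_append, List.map_cons, List.length_cons, List.length_map,
        List.length_nil]
      omega

theorem apply_rho_normalized {φ : TensorAlgebra 𝕜 A.carrier →ₗ[𝕜] A.carrier} (hφ : IsNormalized φ)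
    (Z : List (Σ n, Ops A n)) (hZ : ∀ g ∈ Z, IsNormalized g.2.1) (l k : List A.carrier)
    (h : ∃ x ∈ l ++ k, sq A x = 0) : φ (wd 𝕜 l * (opsRep A).rho Z (wd 𝕜 k)) = 0 := by
  induction Z generalizing l k with
  | nil =>
    rw [OpRep.rho_nil, LinearMap.id_apply, ← wd_append]
    exact hφ _ h
  | cons g X ih =>
    rw [OpRep.apply_rho_cons]
    refine sp_eq_zero _ _ fun k₁ w e => sp_eq_zero _ _ fun u v e' => ?_
    obtain ⟨x, hx, hx0⟩ := h
    rw [e, e', List.mem_append, List.mem_append, List.mem_append] at hx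
    refine ih (fun g hg => hZ g (by simp [hg])) _ _ ?_
    rcases hx with hx | (hx | hx) | hx
    · exact ⟨x, by simp [hx], hx0⟩
    · obtain ⟨y, hy, hy0⟩ := exists_tau ⟨x, hx, hx0⟩ (g.1 + dg X)
      exact ⟨y, by rw [List.append_assoc, List.append_assoc, List.mem_append, List.mem_append]; exact Or.inr (Or.inl hy), hy0⟩
    · refine ⟨(opsRep A).hat g.1 g.2 (wd 𝕜 (v.map (tau (opsRep A).s (dg X)))), by simp, ?_⟩
      have : (opsRep A).hat g.1 g.2 (wd 𝕜 (v.map (tau (opsRep A).s (dg X)))) = 0 :=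
        hZ g (by simp) _ (exists_tau ⟨x, hx, hx0⟩ _)
      rw [this, map_zero]
    · exact ⟨x, by simp [hx], hx0⟩

theorem apply_rho_fin {φ : TensorAlgebra 𝕜 A.carrier →ₗ[𝕜] A.carrier} (hφ : IsFin φ)
    (Z : List (Σ n, Ops A n)) (hZ : ∀ g ∈ Z, IsFin g.2.1) : ∃ M : ℕ, ∀ l k : List A.carrier,
      M ≤ l.length + k.length → φ (wd 𝕜 l * (opsRep A).rho Z (wd 𝕜 k)) = 0 := by
  induction Z with
  | nil =>
    obtain ⟨M, hM⟩ := hφ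
    refine ⟨M, fun l k h => ?_⟩
    rw [OpRep.rho_nil, LinearMap.id_apply, ← wd_append]
    exact hM _ (by rwa [List.length_append])
  | cons g X ih =>
    obtain ⟨M, hM⟩ := ih fun g hg => hZ g (by simp [hg])
    obtain ⟨m, hm⟩ := hZ g (by simp)
    refine ⟨M + m, fun l k h => ?_⟩
    rw [OpRep.apply_rho_cons]
    refine sp_eq_zero _ _ fun k₁ w e => sp_eq_zero _ _ fun u v e' => ?_
    rw [e, e', List.length_append, List.length_append] at h
    by_cases hv : m ≤ v.length
    · have : (opsRep A).hat g.1 g.2 (wd 𝕜 (v.map (tau (opsRep A).s (dg X)))) = 0 :=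
        hm _ (by rwa [List.length_map])
      rw [this]
      exact apply_zero_word φ _ _
    · refine hM _ _ ?_
      simp only [List.length_append, List.length_map, List.length_singleton]
      omega

theorem apply_rho_small {φ : TensorAlgebra 𝕜 A.carrier →ₗ[𝕜] A.carrier} (hb : IsBdd φ) (hφ : IsSmall φ)
    (Z : List (Σ n, Ops A n)) (hZ : ∀ g ∈ Z, IsSmall g.2.1) (r : Seminorm 𝕜 A.carrier)
    (hr : Continuous r) : ∃ M : ℕ, ∀ l k : List A.carrier,
      M ≤ l.length + k.length → r (φ (wd 𝕜 l * (opsRep A).rho Z (wd 𝕜 k))) = 0 := by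
  induction Z with
  | nil =>
    obtain ⟨M, hM⟩ := hφ r hr
    refine ⟨M, fun l k h => ?_⟩
    rw [OpRep.rho_nil, LinearMap.id_apply, ← wd_append]
    exact hM _ (by rwa [List.length_append])
  | cons g X ih =>
    obtain ⟨M, hM⟩ := ih fun g hg => hZ g (by simp [hg])
    choose p C hp hC hpi hpb using fun x : ℕ × ℕ => bdd_rho A X hb x.1 x.2 r hr
    obtain ⟨P, hP, -, hle⟩ := exists_common A (Finset.range M ×ˢ Finset.range M) p hp hpi
    obtain ⟨m, hm⟩ := hZ g (by simp) P hP
    refine ⟨M + m, fun l k h => ?_⟩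
    rw [OpRep.apply_rho_cons]
    refine seminorm_sp_eq_zero r _ _ fun k₁ w e => seminorm_sp_eq_zero r _ _ fun u v e' => ?_
    rw [e, e', List.length_append, List.length_append] at h
    set b := (opsRep A).hat g.1 g.2 (wd 𝕜 (v.map (tau (opsRep A).s (dg X)))) with hbdef
    set L := l ++ u.map (tau (opsRep A).s (g.1 + dg X)) ++ [b] with hL
    have hlen : L.length = l.length + u.length + 1 := by simp [hL]; omega
    by_cases hv : M ≤ L.length + w.length
    · exact hM _ _ hv
    · have h1 : P b = 0 := hm _ (by rw [List.length_map]; omega)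
      have h2 : p (L.length, w.length) b = 0 := le_antisymm
        ((hle (L.length, w.length) (by simp; omega) b).trans h1.le) (apply_nonneg _ _)
      refine le_antisymm ((hpb (L.length, w.length) L w rfl rfl).trans_eq ?_) (apply_nonneg _ _)
      have h3 : (L.map (p (L.length, w.length))).prod = 0 := by
        rw [hL, List.map_append, List.prod_append, List.map_singleton, List.prod_singleton, ← hL, h2,
          mul_zero]
      rw [h3, zero_mul, mul_zero]

end Normalized

section Commutator

variable {𝕜 : Type} [RCLike 𝕜] (A : DGAlg.{u} 𝕜)

theorem rho_single {n : ℤ} (g : Ops A n) (k : List A.carrier) :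
    (opsRep A).rho [⟨n, g⟩] (wd 𝕜 k) = sp k fun u k' => sp k' fun v w =>
      wd 𝕜 (u.map (tau (opsRep A).s n) ++ g.1 (wd 𝕜 v) :: w) := by
  have key := OpRep.apply_rho_cons (opsRep A) LinearMap.id ⟨n, g⟩ [] [] k
  rw [wd_nil, one_mul, LinearMap.id_apply] at key
  rw [key, sp_assoc]
  refine sp_congr fun u k' _ => sp_congr fun v w _ => ?_
  have h0 : (tau (opsRep A).s (dg ([] : List (Σ n, Ops A n))) : A.carrier → A.carrier) = id := by
    funext a
    simp [tau]
  rw [h0, List.map_id, OpRep.rho_nil, LinearMap.id_apply, LinearMap.id_apply, ← wd_append, dg_nil, add_zero,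
    List.nil_append, List.append_assoc]
  rfl

theorem wd_zero_cons (l : List A.carrier) : wd 𝕜 (0 :: l) = 0 := by simp [wd_cons]

/-- The coderivation given by the structure operation. -/
def barCoder : TensorAlgebra 𝕜 A.carrier →ₗ[𝕜] TensorAlgebra 𝕜 A.carrier :=
  (opsRep A).rho [⟨1, structureElt A⟩]

theorem tau_one : (tau (opsRep A).s 1 : A.carrier → A.carrier) = sigma A := by
  funext a
  change tau (sigma A) 1 a = _
  simp [tau]

theorem barCoder_eq (k : List A.carrier) : barCoder A (wd 𝕜 k) = sp k fun u k' => sp k' fun v w =>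
    wd 𝕜 (u.map (sigma A) ++ structureOp A v :: w) := by
  rw [barCoder, rho_single, tau_one]
  simp only [structureElt_wd]

theorem barCoder_nil : barCoder A (wd 𝕜 []) = 0 := by
  rw [barCoder_eq]
  simp [structureOp, wd_zero_cons]

theorem barCoder_cons (a : A.carrier) (k : List A.carrier) : barCoder A (wd 𝕜 (a :: k)) =
    (sp k fun v w => wd 𝕜 (structureOp A (a :: v) :: w)) + wd 𝕜 [sigma A a] * barCoder A (wd 𝕜 k) := by
  rw [barCoder_eq, barCoder_eq, sp_cons, sp_cons, sp_mul_left]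
  congr 1
  · simp [structureOp, wd_zero_cons]
  · refine sp_congr fun u k' _ => ?_
    rw [sp_mul_left]
    refine sp_congr fun v w _ => ?_
    rw [← wd_append]
    rfl

theorem barCoder_singleton (a : A.carrier) : barCoder A (wd 𝕜 [a]) = wd 𝕜 [-A.d a] := by
  rw [barCoder_cons, barCoder_nil, mul_zero, add_zero]
  rfl

theorem barCoder_cons_cons (a c : A.carrier) (k : List A.carrier) : barCoder A (wd 𝕜 (a :: c :: k)) =
    wd 𝕜 (-A.d a :: c :: k) + wd 𝕜 (structureOp A [a, c] :: k) +
      wd 𝕜 [sigma A a] * barCoder A (wd 𝕜 (c :: k)) := by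
  rw [barCoder_cons, sp_cons, sp_eq_left_nil]
  · rfl
  · intro u v hu
    rw [structureOp_long, wd_zero_cons]
    have := List.length_pos_iff.2 hu
    simp only [List.length_cons]
    omega

variable {A}

theorem sq_sigma {a : A.carrier} (h : sq A a = 0) : sq A (sigma A a) = 0 := by
  have := sq_tau h 1
  rwa [tau_one] at this

/-- The value of a normalized operation on the coderivation, for a word that starts with the unit. -/
theorem apply_barCoder_one_cons {φ : TensorAlgebra 𝕜 A.carrier →ₗ[𝕜] A.carrier} (hφ : IsNormalized φ)
    (l : List A.carrier) (y : A.carrier) (k : List A.carrier) :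
    φ (wd 𝕜 l * barCoder A (wd 𝕜 (A.one :: y :: k))) = -φ (wd 𝕜 (l ++ y :: k)) := by
  rw [barCoder_cons_cons, mul_add, mul_add, map_add, map_add, ← wd_append, ← wd_append, d_one,
    neg_zero, hφ (l ++ 0 :: y :: k) ⟨0, by simp, map_zero _⟩, zero_add, ← _root_.mul_assoc, ← wd_append]
  have h2 : φ (wd 𝕜 (l ++ [sigma A A.one]) * barCoder A (wd 𝕜 (y :: k))) = 0 := by
    rw [barCoder_eq, sp_mul_left, map_sp]
    refine sp_eq_zero _ _ fun u k' _ => ?_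
    rw [sp_mul_left, map_sp]
    refine sp_eq_zero _ _ fun v w _ => ?_
    rw [← wd_append]
    exact hφ _ ⟨_, by simp, sq_sigma (sq_one A)⟩
  rw [h2, add_zero, structureOp, sgn_one, A.one_mul, wd_append, wd_append, wd_cons, wd_cons]
  simp

theorem apply_barCoder_append_one {φ : TensorAlgebra 𝕜 A.carrier →ₗ[𝕜] A.carrier} (hφ : IsNormalized φ)
    (l : List A.carrier) (a : A.carrier) (x y : List A.carrier) :
    φ (wd 𝕜 l * barCoder A (wd 𝕜 (a :: x ++ A.one :: y))) =
      if y = [] then φ (wd 𝕜 (l ++ (a :: x).map (sigma A))) else 0 := by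
  induction x generalizing l a with
  | nil =>
    have e : structureOp A [a, A.one] = sigma A a := by simp [structureOp, A.mul_one, sigma]
    rw [List.singleton_append, barCoder_cons_cons, e, mul_add, mul_add, map_add, map_add, ← wd_append,
      ← wd_append, hφ (l ++ -A.d a :: A.one :: y) ⟨A.one, by simp, sq_one A⟩, zero_add,
      ← _root_.mul_assoc, ← wd_append]
    cases y with
    | nil =>
      rw [if_pos rfl, barCoder_singleton, d_one, neg_zero, wd_zero_cons, mul_zero, map_zero, add_zero]
      rfl
    | cons y k =>
      rw [if_neg (by simp), apply_barCoder_one_cons hφ, List.append_assoc, List.singleton_append,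
        add_neg_cancel]
  | cons c x ih =>
    rw [List.cons_append, List.cons_append, barCoder_cons_cons, ← List.cons_append (a := c), mul_add, mul_add, map_add, map_add,
      ← wd_append, ← wd_append, hφ (l ++ -A.d a :: _) ⟨A.one, by simp, sq_one A⟩,
      hφ (l ++ structureOp A [a, c] :: _) ⟨A.one, by simp, sq_one A⟩, zero_add, zero_add,
      ← _root_.mul_assoc, ← wd_append, ih]
    simp

theorem apply_barCoder_one {φ : TensorAlgebra 𝕜 A.carrier →ₗ[𝕜] A.carrier} (hφ : IsNormalized φ)
    (x y : List A.carrier) : φ (barCoder A (wd 𝕜 (x ++ A.one :: y))) =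
      if x = [] then if y = [] then 0 else -φ (wd 𝕜 y) else
        if y = [] then φ (wd 𝕜 (x.map (sigma A))) else 0 := by
  cases x with
  | nil =>
    rw [if_pos rfl, List.nil_append]
    cases y with
    | nil => rw [if_pos rfl, barCoder_singleton, d_one, neg_zero, wd_zero_cons, map_zero]
    | cons y k =>
      have := apply_barCoder_one_cons hφ [] y k
      rw [wd_nil, one_mul] at this
      rw [this, if_neg (by simp)]
      rfl
  | cons a x =>
    have := apply_barCoder_append_one hφ [] a x y
    rw [wd_nil, one_mul] at this
    rw [this, if_neg (by simp : ¬ a :: x = [])]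
    rfl

theorem sp_concat {α N : Type*} [AddCommMonoid N] (l : List α) (a : α) (F : List α → List α → N) :
    sp (l ++ [a]) F = (sp l fun u v => F u (v ++ [a])) + F (l ++ [a]) [] := by
  induction l generalizing F with
  | nil => rfl
  | cons b l ih =>
    rw [List.cons_append, sp_cons, ih, sp_cons, add_assoc]
    rfl

/-- The composite of the structure operation with an operation. -/
theorem structure_rho {n : ℤ} (f : Ops A n) (k : List A.carrier) :
    structureLin A ((opsRep A).rho [⟨n, f⟩] (wd 𝕜 k)) = sp k fun u k' => sp k' fun v w =>
      structureOp A (u.map (tau (opsRep A).s n) ++ f.1 (wd 𝕜 v) :: w) := by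
  rw [rho_single, map_sp]
  refine sp_congr fun u k' _ => ?_
  rw [map_sp]
  exact sp_congr fun v w _ => structureLin_wd A _

theorem structure_rho_nil {n : ℤ} (f : Ops A n) :
    structureLin A ((opsRep A).rho [⟨n, f⟩] (wd 𝕜 [])) = -A.d (f.1 (wd 𝕜 [])) := by
  rw [structure_rho]
  rfl

/-- The composite of the structure operation with an operation, on a word that starts with `a` and
ends with `c`. -/
theorem structure_rho_of_ne_nil {n : ℤ} (f : Ops A n) (k k₁ k₂ : List A.carrier) (a c : A.carrier)
    (h₁ : k = a :: k₁) (h₂ : k = k₂ ++ [c]) :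
    structureLin A ((opsRep A).rho [⟨n, f⟩] (wd 𝕜 k)) = -A.d (f.1 (wd 𝕜 k)) +
      structureOp A [tau (opsRep A).s n a, f.1 (wd 𝕜 k₁)] + structureOp A [f.1 (wd 𝕜 k₂), c] := by
  have z : ∀ (u : List A.carrier) (b : A.carrier) (w : List A.carrier), 1 < u.length + w.length →
      structureOp A (u.map (tau (opsRep A).s n) ++ b :: w) = 0 := fun u b w h => by
    rw [structureOp_long]
    simp only [List.length_append, List.length_map, List.length_cons]
    omega
  have e1 : (sp k fun v w => structureOp A (f.1 (wd 𝕜 v) :: w)) =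
      structureOp A [f.1 (wd 𝕜 k₂), c] + -A.d (f.1 (wd 𝕜 k)) := by
    rw [h₂, sp_concat, sp_eq_right_nil]
    · rfl
    · intro u v hv
      have := List.length_pos_iff.2 hv
      refine z [] (f.1 (wd 𝕜 u)) (v ++ [c]) ?_
      simp only [List.length_append, List.length_singleton, List.length_nil]
      omega
  have e2 : (sp k₁ fun u k' => sp k' fun v w =>
      structureOp A ((a :: u).map (tau (opsRep A).s n) ++ f.1 (wd 𝕜 v) :: w)) =
        structureOp A [tau (opsRep A).s n a, f.1 (wd 𝕜 k₁)] := by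
    rw [sp_eq_left_nil, sp_eq_right_nil]
    · rfl
    · intro v w hw
      have := List.length_pos_iff.2 hw
      exact z [a] (f.1 (wd 𝕜 v)) w (by simp only [List.length_singleton]; omega)
    · intro u k' hu
      have := List.length_pos_iff.2 hu
      exact sp_eq_zero _ _ fun v w _ => z (a :: u) (f.1 (wd 𝕜 v)) w (by simp only [List.length_cons]; omega)
  rw [structure_rho]
  conv_lhs => rw [h₁]
  rw [sp_cons, e2, ← h₁]
  simp only [List.map_nil, List.nil_append]
  rw [e1]
  abel

variable (A) in
/-- The commutator of the structure operation with an operation. -/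
def structureComm {n : ℤ} (f : Ops A n) : TensorAlgebra 𝕜 A.carrier →ₗ[𝕜] A.carrier :=
  structureLin A ∘ₗ (opsRep A).rho [⟨n, f⟩] - ((-1 : 𝕜) ^ n) • f.1 ∘ₗ barCoder A

theorem tau_unit (n : ℤ) : tau (opsRep A).s n A.one = ((-1 : 𝕜) ^ n) • A.one := by
  change tau (sigma A) n _ = _
  rw [tau_sigma, twist]
  split_ifs with h
  · rw [h.neg_one_zpow, one_smul]
  · rw [(Int.not_even_iff_odd.1 h).neg_one_zpow, sgn_one, neg_smul, one_smul]

theorem structureComm_one {n : ℤ} {f : Ops A n} (hf : IsNormalized f.1) (x y : List A.carrier) :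
    structureComm A f (wd 𝕜 (x ++ A.one :: y)) = 0 := by
  have hsq : ((-1 : 𝕜) ^ n) * (-1) ^ n = 1 := GrSp.neg_one_zpow_mul_self n
  have hk : f.1 (wd 𝕜 (x ++ A.one :: y)) = 0 := hf _ ⟨A.one, by simp, sq_one A⟩
  have hl : ∀ a : A.carrier, structureOp A [tau (opsRep A).s n A.one, a] = -((-1 : 𝕜) ^ n) • a := fun a => by
    rw [tau_unit, structureOp, map_smul, sgn_one, tm_smul_left, map_smul, A.one_mul, neg_smul]
  have hr : ∀ a : A.carrier, structureOp A [a, A.one] = -A.sgn a := fun a => by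
    rw [structureOp, A.mul_one]
  rw [structureComm, LinearMap.sub_apply, LinearMap.smul_apply, LinearMap.comp_apply,
    LinearMap.comp_apply, apply_barCoder_one hf]
  rcases x with _ | ⟨a, x⟩
  · rw [if_pos rfl, List.nil_append]
    rcases List.eq_nil_or_concat' y with rfl | ⟨y', c, rfl⟩
    · have hs : A.sgn (f.1 (wd 𝕜 [])) = -((-1 : 𝕜) ^ n) • f.1 (wd 𝕜 []) := by
        have := (f.2.2.1 [] (by simp)).sgn
        simpa [zpow_add₀] using this
      rw [if_pos rfl, smul_zero, sub_zero,
        structure_rho_of_ne_nil f [A.one] [] [] A.one A.one rfl rfl, hf [A.one] ⟨A.one, by simp, sq_one A⟩,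
        hl, hr, hs, map_zero, neg_zero, zero_add, add_neg_cancel]
    · have e : structureOp A [f.1 (wd 𝕜 (A.one :: y')), c] = 0 := by
        rw [hf (A.one :: y') ⟨A.one, by simp, sq_one A⟩]
        simp [structureOp]
      rw [if_neg (by simp), structure_rho_of_ne_nil f (A.one :: (y' ++ [c])) (y' ++ [c]) (A.one :: y') A.one c
        rfl rfl, e, hl]
      rw [List.nil_append] at hk
      rw [hk, map_zero]
      simp
  · rw [if_neg (by simp)]
    rcases List.eq_nil_or_concat' y with rfl | ⟨y', c, rfl⟩
    · have e : structureOp A [tau (opsRep A).s n a, f.1 (wd 𝕜 (x ++ [A.one]))] = 0 := by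
        rw [hf (x ++ [A.one]) ⟨A.one, by simp, sq_one A⟩]
        simp [structureOp]
      have hσ : f.1 (wd 𝕜 ((a :: x).map (sigma A))) = ((-1 : 𝕜) ^ n) • sigma A (f.1 (wd 𝕜 (a :: x))) := by
        have := f.2.2.2 (wd 𝕜 (a :: x))
        rwa [sgp_wd, show tau (sigma A) 1 = sigma A by simp [tau]] at this
      rw [if_pos rfl, structure_rho_of_ne_nil f (a :: x ++ [A.one]) (x ++ [A.one]) (a :: x) a A.one rfl rfl, e, hk, hr, hσ,
        smul_smul, hsq, one_smul, map_zero]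
      simp [sigma]
    · have e1 : structureOp A [tau (opsRep A).s n a, f.1 (wd 𝕜 (x ++ A.one :: (y' ++ [c])))] = 0 := by
        rw [hf (x ++ A.one :: (y' ++ [c])) ⟨A.one, by simp, sq_one A⟩]
        simp [structureOp]
      have e2 : structureOp A [f.1 (wd 𝕜 (a :: x ++ A.one :: y')), c] = 0 := by
        rw [hf (a :: x ++ A.one :: y') ⟨A.one, by simp, sq_one A⟩]
        simp [structureOp]
      rw [if_neg (by simp), structure_rho_of_ne_nil f (a :: x ++ A.one :: (y' ++ [c])) (x ++ A.one :: (y' ++ [c])) (a :: x ++ A.one :: y')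
        a c rfl (by simp), e1, e2, hk, map_zero]
      simp

theorem structureComm_normalized {n : ℤ} {f : Ops A n} (hf : IsNormalized f.1) :
    IsNormalized (structureComm A f) := by
  rintro l ⟨a, ha, h⟩
  obtain ⟨c, rfl⟩ := (mem_span_one_iff A a).1 h
  obtain ⟨x, y, rfl⟩ := List.append_of_mem ha
  have : wd 𝕜 (x ++ c • A.one :: y) = c • wd 𝕜 (x ++ A.one :: y) := by
    simp [wd_append, wd_cons]
  rw [this, map_smul, structureComm_one hf, smul_zero]

end Commutator

section HalfWord

variable {𝕜 : Type} [RCLike 𝕜] (A : DGAlg.{u} 𝕜)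

theorem halfWord_succ (n : ℕ) (a : Fin (n + 1) → A.carrier) : halfWord A (n + 1) a =
    (tm 𝕜 (halfWord A n (Fin.init a)) (sq A (a (Fin.last n))) :
      CT 𝕜 (step A n).P.carrier (susp A).carrier) := rfl

theorem halfWord_snoc (n : ℕ) (a : Fin n → A.carrier) (c : A.carrier) :
    halfWord A (n + 1) (Fin.snoc a c : Fin (n + 1) → A.carrier) =
      (tm 𝕜 (halfWord A n a) (sq A c) : CT 𝕜 (step A n).P.carrier (susp A).carrier) := by
  rw [halfWord_succ, Fin.init_snoc, Fin.snoc_last]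

theorem halfWord_update_add (n : ℕ) (a : Fin n → A.carrier) (i : Fin n) (x y : A.carrier) :
    halfWord A n (Function.update a i (x + y)) =
      halfWord A n (Function.update a i x) + halfWord A n (Function.update a i y) := by
  induction n with
  | zero => exact i.elim0
  | succ n ih =>
    refine Fin.lastCases ?_ (fun i => ?_) i
    · simp only [halfWord_succ, Fin.init_update_last, Function.update_self, map_add]
      exact tm_add_right _ _ _
    · have h : Fin.last n ≠ i.castSucc := (Fin.castSucc_lt_last i).ne'
      simp only [halfWord_succ, Fin.init_update_castSucc, Function.update_of_ne h, ih]
      exact tm_add_left _ _ _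

theorem halfWord_update_smul (n : ℕ) (a : Fin n → A.carrier) (i : Fin n) (c : 𝕜) (x : A.carrier) :
    halfWord A n (Function.update a i (c • x)) = c • halfWord A n (Function.update a i x) := by
  induction n with
  | zero => exact i.elim0
  | succ n ih =>
    refine Fin.lastCases ?_ (fun i => ?_) i
    · simp only [halfWord_succ, Fin.init_update_last, Function.update_self, map_smul]
      exact tm_smul_right _ _ _
    · have h : Fin.last n ≠ i.castSucc := (Fin.castSucc_lt_last i).ne'
      simp only [halfWord_succ, Fin.init_update_castSucc, Function.update_of_ne h, ih]
      exact tm_smul_left _ _ _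

/-- `halfWord` as a multilinear map. -/
def halfMulti (n : ℕ) : MultilinearMap 𝕜 (fun _ : Fin n => A.carrier) (step A n).P.carrier where
  toFun := halfWord A n
  map_update_add' {dec} a i x y := by
    rw [Subsingleton.elim dec (instDecidableEqFin n)]
    exact halfWord_update_add A n a i x y
  map_update_smul' {dec} a i c x := by
    rw [Subsingleton.elim dec (instDecidableEqFin n)]
    exact halfWord_update_smul A n a i c x

theorem halfWord_eq_zero (n : ℕ) (a : Fin n → A.carrier) (i : Fin n) (h : sq A (a i) = 0) :
    halfWord A n a = 0 := by
  induction n with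
  | zero => exact i.elim0
  | succ n ih =>
    rw [halfWord_succ]
    revert h
    refine Fin.lastCases (fun h => ?_) (fun i h => ?_) i
    · rw [h]
      exact tm_zero_right _
    · rw [ih (Fin.init a) i h]
      exact tm_zero_left _

theorem halfWord_bound (n : ℕ) (R : Seminorm 𝕜 (step A n).P.carrier) (hR : Continuous R) :
    ∃ (p : Seminorm 𝕜 A.carrier) (C : ℝ), Continuous p ∧ 0 ≤ C ∧ (∀ a, p (A.sgn a) = p a) ∧
      ∀ a : Fin n → A.carrier, R (halfWord A n a) ≤ C * ∏ i, p (a i) := by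
  induction n with
  | zero => exact ⟨0, R A.one, continuous_zero, apply_nonneg _ _, fun _ => rfl, fun a => by simp [halfWord]⟩
  | succ n ih =>
    obtain ⟨p₁, q, hp₁, hq, hb⟩ := bilin_bound (tmₗ 𝕜 (V := (step A n).P.carrier)
      (W := (susp A).carrier)) tm_continuous R hR
    obtain ⟨p, C, hp, hC, hpi, hpb⟩ := ih p₁ hp₁
    have hq' : Continuous (q.comp (sq A).toLinearMap) := hq.comp (sq A).continuous
    obtain ⟨P, hP, hPi, hle⟩ := exists_invariant A (p := p + q.comp (sq A).toLinearMap) (hp.add hq')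
    have hle' : ∀ a, p a + q (sq A a) ≤ P a := hle
    refine ⟨P, C, hP, hC, hPi, fun a => ?_⟩
    have h1 := hb (halfWord A n (Fin.init a)) (sq A (a (Fin.last n)))
    refine h1.trans ?_
    rw [Fin.prod_univ_castSucc, ← mul_assoc]
    refine mul_le_mul ((hpb _).trans (mul_le_mul_of_nonneg_left ?_ hC)) ?_ (apply_nonneg _ _)
      (mul_nonneg hC (Finset.prod_nonneg fun _ _ => apply_nonneg _ _))
    · refine Finset.prod_le_prod (fun _ _ => apply_nonneg _ _) fun i _ => ?_
      exact (le_add_of_nonneg_right (apply_nonneg q _)).trans (hle' (a i.castSucc))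
    · exact (le_add_of_nonneg_left (apply_nonneg p _)).trans (hle' _)

theorem halfWord_sgn (n : ℕ) (a : Fin n → A.carrier) :
    (step A n).P.sgn (halfWord A n a) = halfWord A n fun i => sigma A (a i) := by
  induction n with
  | zero => exact sgn_one A
  | succ n ih =>
    refine (GrSp.sgn_tm (V := (step A n).P.toGrSp) (W := (susp A).toGrSp) _ _).trans ?_
    rw [ih, susp_sgn, ← map_neg]
    rfl

theorem halfWord_deg (n : ℕ) (d : Fin n → ℤ) (a : Fin n → A.carrier)
    (ha : ∀ i, A.Deg (d i + 1) (a i)) : (step A n).P.Deg (∑ i, d i) (halfWord A n a) := by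
  induction n with
  | zero => exact A.one_deg
  | succ n ih =>
    rw [Fin.sum_univ_castSucc]
    exact GrSp.Deg.tm (V := (step A n).P.toGrSp) (W := (susp A).toGrSp)
      (ih (fun i => d i.castSucc) (Fin.init a) fun i => ha i.castSucc) (susp_deg A (ha _))

/-- The element `a₀ ⊗ a₁ ⊗ ⋯ ⊗ aₙ` of `A ⊗̂ (sĀ)^⊗̂n`. -/
def fullWord (n : ℕ) (b : A.carrier) (a : Fin n → A.carrier) : (step A n).P.carrier :=
  (step A n).P.L (tm 𝕜 b (halfWord A n a))

theorem fullWord_one (n : ℕ) (a : Fin n → A.carrier) : fullWord A n A.one a = halfWord A n a :=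
  (step A n).P.L_one _

theorem fullWord_zero (b : A.carrier) (a : Fin 0 → A.carrier) : fullWord A 0 b a = b := A.mul_one b

theorem fullWord_succ (n : ℕ) (b : A.carrier) (a : Fin (n + 1) → A.carrier) : fullWord A (n + 1) b a =
    (tm 𝕜 (fullWord A n b (Fin.init a)) (sq A (a (Fin.last n))) :
      CT 𝕜 (step A n).P.carrier (susp A).carrier) := by
  change ctMap (step A n).P.L (ContinuousLinearMap.id 𝕜 (susp A).carrier)
    (ctAssocInv 𝕜 A.carrier (step A n).P.carrier (susp A).carrier (tm 𝕜 b (tm 𝕜 _ _))) = _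
  rw [ctAssocInv_tm, ctMap_tm]
  rfl

theorem fullWord_snoc (n : ℕ) (b : A.carrier) (a : Fin n → A.carrier) (c : A.carrier) :
    fullWord A (n + 1) b (Fin.snoc a c : Fin (n + 1) → A.carrier) =
      (tm 𝕜 (fullWord A n b a) (sq A c) : CT 𝕜 (step A n).P.carrier (susp A).carrier) := by
  rw [fullWord_succ, Fin.init_snoc, Fin.snoc_last]

variable {A}

theorem step_ext {n : ℕ} {Z : Type*} [AddCommGroup Z] [Module 𝕜 Z] [TopologicalSpace Z] [T2Space Z]
    {f g : (step A n).P.carrier →L[𝕜] Z} (h : ∀ b a, f (fullWord A n b a) = g (fullWord A n b a)) :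
    f = g := by
  induction n with
  | zero =>
    ext x
    have e : fullWord A 0 x Fin.elim0 = x := fullWord_zero A x _
    have := h x Fin.elim0
    rwa [e] at this
  | succ n ih =>
    refine ContinuousLinearMap.ext fun x => BarStep.red_tm_ext (W := (step A n).P.toGrSp) f g
      (fun w c => ?_) x
    have := ih (f := f ∘L (tmR (step A n).P.carrier (sq A c) : _ →L[𝕜]
        CT 𝕜 (step A n).P.carrier (susp A).carrier)) (g := g ∘L tmR (step A n).P.carrier (sq A c)) fun b a => by
      have := h b (Fin.snoc a c : Fin (n + 1) → A.carrier)
      rw [fullWord_snoc] at this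
      exact this
    exact congrArg (fun F => F w) this

theorem step_hasDeg {n : ℕ} {k : ℤ} {V : GrSp.{u} 𝕜} {f : (step A n).P.carrier →L[𝕜] V.carrier}
    (h : ∀ i (d : Fin n → ℤ) b a, A.Deg i b → (∀ j, A.Deg (d j + 1) (a j)) →
      V.Deg (i + ∑ j, d j + k) (f (fullWord A n b a))) :
    GrSp.HasDeg (V := (step A n).P.toGrSp) (W := V) k f := by
  induction n generalizing k with
  | zero =>
    intro i b hb
    have := h i Fin.elim0 b Fin.elim0 hb fun j => j.elim0
    have e : fullWord A 0 b Fin.elim0 = b := fullWord_zero A b _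
    rw [e] at this
    simpa using this
  | succ n ih =>
    refine GrSp.tens_hasDeg (V := (step A n).P.toGrSp) (W := (susp A).toGrSp) fun i j w x hw hx => ?_
    obtain ⟨c, hc, rfl⟩ := susp_cases hx
    have := ih (k := j + k) (f := f ∘L (tmR (step A n).P.carrier (sq A c) : _ →L[𝕜]
        CT 𝕜 (step A n).P.carrier (susp A).carrier)) (fun i d b a hb ha => by
      have := h i (Fin.snoc d j : Fin (n + 1) → ℤ) b (Fin.snoc a c : Fin (n + 1) → A.carrier) hb fun l => by
        refine Fin.lastCases ?_ (fun l => ?_) l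
        · rw [Fin.snoc_last, Fin.snoc_last]
          exact hc
        · rw [Fin.snoc_castSucc, Fin.snoc_castSucc]
          exact ha l
      rw [fullWord_snoc, Fin.sum_snoc, ← add_assoc, add_assoc _ j k] at this
      exact this) i w hw
    rwa [← add_assoc] at this

/-- A continuous map on `A ⊗̂ (sĀ)^⊗̂n` is bounded as soon as its values on words are. -/
theorem exists_step_seminorm (n : ℕ) {p : Seminorm 𝕜 A.carrier} (hp : Continuous p) :
    ∃ R : Seminorm 𝕜 (step A n).P.carrier, Continuous R ∧
      ∀ (f : (step A n).P.carrier →L[𝕜] A.carrier) (r : Seminorm 𝕜 A.carrier) (C : ℝ), Continuous r → 0 ≤ C →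
        (∀ b a, r (f (fullWord A n b a)) ≤ C * (p b * ∏ i, p (a i))) → ∀ y, r (f y) ≤ C * R y := by
  induction n with
  | zero =>
    refine ⟨p, hp, fun f r C _ _ h y => ?_⟩
    have := h y Fin.elim0
    have e : fullWord A 0 y Fin.elim0 = y := fullWord_zero A y _
    rw [e, Fin.prod_univ_zero, mul_one] at this
    exact this
  | succ n ih =>
    obtain ⟨R, hR, hRb⟩ := ih
    obtain ⟨Q, hQ, hQt⟩ := exists_ctSeminorm R hR (p.comp (sec A).toLinearMap) (hp.comp (sec A).continuous)
    refine ⟨Q, hQ, fun f r C hr hC h y => ?_⟩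
    refine ct_bound (V := (step A n).P.carrier) (W := (susp A).carrier) f r hr R
      (p.comp (sec A).toLinearMap) hQ hQt hC (fun w x => ?_) y
    have hx : sq A (sec A x) = x := redQ_redSec A x
    change _ ≤ C * (R w * p (sec A x))
    have := hRb (f ∘L (tmR (step A n).P.carrier x : _ →L[𝕜]
      CT 𝕜 (step A n).P.carrier (susp A).carrier)) r (C * p (sec A x)) hr (mul_nonneg hC (apply_nonneg _ _))
      (fun b a => by
        have := h b (Fin.snoc a (sec A x) : Fin (n + 1) → A.carrier)
        rw [fullWord_snoc, hx, Fin.prod_univ_castSucc] at this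
        simp only [Fin.snoc_castSucc, Fin.snoc_last] at this
        refine this.trans_eq (by ring)) w
    refine this.trans_eq (by ring)

/-- Bounded normalized multilinear maps extend to `A ⊗̂ (sĀ)^⊗̂n`. -/
theorem exists_step_lift (n : ℕ) (Φ : A.carrier →ₗ[𝕜] TensorAlgebra 𝕜 A.carrier →ₗ[𝕜] A.carrier)
    (hN : ∀ b l, l.length = n → (∃ x ∈ l, sq A x = 0) → Φ b (wd 𝕜 l) = 0)
    (hB : ∀ r : Seminorm 𝕜 A.carrier, Continuous r → ∃ (p : Seminorm 𝕜 A.carrier) (C : ℝ),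
      Continuous p ∧ 0 ≤ C ∧ ∀ b l, l.length = n → r (Φ b (wd 𝕜 l)) ≤ C * (p b * (l.map p).prod)) :
    ∃ f : (step A n).P.carrier →L[𝕜] A.carrier, ∀ b a, f (fullWord A n b a) = Φ b (wd 𝕜 (List.ofFn a)) := by
  induction n generalizing Φ with
  | zero =>
    refine ⟨⟨Φ.flip (wd 𝕜 []), linear_cont _ fun r hr => ?_⟩, fun b a => ?_⟩
    · obtain ⟨p, C, hp, hC, h⟩ := hB r hr
      let c : NNReal := ⟨C, hC⟩
      refine ⟨c • p, continuous_const.mul hp, fun b => ?_⟩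
      have : r (Φ b 1) ≤ C * p b := by simpa using h b [] rfl
      exact this
    · rw [fullWord_zero]
      rfl
  | succ n ih =>
    have hr : ∀ (c : A.carrier) (l : List A.carrier), LinearMap.mulRight 𝕜 (TensorAlgebra.ι 𝕜 c) (wd 𝕜 l) =
        wd 𝕜 (l ++ [c]) := fun c l => by simp [wd_append, wd_singleton]
    let Ψ (c : A.carrier) : A.carrier →ₗ[𝕜] TensorAlgebra 𝕜 A.carrier →ₗ[𝕜] A.carrier :=
      Φ.compl₂ (LinearMap.mulRight 𝕜 (TensorAlgebra.ι 𝕜 c))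
    have hΨ : ∀ c b l, Ψ c b (wd 𝕜 l) = Φ b (wd 𝕜 (l ++ [c])) := fun c b l => by
      change Φ b (LinearMap.mulRight 𝕜 _ _) = _
      rw [hr]
    choose G hG using fun c => ih (Ψ c)
      (fun b l hl hx => by
        rw [hΨ]
        obtain ⟨x, hx, h⟩ := hx
        exact hN b _ (by simp [hl]) ⟨x, by simp [hx], h⟩)
      (fun r hr => by
        obtain ⟨p, C, hp, hC, h⟩ := hB r hr
        refine ⟨p, C * p c, hp, mul_nonneg hC (apply_nonneg _ _), fun b l hl => ?_⟩
        rw [hΨ]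
        have := h b (l ++ [c]) (by simp [hl])
        rw [List.map_append, List.prod_append, List.map_singleton, List.prod_singleton] at this
        exact this.trans_eq (by ring))
    have hadd : ∀ c c', G (c + c') = G c + G c' := fun c c' => step_ext fun b a => by
      rw [add_apply, hG, hG, hG]
      simp [hΨ, wd_append, wd_singleton, mul_add]
    have hsmul : ∀ (t : 𝕜) c, G (t • c) = t • G c := fun t c => step_ext fun b a => by
      rw [smul_apply, hG, hG]
      simp [hΨ, wd_append, wd_singleton]
    let β : (step A n).P.carrier →ₗ[𝕜] (susp A).carrier →ₗ[𝕜] A.carrier :=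
      LinearMap.mk₂ 𝕜 (fun y x => G (sec A x) y) (fun y y' x => map_add _ _ _)
        (fun t y x => map_smul _ _ _) (fun y x x' => by rw [map_add, hadd, add_apply])
        (fun t y x => by rw [map_smul, hsmul, smul_apply])
    have hβ : Continuous fun z : (step A n).P.carrier × (susp A).carrier => β z.1 z.2 := by
      refine bilin_cont _ fun r hr => ?_
      obtain ⟨p, C, hp, hC, h⟩ := hB r hr
      obtain ⟨R, hR, hRb⟩ := exists_step_seminorm n hp
      let c : NNReal := ⟨C, hC⟩
      refine ⟨c • R, p.comp (sec A).toLinearMap, continuous_const.mul hR,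
        hp.comp (sec A).continuous, fun y x => ?_⟩
      refine (hRb (G (sec A x)) r (C * p (sec A x)) hr (mul_nonneg hC (apply_nonneg _ _)) (fun b a => ?_)
        y).trans_eq ?_
      · rw [hG, hΨ]
        have := h b (List.ofFn a ++ [sec A x]) (by simp)
        rw [List.map_append, List.prod_append, List.map_singleton, List.prod_singleton, List.map_ofFn,
          List.prod_ofFn] at this
        exact this.trans_eq (by simp only [Function.comp_apply]; ring)
      · change _ = C * R y * p (sec A x)
        ring
    refine ⟨ctLift β hβ, fun b a => ?_⟩
    rw [fullWord_succ]
    refine (ctLift_tm β hβ _ _).trans ?_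
    change G (sec A (sq A (a (Fin.last n)))) _ = _
    obtain ⟨t, ht⟩ := sec_sq A (a (Fin.last n))
    have h0 : Φ b (wd 𝕜 (List.ofFn (Fin.init a) ++ [A.one])) = 0 :=
      hN _ _ (by simp) ⟨A.one, by simp, sq_one A⟩
    have h1 : List.ofFn a = List.ofFn (Fin.init a) ++ [a (Fin.last n)] := by
      rw [List.ofFn_succ', List.concat_eq_append]
      rfl
    rw [ht, hG, hΨ, h1]
    rw [wd_append, wd_singleton] at h0 ⊢
    rw [wd_append, wd_singleton, map_add, map_smul, mul_add, map_add, mul_smul_comm, map_smul, h0,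
      smul_zero, add_zero]

end HalfWord

section HomDegree

variable {𝕜 : Type} [RCLike 𝕜] {A : DGAlg.{u} 𝕜}

variable (A) in
/-- The `k`-th power of the parity operator of `A`. -/
def sgnPow (k : ℤ) : A.carrier →L[𝕜] A.carrier := if Even k then ContinuousLinearMap.id 𝕜 _ else A.sgn

theorem sgnPow_deg {m : ℤ} {a : A.carrier} (ha : A.Deg m a) (k : ℤ) :
    sgnPow A k a = ((-1 : 𝕜) ^ (m * k)) • a := by
  rw [sgnPow]
  split_ifs with h
  · rw [(h.mul_left m).neg_one_zpow, one_smul]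
    rfl
  · obtain ⟨j, rfl⟩ := Int.not_even_iff_odd.1 h
    rw [ha.sgn, Bimod.neg_one_zpow_congr (m := m) (n := m * (2 * j + 1)) ⟨-(m * j), by ring⟩]

theorem sgnPow_mul (k : ℤ) (a b : A.carrier) :
    sgnPow A k (A.mul (tm 𝕜 a b)) = A.mul (tm 𝕜 (sgnPow A k a) (sgnPow A k b)) := by
  rw [sgnPow]
  split_ifs
  · rfl
  · exact sgn_mul a b

theorem sgnPow_one (k : ℤ) : sgnPow A k A.one = A.one := by
  rw [sgnPow]
  split_ifs
  · rfl
  · exact sgn_one A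

/-- Maps of degree `k` of right `Aᵉ`-modules are the bimodule maps with Koszul signs. -/
theorem mem_HomDeg_toMod {M N : Bimod A} {k : ℤ} {f : M.carrier →L[𝕜] N.carrier} :
    f ∈ HomDeg M.toMod N.toMod k ↔ GrSp.HasDeg (V := M.toGrSp) (W := N.toGrSp) k f ∧
      (∀ a x, f (M.L (tm 𝕜 a x)) = N.L (tm 𝕜 (sgnPow A k a) (f x))) ∧
        ∀ x a, f (M.R (tm 𝕜 x a)) = N.R (tm 𝕜 (f x) a) := by
  constructor
  · rintro ⟨hd, hl⟩
    have hl' : ∀ x s, f (M.envAct (tm 𝕜 x s)) = N.envAct (tm 𝕜 (f x) s) := hl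
    refine ⟨hd, fun a x => ?_, fun x a => ?_⟩
    · refine homog_ext_apply (V := A.toGrSp) (f ∘L M.L ∘L tmR _ x) (N.L ∘L tmR _ (f x) ∘L sgnPow A k)
        (fun m a ha => ?_) a
      refine homog_ext_apply (V := M.toGrSp) (f ∘L M.L ∘L tmL _ a) (N.L ∘L tmL _ (sgnPow A k a) ∘L f)
        (fun n y hy => ?_) x
      have h := hl' y (tm 𝕜 a A.one)
      have e := N.envAct_tm (x := f y) (b := A.one) ha (hd n y hy)
      rw [M.envAct_tm ha hy, M.R_one, map_smul] at h
      rw [N.R_one] at e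
      replace h := h.trans e
      have h2 := congrArg (fun z => ((-1 : 𝕜) ^ (m * n)) • z) h
      simp only [smul_smul, GrSp.neg_one_zpow_mul_self, one_smul] at h2
      simp only [ContinuousLinearMap.comp_apply, tmL_apply, h2, sgnPow_deg ha, tm_smul_left, map_smul]
      rw [← zpow_add₀ (by simp), Bimod.neg_one_zpow_congr (m := m * n + m * (n + k)) (n := m * k)
        ⟨m * n, by ring⟩]
    · refine homog_ext_apply (V := M.toGrSp) (f ∘L M.R ∘L tmR _ a) (N.R ∘L tmR _ a ∘L f)
        (fun n y hy => ?_) x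
      have h := hl' y (tm 𝕜 A.one a)
      have e := N.envAct_tm (x := f y) (b := a) A.one_deg (hd n y hy)
      rw [M.envAct_tm A.one_deg hy, M.L_one, zero_mul, zpow_zero, one_smul] at h
      rw [N.L_one, zero_mul, zpow_zero, one_smul] at e
      exact h.trans e
  · rintro ⟨hd, hL, hR⟩
    refine ⟨hd, fun x s => ?_⟩
    refine tens_ext_apply (V := A.toGrSp) (W := A.toGrSp) (f ∘L M.envAct ∘L tmL _ x)
      (N.envAct ∘L tmL _ (f x)) (fun m l a b ha hb => ?_) s
    refine homog_ext_apply (V := M.toGrSp) (f ∘L M.envAct ∘L tmR _ (tm 𝕜 a b))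
      (N.envAct ∘L tmR _ (tm 𝕜 a b) ∘L f) (fun n y hy => ?_) x
    simp only [ContinuousLinearMap.comp_apply, tmR_apply, M.envAct_tm ha hy, N.envAct_tm ha (hd n y hy),
      map_smul, hL, hR, sgnPow_deg ha, tm_smul_left, smul_smul]
    rw [← zpow_add₀ (by simp), Bimod.neg_one_zpow_congr (m := m * n + m * k) (n := m * (n + k))
        ⟨0, by ring⟩]

end HomDegree

section Cochains

variable {𝕜 : Type} [RCLike 𝕜] {A : DGAlg.{u} 𝕜} {N : ℤ}

/-- The components of a cochain. -/
def cochainMap (f : HCPi A N) (n : ℕ) : CT 𝕜 (step A n).P.carrier A.carrier →L[𝕜] A.carrier := f.1 n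

theorem cochainMap_mem (f : HCPi A N) (n : ℕ) :
    cochainMap f n ∈ HomDeg (step A n).bim.toMod (Bimod.self A).toMod (N + 1) := f.2 n trivial

theorem tm_fullWord (n : ℕ) (b : A.carrier) (a : Fin n → A.carrier) (c : A.carrier) :
    tm 𝕜 (fullWord A n b a) c =
      (step A n).bim.R (tm 𝕜 ((step A n).bim.L (tm 𝕜 b (tm 𝕜 (halfWord A n a) A.one))) c) := by
  simp [fullWord, A.one_mul]

theorem cochainMap_fullWord (f : HCPi A N) (n : ℕ) (b : A.carrier) (a : Fin n → A.carrier) (c : A.carrier) :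
    cochainMap f n (tm 𝕜 (fullWord A n b a) c) = A.mul (tm 𝕜 (A.mul (tm 𝕜 (sgnPow A (N + 1) b)
      (cochainMap f n (tm 𝕜 (halfWord A n a) A.one)))) c) := by
  obtain ⟨-, hL, hR⟩ := mem_HomDeg_toMod.1 (cochainMap_mem f n)
  rw [tm_fullWord]
  exact (hR _ c).trans (congrArg (fun z => A.mul (tm 𝕜 z c)) (hL b _))

theorem bim_ext_fullWord {n : ℕ} {Z : Type*} [AddCommGroup Z] [Module 𝕜 Z] [TopologicalSpace Z] [T2Space Z]
    {f g : CT 𝕜 (step A n).P.carrier A.carrier →L[𝕜] Z}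
    (h : ∀ b a c, f (tm 𝕜 (fullWord A n b a) c) = g (tm 𝕜 (fullWord A n b a) c)) : f = g := by
  refine ct_ext fun w c => ?_
  have := step_ext (f := f ∘L tmR _ c) (g := g ∘L tmR _ c) fun b a => h b a c
  exact congrArg (fun F => F w) this

theorem cochain_ext {f g : HCPi A N} {n : ℕ} (h : ∀ a : Fin n → A.carrier,
    cochainMap f n (tm 𝕜 (halfWord A n a) A.one) = cochainMap g n (tm 𝕜 (halfWord A n a) A.one)) :
    f.1 n = g.1 n := by
  have : cochainMap f n = cochainMap g n := bim_ext_fullWord fun b a c => by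
    rw [cochainMap_fullWord, cochainMap_fullWord, h]
  exact this

/-- The multilinear maps of a cochain. -/
def evalMulti (f : HCPi A N) (n : ℕ) : MultilinearMap 𝕜 (fun _ : Fin n => A.carrier) A.carrier :=
  (cochainMap f n ∘L tmR _ A.one).toLinearMap.compMultilinearMap (halfMulti A n)

theorem evalMulti_apply (f : HCPi A N) (n : ℕ) (a : Fin n → A.carrier) :
    evalMulti f n a = cochainMap f n (tm 𝕜 (halfWord A n a) A.one) := rfl

theorem ofMulti_evalMulti_mem (f : HCPi A N) : ofMulti (evalMulti f) ∈ opsDeg A N := by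
  refine ⟨fun n r hr => ?_, fun l hl => ?_, fun x => ?_⟩
  · obtain ⟨p, C, hp, hC, hpi, h⟩ := halfWord_bound A n
      (r.comp (cochainMap f n ∘L tmR _ A.one).toLinearMap) (hr.comp (ContinuousLinearMap.continuous _))
    refine ⟨p, C, hp, hC, hpi, fun l hl => ?_⟩
    subst hl
    have := h l.get
    rw [ofMulti_wd, evalMulti_apply]
    refine this.trans_eq ?_
    conv_rhs => rw [← List.ofFn_get l, List.map_ofFn, List.prod_ofFn]
    rfl
  · have hd := (mem_HomDeg_toMod.1 (cochainMap_mem f l.length)).1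
    have h1 := halfWord_deg A l.length (fun i => (l.get i).1) (fun i => (l.get i).2) fun i =>
      hl _ (List.get_mem _ _)
    have h2 := hd _ _ (h1.tm A.one_deg)
    have e1 : l.map Prod.snd = List.ofFn fun i => (l.get i).2 := by
      conv_lhs => rw [← List.ofFn_get l, List.map_ofFn]
      rfl
    have e2 : (l.map Prod.fst).sum = ∑ i, (l.get i).1 := by
      conv_lhs => rw [← List.ofFn_get l, List.map_ofFn, List.sum_ofFn]
      rfl
    rw [e1, e2, ofMulti_ofFn, evalMulti_apply, add_assoc]
    rw [add_zero] at h2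
    exact h2
  · have : ofMulti (evalMulti f) ∘ₗ (sgp (sigma A) 1).toLinearMap =
        ((-1 : 𝕜) ^ N) • (sigma A ∘ₗ ofMulti (evalMulti f)) := wd_ext fun l => by
      have ht : tau (sigma A) 1 = sigma A := by simp [tau]
      have e1 : l.map (sigma A) = List.ofFn fun i => sigma A (l.get i) := by
        conv_lhs => rw [← List.ofFn_get l, List.map_ofFn]
        rfl
      have hd := (mem_HomDeg_toMod.1 (cochainMap_mem f l.length)).1
      have h1 := GrSp.sgn_tm (V := (step A l.length).P.toGrSp) (W := A.toGrSp) (halfWord A l.length l.get) A.one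
      have h2 := hd.sgn (tm 𝕜 (halfWord A l.length l.get) A.one)
      have h3 : cochainMap f l.length (tm 𝕜 (halfWord A l.length fun i => sigma A (l.get i)) A.one) =
          ((-1 : 𝕜) ^ (N + 1)) • A.sgn (cochainMap f l.length (tm 𝕜 (halfWord A l.length l.get) A.one)) := by
        rw [← halfWord_sgn]
        rw [sgn_one] at h1
        have h4 := congrArg (fun z => ((-1 : 𝕜) ^ (N + 1)) • z) h2
        simp only [smul_smul, GrSp.neg_one_zpow_mul_self, one_smul] at h4
        exact (congrArg (cochainMap f l.length) h1).symm.trans h4.symm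
      rw [LinearMap.comp_apply, AlgHom.toLinearMap_apply, sgp_wd, ht, e1, ofMulti_ofFn, evalMulti_apply, h3,
        LinearMap.smul_apply, LinearMap.comp_apply, ofMulti_wd, evalMulti_apply, zpow_add₀ (by simp)]
      simp [sigma]
    exact LinearMap.congr_fun this x

variable (A N) in
/-- Cochains as operations on `A`. -/
def hcOps : HCPi A N →ₗ[𝕜] Ops A N where
  toFun f := ⟨ofMulti (evalMulti f), ofMulti_evalMulti_mem f⟩
  map_add' f g := Subtype.ext <| wd_ext fun l => by
    change _ = ofMulti (evalMulti f) _ + ofMulti (evalMulti g) _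
    rw [ofMulti_wd, ofMulti_wd, ofMulti_wd]
    rfl
  map_smul' c f := Subtype.ext <| wd_ext fun l => by
    change _ = c • ofMulti (evalMulti f) _
    rw [ofMulti_wd, ofMulti_wd]
    rfl

theorem hcOps_wd (f : HCPi A N) (l : List A.carrier) : (hcOps A N f).1 (wd 𝕜 l) = evalCochain f l :=
  ofMulti_wd _ l

theorem hcOps_ofFn (f : HCPi A N) {n : ℕ} (a : Fin n → A.carrier) :
    (hcOps A N f).1 (wd 𝕜 (List.ofFn a)) = cochainMap f n (tm 𝕜 (halfWord A n a) A.one) :=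
  ofMulti_ofFn _ a

theorem hcOps_injective : Function.Injective (hcOps A N) := fun f g h => by
  refine Subtype.ext (funext fun n => cochain_ext fun a => ?_)
  rw [← hcOps_ofFn, ← hcOps_ofFn, h]

theorem hcOps_normalized (f : HCPi A N) : IsNormalized (hcOps A N f).1 := by
  rintro l ⟨x, hx, h⟩
  obtain ⟨i, rfl⟩ := List.get_of_mem hx
  rw [hcOps_wd, evalCochain, halfWord_eq_zero A _ _ i h]
  exact (congrArg (cochainMap f l.length) (tm_zero_left A.one)).trans (map_zero _)

theorem exists_hcOps {φ : Ops A N} (h : IsNormalized φ.1) : ∃ f, hcOps A N f = φ := by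
  let Φ : A.carrier →ₗ[𝕜] TensorAlgebra 𝕜 A.carrier →ₗ[𝕜] A.carrier :=
    ((tmₗ 𝕜).compr₂ A.mul.toLinearMap).compl₁₂ (sgnPow A (N + 1)).toLinearMap φ.1
  have hΦ : ∀ b x, Φ b x = A.mul (tm 𝕜 (sgnPow A (N + 1) b) (φ.1 x)) := fun b x => rfl
  choose G hG using fun n => exists_step_lift n Φ
    (fun b l _ hx => by rw [hΦ, h l hx, tm_zero_right, map_zero])
    (fun r hr => by
      obtain ⟨p, q, hp, hq, hb⟩ := bilin_bound (tmₗ 𝕜 (V := A.carrier) (W := A.carrier)) tm_continuous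
        (r.comp A.mul.toLinearMap) (hr.comp A.mul.continuous)
      obtain ⟨p', C, hp', hC, hpi, hb'⟩ := φ.2.1 n q hq
      have hP : Continuous (p.comp (sgnPow A (N + 1)).toLinearMap) := hp.comp (ContinuousLinearMap.continuous _)
      refine ⟨p.comp (sgnPow A (N + 1)).toLinearMap + p', C, hP.add hp', hC, fun b l hl => ?_⟩
      refine (hb (sgnPow A (N + 1) b) (φ.1 (wd 𝕜 l))).trans ?_
      have h1 : p (sgnPow A (N + 1) b) ≤ (p.comp (sgnPow A (N + 1)).toLinearMap + p') b :=
        le_add_of_nonneg_right (apply_nonneg p' b)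
      have h2 : q (φ.1 (wd 𝕜 l)) ≤ C * (l.map (p.comp (sgnPow A (N + 1)).toLinearMap + p')).prod :=
        (hb' l hl).trans (mul_le_mul_of_nonneg_left (list_prod_mono
          (fun x => le_add_of_nonneg_left (apply_nonneg p (sgnPow A (N + 1) x)) :
            ∀ x, p' x ≤ (p.comp (sgnPow A (N + 1)).toLinearMap + p') x) l) hC)
      refine (mul_le_mul h1 h2 (apply_nonneg _ _) (apply_nonneg _ _)).trans_eq (by ring))
  let F (n : ℕ) : CT 𝕜 (step A n).P.carrier A.carrier →L[𝕜] A.carrier :=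
    A.mul ∘L ctMap (G n) (ContinuousLinearMap.id 𝕜 A.carrier)
  have hF : ∀ n w c, F n (tm 𝕜 w c) = A.mul (tm 𝕜 (G n w) c) := fun n w c => by simp [F]
  have hF' : ∀ n b a c, F n (tm 𝕜 (fullWord A n b a) c) =
      A.mul (tm 𝕜 (A.mul (tm 𝕜 (sgnPow A (N + 1) b) (φ.1 (wd 𝕜 (List.ofFn a))))) c) := fun n b a c => by
    rw [hF, hG, hΦ]
  have hmem : ∀ n, F n ∈ HomDeg (step A n).bim.toMod (Bimod.self A).toMod (N + 1) := by
    intro n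
    have hGd : GrSp.HasDeg (V := (step A n).P.toGrSp) (W := A.toGrSp) (N + 1) (G n) := by
      refine step_hasDeg fun i d b a hb ha => ?_
      rw [hG, hΦ, sgnPow_deg hb, tm_smul_left, map_smul]
      have h1 := φ.2.2.1 (List.ofFn fun j => (d j, a j)) (by
        intro x hx
        obtain ⟨j, rfl⟩ := (List.mem_ofFn' _ _).1 hx
        exact ha j)
      rw [List.map_ofFn, List.map_ofFn, List.sum_ofFn] at h1
      have h2 := (A.mul_deg _ _ _ _ hb h1).smul ((-1 : 𝕜) ^ (i * (N + 1)))
      simp only [Function.comp_def] at h2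
      convert h2 using 1
      ring
    refine mem_HomDeg_toMod.2 ⟨?_, fun a x => ?_, fun x a => ?_⟩
    · refine GrSp.tens_hasDeg (V := (step A n).P.toGrSp) (W := A.toGrSp) fun i j w c hw hc => ?_
      rw [hF]
      have := A.mul_deg _ _ _ _ (hGd i w hw) hc
      rwa [show i + (N + 1) + j = i + j + (N + 1) by ring] at this
    · have : F n ∘L (step A n).bim.L ∘L tmL _ a = A.mul ∘L tmL _ (sgnPow A (N + 1) a) ∘L F n :=
        bim_ext_fullWord fun b l c => by
          have e : (step A n).bim.L (tm 𝕜 a (tm 𝕜 (fullWord A n b l) c)) =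
              tm 𝕜 (fullWord A n (A.mul (tm 𝕜 a b)) l) c := by
            simp [fullWord, (step A n).P.L_mul]
          change F n ((step A n).bim.L (tm 𝕜 a (tm 𝕜 (fullWord A n b l) c))) =
            A.mul (tm 𝕜 (sgnPow A (N + 1) a) (F n (tm 𝕜 (fullWord A n b l) c)))
          rw [e, hF', hF', sgnPow_mul]
          simp only [A.mul_assoc]
      exact congrArg (fun T => T x) this
    · have : F n ∘L (step A n).bim.R ∘L tmR _ a = A.mul ∘L tmR _ a ∘L F n :=
        bim_ext_fullWord fun b l c => by
          have e : (step A n).bim.R (tm 𝕜 (tm 𝕜 (fullWord A n b l) c) a) =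
              tm 𝕜 (fullWord A n b l) (A.mul (tm 𝕜 c a)) := by simp
          change F n ((step A n).bim.R (tm 𝕜 (tm 𝕜 (fullWord A n b l) c) a)) =
            A.mul (tm 𝕜 (F n (tm 𝕜 (fullWord A n b l) c)) a)
          rw [e, hF', hF']
          exact (A.mul_assoc _ _ _).symm
      exact congrArg (fun T => T x) this
  refine ⟨⟨F, fun n _ => hmem n⟩, Subtype.ext (wd_ext fun l => ?_)⟩
  rw [hcOps_wd]
  change F l.length (tm 𝕜 (halfWord A l.length l.get) A.one) = _
  rw [← fullWord_one, hF', sgnPow_one, A.one_mul, A.mul_one, List.ofFn_get]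

end Cochains

section ContinuousCochains

variable {𝕜 : Type} [RCLike 𝕜] {A : DGAlg.{u} 𝕜} {N : ℤ}

theorem barIncl_small {U : Set (∀ n : ℕ, (step A n).bim.carrier)}
    (hU : U ∈ 𝓝 (0 : ∀ n : ℕ, (step A n).bim.carrier)) :
    ∀ᶠ n in cofinite, ∀ x, (barIncl A n x : ∀ n, (step A n).bim.carrier) ∈ U := by
  rw [nhds_pi, Filter.mem_pi] at hU
  obtain ⟨I, hI, t, ht, hsub⟩ := hU
  rw [Filter.eventually_cofinite]
  refine hI.subset fun n hn => ?_
  by_contra hnI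
  refine hn fun x => hsub fun k hk => ?_
  have : (barIncl A n x : ∀ n, (step A n).bim.carrier) k = 0 := barIncl_ne A (by rintro rfl; exact hnI hk) x
  rw [this]
  exact mem_of_mem_nhds (ht k)

theorem hasSum_barIncl (x : (Bar A).carrier) :
    HasSum (fun n => barIncl A n ((x : ∀ n, (step A n).bim.carrier) n)) x := by
  refine Pi.hasSum (f := fun n => (barIncl A n ((x : ∀ n, (step A n).bim.carrier) n) :
    ∀ n, (step A n).bim.carrier)).2 fun m => ?_
  have h := hasSum_single (f := fun n => (barIncl A n ((x : ∀ n, (step A n).bim.carrier) n) :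
    ∀ n, (step A n).bim.carrier) m) m fun n hn => barIncl_ne A (Ne.symm hn) _
  rwa [barIncl_same] at h

theorem hcIncl_injective : Function.Injective (hcIncl A N) := fun f g h => by
  refine Subtype.ext (ContinuousLinearMap.ext fun x => ?_)
  have e : ∀ n y, f.1 (barIncl A n y) = g.1 (barIncl A n y) := fun n y =>
    congrArg (fun F : HCPi A N => cochainMap F n y) h
  have hf : HasSum (fun n => f.1 (barIncl A n ((x : ∀ n, (step A n).bim.carrier) n))) (f.1 x) :=
    (hasSum_barIncl x).mapL f.1
  have hg : HasSum (fun n => g.1 (barIncl A n ((x : ∀ n, (step A n).bim.carrier) n))) (g.1 x) :=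
    (hasSum_barIncl x).mapL g.1
  exact hf.unique (hg.congr_fun fun n => e n _)

variable (A N) in
/-- Continuous cochains as operations on `A`. -/
def contOps : HCCont A N →ₗ[𝕜] Ops A N := hcOps A N ∘ₗ hcIncl A N

theorem contOps_injective : Function.Injective (contOps A N) := hcOps_injective.comp hcIncl_injective

theorem contOps_normalized (f : HCCont A N) : IsNormalized (contOps A N f).1 := hcOps_normalized _

theorem contOps_small (f : HCCont A N) : IsSmall (contOps A N f).1 := fun r hr => by
  have hU : {x : (Bar A).carrier | r (f.1 x) < 1} ∈ 𝓝 (0 : (Bar A).carrier) :=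
    ball_mem_nhds (p := r.comp f.1.toLinearMap) (hr.comp f.1.continuous) one_pos
  have h := barIncl_small hU
  rw [Nat.cofinite_eq_atTop, Filter.eventually_atTop] at h
  obtain ⟨M, hM⟩ := h
  refine ⟨M, fun l hl => ?_⟩
  change r ((hcOps A N (hcIncl A N f)).1 _) = 0
  rw [hcOps_wd]
  exact seminorm_eq_zero r (f.1 ∘L barIncl A l.length).toLinearMap (hM _ hl)
    (tm 𝕜 (halfWord A l.length l.get) A.one)

theorem cochainMap_seminorm {h : HCPi A N} (hs : IsSmall (hcOps A N h).1) (r : Seminorm 𝕜 A.carrier)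
    (hr : Continuous r) : ∃ M : ℕ, ∀ n, M ≤ n → ∀ y, r (cochainMap h n y) = 0 := by
  obtain ⟨p, q, hp, hq, hb⟩ := bilin_bound (tmₗ 𝕜 (V := A.carrier) (W := A.carrier)) tm_continuous
    (r.comp A.mul.toLinearMap) (hr.comp A.mul.continuous)
  obtain ⟨p', q', hp', hq', hb'⟩ := bilin_bound (tmₗ 𝕜 (V := A.carrier) (W := A.carrier)) tm_continuous
    (p.comp A.mul.toLinearMap) (hp.comp A.mul.continuous)
  obtain ⟨M, hM⟩ := hs q' hq'
  refine ⟨M, fun n hn y => ?_⟩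
  refine GrSp.ct_seminorm_zero (V := (step A n).P.toGrSp) (W := A.toGrSp) (cochainMap h n) r hr
    (fun w c => ?_) y
  obtain ⟨R, -, hR⟩ := exists_step_seminorm (A := A) n (p := 0) continuous_zero
  refine le_antisymm ((hR (cochainMap h n ∘L tmR _ c) r 0 hr le_rfl (fun b a => ?_) w).trans_eq
    (zero_mul _)) (apply_nonneg _ _)
  rw [ContinuousLinearMap.comp_apply, tmR_apply, cochainMap_fullWord, ← hcOps_ofFn]
  have h1 : p (A.mul (tm 𝕜 (sgnPow A (N + 1) b) ((hcOps A N h).1 (wd 𝕜 (List.ofFn a))))) ≤ _ :=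
    hb' (sgnPow A (N + 1) b) ((hcOps A N h).1 (wd 𝕜 (List.ofFn a)))
  rw [hM _ (by simpa using hn), mul_zero] at h1
  refine (hb _ c).trans ?_
  rw [zero_mul]
  exact mul_nonpos_of_nonpos_of_nonneg h1 (apply_nonneg _ _)

theorem exists_contOps {φ : Ops A N} (hn : IsNormalized φ.1) (hs : IsSmall φ.1) :
    ∃ f, contOps A N f = φ := by
  obtain ⟨h, rfl⟩ := exists_hcOps hn
  let T (n : ℕ) : (Bar A).carrier →L[𝕜] A.carrier :=
    cochainMap h n ∘L (ContinuousLinearMap.proj n : (∀ n, (step A n).bim.carrier) →L[𝕜] (step A n).bim.carrier)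
  have hTs : Small T := (small_iff T).2 fun r hr => by
    obtain ⟨M, hM⟩ := cochainMap_seminorm hs r hr
    exact ⟨Finset.range M, fun n hn x => hM n (by simpa using hn) _⟩
  have hT : ∀ n (x : (Bar A).carrier), T n x = cochainMap h n ((x : ∀ n, (step A n).bim.carrier) n) :=
    fun n x => rfl
  have hsum := sumCLM_hasSum T hTs
  have hmem : sumCLM T hTs ∈ HomDeg (barBimod A).toMod (Bimod.self A).toMod (N + 1) := by
    refine mem_HomDeg_toMod.2 ⟨fun k x hx => ?_, fun a x => ?_, fun x a => ?_⟩
    · exact GrSp.Deg.of_tendsto (V := A.toGrSp) (hsum x) fun n =>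
        (mem_HomDeg_toMod.1 (cochainMap_mem h n)).1 k _ (congrFun hx n)
    · refine (hsum _).unique ?_
      have e : ∀ n, T n ((barBimod A).L (tm 𝕜 a x)) = A.mul (tm 𝕜 (sgnPow A (N + 1) a) (T n x)) := fun n =>
        (congrArg (fun z => cochainMap h n ((step A n).bim.L z)) (ctMap_tm _ _ _ _)).trans
          ((mem_HomDeg_toMod.1 (cochainMap_mem h n)).2.1 a _)
      simp only [e]
      exact (hsum x).mapL (A.mul ∘L tmL _ (sgnPow A (N + 1) a))
    · refine (hsum _).unique ?_
      have e : ∀ n, T n ((barBimod A).R (tm 𝕜 x a)) = A.mul (tm 𝕜 (T n x) a) := fun n =>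
        (congrArg (fun z => cochainMap h n ((step A n).bim.R z)) (ctMap_tm _ _ _ _)).trans
          ((mem_HomDeg_toMod.1 (cochainMap_mem h n)).2.2 _ a)
      simp only [e]
      exact (hsum x).mapL (A.mul ∘L tmR _ a)
  refine ⟨⟨sumCLM T hTs, hmem⟩, congrArg (hcOps A N) (Subtype.ext (funext fun n => ?_))⟩
  refine ContinuousLinearMap.ext fun y => (hsum (barIncl A n y)).unique ?_
  have h1 := hasSum_single (f := fun m => T m (barIncl A n y)) n fun m hm =>
    (congrArg (cochainMap h m) (barIncl_ne A hm y)).trans (map_zero _)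
  have h2 : T n (barIncl A n y) = cochainMap h n y := congrArg (cochainMap h n) (barIncl_same A n y)
  rw [h2] at h1
  exact h1

variable (A N) in
/-- The inclusion of the direct sum totalization into the product totalization. -/
def sumIncl : HCSum A N →ₗ[𝕜] HCPi A N := Submodule.inclusion fun _ h => h.1

variable (A N) in
/-- Finite families of cochains as operations on `A`. -/
def sumOps : HCSum A N →ₗ[𝕜] Ops A N := hcOps A N ∘ₗ sumIncl A N

theorem sumOps_injective : Function.Injective (sumOps A N) :=
  hcOps_injective.comp (Submodule.inclusion_injective _)

theorem sumOps_normalized (f : HCSum A N) : IsNormalized (sumOps A N f).1 := hcOps_normalized _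

theorem sumOps_fin (f : HCSum A N) : IsFin (sumOps A N f).1 := by
  have h := f.2.2
  rw [Nat.cofinite_eq_atTop, Filter.eventually_atTop] at h
  obtain ⟨M, hM⟩ := h
  refine ⟨M, fun l hl => ?_⟩
  change (hcOps A N (sumIncl A N f)).1 _ = 0
  rw [hcOps_wd]
  exact congrArg (fun F : (step A l.length).bim.carrier →L[𝕜] A.carrier =>
    F (tm 𝕜 (halfWord A l.length l.get) A.one)) (hM _ hl)

theorem exists_sumOps {φ : Ops A N} (hn : IsNormalized φ.1) (hs : IsFin φ.1) :
    ∃ f, sumOps A N f = φ := by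
  obtain ⟨h, rfl⟩ := exists_hcOps hn
  obtain ⟨M, hM⟩ := hs
  refine ⟨⟨h.1, h.2, ?_⟩, rfl⟩
  rw [Nat.cofinite_eq_atTop, Filter.eventually_atTop]
  refine ⟨M, fun n hn => (cochain_ext (f := h) (g := 0) fun a => ?_).trans rfl⟩
  rw [← hcOps_ofFn, hM _ (by simpa using hn)]
  rfl

end ContinuousCochains

section Structures

variable {𝕜 : Type} [RCLike 𝕜] {A : DGAlg.{u} 𝕜}

theorem exists_word {k n : ℤ} (φ : Ops A n) (Z : List (Σ n, Ops A n)) (h : n + dg Z = k) :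
    ∃ g : Ops A k, (opsBrace A).m n φ (TS.word 𝕜 Z) = DirectSum.lof 𝕜 ℤ (Ops A) k g ∧
      g.1 = φ.1 ∘ₗ (opsRep A).rho Z := by
  subst h
  exact (opsBrace A).m_word n φ Z

theorem exists_comm {n : ℤ} (f : Ops A n) : ∃ g : Ops A (n + 1),
    (opsBrace A).m 1 (structureElt A) (TS.of 𝕜 f) - ((-1 : 𝕜) ^ n) •
      (opsBrace A).m n f (TS.of 𝕜 (structureElt A)) = DirectSum.lof 𝕜 ℤ (Ops A) (n + 1) g ∧
        g.1 = structureComm A f := by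
  obtain ⟨g, hg, hg'⟩ := exists_word (k := n + 1) (structureElt A) [⟨n, f⟩] (by simp [add_comm])
  obtain ⟨k, hk, hk'⟩ := exists_word (k := n + 1) f [⟨1, structureElt A⟩] (by simp)
  rw [word_singleton] at hg hk
  refine ⟨g - ((-1 : 𝕜) ^ n) • k, by rw [hg, hk, map_sub, map_smul], ?_⟩
  change g.1 - ((-1 : 𝕜) ^ n) • k.1 = _
  rw [hg', hk']
  rfl

variable (A) in
/-- The `B_∞`-structure on the multilinear operations on `A`. -/
def opsBInf : BInf 𝕜 (Ops A) := (opsBrace A).toBInf (structureElt A) (structure_brace A)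

/-- The `B_∞`-structure of the operations restricts to a space of normalized operations which is
given by a condition that is compatible with the brace operations. -/
theorem exists_ops_restrict {V : ℤ → Type u} [∀ n, AddCommGroup (V n)] [∀ n, Module 𝕜 (V n)]
    (i : ∀ n, V n →ₗ[𝕜] Ops A n) (hi : ∀ n, Function.Injective (i n))
    (Q : (TensorAlgebra 𝕜 A.carrier →ₗ[𝕜] A.carrier) → Prop)
    (hQ : ∀ n (f : V n), IsNormalized (i n f).1 ∧ Q (i n f).1)
    (hex : ∀ n (φ : Ops A n), IsNormalized φ.1 → Q φ.1 → ∃ f, i n f = φ)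
    (hb : Q (structureLin A)) (hsub : ∀ (c : 𝕜) φ ψ, Q φ → Q ψ → Q (φ - c • ψ))
    (hrho : ∀ φ, IsBdd φ → Q φ → ∀ Z : List (Σ n, Ops A n), (∀ g ∈ Z, Q g.2.1) →
      Q (φ ∘ₗ (opsRep A).rho Z)) : ∃ b : BInf 𝕜 V, b.IsHom (opsBInf A) i := by
  have hmem : ∀ n (g : Ops A n), IsNormalized g.1 → Q g.1 →
      DirectSum.lof 𝕜 ℤ (Ops A) n g ∈ LinearMap.range (DirectSum.lmap i) := fun n g h1 h2 => by
    obtain ⟨f, rfl⟩ := hex n g h1 h2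
    exact ⟨DirectSum.lof 𝕜 ℤ V n f, DirectSum.lmap_lof _ _ _⟩
  have hZ : ∀ Z : List (Σ n, V n), ∀ g ∈ mapWord i Z, IsNormalized g.2.1 ∧ Q g.2.1 := fun Z g hg => by
    obtain ⟨f, -, rfl⟩ := List.mem_map.1 hg
    exact hQ _ _
  refine (opsBrace A).exists_restrict (structure_brace A) hi (fun n f Z => ?_) (fun n f => ?_) fun Z h => ?_
  · obtain ⟨g, hg, hg'⟩ := exists_word (i n f) (mapWord i Z) rfl
    rw [hg]
    refine hmem _ g (fun l hl => ?_) ?_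
    · have := apply_rho_normalized (hQ n f).1 (mapWord i Z) (fun g hg => (hZ Z g hg).1) [] l (by simpa using hl)
      rw [wd_nil, one_mul] at this
      rw [hg']
      exact this
    · rw [hg']
      exact hrho _ (i n f).2.1 (hQ n f).2 _ fun g hg => (hZ Z g hg).2
  · obtain ⟨g, hg, hg'⟩ := exists_comm (i n f)
    rw [hg]
    refine hmem _ g ?_ ?_
    · rw [hg']
      exact structureComm_normalized (hQ n f).1
    · rw [hg']
      refine hsub _ _ _ (hrho _ (structureElt A).2.1 hb _ fun g hg => ?_)
        (hrho _ (i n f).2.1 (hQ n f).2 _ fun g hg => ?_)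
      · rw [List.mem_singleton.1 hg]
        exact (hQ n f).2
      · rw [List.mem_singleton.1 hg]
        exact hb
  · obtain ⟨g, hg, hg'⟩ := exists_word (structureElt A) (mapWord i Z) rfl
    rw [hg]
    refine hmem _ g (fun l hl => ?_) ?_
    · have := apply_rho_eq_zero_of_sq (φ := structureLin A) (q := 2) (fun l hl => by
        rw [structureLin_wd, structureOp_long A hl]) (mapWord i Z) (fun g hg => (hZ Z g hg).1) [] l
          (by rw [List.length_nil, zero_add, mapWord, List.length_map]; exact h) hl
      rw [wd_nil, one_mul] at this
      rw [hg']
      exact this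
    · rw [hg']
      exact hrho _ (structureElt A).2.1 hb _ fun g hg => (hZ Z g hg).2

variable (A)

theorem exists_bInf_pi : ∃ b : BInf 𝕜 (HCPi A), b.IsHom (opsBInf A) (hcOps A) :=
  exists_ops_restrict (hcOps A) (fun _ => hcOps_injective) (fun _ => True)
    (fun _ f => ⟨hcOps_normalized f, trivial⟩) (fun _ _ h _ => exists_hcOps h) trivial
    (fun _ _ _ _ _ => trivial) fun _ _ _ _ _ => trivial

theorem exists_bInf_cont : ∃ b : BInf 𝕜 (HCCont A), b.IsHom (opsBInf A) (contOps A) :=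
  exists_ops_restrict (contOps A) (fun _ => contOps_injective) IsSmall
    (fun _ f => ⟨contOps_normalized f, contOps_small f⟩) (fun _ _ h h' => exists_contOps h h')
    (structureElt_isFin (A := A)).isSmall
    (fun c φ ψ h1 h2 r hr => by
      obtain ⟨M, hM⟩ := h1 r hr
      obtain ⟨K, hK⟩ := h2 r hr
      refine ⟨max M K, fun l hl => le_antisymm ?_ (apply_nonneg _ _)⟩
      refine (map_sub_le_add r _ _).trans_eq ?_
      rw [hM l (le_of_max_le_left hl), LinearMap.smul_apply, map_smul_eq_mul, hK l (le_of_max_le_right hl)]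
      simp)
    (fun φ hb h Z hZ r hr => by
      obtain ⟨M, hM⟩ := apply_rho_small hb h Z hZ r hr
      refine ⟨M, fun l hl => ?_⟩
      have := hM [] l (by simpa using hl)
      rwa [wd_nil, one_mul] at this)

theorem exists_bInf_sum : ∃ b : BInf 𝕜 (HCSum A), b.IsHom (opsBInf A) (sumOps A) :=
  exists_ops_restrict (sumOps A) (fun _ => sumOps_injective) IsFin
    (fun _ f => ⟨sumOps_normalized f, sumOps_fin f⟩) (fun _ _ h h' => exists_sumOps h h')
    (structureElt_isFin (A := A))
    (fun c φ ψ h1 h2 => by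
      obtain ⟨M, hM⟩ := h1
      obtain ⟨K, hK⟩ := h2
      refine ⟨max M K, fun l hl => ?_⟩
      rw [LinearMap.sub_apply, LinearMap.smul_apply, hM l (le_of_max_le_left hl),
        hK l (le_of_max_le_right hl), smul_zero, sub_zero])
    (fun φ _ h Z hZ => by
      obtain ⟨M, hM⟩ := apply_rho_fin h Z hZ
      refine ⟨M, fun l hl => ?_⟩
      have := hM [] l (by simpa using hl)
      rwa [wd_nil, one_mul] at this)

variable {A}

theorem isCochain_of_lmap {N : ℤ} {x : ⨁ n, HCPi A n} {g : Ops A N} {F : List A.carrier → A.carrier}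
    (h : DirectSum.lmap (hcOps A) x = DirectSum.lof 𝕜 ℤ (Ops A) N g) (hF : ∀ l, g.1 (wd 𝕜 l) = F l) :
    IsCochain N x F := by
  have hx : ∀ n, hcOps A n (x n) = DirectSum.lof 𝕜 ℤ (Ops A) N g n := fun n => by
    rw [← h]
    exact (DirectSum.lmap_apply _ _ _).symm
  have hN : hcOps A N (x N) = g := (hx N).trans (DirectSum.of_eq_same N g)
  refine ⟨x N, DFinsupp.ext fun n => ?_, fun l => ?_⟩
  · refine hcOps_injective ((hx n).trans ?_)
    by_cases hn : N = n
    · subst hn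
      rw [DirectSum.lof_apply, DirectSum.lof_apply, hN]
    · have e1 : DirectSum.lof 𝕜 ℤ (Ops A) N g n = 0 := DirectSum.of_eq_of_ne _ _ _ (Ne.symm hn)
      have e2 : DirectSum.lof 𝕜 ℤ (HCPi A) N (x N) n = 0 := DirectSum.of_eq_of_ne _ _ _ (Ne.symm hn)
      rw [e1, e2, map_zero]
  · rw [← hF, ← hN, hcOps_wd]

theorem isBraceStructure_of_isHom {b : BInf 𝕜 (HCPi A)} (h : b.IsHom (opsBInf A) (hcOps A)) :
    IsBraceStructure b := by
  have he : ∀ {n : ℤ} (f : HCPi A n), (fun x => (hcOps A n f).1 (wd 𝕜 x)) = evalCochain f :=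
    fun f => funext (hcOps_wd f)
  have hb : ∀ (φ : TensorAlgebra 𝕜 A.carrier →ₗ[𝕜] A.carrier) (Z : List (Σ n, Ops A n)) (l : List A.carrier),
      φ ((opsRep A).rho Z (wd 𝕜 l)) =
        brace A (fun x => φ (wd 𝕜 x)) [] (Z.map fun g => (g.1, fun x => g.2.1 (wd 𝕜 x))) l := fun φ Z l => by
    rw [← apply_rho_eq_brace, wd_nil, one_mul]
  have hs : (fun x => structureLin A (wd 𝕜 x)) = structureOp A := funext (structureLin_wd A)
  have hmap : ∀ X : List (Σ n, HCPi A n), ((mapWord (hcOps A) X).map fun g =>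
      ((g.1, fun x => g.2.1 (wd 𝕜 x)) : ℤ × (List A.carrier → A.carrier))) =
        X.map fun g => (g.1, evalCochain g.2) := fun X => by
    rw [mapWord, List.map_map]
    exact List.map_congr_left fun g _ => congrArg (Prod.mk g.1) (he g.2)
  have hinj : Function.Injective (DirectSum.lmap (hcOps A)) :=
    (DirectSum.lmap_injective _).2 fun _ => hcOps_injective
  refine ⟨fun m f => ?_, fun m n f g => ?_, fun l hl => ?_, fun m f l => ?_, fun k l hk _ => ?_⟩
  · obtain ⟨g, hg, hg'⟩ := exists_comm (hcOps A m f)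
    refine isCochain_of_lmap (g := g) ?_ fun l => ?_
    · rw [← h.d_map, map_of, ← hg]
      exact (opsBrace A).toBInf_d_of _ _
    · rw [hg', structureComm, LinearMap.sub_apply, LinearMap.smul_apply, LinearMap.comp_apply,
        LinearMap.comp_apply, barCoder, hb, hb, hs, he]
      simp only [List.map_cons, List.map_nil, he]
      have : (fun x => (structureElt A).1 (wd 𝕜 x)) = structureOp A := hs
      rw [this]
  · obtain ⟨k, hk, hk'⟩ := exists_word (k := m + n + 1) (structureElt A)
      (mapWord (hcOps A) [⟨m, f⟩, ⟨n, g⟩]) (by simp [mapWord]; ring)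
    refine isCochain_of_lmap (g := k) ?_ fun l => ?_
    · rw [← h.d_map, map_word, ← hk]
      exact (opsBrace A).toBInf_d_word _ _ (by simp [mapWord])
    · rw [hk', LinearMap.comp_apply]
      refine (hb (structureLin A) _ l).trans ?_
      rw [hs, hmap]
      rfl
  · refine hinj ?_
    rw [← h.d_map, map_word, LinearMap.map_zero]
    refine ((opsBrace A).toBInf_d_word _ _ (by simpa [mapWord] using by omega)).trans ?_
    obtain ⟨k, hk, hk'⟩ := exists_word (structureElt A) (mapWord (hcOps A) l) rfl
    rw [hk]
    suffices h0 : k = 0 by rw [h0, LinearMap.map_zero]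
    refine Subtype.ext (wd_ext fun x => ?_)
    rw [hk', LinearMap.comp_apply]
    have := apply_rho_eq_zero_of_length (φ := structureLin A) (q := 2) (fun l hl => by
      rw [structureLin_wd, structureOp_long A hl]) (mapWord (hcOps A) l) [] x (by simpa [mapWord] using hl)
    rw [wd_nil, one_mul] at this
    exact this
  · obtain ⟨g, hg, hg'⟩ := exists_word (k := m + (l.map Sigma.fst).sum) (hcOps A m f) (mapWord (hcOps A) l)
      (by rw [dg_mapWord]; rfl)
    refine isCochain_of_lmap (g := g) ?_ fun x => ?_
    · rw [← h.m_map, map_of, map_word, ← hg]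
      exact (opsBrace A).toBInf_m_of _ _ _
    · rw [hg', LinearMap.comp_apply, hb, he, hmap]
  · refine hinj ?_
    rw [← h.m_map, map_word, map_word, LinearMap.map_zero]
    exact (opsBrace A).toBInf_m_word _ _ _ (by simpa [mapWord] using hk)

end Structures

section Differential

variable {𝕜 : Type} [RCLike 𝕜] (A : DGAlg.{u} 𝕜)

/-- The projection of the tensor algebra of `A` to `A ⊗̂ (sĀ)^⊗̂n`, `a₁ ⋯ aₙ ↦ 1 ⊗ a₁ ⊗ ⋯ ⊗ aₙ`. -/
def stepWord (n : ℕ) : TensorAlgebra 𝕜 A.carrier →ₗ[𝕜] (step A n).P.carrier :=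
  ofMulti (Function.update 0 n (halfMulti A n))

theorem stepWord_ofFn {n : ℕ} (a : Fin n → A.carrier) :
    stepWord A n (wd 𝕜 (List.ofFn a)) = halfWord A n a := by
  rw [stepWord, ofMulti_ofFn, Function.update_self]
  rfl

theorem stepWord_of_ne {n : ℕ} {l : List A.carrier} (h : l.length ≠ n) : stepWord A n (wd 𝕜 l) = 0 := by
  rw [stepWord, ofMulti_wd, Function.update_of_ne h]
  rfl

theorem stepWord_nil : stepWord A 0 1 = A.one := stepWord_ofFn A (Fin.elim0 : Fin 0 → A.carrier)

theorem stepWord_mul (n : ℕ) (x : TensorAlgebra 𝕜 A.carrier) (c : A.carrier) :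
    stepWord A (n + 1) (x * wd 𝕜 [c]) =
      (tm 𝕜 (stepWord A n x) (sq A c) : CT 𝕜 (step A n).P.carrier (susp A).carrier) := by
  have : stepWord A (n + 1) ∘ₗ LinearMap.mulRight 𝕜 (wd 𝕜 [c]) =
      (tmR (step A n).P.carrier (sq A c)).toLinearMap ∘ₗ stepWord A n := wd_ext fun l => by
    change stepWord A (n + 1) (wd 𝕜 l * wd 𝕜 [c]) =
      (tm 𝕜 (stepWord A n (wd 𝕜 l)) (sq A c) : CT 𝕜 (step A n).P.carrier (susp A).carrier)
    rw [← wd_append]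
    by_cases h : l.length = n
    · subst h
      have e : l ++ [c] = List.ofFn (Fin.snoc l.get c : Fin (l.length + 1) → A.carrier) := by
        rw [List.ofFn_succ']
        simp [Fin.snoc_last, Fin.snoc_castSucc]
      have e2 := stepWord_ofFn A l.get
      rw [List.ofFn_get] at e2
      rw [e, stepWord_ofFn, halfWord_snoc, e2]
    · rw [stepWord_of_ne A h, stepWord_of_ne A (by simpa using h), tm_zero_left]
      rfl
  exact LinearMap.congr_fun this x

theorem stepWord_append (n : ℕ) (l : List A.carrier) (c : A.carrier) :
    stepWord A (n + 1) (wd 𝕜 (l ++ [c])) =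
      (tm 𝕜 (stepWord A n (wd 𝕜 l)) (sq A c) : CT 𝕜 (step A n).P.carrier (susp A).carrier) := by
  rw [wd_append, stepWord_mul]

theorem stepWord_sgn (n : ℕ) (l : List A.carrier) :
    (step A n).P.sgn (stepWord A n (wd 𝕜 l)) = stepWord A n (wd 𝕜 (l.map (sigma A))) := by
  by_cases h : l.length = n
  · subst h
    have e1 := stepWord_ofFn A l.get
    have e2 := stepWord_ofFn A fun i => sigma A (l.get i)
    rw [List.ofFn_get] at e1
    rw [show (List.ofFn fun i => sigma A (l.get i)) = l.map (sigma A) by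
      conv_rhs => rw [← List.ofFn_get l, List.map_ofFn]
      rfl] at e2
    rw [e1, e2, halfWord_sgn]
  · rw [stepWord_of_ne A h, stepWord_of_ne A (by simpa using h), map_zero]

theorem barCoder_append (l : List A.carrier) (x c : A.carrier) : barCoder A (wd 𝕜 (l ++ [x, c])) =
    barCoder A (wd 𝕜 (l ++ [x])) * wd 𝕜 [c] + wd 𝕜 (l.map (sigma A) ++ [structureOp A [x, c]]) +
      wd 𝕜 ((l ++ [x]).map (sigma A) ++ [-A.d c]) := by
  induction l with
  | nil =>
    rw [List.nil_append, List.nil_append, barCoder_cons_cons, barCoder_singleton, barCoder_singleton, ← wd_append,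
      ← wd_append]
    rfl
  | cons y l ih =>
    have h : ∀ z (k : List A.carrier), barCoder A (wd 𝕜 (y :: z :: k)) =
        wd 𝕜 (-A.d y :: z :: k) + wd 𝕜 (structureOp A [y, z] :: k) +
          wd 𝕜 [sigma A y] * barCoder A (wd 𝕜 (z :: k)) := barCoder_cons_cons A y
    have key : ∀ z (k : List A.carrier) (t : TensorAlgebra 𝕜 A.carrier),
        barCoder A (wd 𝕜 (z :: (k ++ [c]))) = barCoder A (wd 𝕜 (z :: k)) * wd 𝕜 [c] + t →
        barCoder A (wd 𝕜 (y :: z :: (k ++ [c]))) = barCoder A (wd 𝕜 (y :: z :: k)) * wd 𝕜 [c] +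
          wd 𝕜 [sigma A y] * t := fun z k t e => by
      have e1 := wd_append (𝕜 := 𝕜) (-A.d y :: z :: k) [c]
      have e2 := wd_append (𝕜 := 𝕜) (structureOp A [y, z] :: k) [c]
      rw [List.cons_append, List.cons_append] at e1
      rw [List.cons_append] at e2
      rw [h, h, e, e1, e2]
      noncomm_ring
    have e3 : ∀ k : List A.carrier, wd 𝕜 (sigma A y :: k) = wd 𝕜 [sigma A y] * wd 𝕜 k := fun k =>
      wd_append (𝕜 := 𝕜) [sigma A y] k
    rcases l with _ | ⟨z, l⟩
    · have := key x [] _ (by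
        rw [List.nil_append] at ih
        rw [List.nil_append, ih, add_assoc]
        rfl)
      rw [mul_add, ← e3, ← e3] at this
      rw [add_assoc]
      exact this
    · have := key z (l ++ [x]) _ (by
        rw [add_assoc] at ih
        rw [List.append_assoc]
        exact ih)
      rw [mul_add, ← e3, ← e3, List.append_assoc] at this
      rw [add_assoc]
      exact this

theorem stepWord_barCoder (n : ℕ) (l : List A.carrier) (h : l.length = n) :
    stepWord A n (barCoder A (wd 𝕜 l)) = (step A n).P.d (stepWord A n (wd 𝕜 l)) := by
  induction n generalizing l with
  | zero =>
    rw [List.length_eq_zero_iff.1 h, barCoder_nil, map_zero, wd_nil, stepWord_nil]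
    exact (d_one A).symm
  | succ n ih =>
    obtain rfl | ⟨l, c, rfl⟩ := List.eq_nil_or_concat' l
    · simp at h
    have hl : l.length = n := by simpa using h
    have hd : (step A (n + 1)).P.d (stepWord A (n + 1) (wd 𝕜 (l ++ [c]))) =
        (tm 𝕜 ((step A n).P.d (stepWord A n (wd 𝕜 l))) (sq A c) +
          tm 𝕜 ((step A n).P.sgn (stepWord A n (wd 𝕜 l))) (sq A (-A.d c)) :
            CT 𝕜 (step A n).P.carrier (susp A).carrier) := by
      rw [stepWord_append]
      refine (Cpx.tens_d (step A n).P.toCpx (susp A) _ _).trans ?_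
      rw [susp_d, map_neg]
    rw [hd, ← ih l hl, stepWord_sgn]
    obtain rfl | ⟨l, x, rfl⟩ := List.eq_nil_or_concat' l
    · rw [List.nil_append, barCoder_singleton, barCoder_nil, map_zero, tm_zero_left, zero_add]
      exact stepWord_append A n [] (-A.d c)
    · rw [List.append_assoc, List.singleton_append, barCoder_append, map_add, map_add, stepWord_mul,
        stepWord_append, stepWord_append, stepWord_of_ne A (l := l.map (sigma A)) (by
          simp only [List.length_append, List.length_singleton] at hl
          rw [List.length_map]
          omega), tm_zero_left]
      have e0 : ∀ p q : CT 𝕜 (step A n).P.carrier (susp A).carrier, p + 0 + q = p + q := fun p q => by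
        rw [add_zero]
      exact e0 _ _

theorem stepWord_fold (n : ℕ) (l k : List A.carrier) (c a : A.carrier) (h : l.length = n)
    (hk : l ++ [c] = a :: k) : (step A n).fold (tm 𝕜 (stepWord A n (wd 𝕜 l)) c) =
      stepWord A n (barCoder A (wd 𝕜 (l ++ [c]))) + (step A n).P.L (tm 𝕜 a (stepWord A n (wd 𝕜 k))) := by
  induction n generalizing l k c with
  | zero =>
    obtain rfl := List.length_eq_zero_iff.1 h
    obtain ⟨rfl, rfl⟩ : c = a ∧ [] = k := by simpa using hk
    rw [List.nil_append, barCoder_singleton, stepWord_of_ne A (n := 0) (l := [-A.d c]) (by simp), zero_add, wd_nil,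
      stepWord_nil]
    change A.mul (ctMap A.sgn (ContinuousLinearMap.id 𝕜 A.carrier) (tm 𝕜 A.one c)) = A.mul (tm 𝕜 c A.one)
    rw [ctMap_tm, sgn_one, A.mul_one]
    exact A.one_mul c
  | succ n ih =>
    obtain rfl | ⟨l, x, rfl⟩ := List.eq_nil_or_concat' l
    · simp at h
    have hl : l.length = n := by simpa using h
    obtain ⟨k', hk', rfl⟩ : ∃ k', l ++ [x] = a :: k' ∧ k = k' ++ [c] := by
      rcases l with _ | ⟨y, l⟩
      · simp at hk
        exact ⟨[], by simp [hk.1], by simp [hk.2]⟩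
      · simp at hk
        exact ⟨l ++ [x], by simp [hk.1], by simp [← hk.2]⟩
    have e : (step A (n + 1)).fold (tm 𝕜 (stepWord A (n + 1) (wd 𝕜 (l ++ [x]))) c) =
        (tm 𝕜 ((step A n).fold (tm 𝕜 (stepWord A n (wd 𝕜 l)) x)) (sq A c) -
          tm 𝕜 ((step A n).P.sgn (stepWord A n (wd 𝕜 l))) (sq A (A.mul (tm 𝕜 (A.sgn x) c))) :
            CT 𝕜 (step A n).P.carrier (susp A).carrier) := by
      rw [stepWord_append]
      exact (step A n).foldWith_tm (Y := susp A) (sq A) (sgn_one A) (stepWord A n (wd 𝕜 l)) x c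
    have e2 : (step A (n + 1)).P.L (tm 𝕜 a (stepWord A (n + 1) (wd 𝕜 (k' ++ [c])))) =
        (tm 𝕜 ((step A n).P.L (tm 𝕜 a (stepWord A n (wd 𝕜 k')))) (sq A c) :
          CT 𝕜 (step A n).P.carrier (susp A).carrier) := by
      rw [stepWord_append]
      change ctMap (step A n).P.L (ContinuousLinearMap.id 𝕜 (susp A).carrier)
        (ctAssocInv 𝕜 A.carrier (step A n).P.carrier (susp A).carrier (tm 𝕜 a (tm 𝕜 _ _))) = _
      rw [ctAssocInv_tm, ctMap_tm]
      rfl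
    rw [e, e2, ih l k' x hl hk', stepWord_sgn, List.append_assoc, List.singleton_append, barCoder_append, map_add,
      map_add, stepWord_mul, stepWord_append, stepWord_of_ne A (l := (l ++ [x]).map (sigma A) ++ [-A.d c]) (by
        rw [List.length_append, List.length_map, List.length_append, hl]
        simp), structureOp, map_neg, tm_neg_right, tm_add_left]
    have e0 : ∀ p q r : CT 𝕜 (step A n).P.carrier (susp A).carrier, p + q - r = p + -r + 0 + q :=
      fun p q r => by abel
    exact e0 _ _ _

variable {A}

theorem BarStep.del_eq_zero (T : BarStep A) {x : T.next.bim.carrier} (h : x = 0) : T.del x = 0 := by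
  rw [h, map_zero]

theorem bar_d_barIncl_zero (y : (step A 0).bim.carrier) :
    (Bar A).d (barIncl A 0 y) = barIncl A 0 ((step A 0).bim.d y) := by
  funext m
  change (step A m).bim.d ((barIncl A 0 y : ∀ n, (step A n).bim.carrier) m) +
    (step A m).del ((barIncl A 0 y : ∀ n, (step A n).bim.carrier) (m + 1)) =
      (barIncl A 0 ((step A 0).bim.d y) : ∀ n, (step A n).bim.carrier) m
  have e0 : (step A m).del ((barIncl A 0 y : ∀ n, (step A n).bim.carrier) (m + 1)) = 0 :=
    (step A m).del_eq_zero (barIncl_ne A (by omega) y)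
  rw [e0, add_zero]
  by_cases h : m = 0
  · subst h
    rw [barIncl_same, barIncl_same]
  · rw [barIncl_ne A h, barIncl_ne A h, map_zero]

theorem bar_d_barIncl_succ (n : ℕ) (y : (step A (n + 1)).bim.carrier) :
    (Bar A).d (barIncl A (n + 1) y) =
      barIncl A (n + 1) ((step A (n + 1)).bim.d y) + barIncl A n ((step A n).del y) := by
  funext m
  change (step A m).bim.d ((barIncl A (n + 1) y : ∀ n, (step A n).bim.carrier) m) +
    (step A m).del ((barIncl A (n + 1) y : ∀ n, (step A n).bim.carrier) (m + 1)) =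
      (barIncl A (n + 1) ((step A (n + 1)).bim.d y) : ∀ n, (step A n).bim.carrier) m +
        (barIncl A n ((step A n).del y) : ∀ n, (step A n).bim.carrier) m
  congr 1
  · by_cases h : m = n + 1
    · subst h
      rw [barIncl_same, barIncl_same]
    · rw [barIncl_ne A h, barIncl_ne A h, map_zero]
  · by_cases h : m = n
    · subst h
      rw [barIncl_same, barIncl_same]
    · rw [barIncl_ne A h]
      exact (step A m).del_eq_zero (barIncl_ne A (by omega) y)

variable {N : ℤ}

theorem hcOps_stepWord (f : HCPi A N) (l : List A.carrier) :
    (hcOps A N f).1 (wd 𝕜 l) = cochainMap f l.length (tm 𝕜 (stepWord A l.length (wd 𝕜 l)) A.one) := by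
  have e := stepWord_ofFn A l.get
  rw [List.ofFn_get] at e
  rw [e]
  exact hcOps_wd f l

theorem hcOps_barCoder (f : HCPi A N) (n : ℕ) (l : List A.carrier) (h : l.length = n + 1) :
    (hcOps A N f).1 (barCoder A (wd 𝕜 l)) =
      cochainMap f (n + 1) (tm 𝕜 (stepWord A (n + 1) (barCoder A (wd 𝕜 l))) A.one) +
        cochainMap f n (tm 𝕜 (stepWord A n (barCoder A (wd 𝕜 l))) A.one) := by
  let G : TensorAlgebra 𝕜 A.carrier →ₗ[𝕜] A.carrier :=
    (cochainMap f (n + 1) ∘L tmR _ A.one).toLinearMap ∘ₗ stepWord A (n + 1) +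
      (cochainMap f n ∘L tmR _ A.one).toLinearMap ∘ₗ stepWord A n
  have hG : ∀ k : List A.carrier, k.length = n + 1 ∨ k.length = n → (hcOps A N f).1 (wd 𝕜 k) = G (wd 𝕜 k) := by
    intro k hk
    change _ = cochainMap f (n + 1) (tm 𝕜 (stepWord A (n + 1) (wd 𝕜 k)) A.one) +
      cochainMap f n (tm 𝕜 (stepWord A n (wd 𝕜 k)) A.one)
    rw [hcOps_stepWord]
    rcases hk with hk | hk
    · rw [hk, stepWord_of_ne A (n := n) (by omega), tm_zero_left]
      exact (add_zero _).symm.trans (congrArg _ (map_zero (cochainMap f n)).symm)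
    · rw [hk, stepWord_of_ne A (n := n + 1) (by omega), tm_zero_left]
      exact (zero_add _).symm.trans (congrArg (· + _) (map_zero (cochainMap f (n + 1))).symm)
  change _ = G _
  rw [barCoder_eq, map_sp, map_sp]
  refine sp_congr fun u k' e => ?_
  rw [map_sp, map_sp]
  refine sp_congr fun v w e' => ?_
  have hz : structureOp A v = 0 → (hcOps A N f).1 (wd 𝕜 (u.map (sigma A) ++ structureOp A v :: w)) =
      G (wd 𝕜 (u.map (sigma A) ++ structureOp A v :: w)) := fun h => by
    rw [h, wd_append, wd_zero_cons, mul_zero, map_zero, map_zero]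
  have hlen : u.length + v.length + w.length = n + 1 := by
    rw [← h, e, e', List.length_append, List.length_append, add_assoc]
  match v with
  | [] => exact hz rfl
  | [a] =>
    refine hG _ (Or.inl ?_)
    simp at hlen ⊢
    omega
  | [a, b] =>
    refine hG _ (Or.inr ?_)
    simp at hlen ⊢
    omega
  | _ :: _ :: _ :: _ => exact hz (structureOp_long A (by simp))

theorem contOps_hcD (f : HCCont A N) : (contOps A (N + 1) (hcD A N f)).1 = structureComm A (contOps A N f) := by
  set h := hcIncl A N f with hh
  let F : (Bar A).carrier →L[𝕜] A.carrier := f.1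
  have hf : ∀ n y, F (barIncl A n y) = cochainMap h n y := fun n y => rfl
  have hsq : ((-1 : 𝕜) ^ N) * (-1) ^ N = 1 := GrSp.neg_one_zpow_mul_self N
  refine wd_ext fun l => ?_
  have hL : (contOps A (N + 1) (hcD A N f)).1 (wd 𝕜 l) =
      -(A.d (F (barIncl A l.length (tm 𝕜 (stepWord A l.length (wd 𝕜 l)) A.one))) - ((-1 : 𝕜) ^ (N + 1)) •
        F ((Bar A).d (barIncl A l.length (tm 𝕜 (stepWord A l.length (wd 𝕜 l)) A.one)))) :=
    hcOps_stepWord (hcIncl A (N + 1) (hcD A N f)) l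
  have hd : ∀ n (z : (step A n).P.carrier), (step A n).bim.d (tm 𝕜 z A.one) = tm 𝕜 ((step A n).P.d z) A.one :=
    fun n z => by
      refine (Cpx.tens_d (step A n).P.toCpx A.toCpx z A.one).trans ?_
      rw [d_one, tm_zero_right, add_zero]
  have hφ : ∀ k : List A.carrier, (contOps A N f).1 (wd 𝕜 k) =
      cochainMap h k.length (tm 𝕜 (stepWord A k.length (wd 𝕜 k)) A.one) := hcOps_stepWord h
  have hF : F (barIncl A l.length (tm 𝕜 (stepWord A l.length (wd 𝕜 l)) A.one)) = (contOps A N f).1 (wd 𝕜 l) :=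
    (hφ l).symm
  rw [hL, hF, structureComm, LinearMap.sub_apply, LinearMap.smul_apply, LinearMap.comp_apply, LinearMap.comp_apply,
    zpow_add₀ (by simp), zpow_one, mul_neg_one, neg_smul, sub_neg_eq_add]
  obtain rfl | ⟨l, c, rfl⟩ := List.eq_nil_or_concat' l
  · have e : F ((Bar A).d (barIncl A 0 (tm 𝕜 (stepWord A 0 (wd 𝕜 [])) A.one))) = 0 := by
      rw [bar_d_barIncl_zero, hd, wd_nil, stepWord_nil]
      have : (step A 0).P.d A.one = 0 := d_one A
      rw [this, tm_zero_left]
      exact (congrArg F (map_zero _)).trans (map_zero _)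
    rw [List.length_nil, e, structure_rho_nil, barCoder_nil, map_zero, smul_zero, add_zero, sub_zero]
  · obtain ⟨a, k, hk⟩ : ∃ a k, l ++ [c] = a :: k := List.exists_cons_of_ne_nil (by simp)
    have hlen : (l ++ [c]).length = l.length + 1 := by simp
    have hklen : k.length = l.length := by
      have := congrArg List.length hk
      simp at this
      omega
    obtain ⟨-, hLm, hRm⟩ := mem_HomDeg_toMod.1 (cochainMap_mem h l.length)
    have e1 : F ((Bar A).d (barIncl A (l.length + 1) (tm 𝕜 (stepWord A (l.length + 1) (wd 𝕜 (l ++ [c]))) A.one))) =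
        (contOps A N f).1 (barCoder A (wd 𝕜 (l ++ [c]))) +
          A.mul (tm 𝕜 (sgnPow A (N + 1) a) ((contOps A N f).1 (wd 𝕜 k))) -
            A.mul (tm 𝕜 ((contOps A N f).1 (wd 𝕜 (l.map (sigma A)))) c) := by
      rw [bar_d_barIncl_succ, hd, ← stepWord_barCoder A (l.length + 1) (l ++ [c]) hlen, stepWord_append]
      have e2 := (step A l.length).del_tm (stepWord A l.length (wd 𝕜 l)) c A.one
      rw [A.mul_one, stepWord_fold A l.length l k c a rfl hk, tm_add_left, stepWord_sgn] at e2
      have e3 : F (barIncl A l.length ((step A l.length).del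
          (tm 𝕜 (tm 𝕜 (stepWord A l.length (wd 𝕜 l)) (sq A c)) A.one))) = _ := congrArg (cochainMap h l.length) e2
      have e4 : cochainMap h l.length (tm 𝕜 ((step A l.length).P.L (tm 𝕜 a (stepWord A l.length (wd 𝕜 k)))) A.one) =
          A.mul (tm 𝕜 (sgnPow A (N + 1) a) ((contOps A N f).1 (wd 𝕜 k))) := by
        have := hLm a (tm 𝕜 (stepWord A l.length (wd 𝕜 k)) A.one)
        rw [hφ, hklen]
        refine Eq.trans (congrArg _ ?_) this
        simp
      have e5 : cochainMap h l.length (tm 𝕜 (stepWord A l.length (wd 𝕜 (l.map (sigma A)))) c) =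
          A.mul (tm 𝕜 ((contOps A N f).1 (wd 𝕜 (l.map (sigma A)))) c) := by
        have := hRm (tm 𝕜 (stepWord A l.length (wd 𝕜 (l.map (sigma A)))) A.one) c
        rw [hφ, List.length_map]
        refine Eq.trans (congrArg _ ?_) this
        simp [A.one_mul]
      have e6 := hcOps_barCoder h l.length (l ++ [c]) hlen
      have e7 : (contOps A N f).1 (barCoder A (wd 𝕜 (l ++ [c]))) = _ := e6
      rw [e7, ← e4, ← e5]
      rw [map_add F]
      have e8 : F (barIncl A (l.length + 1)
        (tm 𝕜 (stepWord A (l.length + 1) (barCoder A (wd 𝕜 (l ++ [c])))) A.one)) = _ := hf _ _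
      rw [e8]
      refine (congrArg _ e3).trans ?_
      rw [map_sub, map_add]
      abel
    have hσ : (contOps A N f).1 (wd 𝕜 (l.map (sigma A))) =
        ((-1 : 𝕜) ^ N) • sigma A ((contOps A N f).1 (wd 𝕜 l)) := by
      have := (contOps A N f).2.2.2 (wd 𝕜 l)
      rwa [sgp_wd, show tau (sigma A) 1 = sigma A by simp [tau]] at this
    have hτ : structureOp A [tau (opsRep A).s N a, (contOps A N f).1 (wd 𝕜 k)] =
        -((-1 : 𝕜) ^ N) • A.mul (tm 𝕜 (sgnPow A (N + 1) a) ((contOps A N f).1 (wd 𝕜 k))) := by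
      have : (tau (opsRep A).s N : A.carrier → A.carrier) = twist A N := funext fun a => tau_sigma A N a
      rw [structureOp, this, twist, sgnPow]
      by_cases hN : Even N
      · rw [if_pos hN, if_neg (by rw [Int.not_even_iff_odd]; exact hN.add_one), hN.neg_one_zpow, neg_smul, one_smul]
      · rw [if_neg hN, if_pos (Int.not_even_iff_odd.1 hN).add_one, (Int.not_even_iff_odd.1 hN).neg_one_zpow]
        simp
    rw [hlen, e1, structure_rho_of_ne_nil (contOps A N f) (l ++ [c]) k l a c hk rfl, hτ, hσ]
    simp only [structureOp, smul_add, smul_sub, map_smul, tm_smul_left, smul_smul, hsq, one_smul, sigma,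
      LinearMap.neg_apply, tm_neg_left, map_neg, ContinuousLinearMap.coe_coe]
    module

end Differential

section Bracket

variable {𝕜 : Type} [RCLike 𝕜] {U : Type*} [AddCommGroup U] [Module 𝕜 U] {E V : ℤ → Type u}
  [∀ n, AddCommGroup (E n)] [∀ n, Module 𝕜 (E n)] [∀ n, AddCommGroup (V n)] [∀ n, Module 𝕜 (V n)]
  (P : BraceRep 𝕜 U E) {i : ∀ n, V n →ₗ[𝕜] E n}

theorem BraceRep.bracket_mem {b : E 1} (hb : P.m 1 b (TS.of 𝕜 b) = 0) (hi : ∀ n, Function.Injective (i n))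
    {b' : BInf 𝕜 V} (h : b'.IsHom (P.toBInf b hb) i) (m n : ℤ) (f : V m) (g : V n) :
    b'.mul (TS.of 𝕜 f ⊗ₜ TS.of 𝕜 g) - ((-1 : 𝕜) ^ (m * n)) • b'.mul (TS.of 𝕜 g ⊗ₜ TS.of 𝕜 f) ∈
      LinearMap.range (TensorAlgebra.ι 𝕜 : (⨁ n, V n) →ₗ[𝕜] TS 𝕜 V) := by
  have hsq : ((-1 : 𝕜) ^ (m * n)) * (-1) ^ (m * n) = 1 := GrSp.neg_one_zpow_mul_self _
  have key : ∀ {k l : ℤ} (u : V k) (v : V l), TS.map 𝕜 i (b'.mul (TS.of 𝕜 u ⊗ₜ TS.of 𝕜 v)) =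
      TS.of 𝕜 (i k u) * TS.of 𝕜 (i l v) + TensorAlgebra.ι 𝕜 (P.m k (i k u) (TS.of 𝕜 (i l v))) +
        ((-1 : 𝕜) ^ (k * l)) • (TS.of 𝕜 (i l v) * TS.of 𝕜 (i k u)) := fun u v => by
    rw [h.2, map_of, map_of]
    exact P.mul_of_of _ _
  have hy : TensorAlgebra.ι 𝕜 (P.m m (i m f) (TS.of 𝕜 (i n g)) - ((-1 : 𝕜) ^ (m * n)) •
      P.m n (i n g) (TS.of 𝕜 (i m f))) = TS.map 𝕜 i (b'.mul (TS.of 𝕜 f ⊗ₜ TS.of 𝕜 g) -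
        ((-1 : 𝕜) ^ (m * n)) • b'.mul (TS.of 𝕜 g ⊗ₜ TS.of 𝕜 f)) := by
    rw [map_sub, map_sub, map_smul, map_smul, key, key, smul_add, smul_add, mul_comm n m, smul_smul, hsq, one_smul]
    abel
  refine ⟨TensorAlgebra.ιInv (b'.mul (TS.of 𝕜 f ⊗ₜ TS.of 𝕜 g) -
    ((-1 : 𝕜) ^ (m * n)) • b'.mul (TS.of 𝕜 g ⊗ₜ TS.of 𝕜 f)), map_injective (𝕜 := 𝕜) i hi ?_⟩
  rw [map_ι, ← ιInv_map, ← hy, ιInv_ι]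

end Bracket

section Assembly

variable {𝕜 : Type} [RCLike 𝕜] {A : DGAlg.{u} 𝕜}

theorem contOps_exists_sum {N : ℤ} (f : HCSum A N) : ∃ g, contOps A N g = sumOps A N f :=
  exists_contOps (sumOps_normalized f) (sumOps_fin f).isSmall

variable (A) in
/-- The inclusion of the direct sum totalization into the continuous Hochschild complex. -/
def sumToCont (N : ℤ) : HCSum A N →ₗ[𝕜] HCCont A N :=
  (LinearEquiv.ofInjective (contOps A N) contOps_injective).symm.toLinearMap ∘ₗ
    (sumOps A N).codRestrict (LinearMap.range (contOps A N)) contOps_exists_sum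

theorem contOps_sumToCont {N : ℤ} (f : HCSum A N) : contOps A N (sumToCont A N f) = sumOps A N f := by
  have := LinearEquiv.apply_symm_apply (LinearEquiv.ofInjective (contOps A N) contOps_injective)
    ((sumOps A N).codRestrict (LinearMap.range (contOps A N)) contOps_exists_sum f)
  exact congrArg Subtype.val this

variable {b : BInf 𝕜 (HCCont A)}

theorem cont_D (h : b.IsHom (opsBInf A) (contOps A)) (N : ℤ) (f : HCCont A N) :
    b.D (TS.of 𝕜 (V := HCCont A) f) = TS.of 𝕜 (V := HCCont A) (hcD A N f) := by
  refine map_injective (𝕜 := 𝕜) (contOps A) (fun _ => contOps_injective) ?_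
  obtain ⟨g, hg, hg'⟩ := exists_comm (contOps A N f)
  have e : g = contOps A (N + 1) (hcD A N f) := Subtype.ext (hg'.trans (contOps_hcD f).symm)
  rw [h.1, map_of, map_of, ← e]
  exact ((opsBrace A).toBInf_D_of (structure_brace A) _).trans (congrArg (TensorAlgebra.ι 𝕜) hg)

variable (A) in
theorem exists_hochschild_structures :
    ∃ (bS : BInf 𝕜 (HCSum A)) (bC : BInf 𝕜 (HCCont A)) (bP : BInf 𝕜 (HCPi A))
        (j : ∀ N, HCSum A N →ₗ[𝕜] HCCont A N),
      (∀ N (f : HCSum A N), (hcIncl A N (j N f)).1 = f.1) ∧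
      (∀ N, Function.Injective (j N)) ∧
      (∀ N, Function.Injective (hcIncl A N)) ∧
      IsBraceStructure bP ∧
      BInf.IsHom bS bC j ∧
      BInf.IsHom bC bP (hcIncl A) ∧
      (∀ N (f : HCCont A N), bC.d (TS.of 𝕜 (V := HCCont A) f) =
        DirectSum.lof 𝕜 ℤ (HCCont A) (N + 1) (hcD A N f)) ∧
      ∃ g : DGLie 𝕜 (HCCont A), (∀ N, g.d N = hcD A N) ∧
        ∀ (m n : ℤ) (x : HCCont A m) (y : HCCont A n),
          DirectSum.lof 𝕜 ℤ (HCCont A) (m + n) (g.brk m n x y) =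
            bC.m (TS.of 𝕜 (V := HCCont A) x) (TS.of 𝕜 (V := HCCont A) y) -
              ((-1 : 𝕜) ^ (m * n)) •
                bC.m (TS.of 𝕜 (V := HCCont A) y) (TS.of 𝕜 (V := HCCont A) x) := by
  obtain ⟨bP, hP⟩ := exists_bInf_pi A
  obtain ⟨bC, hC⟩ := exists_bInf_cont A
  obtain ⟨bS, hS⟩ := exists_bInf_sum A
  refine ⟨bS, bC, bP, sumToCont A, fun N f => ?_, fun N f g h => ?_, fun _ => hcIncl_injective,
    isBraceStructure_of_isHom hP, ?_, ?_, fun N f => ?_, ?_⟩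
  · exact congrArg Subtype.val (hcOps_injective (contOps_sumToCont f) : hcIncl A N _ = sumIncl A N f)
  · refine sumOps_injective ?_
    rw [← contOps_sumToCont, ← contOps_sumToCont, h]
  · exact BInf.IsHom.of_comp (i := contOps A) (fun _ => contOps_injective) hC hS fun N =>
      LinearMap.ext fun f => (contOps_sumToCont f).symm
  · exact BInf.IsHom.of_comp (i := hcOps A) (fun _ => hcOps_injective) hP hC fun N => rfl
  · rw [BInf.d, cont_D hC, TS.of, ιInv_ι]
  · exact bC.exists_dgLie (hcD A) (cont_D hC) 
      ((opsBrace A).bracket_mem (structure_brace A) (fun _ => contOps_injective) hC)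

end Assembly

section Shortcuts

variable {𝕜 E F : Type*} [Semiring 𝕜] [AddCommMonoid E] [AddCommMonoid F] [Module 𝕜 E] [Module 𝕜 F]
  [TopologicalSpace E] [TopologicalSpace F]

instance : ZeroHomClass (E →L[𝕜] F) E F := inferInstance

instance : AddHomClass (E →L[𝕜] F) E F := inferInstance

instance : AddMonoidHomClass (E →L[𝕜] F) E F := inferInstance

end Shortcuts



section ConeCalculus

variable {𝕜 : Type} [RCLike 𝕜] {B : DGAlg.{u} 𝕜} {M N P : DGMod B}

theorem HomDeg.comp_mem {m n k : ℤ} {f : M.carrier →L[𝕜] N.carrier}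
    {g : N.carrier →L[𝕜] P.carrier} (hf : f ∈ HomDeg M N m) (hg : g ∈ HomDeg N P n)
    (h : m + n = k) : g ∘L f ∈ HomDeg M P k := h ▸ comp_mem_HomDeg hf hg

theorem hom_mem (f : M ⟶ N) : f.1 ∈ HomDeg M N 0 := (mem_HomZ.1 f.2).1

/-- A closed map of degree zero. -/
def homMk (f : M.carrier →L[𝕜] N.carrier) (hf : f ∈ HomDeg M N 0)
    (hd : ∀ x, N.d (f x) = f (M.d x)) : M ⟶ N :=
  ⟨f, mem_HomZ.2 ⟨hf, by simpa using hd⟩⟩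

@[simp] theorem homMk_val (f : M.carrier →L[𝕜] N.carrier) (hf : f ∈ HomDeg M N 0)
    (hd : ∀ x, N.d (f x) = f (M.d x)) : (homMk f hf hd).1 = f := rfl

@[simp] theorem comp_val (f : M ⟶ N) (g : N ⟶ P) (x : M.carrier) :
    (f ≫ g).1 x = g.1 (f.1 x) := rfl

@[simp] theorem id_val (x : M.carrier) : (𝟙 M : M ⟶ M).1 x = x := rfl

theorem toH0_map_eq_iff {f g : M ⟶ N} : (toH0 B).map f = (toH0 B).map g ↔
    ∃ h ∈ HomDeg M N (-1), ∀ x, f.1 x - g.1 x = N.d (h x) + h (M.d x) := by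
  rw [Quotient.functor_map_eq_iff]
  refine mem_HomB.trans (exists_congr fun h => and_congr_right fun _ => ?_)
  exact ⟨fun e x => congrArg (fun F => F x) e, fun e => ContinuousLinearMap.ext e⟩

/-- The inclusion of the target into a cone. -/
def coneInl (f : M ⟶ N) : N.carrier →L[𝕜] (cone f).carrier :=
  ContinuousLinearMap.inl 𝕜 N.carrier M.carrier

/-- The inclusion of the source into a cone. -/
def coneInr (f : M ⟶ N) : M.carrier →L[𝕜] (cone f).carrier :=
  ContinuousLinearMap.inr 𝕜 N.carrier M.carrier

/-- The projection of a cone to the target. -/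
def coneFst (f : M ⟶ N) : (cone f).carrier →L[𝕜] N.carrier :=
  ContinuousLinearMap.fst 𝕜 N.carrier M.carrier

/-- The projection of a cone to the source. -/
def coneSnd (f : M ⟶ N) : (cone f).carrier →L[𝕜] M.carrier :=
  ContinuousLinearMap.snd 𝕜 N.carrier M.carrier

variable (f : M ⟶ N)

@[simp] theorem coneFst_inl (y : N.carrier) : coneFst f (coneInl f y) = y := rfl
@[simp] theorem coneSnd_inl (y : N.carrier) : coneSnd f (coneInl f y) = 0 := rfl
@[simp] theorem coneFst_inr (x : M.carrier) : coneFst f (coneInr f x) = 0 := rfl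
@[simp] theorem coneSnd_inr (x : M.carrier) : coneSnd f (coneInr f x) = x := rfl

@[simp] theorem coneFst_d (x : (cone f).carrier) :
    coneFst f ((cone f).d x) = N.d (coneFst f x) + f.1 (coneSnd f x) := rfl

@[simp] theorem coneSnd_d (x : (cone f).carrier) :
    coneSnd f ((cone f).d x) = -M.d (coneSnd f x) := rfl

theorem cone_ext {x y : (cone f).carrier} (h1 : coneFst f x = coneFst f y)
    (h2 : coneSnd f x = coneSnd f y) : x = y := Prod.ext h1 h2

variable {f} in
theorem cone_deg {k : ℤ} {x : (cone f).carrier} :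
    (cone f).Deg k x ↔ N.Deg k (coneFst f x) ∧ M.Deg (k + 1) (coneSnd f x) := Prod.ext_iff

@[simp] theorem coneFst_act (x : (cone f).carrier) (b : B.carrier) :
    coneFst f ((cone f).act (tm 𝕜 x b)) = N.act (tm 𝕜 (coneFst f x) b) :=
  congrArg N.act (ctMap_tm (ContinuousLinearMap.fst 𝕜 N.carrier M.carrier) _ _ _)

@[simp] theorem coneSnd_act (x : (cone f).carrier) (b : B.carrier) :
    coneSnd f ((cone f).act (tm 𝕜 x b)) = M.act (tm 𝕜 (coneSnd f x) b) :=
  congrArg M.act (ctMap_tm (ContinuousLinearMap.snd 𝕜 N.carrier M.carrier) _ _ _)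

theorem coneInl_mem : coneInl f ∈ HomDeg N (cone f) 0 :=
  ⟨fun _ y hy => cone_deg.2 ⟨by simpa using hy, GrSp.Deg.zero _⟩, fun y b =>
    cone_ext f (by simp) (by simp)⟩

theorem coneInr_mem : coneInr f ∈ HomDeg M (cone f) (-1) :=
  ⟨fun _ y hy => cone_deg.2 ⟨GrSp.Deg.zero _, by simpa using hy⟩, fun y b =>
    cone_ext f (by simp) (by simp)⟩

theorem coneFst_mem : coneFst f ∈ HomDeg (cone f) N 0 :=
  ⟨fun k x hx => by simpa using (cone_deg.1 hx).1, fun x b => coneFst_act f x b⟩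

theorem coneSnd_mem : coneSnd f ∈ HomDeg (cone f) M 1 :=
  ⟨fun k x hx => (cone_deg.1 hx).2, fun x b => coneSnd_act f x b⟩

/-- The shift of a dg-module. -/
def Sh (M : DGMod B) (n : ℤ) : DGMod B := M.shift n

/-- The identity, as a map to the shift. -/
def toSh (M : DGMod B) (n : ℤ) : M.carrier →L[𝕜] (Sh M n).carrier :=
  ContinuousLinearMap.id 𝕜 M.carrier

/-- The identity, as a map from the shift. -/
def unSh (M : DGMod B) (n : ℤ) : (Sh M n).carrier →L[𝕜] M.carrier :=
  ContinuousLinearMap.id 𝕜 M.carrier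

@[simp] theorem unSh_toSh (M : DGMod B) (n : ℤ) (x : M.carrier) : unSh M n (toSh M n x) = x := rfl

@[simp] theorem toSh_unSh (M : DGMod B) (n : ℤ) (x : (Sh M n).carrier) :
    toSh M n (unSh M n x) = x := rfl

@[simp] theorem Sh_d (M : DGMod B) (n : ℤ) (x : (Sh M n).carrier) :
    (Sh M n).d x = ((-1 : 𝕜) ^ n) • toSh M n (M.d (unSh M n x)) := rfl

theorem sh_ext (M : DGMod B) (n : ℤ) {x y : (Sh M n).carrier}
    (h : unSh M n x = unSh M n y) : x = y := h

theorem toSh_mem (M : DGMod B) (n : ℤ) : toSh M n ∈ HomDeg M (Sh M n) n :=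
  ⟨fun k x hx => by
    change M.Deg (k + n - n) x
    rwa [add_sub_cancel_right], fun _ _ => rfl⟩

theorem unSh_mem (M : DGMod B) (n : ℤ) : unSh M n ∈ HomDeg (Sh M n) M (-n) :=
  ⟨fun _ _ hx => hx, fun _ _ => rfl⟩

end ConeCalculus

section ContraacyclicCalculus

variable {𝕜 : Type} [RCLike 𝕜] {B : DGAlg.{u} 𝕜} {M N P : DGMod B}

theorem Contraacyclic.of_homotopy_retract (hN : Contraacyclic N) (a : M ⟶ N) (b : N ⟶ M)
    (h : M.carrier →L[𝕜] M.carrier) (hh : h ∈ HomDeg M M (-1))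
    (e : ∀ x, b.1 (a.1 x) - x = M.d (h x) + h (M.d x)) : Contraacyclic M :=
  .retract ((toH0 B).map a) ((toH0 B).map b) (by
    rw [← Functor.map_comp, ← (toH0 B).map_id]
    exact toH0_map_eq_iff.2 ⟨h, hh, e⟩) hN

theorem Contraacyclic.of_retract (hN : Contraacyclic N) (a : M ⟶ N) (b : N ⟶ M)
    (e : ∀ x, b.1 (a.1 x) = x) : Contraacyclic M :=
  hN.of_homotopy_retract a b 0 (zero_mem _) fun x => by simp [e]

theorem Contraacyclic.of_contraction (h : M.carrier →L[𝕜] M.carrier) (hh : h ∈ HomDeg M M (-1))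
    (e : ∀ x, M.d (h x) + h (M.d x) = x) : Contraacyclic M :=
  (Contraacyclic.pi (K := PEmpty) (fun _ => M) fun k => k.elim).of_homotopy_retract 0 0 (-h)
    (neg_mem hh) fun x => by
      have := e x
      change (0 : M.carrier) - x = M.d (-h x) + -h (M.d x)
      rw [map_neg, ← neg_add, this, zero_sub]

theorem contraacyclic_cone_id : Contraacyclic (cone (𝟙 M)) :=
  .of_contraction (coneInr (𝟙 M) ∘L coneFst (𝟙 M))
    (HomDeg.comp_mem (coneFst_mem _) (coneInr_mem _) (by simp)) fun _ =>
      cone_ext _ (by simp) (by simp)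

theorem Contraacyclic.sh (hM : Contraacyclic M) (n : ℤ) : Contraacyclic (Sh M n) := hM.shift n

theorem Contraacyclic.cone_comp {f : M ⟶ N} {g : N ⟶ P} (hf : Contraacyclic (CtrHoch.cone f))
    (hg : Contraacyclic (CtrHoch.cone g)) : Contraacyclic (CtrHoch.cone (f ≫ g)) := by
  obtain ⟨φ, hφ⟩ : ∃ φ : Sh (CtrHoch.cone g) 1 ⟶ CtrHoch.cone f,
      ∀ x, φ.1 x = coneInl f (coneSnd g (unSh _ 1 x)) :=
    ⟨homMk (coneInl f ∘L coneSnd g ∘L unSh _ 1) (HomDeg.comp_mem (HomDeg.comp_mem (unSh_mem _ 1)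
      (coneSnd_mem g) rfl) (coneInl_mem f) (by norm_num)) fun x =>
        cone_ext f (by simp) (by simp), fun _ => rfl⟩
  refine (Contraacyclic.cone φ (hg.sh 1) hf).of_retract
    (homMk (-(coneInl φ ∘L coneInr f ∘L coneSnd (f ≫ g)) +
      coneInr φ ∘L toSh _ 1 ∘L (coneInl g ∘L coneFst (f ≫ g) +
        coneInr g ∘L f.1 ∘L coneSnd (f ≫ g))) ?_ ?_)
    (homMk (coneInl (f ≫ g) ∘L (coneFst g ∘L unSh _ 1 ∘L coneSnd φ - g.1 ∘L coneFst f ∘L coneFst φ) -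
      coneInr (f ≫ g) ∘L coneSnd f ∘L coneFst φ) ?_ ?_) ?_
  · refine add_mem (neg_mem (HomDeg.comp_mem (HomDeg.comp_mem (coneSnd_mem _) (coneInr_mem _) rfl)
      (coneInl_mem _) (by norm_num))) (HomDeg.comp_mem (HomDeg.comp_mem (add_mem
        (HomDeg.comp_mem (coneFst_mem _) (coneInl_mem _) rfl)
        (HomDeg.comp_mem (HomDeg.comp_mem (coneSnd_mem _) (hom_mem f) rfl) (coneInr_mem _)
          (by norm_num))) (toSh_mem _ 1) rfl) (coneInr_mem φ) (by norm_num))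
  · intro x
    refine cone_ext φ (cone_ext f ?_ ?_) (sh_ext _ 1 (cone_ext g ?_ ?_)) <;> simp [hφ, closed_zero]
  · refine sub_mem (HomDeg.comp_mem (sub_mem (HomDeg.comp_mem (HomDeg.comp_mem (coneSnd_mem φ)
      (unSh_mem _ 1) rfl) (coneFst_mem g) (by norm_num))
      (HomDeg.comp_mem (HomDeg.comp_mem (coneFst_mem φ) (coneFst_mem f) rfl) (hom_mem g) rfl))
      (coneInl_mem _) (by norm_num)) (HomDeg.comp_mem (HomDeg.comp_mem (coneFst_mem φ)
        (coneSnd_mem f) rfl) (coneInr_mem _) (by norm_num))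
  · intro x
    refine cone_ext (f ≫ g) ?_ ?_ <;> simp [hφ, closed_zero]
    abel
  · intro x
    refine cone_ext (f ≫ g) ?_ ?_ <;> simp

/-- The closed inclusion of the target into a cone. -/
def coneι (f : M ⟶ N) : N ⟶ cone f :=
  homMk (coneInl f) (coneInl_mem f) fun x => cone_ext f (by simp) (by simp)

@[simp] theorem coneι_val (f : M ⟶ N) : (coneι f).1 = coneInl f := rfl

theorem Contraacyclic.cone_coneι (hM : Contraacyclic M) (f : M ⟶ N) :
    Contraacyclic (CtrHoch.cone (coneι f)) := by
  refine (hM.sh (-1)).of_homotopy_retract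
    (homMk (toSh M (-1) ∘L coneSnd f ∘L coneFst (coneι f)) ?_ ?_)
    (homMk ((coneInl (coneι f) ∘L coneInr f - coneInr (coneι f) ∘L f.1) ∘L unSh M (-1)) ?_ ?_)
    (-(coneInr (coneι f) ∘L coneFst f ∘L coneFst (coneι f))) ?_ ?_
  · exact HomDeg.comp_mem (HomDeg.comp_mem (coneFst_mem _) (coneSnd_mem f) rfl) (toSh_mem _ _)
      (by norm_num)
  · intro x; simp
  · exact HomDeg.comp_mem (unSh_mem _ _) (sub_mem (HomDeg.comp_mem (coneInr_mem f) (coneInl_mem _)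
      rfl) (HomDeg.comp_mem (hom_mem f) (coneInr_mem _) rfl)) (by norm_num)
  · intro x
    refine cone_ext (coneι f) (cone_ext f ?_ ?_) ?_ <;> simp [closed_zero]
  · exact neg_mem (HomDeg.comp_mem (HomDeg.comp_mem (coneFst_mem _) (coneFst_mem f) rfl)
      (coneInr_mem _) rfl)
  · intro x
    refine cone_ext (coneι f) (cone_ext f ?_ ?_) ?_ <;> simp
    abel

theorem Contraacyclic.source {f : M ⟶ N} (hf : Contraacyclic (CtrHoch.cone f))
    (hN : Contraacyclic N) : Contraacyclic M := by
  refine ((Contraacyclic.cone (coneι f) hN hf).sh 1).of_retract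
    (homMk (toSh _ 1 ∘L (coneInl (coneι f) ∘L coneInr f - coneInr (coneι f) ∘L f.1)) ?_ ?_)
    (homMk (coneSnd f ∘L coneFst (coneι f) ∘L unSh _ 1) ?_ ?_) ?_
  · exact HomDeg.comp_mem (sub_mem (HomDeg.comp_mem (coneInr_mem f) (coneInl_mem _) rfl)
      (HomDeg.comp_mem (hom_mem f) (coneInr_mem _) rfl)) (toSh_mem _ 1) (by norm_num)
  · intro x
    refine sh_ext _ 1 (cone_ext (coneι f) (cone_ext f ?_ ?_) ?_) <;> simp [closed_zero]
  · exact HomDeg.comp_mem (HomDeg.comp_mem (unSh_mem _ 1) (coneFst_mem _) rfl) (coneSnd_mem f)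
      (by norm_num)
  · intro x; simp
  · intro x; change x - 0 = x; simp

theorem Contraacyclic.target {f : M ⟶ N} (hf : Contraacyclic (CtrHoch.cone f))
    (hM : Contraacyclic M) : Contraacyclic N := by
  obtain ⟨δ, hδ⟩ : ∃ δ : Sh (CtrHoch.cone f) 1 ⟶ M, ∀ x, δ.1 x = coneSnd f (unSh _ 1 x) :=
    ⟨homMk (coneSnd f ∘L unSh _ 1) (HomDeg.comp_mem (unSh_mem _ 1) (coneSnd_mem f) (by norm_num))
      fun x => by simp, fun _ => rfl⟩
  refine (Contraacyclic.cone δ (hf.sh 1) hM).of_retract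
    (homMk (coneInr δ ∘L toSh _ 1 ∘L coneInl f) ?_ ?_)
    (homMk (coneFst f ∘L unSh _ 1 ∘L coneSnd δ - f.1 ∘L coneFst δ) ?_ ?_) ?_
  · exact HomDeg.comp_mem (HomDeg.comp_mem (coneInl_mem f) (toSh_mem _ 1) rfl) (coneInr_mem δ)
      (by norm_num)
  · intro x
    refine cone_ext δ ?_ (sh_ext _ 1 (cone_ext f ?_ ?_)) <;>
      simp [hδ]
  · exact sub_mem (HomDeg.comp_mem (HomDeg.comp_mem (coneSnd_mem δ) (unSh_mem _ 1) rfl)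
      (coneFst_mem f) (by norm_num)) (HomDeg.comp_mem (coneFst_mem δ) (hom_mem f) rfl)
  · intro x
    simp [hδ, closed_zero]
  · intro x; simp

/-- The shift of a closed map of degree zero. -/
def shMap (f : M ⟶ N) (n : ℤ) : Sh M n ⟶ Sh N n := shiftMap f n

@[simp] theorem shMap_apply (f : M ⟶ N) (n : ℤ) (x : (Sh M n).carrier) :
    (shMap f n).1 x = toSh N n (f.1 (unSh M n x)) := rfl

theorem Contraacyclic.cone_shMap {f : M ⟶ N} (hf : Contraacyclic (CtrHoch.cone f)) (n : ℤ) :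
    Contraacyclic (CtrHoch.cone (shMap f n)) := by
  have e := GrSp.neg_one_zpow_mul_self (𝕜 := 𝕜) n
  refine (hf.sh n).of_retract
    (homMk (toSh _ n ∘L (coneInl f ∘L unSh _ n ∘L coneFst (shMap f n) +
      ((-1 : 𝕜) ^ n) • (coneInr f ∘L unSh _ n ∘L coneSnd (shMap f n)))) ?_ ?_)
    (homMk ((coneInl (shMap f n) ∘L toSh _ n ∘L coneFst f +
      ((-1 : 𝕜) ^ n) • (coneInr (shMap f n) ∘L toSh _ n ∘L coneSnd f)) ∘L unSh _ n) ?_ ?_) ?_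
  · exact HomDeg.comp_mem (add_mem (HomDeg.comp_mem (HomDeg.comp_mem (coneFst_mem (shMap f n))
      (unSh_mem _ n) rfl) (coneInl_mem f) (by ring)) (Submodule.smul_mem _ _
        (HomDeg.comp_mem (HomDeg.comp_mem (coneSnd_mem (shMap f n)) (unSh_mem _ n) rfl)
          (coneInr_mem f) (by ring)))) (toSh_mem _ n) (neg_add_cancel n)
  · intro x
    refine sh_ext _ n (cone_ext f ?_ ?_) <;>
      simp [smul_smul, e]
  · exact HomDeg.comp_mem (unSh_mem _ n) (add_mem (HomDeg.comp_mem (HomDeg.comp_mem (coneFst_mem f)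
      (toSh_mem _ n) rfl) (coneInl_mem _) (by ring)) (Submodule.smul_mem _ _
        (HomDeg.comp_mem (HomDeg.comp_mem (coneSnd_mem f) (toSh_mem _ n) rfl)
          (coneInr_mem _) (by ring)))) (neg_add_cancel n)
  · intro x
    refine cone_ext (shMap f n) ?_ ?_ <;> simp [smul_smul, e]
  · intro x
    refine cone_ext (shMap f n) ?_ ?_ <;> simp [smul_smul, e]

theorem SplitExact.of_exact {M₁ M₂ M₃ : DGMod B} {i : M₁ ⟶ M₂} {p : M₂ ⟶ M₃}
    (r : M₂.carrier →L[𝕜] M₁.carrier) (s : M₃.carrier →L[𝕜] M₂.carrier)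
    (hr : GrSp.HasDeg (V := M₂.toGrSp) (W := M₁.toGrSp) 0 r)
    (hs : GrSp.HasDeg (V := M₃.toGrSp) (W := M₂.toGrSp) 0 s)
    (pi : ∀ x, p.1 (i.1 x) = 0) (ri : ∀ x, r (i.1 x) = x) (ps : ∀ x, p.1 (s x) = x)
    (ir : ∀ x, p.1 x = 0 → i.1 (r x) = x) : SplitExact i p := by
  refine ⟨r - r ∘L s ∘L p.1, s, fun k x hx => ?_, hs, fun x => by simp [pi, ri], ps, fun x => ?_⟩
  · have := hr _ _ (hs _ _ ((hom_mem p).1 k x hx))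
    simp only [add_zero] at this
    exact (hr k x hx).sub (by simpa using this)
  · have := ir (x - s (p.1 x)) (by simp [ps])
    simp only [sub_apply, ContinuousLinearMap.comp_apply, ← map_sub, this]
    abel

theorem SplitExact.comp_eq_zero {M₁ M₂ M₃ : DGMod B} {i : M₁ ⟶ M₂} {p : M₂ ⟶ M₃}
    (h : SplitExact i p) (x : M₁.carrier) : p.1 (i.1 x) = 0 := by
  obtain ⟨r, s, -, -, ri, ps, e⟩ := h
  have := e (i.1 x)
  rw [ri, add_eq_left] at this
  rw [← ps (p.1 (i.1 x)), this, map_zero]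

theorem SplitExact.contraacyclic_cone {M₁ M₂ M₃ : DGMod B} {i : M₁ ⟶ M₂} {p : M₂ ⟶ M₃}
    (h : SplitExact i p) (h₃ : Contraacyclic M₃) : Contraacyclic (cone i) :=
  (Contraacyclic.tot i p h (homMk (p.1 ∘L coneFst i)
    (HomDeg.comp_mem (coneFst_mem i) (hom_mem p) rfl)
      fun x => by simp [closed_zero, h.comp_eq_zero]) fun _ _ => rfl).source h₃

end ContraacyclicCalculus

section Fractions

variable {𝕜 : Type} [RCLike 𝕜] {B : DGAlg.{u} 𝕜} {M N P : DGMod B}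

theorem contraIso_map {f : M ⟶ N} (hf : Contraacyclic (cone f)) :
    contraIso B ((toH0 B).map f) := ⟨f, rfl, hf⟩

theorem contraIso_cases {X Y : H0 B} {f : X ⟶ Y} (hf : contraIso B f) :
    ∃ g : X.as ⟶ Y.as, (toH0 B).map g = f ∧ Contraacyclic (cone g) := hf

instance : (contraIso B).IsMultiplicative where
  id_mem X := ⟨𝟙 X.as, (toH0 B).map_id _, contraacyclic_cone_id⟩
  comp_mem f g hf hg := by
    obtain ⟨f', ef, hf'⟩ := contraIso_cases hf
    obtain ⟨g', eg, hg'⟩ := contraIso_cases hg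
    exact ⟨f' ≫ g', by rw [(toH0 B).map_comp, ← ef, ← eg], hf'.cone_comp hg'⟩

/-- A homotopy pushout of a map along a map with contraacyclic cone. -/
theorem exists_homotopy_pushout {s : M ⟶ N} (hs : Contraacyclic (cone s)) (f : M ⟶ P) :
    ∃ (Q : DGMod B) (g : N ⟶ Q) (t : P ⟶ Q), Contraacyclic (cone t) ∧
      (toH0 B).map (f ≫ t) = (toH0 B).map (s ≫ g) := by
  obtain ⟨σ, hσ⟩ : ∃ σ : Sh (cone s) 1 ⟶ P, ∀ x, σ.1 x = f.1 (coneSnd s (unSh _ 1 x)) :=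
    ⟨homMk (f.1 ∘L coneSnd s ∘L unSh _ 1) (HomDeg.comp_mem (HomDeg.comp_mem (unSh_mem _ 1)
      (coneSnd_mem s) (by norm_num)) (hom_mem f) (zero_add 0)) fun x => by simp [closed_zero],
      fun _ => rfl⟩
  refine ⟨cone σ, homMk (-(coneInr σ ∘L toSh _ 1 ∘L coneInl s)) (neg_mem (HomDeg.comp_mem
    (HomDeg.comp_mem (coneInl_mem s) (toSh_mem _ 1) rfl) (coneInr_mem σ) (by norm_num))) (fun x =>
      cone_ext σ (by simp [hσ]) (sh_ext _ 1 (cone_ext s (by simp) (by simp)))), coneι σ,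
    (hs.sh 1).cone_coneι σ, toH0_map_eq_iff.2 ⟨coneInr σ ∘L toSh _ 1 ∘L coneInr s,
      HomDeg.comp_mem (HomDeg.comp_mem (coneInr_mem s) (toSh_mem _ 1) rfl) (coneInr_mem σ)
        (by norm_num), fun x => cone_ext σ ?_ (sh_ext _ 1 (cone_ext s ?_ ?_))⟩⟩ <;> simp [hσ]

theorem exists_coequalizing {s : M ⟶ N} (hs : Contraacyclic (cone s)) (f : N ⟶ P)
    (h : (toH0 B).map (s ≫ f) = 0) : ∃ (Q : DGMod B) (t : P ⟶ Q), Contraacyclic (cone t) ∧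
      (toH0 B).map (f ≫ t) = 0 := by
  rw [← (toH0 B).map_zero] at h
  obtain ⟨h, hh, e⟩ := toH0_map_eq_iff.1 h
  have e' : ∀ x, f.1 (s.1 x) = P.d (h x) + h (M.d x) := fun x => by
    rw [← e x]; exact (sub_zero _).symm
  obtain ⟨g, hg⟩ : ∃ g : cone s ⟶ P, ∀ x, g.1 x = f.1 (coneFst s x) + h (coneSnd s x) :=
    ⟨homMk (f.1 ∘L coneFst s + h ∘L coneSnd s) (add_mem
      (HomDeg.comp_mem (coneFst_mem s) (hom_mem f) rfl)
      (HomDeg.comp_mem (coneSnd_mem s) hh (by norm_num))) fun x => by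
        simp [closed_zero, e', add_assoc], fun _ => rfl⟩
  refine ⟨cone g, coneι g, hs.cone_coneι g, ?_⟩
  rw [← (toH0 B).map_zero]
  refine toH0_map_eq_iff.2 ⟨coneInr g ∘L coneInl s,
    HomDeg.comp_mem (coneInl_mem s) (coneInr_mem g) rfl, fun x => ?_⟩
  rw [show (0 : N ⟶ cone g).1 x = 0 from rfl]
  refine cone_ext g ?_ (cone_ext s ?_ ?_) <;> simp [hg]

instance : (contraIso B).HasLeftCalculusOfFractions where
  exists_leftFraction X Y φ := by
    obtain ⟨s, es, hs⟩ := contraIso_cases φ.hs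
    obtain ⟨f, ef⟩ := (toH0 B).map_surjective (X := φ.X'.as) (Y := Y.as) φ.f
    obtain ⟨Q, g, t, ht, e⟩ := exists_homotopy_pushout hs f
    refine ⟨⟨(toH0 B).map g, (toH0 B).map t, contraIso_map ht⟩, ?_⟩
    rw [(toH0 B).map_comp, (toH0 B).map_comp] at e
    change φ.f ≫ (toH0 B).map t = φ.s ≫ (toH0 B).map g
    rw [← ef, ← es]
    exact e
  ext {X' X Y} f₁ f₂ s hs e := by
    obtain ⟨s', es, hs'⟩ := contraIso_cases hs
    obtain ⟨f, ef⟩ := (toH0 B).map_surjective (X := X.as) (Y := Y.as) (f₁ - f₂)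
    obtain ⟨Q, t, ht, e'⟩ := exists_coequalizing hs' f (by
      rw [(toH0 B).map_comp, ef, es]
      exact (Preadditive.comp_sub _ _ _).trans (sub_eq_zero.2 e))
    refine ⟨_, (toH0 B).map t, contraIso_map ht, ?_⟩
    rw [(toH0 B).map_comp, ef] at e'
    exact sub_eq_zero.1 ((Preadditive.sub_comp _ _ _).symm.trans e')

end Fractions

section RelativelyProjective

variable {𝕜 : Type} [RCLike 𝕜] {B : DGAlg.{u} 𝕜} {M N P : DGMod B}

/-- The graded module underlying `P` has the lifting property for the surjections that split
by a continuous linear map. -/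
def RelProj (P : DGMod B) : Prop :=
  ∀ ⦃M N : DGMod B⦄ (p : M ⟶ N) (s : N.carrier →L[𝕜] M.carrier),
    GrSp.HasDeg (V := N.toGrSp) (W := M.toGrSp) 0 s → (∀ x, p.1 (s x) = x) →
    ∀ k, ∀ f ∈ HomDeg P N k, ∃ l ∈ HomDeg P M k, ∀ x, p.1 (l x) = f x

theorem RelProj.sh (hP : RelProj P) (n : ℤ) : RelProj (Sh P n) := fun M N p s hs ps k f hf => by
  obtain ⟨l, hl, e⟩ := hP p s hs ps (n + k) (f ∘L toSh P n) (HomDeg.comp_mem (toSh_mem P n) hf rfl)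
  exact ⟨l ∘L unSh P n, HomDeg.comp_mem (unSh_mem P n) hl (by ring), fun x => e (unSh P n x)⟩

/-- Every closed map of degree zero from a relatively projective module is nullhomotopic. -/
def RightOrthogonal (N : DGMod B) : Prop :=
  ∀ ⦃P : DGMod B⦄, RelProj P → ∀ f : P ⟶ N,
    ∃ h ∈ HomDeg P N (-1), ∀ x, f.1 x = N.d (h x) + h (P.d x)

theorem rightOrthogonal_tot {M₁ M₂ M₃ : DGMod B} {i : M₁ ⟶ M₂} {p : M₂ ⟶ M₃} (H : SplitExact i p)
    (q : cone i ⟶ M₃) (hq : ∀ x, q.1 x = p.1 (coneFst i x)) : RightOrthogonal (cone q) := by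
  intro P hP f
  obtain ⟨r, s, hr, hs, ri, ps, e⟩ := H
  have inj : Function.Injective i.1 := fun x y h => by rw [← ri x, h, ri]
  obtain ⟨l, hl, pl⟩ := hP p s hs ps 0 (coneFst q ∘L f.1)
    (HomDeg.comp_mem (hom_mem f) (coneFst_mem q) rfl)
  have pl' : ∀ x, p.1 (l x) = coneFst q (f.1 x) := pl
  have c := closed_zero f
  have c₃ : ∀ x, M₃.d (coneFst q (f.1 x)) + p.1 (coneFst i (coneSnd q (f.1 x))) =
      coneFst q (f.1 (P.d x)) := fun x => by rw [← c, coneFst_d, hq]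
  have c₂ : ∀ x, -(M₂.d (coneFst i (coneSnd q (f.1 x))) + i.1 (coneSnd i (coneSnd q (f.1 x)))) =
      coneFst i (coneSnd q (f.1 (P.d x))) := fun x => by simp [← c]
  let g : P.carrier →L[𝕜] M₂.carrier := coneFst i ∘L coneSnd q ∘L f.1 + M₂.d ∘L l - l ∘L P.d
  have hg : g ∈ HomDeg P M₂ 1 := by
    have h1 := hom_d l hl
    have h2 := HomDeg.comp_mem (HomDeg.comp_mem (hom_mem f) (coneSnd_mem q) rfl) (coneFst_mem i) rfl
    rw [zpow_zero, one_smul] at h1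
    rw [show g = coneFst i ∘L coneSnd q ∘L f.1 + (M₂.d ∘L l - l ∘L P.d) from add_sub_assoc _ _ _]
    exact add_mem h2 h1
  have gv : ∀ x, g x = coneFst i (coneSnd q (f.1 x)) + M₂.d (l x) - l (P.d x) := fun _ => rfl
  have ig : ∀ x, i.1 (r (g x)) = g x := fun x => by
    have h : p.1 (g x) = 0 := by
      rw [gv, map_sub, map_add, ← closed_zero, pl', pl', ← c₃]
      abel
    simpa [h] using e (g x)
  have hm : r ∘L g ∈ HomDeg P M₁ 1 := ⟨fun k x hx => by
    have := hr _ _ (hg.1 k x hx)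
    rwa [add_zero] at this, fun x b => inj (by
      rw [(hom_mem i).2, ContinuousLinearMap.comp_apply, ContinuousLinearMap.comp_apply, ig, ig,
        hg.2])⟩
  have hm' : ∀ x, M₁.d (r (g x)) + r (g (P.d x)) = -coneSnd i (coneSnd q (f.1 x)) := fun x =>
    inj (by
      rw [map_add, ← closed_zero, ig, ig, gv, gv, P.d_d, ← c₂]
      simp [M₂.d_d])
  refine ⟨coneInr q ∘L (coneInl i ∘L l - coneInr i ∘L r ∘L g), HomDeg.comp_mem (sub_mem
    (HomDeg.comp_mem hl (coneInl_mem i) rfl) (HomDeg.comp_mem hm (coneInr_mem i) rfl))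
      (coneInr_mem q) rfl, fun x => cone_ext q ?_ (cone_ext i ?_ ?_)⟩
  · simp [hq, pl']
  · simp only [ContinuousLinearMap.comp_apply, sub_apply, map_sub, map_add, coneSnd_d, coneFst_d,
      coneFst_inr, coneFst_inl, coneSnd_inr, coneSnd_inl, map_zero, map_neg, ig]
    rw [gv]
    abel
  · have := hm' x
    simp only [ContinuousLinearMap.comp_apply, sub_apply, map_sub, map_add, coneSnd_d, coneSnd_inr,
      coneSnd_inl, map_zero, map_neg]
    rw [← neg_eq_iff_eq_neg.2 this]
    abel

theorem rightOrthogonal_cone {f : M ⟶ N} (hM : RightOrthogonal M) (hN : RightOrthogonal N) :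
    RightOrthogonal (cone f) := by
  intro P hP g
  have c := closed_zero g
  have c₁ : ∀ x, N.d (coneFst f (g.1 x)) + f.1 (coneSnd f (g.1 x)) = coneFst f (g.1 (P.d x)) :=
    fun x => by simp [← c]
  have c₂ : ∀ x, -M.d (coneSnd f (g.1 x)) = coneSnd f (g.1 (P.d x)) := fun x => by simp [← c]
  obtain ⟨h₂, hh₂, e₂⟩ := hM (hP.sh 1) (homMk (coneSnd f ∘L g.1 ∘L unSh P 1)
    (HomDeg.comp_mem (HomDeg.comp_mem (unSh_mem P 1) (hom_mem g) rfl) (coneSnd_mem f) (by norm_num))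
    fun x => by simp [← c₂])
  have e₂' : ∀ x, coneSnd f (g.1 x) = M.d (h₂ (toSh P 1 x)) - h₂ (toSh P 1 (P.d x)) := fun x => by
    have : coneSnd f (g.1 x) = _ := e₂ (toSh P 1 x)
    simpa [sub_eq_add_neg] using this
  have hk : h₂ ∘L toSh P 1 ∈ HomDeg P M 0 := HomDeg.comp_mem (toSh_mem P 1) hh₂ (by norm_num)
  obtain ⟨h₁, hh₁, e₁⟩ := hN hP (homMk (coneFst f ∘L g.1 + f.1 ∘L h₂ ∘L toSh P 1)
    (add_mem (HomDeg.comp_mem (hom_mem g) (coneFst_mem f) rfl)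
      (HomDeg.comp_mem hk (hom_mem f) rfl)) fun x => by
        simp only [add_apply, ContinuousLinearMap.comp_apply, map_add, ← c₁, e₂', closed_zero,
          map_sub]
        abel)
  have e₁' : ∀ x, coneFst f (g.1 x) + f.1 (h₂ (toSh P 1 x)) = N.d (h₁ x) + h₁ (P.d x) := e₁
  refine ⟨coneInl f ∘L h₁ - coneInr f ∘L h₂ ∘L toSh P 1, sub_mem
    (HomDeg.comp_mem hh₁ (coneInl_mem f) rfl) (HomDeg.comp_mem hk (coneInr_mem f) rfl), fun x =>
      cone_ext f ?_ ?_⟩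
  · have := e₁' x
    simp only [ContinuousLinearMap.comp_apply, sub_apply, map_sub, map_add, coneFst_d, coneFst_inr,
      coneFst_inl, coneSnd_inl, coneSnd_inr, map_zero]
    rw [eq_sub_of_add_eq this]
    abel
  · have := e₂' x
    simp [this, sub_eq_add_neg]

theorem rightOrthogonal_shift (hM : RightOrthogonal M) (n : ℤ) : RightOrthogonal (Sh M n) := by
  intro P hP f
  have ε := GrSp.neg_one_zpow_mul_self (𝕜 := 𝕜) n
  have ε' : ((-1 : 𝕜) ^ (-n)) = (-1) ^ n := Bimod.neg_one_zpow_congr ⟨-n, by ring⟩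
  have c : ∀ x, unSh M n (f.1 (P.d x)) = ((-1 : 𝕜) ^ n) • M.d (unSh M n (f.1 x)) := fun x => by
    rw [← closed_zero]; simp
  obtain ⟨h, hh, e⟩ := hM (hP.sh (-n)) (homMk (unSh M n ∘L f.1 ∘L unSh P (-n))
    (HomDeg.comp_mem (HomDeg.comp_mem (unSh_mem P (-n)) (hom_mem f) rfl) (unSh_mem M n) (by ring))
    fun x => by simp only [ContinuousLinearMap.comp_apply, Sh_d, map_smul, unSh_toSh, c, ε', smul_smul, ε, one_smul])
  refine ⟨((-1 : 𝕜) ^ n) • (toSh M n ∘L h ∘L toSh P (-n)), Submodule.smul_mem _ _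
    (HomDeg.comp_mem (HomDeg.comp_mem (toSh_mem P (-n)) hh rfl) (toSh_mem M n) (by ring)), fun x =>
      sh_ext M n ?_⟩
  have : unSh M n (f.1 x) = _ := e (toSh P (-n) x)
  simp only [unSh_toSh, Sh_d, ε', map_smul] at this
  simp only [ContinuousLinearMap.comp_apply, smul_apply, map_smul, map_add, Sh_d, unSh_toSh,
    smul_smul, ε, one_smul, this]

theorem Contraacyclic.rightOrthogonal (hN : Contraacyclic N) : RightOrthogonal N := by
  induction hN with
  | tot i p h q hq => exact rightOrthogonal_tot h q fun x => hq (coneFst i x) (coneSnd i x)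
  | cone f _ _ hM hN => exact rightOrthogonal_cone hM hN
  | shift n _ hM => exact rightOrthogonal_shift hM n
  | pi M _ hM =>
    intro P hP f
    let pr (k) : (DGMod.pi M).carrier →L[𝕜] (M k).carrier := ContinuousLinearMap.proj k
    have prm (k) : pr k ∈ HomDeg (DGMod.pi M) (M k) 0 := ⟨fun j x hx => by
      have : (M k).Deg j (x k) := congrFun hx k
      rw [add_zero]
      exact this, fun x b => by simp [pr]⟩
    choose h hh e using fun k => hM k hP (homMk (pr k ∘L f.1)
      (HomDeg.comp_mem (hom_mem f) (prm k) rfl) fun x => congrFun (closed_zero f x) k)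
    refine ⟨ContinuousLinearMap.pi h, ⟨fun j x hx => funext fun k => (hh k).1 j x hx,
      fun x b => funext fun k => ?_⟩, fun x => funext fun k => e k x⟩
    have := (hh k).2 x b
    simpa using this
  | @retract M N a b eab _ hN =>
    intro P hP f
    obtain ⟨a, rfl⟩ := (toH0 B).map_surjective a
    obtain ⟨b, rfl⟩ := (toH0 B).map_surjective b
    rw [← (toH0 B).map_comp, ← (toH0 B).map_id] at eab
    obtain ⟨k, hk, ek⟩ := toH0_map_eq_iff.1 eab
    obtain ⟨h, hh, e⟩ := hN hP (f ≫ a)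
    refine ⟨b.1 ∘L h - k ∘L f.1, sub_mem (HomDeg.comp_mem hh (hom_mem b) rfl)
      (HomDeg.comp_mem (hom_mem f) hk rfl), fun x => ?_⟩
    have e1 := ek (f.1 x)
    have e2 := e x
    simp only [comp_val, id_val] at e1 e2
    rw [e2, map_add, ← closed_zero, closed_zero f] at e1
    simp only [ContinuousLinearMap.comp_apply, sub_apply, map_sub]
    rw [sub_eq_iff_eq_add] at e1
    rw [sub_add_sub_comm, e1]
    abel

variable {t : M ⟶ N}

theorem RelProj.map_injective (hP : RelProj P) (ht : Contraacyclic (cone t)) (f : P ⟶ M)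
    (h : (toH0 B).map (f ≫ t) = 0) : (toH0 B).map f = 0 := by
  rw [← (toH0 B).map_zero] at h ⊢
  obtain ⟨k, hk, e⟩ := toH0_map_eq_iff.1 h
  have e' : ∀ x, t.1 (f.1 x) = N.d (k x) + k (P.d x) := fun x => by
    rw [← e x]; exact (sub_zero _).symm
  obtain ⟨h, hh, eh⟩ := ht.rightOrthogonal (hP.sh (-1))
    (homMk ((coneInr t ∘L f.1 - coneInl t ∘L k) ∘L unSh P (-1))
      (HomDeg.comp_mem (unSh_mem P (-1)) (sub_mem (HomDeg.comp_mem (hom_mem f) (coneInr_mem t) rfl)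
        (HomDeg.comp_mem hk (coneInl_mem t) rfl)) (by norm_num)) fun x =>
          cone_ext t (by simp [e']) (by simp [closed_zero]))
  refine toH0_map_eq_iff.2 ⟨-(coneSnd t ∘L h ∘L toSh P (-1)), neg_mem (HomDeg.comp_mem
    (HomDeg.comp_mem (toSh_mem P (-1)) hh rfl) (coneSnd_mem t) (by norm_num)), fun x => ?_⟩
  have := congrArg (coneSnd t) (eh (toSh P (-1) x))
  simp only [homMk_val, ContinuousLinearMap.comp_apply, unSh_toSh, sub_apply, map_sub, coneSnd_inr,
    coneSnd_inl, sub_zero, map_add, coneSnd_d, Sh_d, map_smul] at this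
  rw [show (0 : P ⟶ M).1 x = 0 from rfl, this]
  simp

theorem RelProj.map_surjective (hP : RelProj P) (ht : Contraacyclic (cone t)) (f : P ⟶ N) :
    ∃ g : P ⟶ M, (toH0 B).map (g ≫ t) = (toH0 B).map f := by
  obtain ⟨h, hh, eh⟩ := ht.rightOrthogonal hP (f ≫ coneι t)
  have e₁ : ∀ x, f.1 x = N.d (coneFst t (h x)) + t.1 (coneSnd t (h x)) + coneFst t (h (P.d x)) :=
    fun x => by simpa using congrArg (coneFst t) (eh x)
  have e₂ : ∀ x, M.d (coneSnd t (h x)) = coneSnd t (h (P.d x)) := fun x => by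
    have := congrArg (coneSnd t) (eh x)
    simp only [comp_val, coneι_val, coneSnd_inl, map_add, coneSnd_d] at this
    rw [← sub_eq_zero, ← neg_eq_zero, neg_sub, sub_eq_neg_add, ← this]
  refine ⟨homMk (coneSnd t ∘L h) (HomDeg.comp_mem hh (coneSnd_mem t) (by norm_num)) e₂,
    toH0_map_eq_iff.2 ⟨-(coneFst t ∘L h), neg_mem (HomDeg.comp_mem hh (coneFst_mem t) rfl),
      fun x => ?_⟩⟩
  change t.1 (coneSnd t (h x)) - f.1 x = N.d (-coneFst t (h x)) + -coneFst t (h (P.d x))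
  rw [e₁, map_neg]
  abel

theorem RelProj.toDctr_bijective (hP : RelProj P) (Y : DGMod B) :
    Function.Bijective fun f : (toH0 B).obj P ⟶ (toH0 B).obj Y => (contraIso B).Q.map f := by
  refine ⟨fun f g h => ?_, fun g => ?_⟩
  · obtain ⟨Z, s, hs, e⟩ := (MorphismProperty.map_eq_iff_postcomp (contraIso B).Q (contraIso B)
      f g).1 h
    obtain ⟨t, rfl, ht⟩ := contraIso_cases hs
    obtain ⟨k, ek⟩ := (toH0 B).map_surjective (f - g)
    rw [← sub_eq_zero, ← ek]
    refine hP.map_injective (t := t) ht k ?_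
    rw [(toH0 B).map_comp, ek]
    exact (Preadditive.sub_comp _ _ _).trans (sub_eq_zero.2 e)
  · obtain ⟨φ, hφ⟩ := Localization.exists_leftFraction (contraIso B).Q (contraIso B) g
    obtain ⟨t, et, ht⟩ := contraIso_cases φ.hs
    obtain ⟨k, ek⟩ := (toH0 B).map_surjective (X := P) (Y := φ.Y'.as) φ.f
    obtain ⟨l, el⟩ := hP.map_surjective (t := t) ht k
    refine ⟨(toH0 B).map l, ?_⟩
    have : IsIso ((contraIso B).Q.map φ.s) := Localization.inverts (contraIso B).Q _ _ φ.hs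
    rw [← cancel_mono ((contraIso B).Q.map φ.s), hφ, MorphismProperty.LeftFraction.map_comp_map_s,
      ← ek, ← el, ← et, (toH0 B).map_comp]
    exact ((contraIso B).Q.map_comp _ _).symm

end RelativelyProjective

section Submodules

variable {𝕜 : Type} [RCLike 𝕜] {B : DGAlg.{u} 𝕜} {M N : DGMod B}

/-- The closed dg-submodules of a dg-module. -/
structure ClosedSub (M : DGMod B) where
  S : Submodule 𝕜 M.carrier
  closed : IsClosed (S : Set M.carrier)
  proj_mem : ∀ n, ∀ x ∈ S, M.proj n x ∈ S
  d_mem : ∀ x ∈ S, M.d x ∈ S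
  act_mem : ∀ x ∈ S, ∀ b, M.act (tm 𝕜 x b) ∈ S

namespace ClosedSub

variable (C : ClosedSub M)

/-- The underlying graded space of a closed dg-submodule. -/
def gr : GrSp.{u} 𝕜 where
  carrier := C.S
  uag := C.S.toAddSubgroup.isUniformAddGroup
  complete := C.closed.completeSpace_coe
  proj n := (M.proj n ∘L C.S.subtypeL).codRestrict C.S fun x => C.proj_mem n x.1 x.2
  proj_proj m n x := by
    have := M.proj_proj m n x.1
    split_ifs at this ⊢ <;> exact Subtype.ext this
  proj_small U hU := by
    rw [nhds_subtype_eq_comap, Filter.mem_comap] at hU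
    obtain ⟨t, ht, hU⟩ := hU
    filter_upwards [M.proj_small t ht] with n hn x
    exact hU (hn x.1)
  proj_sep x hx := Subtype.ext (M.proj_sep x.1 fun n => congrArg Subtype.val (hx n))

/-- The inclusion of the underlying graded space. -/
def grVal : C.gr.carrier →L[𝕜] M.carrier := C.S.subtypeL

theorem gr_deg {k : ℤ} {x : C.gr.carrier} : C.gr.Deg k x ↔ M.Deg k (C.grVal x) :=
  ⟨fun h => congrArg Subtype.val h, fun h => Subtype.ext h⟩

theorem gr_sgn (x : C.gr.carrier) : C.grVal (C.gr.sgn x) = M.sgn (C.grVal x) :=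
  (GrSp.HasDeg.sgn_zero (V := C.gr) (W := M.toGrSp) (f := C.grVal) (fun n y hy => by
    rw [add_zero]
    exact C.gr_deg.1 hy) x).symm

theorem grVal_act_mem (t : CT 𝕜 C.gr.carrier B.carrier) :
    M.act (ctMap C.grVal (ContinuousLinearMap.id 𝕜 B.carrier) t) ∈ C.S := by
  have := C.closed
  have h := ct_ext_apply (C.S.mkQL ∘L M.act ∘L
    ctMap C.grVal (ContinuousLinearMap.id 𝕜 B.carrier)) 0 (fun x b => by
      have := C.act_mem (C.grVal x) x.2 b
      simpa using this) t
  simpa using h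

/-- The action on a closed dg-submodule. -/
def grAct : CT 𝕜 C.gr.carrier B.carrier →L[𝕜] C.gr.carrier :=
  (M.act ∘L ctMap C.grVal (ContinuousLinearMap.id 𝕜 B.carrier)).codRestrict C.S C.grVal_act_mem

theorem grVal_act (x : C.gr.carrier) (b : B.carrier) :
    C.grVal (C.grAct (tm 𝕜 x b)) = M.act (tm 𝕜 (C.grVal x) b) :=
  congrArg M.act (ctMap_tm C.grVal _ _ _)

theorem gr_ext {x y : C.gr.carrier} (h : C.grVal x = C.grVal y) : x = y := Subtype.ext h

/-- The differential on a closed dg-submodule. -/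
def grD : C.gr.carrier →L[𝕜] C.gr.carrier :=
  (M.d ∘L C.grVal).codRestrict C.S fun x => C.d_mem x.1 x.2

theorem grVal_d (x : C.gr.carrier) : C.grVal (C.grD x) = M.d (C.grVal x) := rfl

/-- A closed dg-submodule as a dg-module. -/
def toMod : DGMod B where
  toGrSp := C.gr
  d := C.grD
  d_deg n x hx := C.gr_deg.2 (M.d_deg n _ (C.gr_deg.1 hx))
  d_d x := C.gr_ext (by rw [grVal_d, grVal_d, M.d_d, map_zero])
  act := C.grAct
  act_deg m n x b hx hb := C.gr_deg.2 (by
    rw [grVal_act]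
    exact M.act_deg m n _ b (C.gr_deg.1 hx) hb)
  act_mul x b c := C.gr_ext (by rw [grVal_act, grVal_act, grVal_act, M.act_mul])
  act_one x := C.gr_ext (by rw [grVal_act, M.act_one])
  d_act x b := C.gr_ext (by
    rw [map_add, grVal_act, grVal_act, grVal_d, grVal_d, grVal_act, M.d_act, gr_sgn])

/-- The inclusion of a closed dg-submodule. -/
def val : C.toMod.carrier →L[𝕜] M.carrier := C.grVal

theorem val_mem (x : C.toMod.carrier) : C.val x ∈ C.S := x.2

theorem ext {x y : C.toMod.carrier} (h : C.val x = C.val y) : x = y := Subtype.ext h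

/-- A continuous linear map with values in a closed dg-submodule. -/
def lift {E : Type*} [AddCommGroup E] [Module 𝕜 E] [TopologicalSpace E] (f : E →L[𝕜] M.carrier)
    (hf : ∀ x, f x ∈ C.S) : E →L[𝕜] C.toMod.carrier := f.codRestrict C.S hf

@[simp] theorem val_lift {E : Type*} [AddCommGroup E] [Module 𝕜 E] [TopologicalSpace E]
    (f : E →L[𝕜] M.carrier) (hf : ∀ x, f x ∈ C.S) (x : E) : C.val (C.lift f hf x) = f x := rfl

@[simp] theorem val_d (x : C.toMod.carrier) : C.val (C.toMod.d x) = M.d (C.val x) := rfl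

@[simp] theorem val_act (x : C.toMod.carrier) (b : B.carrier) :
    C.val (C.toMod.act (tm 𝕜 x b)) = M.act (tm 𝕜 (C.val x) b) :=
  C.grVal_act x b

theorem deg_val {k : ℤ} {x : C.toMod.carrier} : M.Deg k (C.val x) ↔ C.toMod.Deg k x :=
  C.gr_deg.symm

theorem val_hom : C.val ∈ HomDeg C.toMod M 0 :=
  ⟨fun k x hx => by
    rw [add_zero]
    exact C.deg_val.2 hx, C.val_act⟩

theorem lift_hom {f : N.carrier →L[𝕜] M.carrier} (hf : ∀ x, f x ∈ C.S) {k : ℤ}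
    (h : f ∈ HomDeg N M k) : C.lift f hf ∈ HomDeg N C.toMod k :=
  ⟨fun j x hx => C.deg_val.1 (h.1 j x hx), fun x b => C.ext (by
    rw [val_lift, val_act, val_lift, h.2])⟩

end ClosedSub

/-- The product of a family of dg-modules. -/
def prodMod {K : Type u} (N : K → DGMod B) : DGMod B := DGMod.pi N

/-- The projections from a product. -/
def prodπ {K : Type u} (N : K → DGMod B) (k : K) : (prodMod N).carrier →L[𝕜] (N k).carrier :=
  (ContinuousLinearMap.proj k : (∀ k, (N k).carrier) →L[𝕜] (N k).carrier)

/-- The map to a product given by its components. -/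
def prodLift {K : Type u} {N : K → DGMod B} {E : Type*} [AddCommGroup E] [Module 𝕜 E]
    [TopologicalSpace E] (f : ∀ k, E →L[𝕜] (N k).carrier) : E →L[𝕜] (prodMod N).carrier :=
  ContinuousLinearMap.pi f

section

variable {K : Type u} {L : K → DGMod B}

@[simp] theorem prodπ_lift {E : Type*} [AddCommGroup E] [Module 𝕜 E]
    [TopologicalSpace E] (f : ∀ k, E →L[𝕜] (L k).carrier) (k : K) (x : E) :
    prodπ L k (prodLift f x) = f k x := rfl

theorem prod_ext {x y : (prodMod L).carrier} (h : ∀ k, prodπ L k x = prodπ L k y) : x = y :=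
  funext h

theorem prod_deg {k : ℤ} {x : (prodMod L).carrier} :
    (prodMod L).Deg k x ↔ ∀ i, (L i).Deg k (prodπ L i x) := funext_iff

@[simp] theorem prodπ_d (x : (prodMod L).carrier) (k : K) :
    prodπ L k ((prodMod L).d x) = (L k).d (prodπ L k x) := rfl

@[simp] theorem prodπ_act (x : (prodMod L).carrier) (b : B.carrier) (k : K) :
    prodπ L k ((prodMod L).act (tm 𝕜 x b)) = (L k).act (tm 𝕜 (prodπ L k x) b) :=
  congrArg (L k).act (ctMap_tm (ContinuousLinearMap.proj k : (∀ k, (L k).carrier) →L[𝕜] _) _ _ _)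

theorem prodπ_mem (k : K) : prodπ L k ∈ HomDeg (prodMod L) (L k) 0 :=
  ⟨fun j x hx => by
    rw [add_zero]
    exact prod_deg.1 hx k, fun x b => prodπ_act x b k⟩

theorem prodLift_mem {f : ∀ k, N.carrier →L[𝕜] (L k).carrier} {j : ℤ}
    (hf : ∀ k, f k ∈ HomDeg N (L k) j) : prodLift f ∈ HomDeg N (prodMod L) j :=
  ⟨fun i x hx => prod_deg.2 fun k => (hf k).1 i x hx, fun x b => prod_ext fun k => by
    simp [(hf k).2]⟩

end

end Submodules

section Telescope

variable {𝕜 : Type} [RCLike 𝕜] {B : DGAlg.{u} 𝕜}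

/-- A module that is the product of its parts in positions `0, 1, 2, …`, where `T n` is the
projection to the positions below `n`, with a differential that lowers positions by at most one
and a continuous linear contracting homotopy that raises positions by one. -/
structure Tower (X : DGMod B) where
  T : ℕ → X.carrier →L[𝕜] X.carrier
  T_mem : ∀ n, T n ∈ HomDeg X X 0
  T_T : ∀ m n x, m ≤ n → T m (T n x) = T m x
  T_T' : ∀ m n x, m ≤ n → T n (T m x) = T m x
  T_zero : ∀ x, T 0 x = 0
  T_sep : ∀ x, (∀ n, T n x = 0) → x = 0
  T_d_T : ∀ n x, T n (X.d (T n x)) = X.d (T n x)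
  T_d : ∀ n x, T n (X.d (T (n + 1) x)) = T n (X.d x)
  h : X.carrier →L[𝕜] X.carrier
  h_deg : GrSp.HasDeg (V := X.toGrSp) (W := X.toGrSp) (-1) h
  T_h : ∀ n x, T (n + 1) (h x) = h (T n x)
  d_h : ∀ x, X.d (h x) + h (X.d x) = x
  glue : (ℕ → X.carrier) →L[𝕜] X.carrier
  glue_deg : ∀ k x, (∀ n, X.Deg k (x n)) → X.Deg k (glue x)
  T_glue : ∀ n x, T (n + 1) (glue x) - T n (glue x) = T (n + 1) (x n) - T n (x n)

namespace Tower

variable {X : DGMod B} (W : Tower X)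

theorem proj_T (k : ℤ) (n : ℕ) (x : X.carrier) : W.T n (X.proj k x) = X.proj k (W.T n x) := by
  refine homog_ext_apply (V := X.toGrSp) (W.T n ∘L X.proj k) (X.proj k ∘L W.T n) (fun j y hy => ?_) x
  have h := (W.T_mem n).1 j y hy
  rw [add_zero] at h
  simp only [ContinuousLinearMap.comp_apply]
  rw [hy.proj_eq, h.proj_eq]
  split_ifs <;> simp

theorem isClosed_eq_zero (f : X.carrier →L[𝕜] X.carrier) : IsClosed {x | f x = 0} :=
  isClosed_eq f.continuous continuous_const

/-- The part in positions below `n`. -/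
def F (n : ℕ) : ClosedSub X where
  S := LinearMap.ker (W.T n - ContinuousLinearMap.id 𝕜 X.carrier : X.carrier →L[𝕜] X.carrier).toLinearMap
  closed := isClosed_eq_zero _
  proj_mem k x hx := by
    simp only [LinearMap.mem_ker, ContinuousLinearMap.coe_coe, sub_apply, ContinuousLinearMap.id_apply,
      sub_eq_zero] at hx ⊢
    rw [proj_T, hx]
  d_mem x hx := by
    simp only [LinearMap.mem_ker, ContinuousLinearMap.coe_coe, sub_apply, ContinuousLinearMap.id_apply,
      sub_eq_zero] at hx ⊢
    rw [← hx, W.T_d_T]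
  act_mem x hx b := by
    simp only [LinearMap.mem_ker, ContinuousLinearMap.coe_coe, sub_apply, ContinuousLinearMap.id_apply,
      sub_eq_zero] at hx ⊢
    rw [(W.T_mem n).2, hx]

theorem mem_F {n : ℕ} {x : X.carrier} : x ∈ (W.F n).S ↔ W.T n x = x := by
  simp [F, sub_eq_zero]

/-- The cycles in position `n - 1`. -/
def Z (n : ℕ) : ClosedSub X where
  S := (W.F n).S ⊓ ⨅ m : Fin n, LinearMap.ker (W.T m).toLinearMap ⊓
    LinearMap.ker (W.T m ∘L X.d).toLinearMap
  closed := by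
    simp only [Submodule.coe_inf, Submodule.coe_iInf]
    exact (W.F n).closed.inter (isClosed_iInter fun m => (isClosed_eq_zero (W.T m)).inter
      (isClosed_eq_zero (W.T m ∘L X.d)))
  proj_mem k x hx := by
    simp only [Submodule.mem_inf, Submodule.mem_iInf, LinearMap.mem_ker, ContinuousLinearMap.coe_coe,
      ContinuousLinearMap.comp_apply] at hx ⊢
    have hd : X.d (X.proj k x) = X.proj (k + 1) (X.d x) := by
      refine homog_ext_apply (V := X.toGrSp) (X.d ∘L X.proj k) (X.proj (k + 1) ∘L X.d)
        (fun j y hy => ?_) x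
      have h := X.d_deg j y hy
      simp only [ContinuousLinearMap.comp_apply]
      rw [hy.proj_eq, h.proj_eq]
      by_cases e : k = j
      · simp [e]
      · rw [if_neg e, if_neg (by omega), map_zero]
    refine ⟨(W.F n).proj_mem k x hx.1, fun m => ⟨?_, ?_⟩⟩
    · rw [proj_T, (hx.2 m).1, map_zero]
    · rw [hd, proj_T, (hx.2 m).2, map_zero]
  d_mem x hx := by
    simp only [Submodule.mem_inf, Submodule.mem_iInf, LinearMap.mem_ker, ContinuousLinearMap.coe_coe,
      ContinuousLinearMap.comp_apply] at hx ⊢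
    exact ⟨(W.F n).d_mem x hx.1, fun m => ⟨(hx.2 m).2, by rw [X.d_d, map_zero]⟩⟩
  act_mem x hx b := by
    simp only [Submodule.mem_inf, Submodule.mem_iInf, LinearMap.mem_ker, ContinuousLinearMap.coe_coe,
      ContinuousLinearMap.comp_apply] at hx ⊢
    have e : ∀ m, W.T m (X.sgn x) = X.sgn (W.T m x) := fun m => ((W.T_mem m).1.sgn_zero x).symm
    refine ⟨(W.F n).act_mem x hx.1 b, fun m => ⟨?_, ?_⟩⟩
    · rw [(W.T_mem m).2, (hx.2 m).1]; simp
    · rw [X.d_act, map_add, (W.T_mem m).2, (W.T_mem m).2, (hx.2 m).2, e, (hx.2 m).1]; simp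

theorem mem_Z {n : ℕ} {x : X.carrier} :
    x ∈ (W.Z n).S ↔ W.T n x = x ∧ ∀ m < n, W.T m x = 0 ∧ W.T m (X.d x) = 0 := by
  simp only [Z, Submodule.mem_inf, mem_F, Submodule.mem_iInf, LinearMap.mem_ker,
    ContinuousLinearMap.coe_coe, ContinuousLinearMap.comp_apply]
  exact and_congr_right fun _ => ⟨fun h m hm => h ⟨m, hm⟩, fun h m => h m.1 m.2⟩

/-- The inclusion of the cycles. -/
def incl (n : ℕ) : (W.Z n).toMod ⟶ (W.F n).toMod :=
  homMk ((W.F n).lift (W.Z n).val fun x => W.mem_F.2 (W.mem_Z.1 ((W.Z n).val_mem x)).1)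
    ((W.F n).lift_hom _ (W.Z n).val_hom) fun _ => (W.F n).ext (by simp)

@[simp] theorem val_incl (n : ℕ) (x : (W.Z n).toMod.carrier) :
    (W.F n).val ((W.incl n).1 x) = (W.Z n).val x := rfl

/-- A model for the quotient of `F n` by the cycles in the last position. -/
def Y (n : ℕ) : DGMod B := cone (W.incl n)

/-- The first component of an element of `Y n`. -/
def fstY (n : ℕ) : (W.Y n).carrier →L[𝕜] X.carrier := (W.F n).val ∘L coneFst (W.incl n)

/-- The second component of an element of `Y n`. -/
def sndY (n : ℕ) : (W.Y n).carrier →L[𝕜] X.carrier := (W.Z n).val ∘L coneSnd (W.incl n)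

/-- The map to `Y n` with given components. -/
def pairY {E : Type*} [AddCommGroup E] [Module 𝕜 E] [TopologicalSpace E] (n : ℕ)
    (f g : E →L[𝕜] X.carrier) (hf : ∀ x, f x ∈ (W.F n).S) (hg : ∀ x, g x ∈ (W.Z n).S) :
    E →L[𝕜] (W.Y n).carrier :=
  coneInl (W.incl n) ∘L (W.F n).lift f hf + coneInr (W.incl n) ∘L (W.Z n).lift g hg

section Pair

variable {E : Type*} [AddCommGroup E] [Module 𝕜 E] [TopologicalSpace E] {n : ℕ}
  (f g : E →L[𝕜] X.carrier) (hf : ∀ x, f x ∈ (W.F n).S) (hg : ∀ x, g x ∈ (W.Z n).S) (x : E)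

@[simp] theorem fstY_pair : W.fstY n (W.pairY n f g hf hg x) = f x := by
  change (W.F n).val (coneFst (W.incl n) (coneInl (W.incl n) ((W.F n).lift f hf x) +
    coneInr (W.incl n) ((W.Z n).lift g hg x))) = _
  rw [map_add, coneFst_inl, coneFst_inr, add_zero, ClosedSub.val_lift]

@[simp] theorem sndY_pair : W.sndY n (W.pairY n f g hf hg x) = g x := by
  change (W.Z n).val (coneSnd (W.incl n) (coneInl (W.incl n) ((W.F n).lift f hf x) +
    coneInr (W.incl n) ((W.Z n).lift g hg x))) = _
  rw [map_add, coneSnd_inl, coneSnd_inr, zero_add, ClosedSub.val_lift]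

end Pair

theorem Y_ext {n : ℕ} {x y : (W.Y n).carrier} (h1 : W.fstY n x = W.fstY n y)
    (h2 : W.sndY n x = W.sndY n y) : x = y :=
  cone_ext (W.incl n) ((W.F n).ext h1) ((W.Z n).ext h2)

@[simp] theorem fstY_d (n : ℕ) (x : (W.Y n).carrier) :
    W.fstY n ((W.Y n).d x) = X.d (W.fstY n x) + W.sndY n x := by
  have h : ∀ x : (cone (W.incl n)).carrier,
      (W.F n).val (coneFst (W.incl n) ((cone (W.incl n)).d x)) =
        X.d ((W.F n).val (coneFst (W.incl n) x)) + (W.Z n).val (coneSnd (W.incl n) x) := fun x => by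
    rw [coneFst_d, map_add, ClosedSub.val_d, val_incl]
  exact h x

@[simp] theorem sndY_d (n : ℕ) (x : (W.Y n).carrier) :
    W.sndY n ((W.Y n).d x) = -X.d (W.sndY n x) := by
  have h : ∀ x : (cone (W.incl n)).carrier,
      (W.Z n).val (coneSnd (W.incl n) ((cone (W.incl n)).d x)) =
        -X.d ((W.Z n).val (coneSnd (W.incl n) x)) := fun x => by
    rw [coneSnd_d, map_neg, ClosedSub.val_d]
  exact h x

theorem fstY_mem (n : ℕ) : W.fstY n ∈ HomDeg (W.Y n) X 0 :=
  HomDeg.comp_mem (coneFst_mem (W.incl n)) (W.F n).val_hom rfl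

theorem pairY_mem {N : DGMod B} {k : ℤ} {n : ℕ} {f g : N.carrier →L[𝕜] X.carrier}
    (hf : ∀ x, f x ∈ (W.F n).S) (hg : ∀ x, g x ∈ (W.Z n).S) (h1 : f ∈ HomDeg N X k)
    (h2 : g ∈ HomDeg N X (k + 1)) : W.pairY n f g hf hg ∈ HomDeg N (W.Y n) k :=
  add_mem (HomDeg.comp_mem ((W.F n).lift_hom hf h1) (coneInl_mem (W.incl n)) (add_zero k))
    (HomDeg.comp_mem ((W.Z n).lift_hom hg h2) (coneInr_mem (W.incl n)) (by ring))

theorem Y_deg {n : ℕ} {k : ℤ} {x : (W.Y n).carrier} :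
    (W.Y n).Deg k x ↔ X.Deg k (W.fstY n x) ∧ X.Deg (k + 1) (W.sndY n x) :=
  cone_deg.trans (and_congr (W.F n).deg_val.symm (W.Z n).deg_val.symm)

theorem T_fstY (n : ℕ) (x : (W.Y n).carrier) : W.T n (W.fstY n x) = W.fstY n x :=
  W.mem_F.1 ((W.F n).val_mem _)

theorem sndY_mem_Z (n : ℕ) (x : (W.Y n).carrier) : W.sndY n x ∈ (W.Z n).S := (W.Z n).val_mem _

/-- The part of the differential from position `n` to position `n - 1`. -/
def κ (n : ℕ) : X.carrier →L[𝕜] X.carrier := W.T n ∘L X.d - X.d ∘L W.T n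

theorem κ_apply (n : ℕ) (x : X.carrier) : W.κ n x = W.T n (X.d x) - X.d (W.T n x) := rfl

theorem κ_mem (n : ℕ) : W.κ n ∈ HomDeg X X 1 := by
  have := hom_d (W.T n) (W.T_mem n)
  rw [zpow_zero, one_smul] at this
  rw [κ, ← neg_sub]
  exact neg_mem this

theorem T_d_T_of_lt {m n : ℕ} (h : m < n) (x : X.carrier) :
    W.T m (X.d (W.T n x)) = W.T m (X.d x) := by
  rw [← W.T_d, W.T_T _ _ _ h, W.T_d]

theorem κ_mem_Z (n : ℕ) (x : X.carrier) : W.κ n x ∈ (W.Z n).S := by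
  refine W.mem_Z.2 ⟨?_, fun m hm => ⟨?_, ?_⟩⟩
  · rw [κ_apply, map_sub, W.T_T' _ _ _ le_rfl, W.T_d_T]
  · rw [κ_apply, map_sub, W.T_T _ _ _ hm.le, W.T_d_T_of_lt hm, sub_self]
  · rw [κ_apply, map_sub, X.d_d, sub_zero, W.T_d_T_of_lt hm, X.d_d, map_zero]

theorem T_mem_F (n : ℕ) (x : X.carrier) : W.T n x ∈ (W.F n).S :=
  W.mem_F.2 (W.T_T' _ _ _ le_rfl)

/-- The projection to `Y n`. -/
def toY (n : ℕ) : X ⟶ W.Y n :=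
  homMk (W.pairY n (W.T n) (W.κ n) (W.T_mem_F n) (W.κ_mem_Z n))
    (W.pairY_mem _ _ (W.T_mem n) (W.κ_mem n)) fun x => W.Y_ext (by simp [κ_apply])
      (by simp [κ_apply, X.d_d])

@[simp] theorem fstY_toY (n : ℕ) (x : X.carrier) : W.fstY n ((W.toY n).1 x) = W.T n x :=
  W.fstY_pair _ _ _ _ _

@[simp] theorem sndY_toY (n : ℕ) (x : X.carrier) : W.sndY n ((W.toY n).1 x) = W.κ n x :=
  W.sndY_pair _ _ _ _ _

theorem toY_eq_zero {n : ℕ} {x : X.carrier} (hx : x ∈ (W.Z (n + 1)).S) : (W.toY n).1 x = 0 := by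
  obtain ⟨-, h⟩ := W.mem_Z.1 hx
  have h := h n (Nat.lt_succ_self n)
  exact W.Y_ext (by simp [h.1]) (by simp [κ_apply, h.1, h.2])

theorem toY_T (n : ℕ) (x : X.carrier) : (W.toY n).1 (W.T (n + 1) x) = (W.toY n).1 x :=
  W.Y_ext (by simp [W.T_T]) (by simp [κ_apply, W.T_T, W.T_d])

/-- The projection from `Y (n + 1)` to `Y n`. -/
def ρ (n : ℕ) : W.Y (n + 1) ⟶ W.Y n :=
  homMk ((W.toY n).1 ∘L W.fstY (n + 1)) (HomDeg.comp_mem (W.fstY_mem _) (hom_mem _) rfl) fun x => by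
    simp [closed_zero, W.toY_eq_zero (W.sndY_mem_Z (n + 1) x)]

theorem ρ_apply (n : ℕ) (x : (W.Y (n + 1)).carrier) :
    (W.ρ n).1 x = (W.toY n).1 (W.fstY (n + 1) x) := rfl

theorem T_h_of_mem_Z {n m : ℕ} (hm : m ≤ n) {z : X.carrier} (hz : z ∈ (W.Z n).S) :
    W.T m (W.h z) = 0 ∧ W.T m (W.h (X.d z)) = 0 := by
  cases m with
  | zero => exact ⟨W.T_zero _, W.T_zero _⟩
  | succ m =>
    have := (W.mem_Z.1 hz).2 m hm
    exact ⟨by rw [W.T_h, this.1, map_zero], by rw [W.T_h, this.2, map_zero]⟩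

/-- A continuous linear section of `ρ n`. -/
def sec (n : ℕ) : (W.Y n).carrier →L[𝕜] (W.Y (n + 1)).carrier :=
  W.pairY (n + 1) (W.fstY n + W.h ∘L W.sndY n) 0 (fun x => W.mem_F.2 (by
    have h := (W.mem_Z.1 (W.sndY_mem_Z n x)).1
    simp only [add_apply, map_add, ContinuousLinearMap.comp_apply, W.T_h, h]
    rw [← W.T_fstY, W.T_T' _ _ _ n.le_succ])) fun x => zero_mem _

theorem fstY_sec (n : ℕ) (x : (W.Y n).carrier) :
    W.fstY (n + 1) (W.sec n x) = W.fstY n x + W.h (W.sndY n x) := W.fstY_pair _ _ _ _ _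

theorem ρ_sec (n : ℕ) (x : (W.Y n).carrier) : (W.ρ n).1 (W.sec n x) = x := by
  have hz := W.T_h_of_mem_Z le_rfl (W.sndY_mem_Z n x)
  have h1 := W.T_fstY n x
  have h2 := W.T_d_T n (W.fstY n x)
  rw [h1] at h2
  rw [ρ_apply, fstY_sec]
  refine W.Y_ext ?_ ?_
  · simp [hz.1, h1]
  · have e : X.d (W.h (W.sndY n x)) = W.sndY n x - W.h (X.d (W.sndY n x)) :=
      eq_sub_of_add_eq (W.d_h _)
    simp [κ_apply, h1, h2, hz.1, e, hz.2, (W.mem_Z.1 (W.sndY_mem_Z n x)).1]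

theorem sec_deg (n : ℕ) {k : ℤ} {x : (W.Y n).carrier} (hx : (W.Y n).Deg k x) :
    (W.Y (n + 1)).Deg k (W.sec n x) := by
  obtain ⟨h1, h2⟩ := W.Y_deg.1 hx
  have := W.h_deg _ _ h2
  rw [add_neg_cancel_right] at this
  exact W.Y_deg.2 ⟨by rw [fstY_sec]; exact h1.add this, by
    rw [show W.sndY (n + 1) (W.sec n x) = 0 from W.sndY_pair _ _ _ _ _]
    exact GrSp.Deg.zero _⟩

/-- The map underlying `ker`. -/
def kerL (n : ℕ) : (cone (𝟙 (W.Z (n + 1)).toMod)).carrier →L[𝕜] (W.Y (n + 1)).carrier :=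
  W.pairY (n + 1) ((W.Z (n + 1)).val ∘L coneFst _) ((W.Z (n + 1)).val ∘L coneSnd _)
    (fun _ => W.mem_F.2 (W.mem_Z.1 ((W.Z (n + 1)).val_mem _)).1) fun _ => (W.Z (n + 1)).val_mem _

theorem fstY_kerL (n : ℕ) (x : (cone (𝟙 (W.Z (n + 1)).toMod)).carrier) :
    W.fstY (n + 1) (W.kerL n x) = (W.Z (n + 1)).val (coneFst _ x) := W.fstY_pair _ _ _ _ _

theorem sndY_kerL (n : ℕ) (x : (cone (𝟙 (W.Z (n + 1)).toMod)).carrier) :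
    W.sndY (n + 1) (W.kerL n x) = (W.Z (n + 1)).val (coneSnd _ x) := W.sndY_pair _ _ _ _ _

/-- The kernel of `ρ n`. -/
def ker (n : ℕ) : cone (𝟙 (W.Z (n + 1)).toMod) ⟶ W.Y (n + 1) :=
  homMk (W.kerL n)
    (W.pairY_mem _ _ (HomDeg.comp_mem (coneFst_mem _) (W.Z (n + 1)).val_hom rfl)
      (HomDeg.comp_mem (coneSnd_mem _) (W.Z (n + 1)).val_hom rfl)) fun x =>
        W.Y_ext (by rw [fstY_d, fstY_kerL, sndY_kerL, fstY_kerL]; simp)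
          (by rw [sndY_d, sndY_kerL, sndY_kerL]; simp)

theorem ker_val (n : ℕ) : (W.ker n).1 = W.kerL n := rfl

/-- The projection of the last position to the cycles. -/
def toZ (n : ℕ) : (W.Y (n + 1)).carrier →L[𝕜] (W.Z (n + 1)).toMod.carrier :=
  (W.Z (n + 1)).lift (W.fstY (n + 1) - W.T n ∘L W.fstY (n + 1) -
    W.h ∘L W.κ n ∘L W.fstY (n + 1)) fun x => by
      set v := W.fstY (n + 1) x with hv
      have h1 : W.T (n + 1) v = v := W.T_fstY (n + 1) x
      have hκ := W.κ_mem_Z n v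
      refine W.mem_Z.2 ⟨?_, fun m hm => ?_⟩
      · simp only [sub_apply, ContinuousLinearMap.comp_apply, ← hv, map_sub, h1,
          W.T_T' _ _ _ n.le_succ, W.T_h, (W.mem_Z.1 hκ).1]
      · have hm' : m ≤ n := Nat.le_of_lt_succ hm
        have hz := W.T_h_of_mem_Z hm' hκ
        have e : X.d (W.h (W.κ n v)) = W.κ n v - W.h (X.d (W.κ n v)) :=
          eq_sub_of_add_eq (W.d_h _)
        simp only [sub_apply, ContinuousLinearMap.comp_apply, ← hv, map_sub, e, hz.1, hz.2,
          W.T_T _ _ _ hm']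
        refine ⟨by simp, ?_⟩
        rw [κ_apply, map_sub, W.T_T _ _ _ hm']
        abel

/-- The second component of an element of `Y n`, as a cycle. -/
def cycY (n : ℕ) : (W.Y n).carrier →L[𝕜] (W.Z n).toMod.carrier := coneSnd (W.incl n)

/-- A continuous linear retraction of `ker n`. -/
def kerRetr (n : ℕ) : (W.Y (n + 1)).carrier →L[𝕜] (cone (𝟙 (W.Z (n + 1)).toMod)).carrier :=
  coneInl (𝟙 (W.Z (n + 1)).toMod) ∘L W.toZ n + coneInr (𝟙 (W.Z (n + 1)).toMod) ∘L W.cycY (n + 1)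

theorem val_fst_kerRetr (n : ℕ) (x : (W.Y (n + 1)).carrier) :
    (W.Z (n + 1)).val (coneFst _ (W.kerRetr n x)) = W.fstY (n + 1) x -
      W.T n (W.fstY (n + 1) x) - W.h (W.κ n (W.fstY (n + 1) x)) := by
  rw [show W.kerRetr n x = coneInl _ (W.toZ n x) + coneInr _ (W.cycY (n + 1) x) from rfl, map_add,
    coneFst_inl, coneFst_inr, add_zero]
  rfl

theorem val_snd_kerRetr (n : ℕ) (x : (W.Y (n + 1)).carrier) :
    (W.Z (n + 1)).val (coneSnd _ (W.kerRetr n x)) = W.sndY (n + 1) x := by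
  rw [show W.kerRetr n x = coneInl _ (W.toZ n x) + coneInr _ (W.cycY (n + 1) x) from rfl, map_add,
    coneSnd_inl, coneSnd_inr, zero_add]
  rfl

theorem splitExact_ρ (n : ℕ) : SplitExact (W.ker n) (W.ρ n) := by
  refine SplitExact.of_exact (W.kerRetr n) (W.sec n) ?_ ?_ ?_ ?_ (W.ρ_sec n) ?_
  · intro k x hx
    obtain ⟨h1, h2⟩ := W.Y_deg.1 hx
    have h3 := (W.T_mem n).1 _ _ h1
    have h4 := W.h_deg _ _ ((W.κ_mem n).1 _ _ h1)
    rw [add_neg_cancel_right] at h4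
    rw [add_zero] at h3 ⊢
    refine cone_deg.2 ⟨?_, ?_⟩
    · rw [← ClosedSub.deg_val, val_fst_kerRetr]
      exact (h1.sub h3).sub h4
    · rw [← ClosedSub.deg_val, val_snd_kerRetr]
      exact h2
  · intro k x hx
    rw [add_zero]
    exact W.sec_deg n hx
  · intro x
    rw [ρ_apply, ker_val, fstY_kerL]
    exact W.toY_eq_zero ((W.Z (n + 1)).val_mem _)
  · intro x
    have h0 := W.toY_eq_zero ((W.Z (n + 1)).val_mem (coneFst _ x))
    have h1 := congrArg (W.fstY n) h0
    have h2 := congrArg (W.sndY n) h0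
    rw [fstY_toY, map_zero] at h1
    rw [sndY_toY, map_zero] at h2
    refine cone_ext _ ((W.Z (n + 1)).ext ?_) ((W.Z (n + 1)).ext ?_)
    · rw [val_fst_kerRetr, ker_val, fstY_kerL, h1, h2, map_zero, sub_zero, sub_zero]
    · rw [val_snd_kerRetr, ker_val, sndY_kerL]
  · intro x hx
    rw [ρ_apply] at hx
    have h1 := congrArg (W.fstY n) hx
    have h2 := congrArg (W.sndY n) hx
    rw [fstY_toY, map_zero] at h1
    rw [sndY_toY, map_zero] at h2
    refine W.Y_ext ?_ ?_
    · rw [ker_val, fstY_kerL, val_fst_kerRetr, h1, h2, map_zero, sub_zero, sub_zero]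
    · rw [ker_val, sndY_kerL, val_snd_kerRetr]

theorem contraacyclic_Y (n : ℕ) : Contraacyclic (W.Y n) := by
  induction n with
  | zero =>
    refine .of_contraction 0 (zero_mem _) fun x => W.Y_ext ?_ ?_
    · have := W.T_fstY 0 x
      rw [W.T_zero] at this
      simp [← this]
    · have := (W.mem_Z.1 (W.sndY_mem_Z 0 x)).1
      rw [W.T_zero] at this
      simp [← this]
  | succ n ih => exact ((W.splitExact_ρ n).contraacyclic_cone ih).target contraacyclic_cone_id

/-- The product of the modules `Y n`. -/
def prodY : DGMod B := prodMod fun k : ULift.{u} ℕ => W.Y k.down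

/-- The component of index `n` of the product of the modules `Y n`. -/
def πY (n : ℕ) : W.prodY.carrier →L[𝕜] (W.Y n).carrier :=
  prodπ (fun k : ULift.{u} ℕ => W.Y k.down) ⟨n⟩

/-- The map to the product of the modules `Y n` given by its components. -/
def liftY {E : Type*} [AddCommGroup E] [Module 𝕜 E] [TopologicalSpace E]
    (f : ∀ n, E →L[𝕜] (W.Y n).carrier) : E →L[𝕜] W.prodY.carrier :=
  prodLift (N := fun k : ULift.{u} ℕ => W.Y k.down) fun k => f k.down

@[simp] theorem πY_lift {E : Type*} [AddCommGroup E] [Module 𝕜 E] [TopologicalSpace E]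
    (f : ∀ n, E →L[𝕜] (W.Y n).carrier) (n : ℕ) (x : E) : W.πY n (W.liftY f x) = f n x := rfl

theorem prodY_ext {x y : W.prodY.carrier} (h : ∀ n, W.πY n x = W.πY n y) : x = y :=
  prod_ext (L := fun k : ULift.{u} ℕ => W.Y k.down) fun k => h k.down

theorem prodY_deg {k : ℤ} {x : W.prodY.carrier} :
    W.prodY.Deg k x ↔ ∀ n, (W.Y n).Deg k (W.πY n x) :=
  (prod_deg (L := fun k : ULift.{u} ℕ => W.Y k.down)).trans
    ⟨fun h n => h ⟨n⟩, fun h i => h i.down⟩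

@[simp] theorem πY_d (x : W.prodY.carrier) (n : ℕ) :
    W.πY n (W.prodY.d x) = (W.Y n).d (W.πY n x) := rfl

theorem πY_mem (n : ℕ) : W.πY n ∈ HomDeg W.prodY (W.Y n) 0 :=
  prodπ_mem (L := fun k : ULift.{u} ℕ => W.Y k.down) ⟨n⟩

theorem liftY_mem {N : DGMod B} {f : ∀ n, N.carrier →L[𝕜] (W.Y n).carrier} {j : ℤ}
    (hf : ∀ n, f n ∈ HomDeg N (W.Y n) j) : W.liftY f ∈ HomDeg N W.prodY j :=
  prodLift_mem (L := fun k : ULift.{u} ℕ => W.Y k.down) fun k => hf k.down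

theorem contraacyclic_prodY : Contraacyclic W.prodY :=
  .pi _ fun k => W.contraacyclic_Y k.down

/-- The map from the limit of the `Y n` to their product. -/
def toProd : X ⟶ W.prodY :=
  homMk (W.liftY fun n => (W.toY n).1) (W.liftY_mem fun n => hom_mem (W.toY n)) fun x =>
    W.prodY_ext fun n => by simp [closed_zero]

theorem πY_toProd (n : ℕ) (x : X.carrier) : W.πY n (W.toProd.1 x) = (W.toY n).1 x := rfl

/-- The identity minus the shift map. -/
def oneSubShift : W.prodY ⟶ W.prodY :=
  homMk (W.liftY fun n => W.πY n - (W.ρ n).1 ∘L W.πY (n + 1)) (W.liftY_mem fun n =>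
    sub_mem (W.πY_mem n) (HomDeg.comp_mem (W.πY_mem _) (hom_mem _) rfl)) fun x =>
      W.prodY_ext fun n => by simp [closed_zero]

theorem πY_oneSubShift (n : ℕ) (x : W.prodY.carrier) :
    W.πY n (W.oneSubShift.1 x) = W.πY n x - (W.ρ n).1 (W.πY (n + 1) x) := rfl

/-- The components of a continuous linear section of `oneSubShift`. -/
def secProd : ∀ n, W.prodY.carrier →L[𝕜] (W.Y n).carrier
  | 0 => 0
  | n + 1 => W.sec n ∘L (secProd n - W.πY n)

theorem secProd_succ (n : ℕ) (x : W.prodY.carrier) :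
    W.secProd (n + 1) x = W.sec n (W.secProd n x - W.πY n x) := rfl

theorem secProd_deg (n : ℕ) {k : ℤ} {x : W.prodY.carrier} (hx : W.prodY.Deg k x) :
    (W.Y n).Deg k (W.secProd n x) := by
  induction n with
  | zero => exact GrSp.Deg.zero _
  | succ n ih =>
    rw [secProd_succ]
    exact W.sec_deg n (ih.sub (W.prodY_deg.1 hx n))

/-- A continuous linear retraction of `toProd`. -/
def retr : W.prodY.carrier →L[𝕜] X.carrier :=
  W.glue ∘L ContinuousLinearMap.pi fun n => W.fstY (n + 1) ∘L W.πY (n + 1)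

theorem retr_apply (x : W.prodY.carrier) :
    W.retr x = W.glue fun n => W.fstY (n + 1) (W.πY (n + 1) x) := rfl

theorem T_eq_of_glue {y : ℕ → X.carrier} {w : ℕ → X.carrier} (h0 : w 0 = 0)
    (h : ∀ n, W.T (n + 1) (y n) = w (n + 1) ∧ W.T n (y n) = w n) (n : ℕ) :
    W.T n (W.glue y) = w n := by
  induction n with
  | zero => rw [W.T_zero, h0]
  | succ n ih =>
    have := W.T_glue n y
    rw [ih, (h n).1, (h n).2] at this
    exact sub_left_injective this

theorem splitExact_toProd : SplitExact W.toProd W.oneSubShift := by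
  refine SplitExact.of_exact W.retr (W.liftY W.secProd) ?_ ?_ ?_ ?_ ?_ ?_
  · intro k x hx
    rw [add_zero]
    exact W.glue_deg k _ fun n => (W.Y_deg.1 (W.prodY_deg.1 hx (n + 1))).1
  · intro k x hx
    rw [add_zero]
    exact W.prodY_deg.2 fun n => W.secProd_deg n hx
  · intro x
    refine W.prodY_ext fun n => ?_
    rw [πY_oneSubShift, πY_toProd, πY_toProd, ρ_apply, fstY_toY, toY_T, sub_self, map_zero]
  · intro x
    rw [retr_apply]
    refine sub_eq_zero.1 (W.T_sep _ fun n => ?_)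
    rw [map_sub, sub_eq_zero]
    refine W.T_eq_of_glue (w := fun n => W.T n x) (W.T_zero x) (fun n => ?_) n
    rw [πY_toProd, fstY_toY]
    exact ⟨W.T_T _ _ _ le_rfl, W.T_T _ _ _ n.le_succ⟩
  · intro x
    refine W.prodY_ext fun n => ?_
    rw [πY_oneSubShift, πY_lift, πY_lift, secProd_succ, ρ_sec, sub_sub_cancel]
  · intro x hx
    have e : ∀ n, W.πY n x = (W.toY n).1 (W.fstY (n + 1) (W.πY (n + 1) x)) := fun n => by
      have := congrArg (W.πY n) hx
      rwa [πY_oneSubShift, map_zero, sub_eq_zero] at this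
    have hT : ∀ n, W.T n (W.retr x) = W.fstY n (W.πY n x) := by
      refine W.T_eq_of_glue (w := fun n => W.fstY n (W.πY n x)) ?_ fun n => ⟨W.T_fstY _ _, ?_⟩
      · rw [← W.T_fstY, W.T_zero]
      · change W.T n (W.fstY (n + 1) (W.πY (n + 1) x)) = W.fstY n (W.πY n x)
        rw [e n, fstY_toY]
    refine W.prodY_ext fun n => ?_
    rw [πY_toProd, ← W.toY_T, hT, ← e]

theorem contraacyclic (W : Tower X) : Contraacyclic X :=
  (SplitExact.contraacyclic_cone W.splitExact_toProd W.contraacyclic_prodY).source W.contraacyclic_prodY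

end Tower

end Telescope

section ExtraDegeneracy

variable {𝕜 : Type} [RCLike 𝕜] {A : DGAlg.{u} 𝕜}

namespace BarStep

variable (T : BarStep A)

/-- `η` inserts a unit on the left of `P`, as `a₀ ⊗ ā₁ ⊗ ⋯ ↦ 1 ⊗ ā₀ ⊗ ā₁ ⊗ ⋯`. -/
structure Degeneracy (η : T.P.carrier →L[𝕜] T.next.P.carrier) : Prop where
  deg : GrSp.HasDeg (V := T.P.toGrSp) (W := T.next.P.toGrSp) (-1) η
  d : ∀ y, T.next.P.d (η y) = -η (T.P.d y)
  fold : ∀ y a, T.next.fold (tm 𝕜 (η y) a) =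
    (tm 𝕜 y (sq A a) : CT 𝕜 T.P.carrier (susp A).carrier) - η (T.fold (tm 𝕜 y a))

variable {T} {η : T.P.carrier →L[𝕜] T.next.P.carrier}

theorem Degeneracy.sgn (h : T.Degeneracy η) (y : T.P.carrier) :
    T.next.P.sgn (η y) = -η (T.P.sgn y) := by
  simpa using GrSp.HasDeg.sgn h.deg y

/-- `η ⊗ id`. -/
def etaNext (η : T.P.carrier →L[𝕜] T.next.P.carrier) :
    T.next.P.carrier →L[𝕜] T.next.next.P.carrier :=
  (ctMap η (ContinuousLinearMap.id 𝕜 (susp A).carrier) :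
    CT 𝕜 T.P.carrier (susp A).carrier →L[𝕜] CT 𝕜 T.next.P.carrier (susp A).carrier)

/-- `η ⊗ id`. -/
def etaBim (η : T.P.carrier →L[𝕜] T.next.P.carrier) : T.bim.carrier →L[𝕜] T.next.bim.carrier :=
  (ctMap η (ContinuousLinearMap.id 𝕜 A.carrier) :
    CT 𝕜 T.P.carrier A.carrier →L[𝕜] CT 𝕜 T.next.P.carrier A.carrier)

theorem Degeneracy.next (h : T.Degeneracy η) : T.next.Degeneracy (etaNext η) where
  deg := GrSp.tens_hasDeg (V := T.P.toGrSp) (W := (susp A).toGrSp)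
    (Z := GrSp.tens T.next.P.toGrSp (susp A).toGrSp) fun i j y x hy hx => by
      have := (h.deg i y hy).tm hx
      rw [show i + -1 + j = i + j + -1 by ring] at this
      simpa [etaNext] using this
  d y := ct_ext_apply (V := T.P.carrier) (W := (susp A).carrier)
    (T.next.next.P.d ∘L etaNext η) (-(etaNext η ∘L T.next.P.d)) (fun y x => by
      have e1 := Cpx.tens_d T.next.P.toCpx (susp A) (η y) x
      have e2 := Cpx.tens_d T.P.toCpx (susp A) y x
      have e3 : etaNext η (tm 𝕜 y x : CT 𝕜 T.P.carrier (susp A).carrier) =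
        (tm 𝕜 (η y) x : CT 𝕜 T.next.P.carrier (susp A).carrier) := ctMap_tm _ _ _ _
      have e4 := h.sgn y
      have e5 := h.d y
      simp only [ContinuousLinearMap.comp_apply, neg_apply]
      rw [e3]
      refine e1.trans ?_
      rw [e4, e5]
      refine Eq.trans ?_ (congrArg (fun z => -etaNext η z) e2).symm
      simp [etaNext, tm_neg_left, add_comm]) y
  fold y a := red_tm_ext (W := T.P.toGrSp)
    (T.next.next.fold ∘L tmR _ a ∘L etaNext η)
    ((tmR _ (sq A a) : T.next.P.carrier →L[𝕜] CT 𝕜 T.next.P.carrier (susp A).carrier) - etaNext η ∘L T.next.fold ∘L tmR _ a) (fun y c => by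
      have e3 : etaNext η (tm 𝕜 y (sq A c) : CT 𝕜 T.P.carrier (susp A).carrier) =
        (tm 𝕜 (η y) (sq A c) : CT 𝕜 T.next.P.carrier (susp A).carrier) := ctMap_tm _ _ _ _
      have e1 : T.next.next.fold (tm 𝕜 (tm 𝕜 (η y) (sq A c) : CT 𝕜 T.next.P.carrier (susp A).carrier) a) = _ :=
        T.next.foldWith_tm (Y := susp A) (sq A) (sgn_one A) (η y) c a
      have e2 : T.next.fold (tm 𝕜 (tm 𝕜 y (sq A c) : CT 𝕜 T.P.carrier (susp A).carrier) a) = _ :=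
        T.foldWith_tm (Y := susp A) (sq A) (sgn_one A) y c a
      have e4 := h.sgn y
      have e5 := h.fold y c
      rw [e4, e5] at e1
      simp only [ContinuousLinearMap.comp_apply, sub_apply, tmR_apply]
      rw [e3]
      refine e1.trans ?_
      refine Eq.trans ?_ (congrArg (fun z => tm 𝕜 (tm 𝕜 y (sq A c)) (sq A a) - etaNext η z) e2).symm
      simp [etaNext, tm_neg_left, tm_sub_left]
      abel) y

theorem Degeneracy.etaBim_deg (h : T.Degeneracy η) :
    GrSp.HasDeg (V := T.bim.toGrSp) (W := T.next.bim.toGrSp) (-1) (etaBim η) :=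
  GrSp.tens_hasDeg (V := T.P.toGrSp) (W := A.toGrSp)
    (Z := GrSp.tens T.next.P.toGrSp A.toGrSp) fun i j y x hy hx => by
      have := (h.deg i y hy).tm hx
      rw [show i + -1 + j = i + j + -1 by ring] at this
      simpa [etaBim] using this

theorem Degeneracy.etaBim_d (h : T.Degeneracy η) (x : T.bim.carrier) :
    T.next.bim.d (etaBim η x) = -etaBim η (T.bim.d x) :=
  ct_ext_apply (V := T.P.carrier) (W := A.carrier)
    (T.next.bim.d ∘L etaBim η) (-(etaBim η ∘L T.bim.d)) (fun y x => by
      have e1 := Cpx.tens_d T.next.P.toCpx A.toCpx (η y) x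
      have e2 := Cpx.tens_d T.P.toCpx A.toCpx y x
      have e3 : etaBim η (tm 𝕜 y x : CT 𝕜 T.P.carrier A.carrier) =
        (tm 𝕜 (η y) x : CT 𝕜 T.next.P.carrier A.carrier) := ctMap_tm _ _ _ _
      have e4 := h.sgn y
      have e5 := h.d y
      simp only [ContinuousLinearMap.comp_apply, neg_apply]
      rw [e3]
      refine e1.trans ?_
      rw [e4, e5]
      refine Eq.trans ?_ (congrArg (fun z => -etaBim η z) e2).symm
      simp [etaBim, tm_neg_left, add_comm]) x

theorem Degeneracy.del_etaBim (h : T.Degeneracy η) (x : T.next.bim.carrier) :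
    T.next.del (etaBim (etaNext η) x) + etaBim η (T.del x) = x :=
  T.bim_ext (T.next.del ∘L etaBim (etaNext η) + etaBim η ∘L T.del)
    (ContinuousLinearMap.id 𝕜 _) (fun y c b => by
      have e3 : etaBim (etaNext η) (tm 𝕜 (tm 𝕜 y (sq A c)) b :
            CT 𝕜 (CT 𝕜 T.P.carrier (susp A).carrier) A.carrier) =
          (tm 𝕜 (tm 𝕜 (η y) (sq A c)) b :
            CT 𝕜 (CT 𝕜 T.next.P.carrier (susp A).carrier) A.carrier) :=
        (ctMap_tm _ _ _ _).trans (congrArg (fun z => tm 𝕜 z b) (ctMap_tm _ _ _ _))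
      have e1 := T.next.del_tm (η y) c b
      have e2 := T.del_tm y c b
      rw [h.sgn y, h.fold y c] at e1
      simp only [ContinuousLinearMap.comp_apply, add_apply, ContinuousLinearMap.id_apply]
      rw [e3, e2]
      refine (congrArg (· + _) e1).trans ?_
      simp [etaBim, tm_neg_left, tm_sub_left]) x

end BarStep

variable (A)

/-- The map `a ↦ 1 ⊗ ā`. -/
def etaZero : A.carrier →L[𝕜] CT 𝕜 A.carrier (susp A).carrier := tmL _ A.one ∘L sq A

theorem zero_fold (a b : A.carrier) :
    (BarStep.zero A).fold (tm 𝕜 a b : CT 𝕜 A.carrier A.carrier) = A.mul (tm 𝕜 (A.sgn a) b) :=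
  congrArg A.mul (ctMap_tm _ _ _ _)

theorem zero_fold_one (a : A.carrier) :
    (BarStep.zero A).fold (tm 𝕜 A.one a : CT 𝕜 A.carrier A.carrier) = a := by
  rw [zero_fold, sgn_one, A.one_mul]

theorem etaZero_degeneracy : (BarStep.zero A).Degeneracy (etaZero A) where
  deg n a ha := by
    have ha' : A.Deg n a := ha
    have := A.one_deg.tm (susp_deg A (n := n - 1) (by simpa using ha'))
    rw [show 0 + (n - 1) = n + -1 by ring] at this
    exact this
  d (a : A.carrier) := by
    have h := Cpx.tens_d A.toCpx (susp A) A.one (sq A a)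
    rw [d_one, sgn_one, susp_d, tm_zero_left, zero_add, tm_neg_right] at h
    exact h
  fold (a : A.carrier) b := by
    have h := (BarStep.zero A).foldWith_tm (Y := susp A) (sq A) (sgn_one A) A.one a b
    have h1 := zero_fold_one A a
    have h2 : (BarStep.zero A).P.sgn A.one = A.one := sgn_one A
    rw [h1, h2] at h
    exact h.trans (congrArg (fun z => tm 𝕜 a (sq A b) - etaZero A z) (zero_fold A a b).symm)

theorem del_etaZero (x : CT 𝕜 A.carrier A.carrier) :
    (BarStep.zero A).del (BarStep.etaBim (etaZero A) x) + tm 𝕜 A.one (A.mul x) = x :=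
  ct_ext_apply (V := A.carrier) (W := A.carrier)
    (((BarStep.zero A).del ∘L BarStep.etaBim (T := BarStep.zero A) (etaZero A) :
      CT 𝕜 A.carrier A.carrier →L[𝕜] CT 𝕜 A.carrier A.carrier) + tmL _ A.one ∘L A.mul)
    (ContinuousLinearMap.id 𝕜 _) (fun c b => by
      have e3 : BarStep.etaBim (T := BarStep.zero A) (etaZero A) (tm 𝕜 c b : CT 𝕜 A.carrier A.carrier) =
          (tm 𝕜 (tm 𝕜 A.one (sq A c)) b :
            CT 𝕜 (CT 𝕜 A.carrier (susp A).carrier) A.carrier) := ctMap_tm _ _ _ _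
      have e1 := (BarStep.zero A).del_tm A.one c b
      have h1 := zero_fold_one A c
      have h2 : (BarStep.zero A).P.sgn A.one = A.one := sgn_one A
      rw [h1, h2] at e1
      simp only [ContinuousLinearMap.comp_apply, add_apply, ContinuousLinearMap.id_apply]
      refine (congrArg (fun z => (BarStep.zero A).del z + tm 𝕜 A.one (A.mul (tm 𝕜 c b))) e3).trans ?_
      exact (congrArg (fun z => z + tm 𝕜 A.one (A.mul (tm 𝕜 c b))) e1).trans (sub_add_cancel _ _)) x

/-- The insertion of a unit on the left of `A ⊗̂ (sĀ)^⊗̂n`. -/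
def eta : ∀ n, (step A n).P.carrier →L[𝕜] (step A (n + 1)).P.carrier
  | 0 => etaZero A
  | n + 1 => BarStep.etaNext (eta n)

theorem eta_degeneracy : ∀ n, (step A n).Degeneracy (eta A n)
  | 0 => etaZero_degeneracy A
  | n + 1 => (eta_degeneracy n).next

/-- The insertion of a unit on the left of the `n`-th term of the bar construction. -/
def barEta (n : ℕ) : (barTerm A n).carrier →L[𝕜] (barTerm A (n + 1)).carrier :=
  BarStep.etaBim (eta A n)

/-- The part of the bar differential that multiplies neighbouring factors. -/
def barDel (n : ℕ) : (barTerm A (n + 1)).carrier →L[𝕜] (barTerm A n).carrier := (step A n).del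

/-- The map `a ↦ 1 ⊗ a`. -/
def barOne : (selfMod A).carrier →L[𝕜] (barTerm A 0).carrier :=
  (tmL _ A.one : A.carrier →L[𝕜] CT 𝕜 A.carrier A.carrier)

/-- The multiplication of `A`, on the zeroth term of the bar construction. -/
def barMul : (barTerm A 0).carrier →L[𝕜] (selfMod A).carrier := A.mul

/-- The `n`-th coordinate of an element of the bar construction. -/
def barProj (n : ℕ) : (Bar A).carrier →L[𝕜] (barTerm A n).carrier :=
  (ContinuousLinearMap.proj n : (∀ n : ℕ, (step A n).bim.carrier) →L[𝕜] (step A n).bim.carrier)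

variable {A}

theorem barEta_deg (n : ℕ) :
    GrSp.HasDeg (V := (barTerm A n).toGrSp) (W := (barTerm A (n + 1)).toGrSp) (-1) (barEta A n) :=
  (eta_degeneracy A n).etaBim_deg

theorem d_barEta (n : ℕ) (x : (barTerm A n).carrier) :
    (barTerm A (n + 1)).d (barEta A n x) = -barEta A n ((barTerm A n).d x) :=
  (eta_degeneracy A n).etaBim_d x

theorem barDel_barEta (n : ℕ) (x : (barTerm A (n + 1)).carrier) :
    barDel A (n + 1) (barEta A (n + 1) x) + barEta A n (barDel A n x) = x :=
  (eta_degeneracy A n).del_etaBim x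

theorem barDel_barEta_zero (x : (barTerm A 0).carrier) :
    barDel A 0 (barEta A 0 x) + barOne A (barMul A x) = x := del_etaZero A x

theorem barMul_one (a : (selfMod A).carrier) : barMul A (barOne A a) = a := A.one_mul a

theorem barOne_deg : GrSp.HasDeg (V := (selfMod A).toGrSp) (W := (barTerm A 0).toGrSp) 0 (barOne A) :=
  fun n a ha => by
    have h := A.one_deg.tm (show A.Deg n a from ha)
    rw [add_comm] at h
    exact h

theorem d_barOne (a : (selfMod A).carrier) :
    (barTerm A 0).d (barOne A a) = barOne A ((selfMod A).d a) := by
  have h : ∀ a : A.carrier, (A.toCpx.tens A.toCpx).d (tm 𝕜 A.one a) = tm 𝕜 A.one (A.d a) :=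
    fun a => by rw [Cpx.tens_d, d_one, sgn_one, tm_zero_left, zero_add]
  exact h a

theorem bar_ext {x y : (Bar A).carrier} (h : ∀ n, barProj A n x = barProj A n y) : x = y := funext h

theorem bar_deg {k : ℤ} {x : (Bar A).carrier} :
    (Bar A).Deg k x ↔ ∀ n, (barTerm A n).Deg k (barProj A n x) := funext_iff

theorem barProj_d (n : ℕ) (x : (Bar A).carrier) : barProj A n ((Bar A).d x) =
    (barTerm A n).d (barProj A n x) + barDel A n (barProj A (n + 1) x) := rfl

theorem barProj_mem (n : ℕ) : barProj A n ∈ HomDeg (Bar A) (barTerm A n) 0 :=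
  toMod_hom A (M := barBimod A) (N := (step A n).bim) (barProj A n)
    (fun k x hx => by rw [add_zero]; exact bar_deg.1 hx n)
    (fun a x => congrArg (step A n).bim.L (ctMap_tm _ _ _ _))
    (fun x a => congrArg (step A n).bim.R (ctMap_tm _ _ _ _))

theorem barProj_act (n : ℕ) (x : (Bar A).carrier) (s : (env A).carrier) :
    barProj A n ((Bar A).act (tm 𝕜 x s)) = (barTerm A n).act (tm 𝕜 (barProj A n x) s) :=
  (barProj_mem n).2 x s

theorem aug_apply (x : (Bar A).carrier) : (aug A).1 x = barMul A (barProj A 0 x) := rfl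

section Mk

variable {E : Type*} [AddCommGroup E] [Module 𝕜 E] [TopologicalSpace E]

/-- The map to the bar construction with given coordinates. -/
def barMk (f : ∀ n, E →L[𝕜] (barTerm A n).carrier) : E →L[𝕜] (Bar A).carrier :=
  (ContinuousLinearMap.pi f : E →L[𝕜] ∀ n : ℕ, (barTerm A n).carrier)

theorem barProj_mk (f : ∀ n, E →L[𝕜] (barTerm A n).carrier) (n : ℕ) (x : E) :
    barProj A n (barMk f x) = f n x := rfl

end Mk

variable (A)

/-- The projection to the terms with index below `n`. -/
def barTrunc (n : ℕ) : (Bar A).carrier →L[𝕜] (Bar A).carrier :=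
  barMk fun k => if k < n then barProj A k else 0

variable {A}

theorem barProj_trunc (k n : ℕ) (x : (Bar A).carrier) :
    barProj A k (barTrunc A n x) = if k < n then barProj A k x else 0 := by
  rw [barTrunc, barProj_mk]
  split_ifs <;> rfl

theorem barTrunc_mem (n : ℕ) : barTrunc A n ∈ HomDeg (Bar A) (Bar A) 0 :=
  ⟨fun k x hx => bar_deg.2 fun m => by
    have h := bar_deg.1 hx m
    rw [barProj_trunc, add_zero]
    split_ifs
    · exact h
    · exact GrSp.Deg.zero _, fun x s => bar_ext fun m => by
    rw [barProj_trunc, barProj_act, barProj_act, barProj_trunc]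
    split_ifs
    · rfl
    · rw [tm_zero_left, map_zero]⟩

theorem barTrunc_barTrunc (m n : ℕ) (x : (Bar A).carrier) :
    barTrunc A m (barTrunc A n x) = barTrunc A (min m n) x := bar_ext fun k => by
  simp only [barProj_trunc, lt_min_iff]
  split_ifs <;> first | rfl | omega

theorem barTrunc_d_trunc (n : ℕ) (x : (Bar A).carrier) :
    barTrunc A n ((Bar A).d (barTrunc A n x)) = (Bar A).d (barTrunc A n x) := bar_ext fun k => by
  simp only [barProj_trunc, barProj_d]
  split_ifs <;> first | rfl | omega | simp

theorem barTrunc_d (n : ℕ) (x : (Bar A).carrier) :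
    barTrunc A n ((Bar A).d (barTrunc A (n + 1) x)) = barTrunc A n ((Bar A).d x) :=
  bar_ext fun k => by
    simp only [barProj_trunc, barProj_d]
    split_ifs <;> first | rfl | omega

variable (A)

/-- The extra degeneracy of the augmented bar construction. -/
def coneHomotopy : (cone (aug A)).carrier →L[𝕜] (Bar A).carrier :=
  barMk fun
    | 0 => barOne A ∘L coneFst (aug A)
    | n + 1 => -(barEta A n ∘L barProj A n ∘L coneSnd (aug A))

variable {A}

theorem coneHomotopy_zero (x : (cone (aug A)).carrier) :
    barProj A 0 (coneHomotopy A x) = barOne A (coneFst (aug A) x) := rfl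

theorem coneHomotopy_succ (n : ℕ) (x : (cone (aug A)).carrier) :
    barProj A (n + 1) (coneHomotopy A x) = -barEta A n (barProj A n (coneSnd (aug A) x)) := rfl

theorem coneHomotopy_deg {k : ℤ} {x : (cone (aug A)).carrier} (hx : (cone (aug A)).Deg k x) :
    (Bar A).Deg k (coneHomotopy A x) := bar_deg.2 fun n => by
  obtain ⟨h1, h2⟩ := cone_deg.1 hx
  cases n with
  | zero => simpa [coneHomotopy_zero] using barOne_deg k _ h1
  | succ n =>
    have h := barEta_deg n (k + 1) _ (bar_deg.1 h2 n)
    rw [add_neg_cancel_right] at h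
    exact h.neg

theorem aug_coneHomotopy (x : (cone (aug A)).carrier) :
    (aug A).1 (coneHomotopy A x) = coneFst (aug A) x := barMul_one _

theorem coneHomotopy_d (x : (cone (aug A)).carrier) :
    coneHomotopy A ((cone (aug A)).d x) = (Bar A).d (coneHomotopy A x) + coneSnd (aug A) x :=
  bar_ext fun n => by
    rw [map_add, barProj_d, coneHomotopy_succ]
    cases n with
    | zero =>
      have h1 := barDel_barEta_zero (barProj A 0 (coneSnd (aug A) x))
      rw [coneHomotopy_zero, coneHomotopy_zero, coneFst_d, map_neg, d_barOne, map_add, aug_apply]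
      rw [← eq_sub_iff_add_eq'] at h1
      rw [h1]
      abel
    | succ n =>
      have h1 := barDel_barEta n (barProj A (n + 1) (coneSnd (aug A) x))
      have h2 := d_barEta n (barProj A n (coneSnd (aug A) x))
      rw [coneHomotopy_succ, coneHomotopy_succ, coneSnd_d, map_neg, map_neg, neg_neg, barProj_d,
        map_add, map_neg, map_neg, h2, neg_neg]
      rw [← eq_sub_iff_add_eq'] at h1
      rw [h1]
      abel

/-- The cone of the augmentation, filtered by the number of tensor factors. -/
def augTower : Tower (cone (aug A)) where
  T
    | 0 => 0
    | n + 1 => coneInl (aug A) ∘L coneFst (aug A) +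
        coneInr (aug A) ∘L barTrunc A n ∘L coneSnd (aug A)
  T_mem
    | 0 => zero_mem _
    | n + 1 => add_mem (HomDeg.comp_mem (coneFst_mem _) (coneInl_mem _) rfl)
        (HomDeg.comp_mem (HomDeg.comp_mem (coneSnd_mem _) (barTrunc_mem n) rfl) (coneInr_mem _)
          (by norm_num))
  T_T
    | 0, _, _, _ => rfl
    | m + 1, 0, _, h => by omega
    | m + 1, n + 1, x, h => by
      have h' : min m n = m := by omega
      refine cone_ext _ ?_ ?_ <;> simp [barTrunc_barTrunc, h']
  T_T'
    | 0, n, _, _ => map_zero _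
    | m + 1, 0, _, h => by omega
    | m + 1, n + 1, x, h => by
      have h' : min n m = m := by omega
      refine cone_ext _ ?_ ?_ <;> simp [barTrunc_barTrunc, h']
  T_zero _ := rfl
  T_sep x h := by
    refine cone_ext _ ?_ (bar_ext fun n => ?_)
    · simpa using congrArg (coneFst (aug A)) (h 1)
    · simpa [barProj_trunc] using congrArg (fun y => barProj A n (coneSnd (aug A) y)) (h (n + 2))
  T_d_T
    | 0, x => (map_zero (cone (aug A)).d).symm
    | n + 1, x => by
      refine cone_ext _ ?_ ?_ <;> simp [barTrunc_d_trunc]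
  T_d
    | 0, x => rfl
    | n + 1, x => by
      refine cone_ext _ ?_ ?_
      · simp [aug_apply, barProj_trunc]
      · simp [barTrunc_d]
  h := coneInr (aug A) ∘L coneHomotopy A
  h_deg k x hx := cone_deg.2 ⟨by
    simpa using GrSp.Deg.zero _, by
    have := coneHomotopy_deg hx
    simpa using this⟩
  T_h
    | 0, x => by
      refine cone_ext _ ?_ (bar_ext fun k => ?_) <;> simp [barProj_trunc]
    | n + 1, x => by
      refine cone_ext _ ?_ (bar_ext fun k => ?_)
      · simp
      · cases k with
        | zero => simp [barProj_trunc, coneHomotopy_zero]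
        | succ k =>
          simp only [add_apply, ContinuousLinearMap.comp_apply, map_add, coneSnd_inl, coneSnd_inr,
            barProj_trunc, coneHomotopy_succ, map_zero, zero_add, add_lt_add_iff_right]
          split_ifs <;> simp
  d_h x := by
    refine cone_ext _ ?_ ?_
    · simp [aug_coneHomotopy]
    · simp [coneHomotopy_d]
  glue := coneInl (aug A) ∘L coneFst (aug A) ∘L ContinuousLinearMap.proj 0 +
    coneInr (aug A) ∘L barMk fun n => barProj A n ∘L coneSnd (aug A) ∘L
      (ContinuousLinearMap.proj (n + 1) : (ℕ → (cone (aug A)).carrier) →L[𝕜] (cone (aug A)).carrier)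
  glue_deg k x hx := cone_deg.2 ⟨by
    simpa using (cone_deg.1 (hx 0)).1, by
    refine bar_deg.2 fun n => ?_
    simpa [barProj_mk] using bar_deg.1 (cone_deg.1 (hx (n + 1))).2 n⟩
  T_glue
    | 0, x => by
      refine cone_ext _ ?_ (bar_ext fun k => ?_) <;> simp [barProj_trunc]
    | n + 1, x => by
      refine cone_ext _ ?_ (bar_ext fun k => ?_)
      · simp
      · simp only [add_apply, ContinuousLinearMap.comp_apply, map_add, map_sub, coneSnd_inl, coneSnd_inr,
            barProj_trunc, barProj_mk, map_zero, zero_add, ContinuousLinearMap.proj_apply]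
        rcases lt_trichotomy k n with h | rfl | h
        · rw [if_pos (by omega), if_pos h, if_pos (by omega), if_pos h, sub_self, sub_self]
        · simp
        · rw [if_neg (by omega), if_neg (by omega), if_neg (by omega), if_neg (by omega)]

variable (A)

theorem contraacyclic_cone_aug : Contraacyclic (CtrHoch.cone (aug A)) := augTower.contraacyclic

end ExtraDegeneracy

section RelativelyProjective

variable {𝕜 : Type} [RCLike 𝕜] {B : DGAlg.{u} 𝕜}

/-- Right multiplication by `b` on `M ⊗̂ B`. -/
def rmul (M : DGMod B) (b : B.carrier) : CT 𝕜 M.carrier B.carrier →L[𝕜] CT 𝕜 M.carrier B.carrier :=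
  ctMap (ContinuousLinearMap.id 𝕜 M.carrier) (B.mul ∘L tmR _ b)

theorem rmul_tm (M : DGMod B) (x : M.carrier) (b c : B.carrier) :
    rmul M b (tm 𝕜 x c) = tm 𝕜 x (B.mul (tm 𝕜 c b)) := ctMap_tm _ _ _ _

theorem rmul_eq (M : DGMod B) (b : B.carrier) (t : CT 𝕜 M.carrier B.carrier) :
    rmul M b t = ctMap (ContinuousLinearMap.id 𝕜 M.carrier) B.mul
      (ctAssoc 𝕜 M.carrier B.carrier B.carrier (tm 𝕜 t b)) :=
  ct_ext_apply (rmul M b) (ctMap (ContinuousLinearMap.id 𝕜 M.carrier) B.mul ∘L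
    ctAssoc 𝕜 M.carrier B.carrier B.carrier ∘L tmR _ b) (fun x c => by simp [rmul_tm]) t

theorem act_rmul (M : DGMod B) (b : B.carrier) (t : CT 𝕜 M.carrier B.carrier) :
    M.act (rmul M b t) = M.act (tm 𝕜 (M.act t) b) :=
  ct_ext_apply (M.act ∘L rmul M b) (M.act ∘L tmR _ b ∘L M.act)
    (fun x c => by simp [rmul_tm, M.act_mul]) t

theorem ctMap_rmul {M N : DGMod B} (f : M.carrier →L[𝕜] N.carrier) (b : B.carrier)
    (t : CT 𝕜 M.carrier B.carrier) : ctMap f (ContinuousLinearMap.id 𝕜 B.carrier) (rmul M b t) =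
      rmul N b (ctMap f (ContinuousLinearMap.id 𝕜 B.carrier) t) :=
  ct_ext_apply (ctMap f (ContinuousLinearMap.id 𝕜 B.carrier) ∘L rmul M b)
    (rmul N b ∘L ctMap f (ContinuousLinearMap.id 𝕜 B.carrier)) (fun x c => by simp [rmul_tm]) t

theorem act_ctMap {M N : DGMod B} {k : ℤ} {f : M.carrier →L[𝕜] N.carrier} (hf : f ∈ HomDeg M N k)
    (t : CT 𝕜 M.carrier B.carrier) :
    N.act (ctMap f (ContinuousLinearMap.id 𝕜 B.carrier) t) = f (M.act t) :=
  ct_ext_apply (N.act ∘L ctMap f (ContinuousLinearMap.id 𝕜 B.carrier)) (f ∘L M.act)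
    (fun x c => by simp [hf.2]) t

theorem act_hasDeg (M : DGMod B) : GrSp.HasDeg (V := GrSp.tens M.toGrSp B.toGrSp)
    (W := M.toGrSp) 0 M.act :=
  GrSp.tens_hasDeg fun i j x b hx hb => by simpa using M.act_deg i j x b hx hb

theorem ctMap_hasDeg {V W Y : GrSp.{u} 𝕜} {k : ℤ} {f : V.carrier →L[𝕜] W.carrier}
    (hf : GrSp.HasDeg k f) : GrSp.HasDeg (V := GrSp.tens V Y) (W := GrSp.tens W Y) k
      (ctMap f (ContinuousLinearMap.id 𝕜 Y.carrier)) :=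
  GrSp.tens_hasDeg fun i j v w hv hw => by
    have := (hf i v hv).tm hw
    rw [add_right_comm] at this
    simpa using this

/-- `σ` is a `B`-linear section of degree zero of the action `P ⊗̂ B → P`. -/
structure ActSection (P : DGMod B) (σ : P.carrier →L[𝕜] CT 𝕜 P.carrier B.carrier) : Prop where
  deg : GrSp.HasDeg (V := P.toGrSp) (W := GrSp.tens P.toGrSp B.toGrSp) 0 σ
  act : ∀ x, P.act (σ x) = x
  linear : ∀ x b, σ (P.act (tm 𝕜 x b)) = rmul P b (σ x)

theorem ActSection.relProj {P : DGMod B} {σ : P.carrier →L[𝕜] CT 𝕜 P.carrier B.carrier}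
    (h : ActSection P σ) : RelProj P := fun M N p s hs hps k f hf => by
  have hsf : GrSp.HasDeg (V := P.toGrSp) (W := M.toGrSp) k (s ∘L f) := fun n x hx => by
    simpa using hs _ _ (hf.1 n x hx)
  refine ⟨M.act ∘L ctMap (s ∘L f) (ContinuousLinearMap.id 𝕜 B.carrier) ∘L σ, ⟨fun n x hx => ?_,
    fun x b => ?_⟩, fun x => ?_⟩
  · have h1 := act_hasDeg M _ _ (ctMap_hasDeg (Y := B.toGrSp) hsf _ _ (h.deg n x hx))
    simpa using h1
  · change M.act (ctMap (s ∘L f) (ContinuousLinearMap.id 𝕜 B.carrier) (σ (P.act (tm 𝕜 x b)))) = _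
    rw [h.linear, ctMap_rmul, act_rmul]
    rfl
  · have e : ∀ t : CT 𝕜 P.carrier B.carrier,
        ctMap p.1 (ContinuousLinearMap.id 𝕜 B.carrier)
          (ctMap (s ∘L f) (ContinuousLinearMap.id 𝕜 B.carrier) t) =
        ctMap f (ContinuousLinearMap.id 𝕜 B.carrier) t := fun t =>
      ct_ext_apply (ctMap p.1 (ContinuousLinearMap.id 𝕜 B.carrier) ∘L
          ctMap (s ∘L f) (ContinuousLinearMap.id 𝕜 B.carrier))
        (ctMap f (ContinuousLinearMap.id 𝕜 B.carrier)) (fun x c => by simp [hps]) t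
    change p.1 (M.act (ctMap (s ∘L f) (ContinuousLinearMap.id 𝕜 B.carrier) (σ x))) = f x
    rw [← act_ctMap (hom_mem p), e, act_ctMap hf, h.act]

end RelativelyProjective

section InducedModules

variable {𝕜 : Type} [RCLike 𝕜] {A : DGAlg.{u} 𝕜}

/-- `τ` is an `A`-linear section of degree zero of the action `A ⊗̂ P → P`. -/
structure LeftSection (P : LMod A) (τ : P.carrier →L[𝕜] CT 𝕜 A.carrier P.carrier) : Prop where
  deg : GrSp.HasDeg (V := P.toGrSp) (W := GrSp.tens A.toGrSp P.toGrSp) 0 τ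
  act : ∀ y, P.L (τ y) = y
  linear : ∀ a y, τ (P.L (tm 𝕜 a y)) =
    ctMap (A.mul ∘L tmL _ a) (ContinuousLinearMap.id 𝕜 P.carrier) (τ y)

variable (A) in
theorem leftSection_self : LeftSection (LMod.self A) (tmR _ A.one) where
  deg n a ha := by simpa using ha.tm A.one_deg
  act a := A.mul_one a
  linear a b := by simp

theorem LeftSection.tens {P : LMod A} {τ : P.carrier →L[𝕜] CT 𝕜 A.carrier P.carrier}
    (h : LeftSection P τ) (Y : Cpx.{u} 𝕜) : LeftSection (P.tens Y)
      (ctAssoc 𝕜 A.carrier P.carrier Y.carrier ∘L ctMap τ (ContinuousLinearMap.id 𝕜 Y.carrier)) where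
  deg := GrSp.tens_hasDeg (V := P.toGrSp) (W := Y.toGrSp)
    (Z := GrSp.tens A.toGrSp (GrSp.tens P.toGrSp Y.toGrSp)) fun i j y w hy hw => by
      have h1 : GrSp.HasDeg (V := GrSp.tens A.toGrSp P.toGrSp)
          (W := GrSp.tens A.toGrSp (GrSp.tens P.toGrSp Y.toGrSp)) j
          (ctAssoc 𝕜 A.carrier P.carrier Y.carrier ∘L tmR _ w) :=
        GrSp.tens_hasDeg fun k l a z ha hz => by
          simpa [add_assoc] using ha.tm (hz.tm hw)
      have h2 := h1 _ _ (h.deg i y hy)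
      rw [add_right_comm] at h2
      simpa using h2
  act y := ct_ext_apply (ctMap P.L (ContinuousLinearMap.id 𝕜 Y.carrier) ∘L
      ctAssocInv 𝕜 A.carrier P.carrier Y.carrier ∘L ctAssoc 𝕜 A.carrier P.carrier Y.carrier ∘L
        ctMap τ (ContinuousLinearMap.id 𝕜 Y.carrier)) (ContinuousLinearMap.id 𝕜 _) (fun y w => by
      have e : ∀ t : CT 𝕜 A.carrier P.carrier, ctAssocInv 𝕜 A.carrier P.carrier Y.carrier
          (ctAssoc 𝕜 A.carrier P.carrier Y.carrier (tm 𝕜 t w)) = tm 𝕜 t w := fun t =>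
        ct_ext_apply (ctAssocInv 𝕜 A.carrier P.carrier Y.carrier ∘L
          ctAssoc 𝕜 A.carrier P.carrier Y.carrier ∘L tmR _ w) (tmR _ w) (fun a z => by simp) t
      simp [e, h.act]) y
  linear a y := ct_ext_apply (ctAssoc 𝕜 A.carrier P.carrier Y.carrier ∘L
      ctMap τ (ContinuousLinearMap.id 𝕜 Y.carrier) ∘L ctMap P.L (ContinuousLinearMap.id 𝕜 Y.carrier) ∘L
        ctAssocInv 𝕜 A.carrier P.carrier Y.carrier ∘L tmL _ a)
      (ctMap (A.mul ∘L tmL _ a) (ContinuousLinearMap.id 𝕜 (CT 𝕜 P.carrier Y.carrier)) ∘L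
        ctAssoc 𝕜 A.carrier P.carrier Y.carrier ∘L ctMap τ (ContinuousLinearMap.id 𝕜 Y.carrier))
      (fun y w => by
        have e : ∀ t : CT 𝕜 A.carrier P.carrier, ctAssoc 𝕜 A.carrier P.carrier Y.carrier
            (tm 𝕜 (ctMap (A.mul ∘L tmL _ a) (ContinuousLinearMap.id 𝕜 P.carrier) t) w) =
            ctMap (A.mul ∘L tmL _ a) (ContinuousLinearMap.id 𝕜 (CT 𝕜 P.carrier Y.carrier))
              (ctAssoc 𝕜 A.carrier P.carrier Y.carrier (tm 𝕜 t w)) := fun t =>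
          ct_ext_apply (ctAssoc 𝕜 A.carrier P.carrier Y.carrier ∘L tmR _ w ∘L
              ctMap (A.mul ∘L tmL _ a) (ContinuousLinearMap.id 𝕜 P.carrier))
            (ctMap (A.mul ∘L tmL _ a) (ContinuousLinearMap.id 𝕜 (CT 𝕜 P.carrier Y.carrier)) ∘L
              ctAssoc 𝕜 A.carrier P.carrier Y.carrier ∘L tmR _ w) (fun b z => by simp) t
        simp [h.linear, e]) y

variable (P : LMod A)

/-- The signed flip `a ⊗ z ↦ (-1)^(|a||z|) z ⊗ a`. -/
def signedFlip : CT 𝕜 A.carrier P.carrier →L[𝕜] CT 𝕜 P.carrier A.carrier :=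
  (ctMap (ContinuousLinearMap.id 𝕜 P.carrier)
      ((2⁻¹ : 𝕜) • (ContinuousLinearMap.id 𝕜 A.carrier + A.sgn)) +
    ctMap P.sgn ((2⁻¹ : 𝕜) • (ContinuousLinearMap.id 𝕜 A.carrier - A.sgn))) ∘L
      ctComm 𝕜 A.carrier P.carrier

variable {P} in
theorem signedFlip_tm {m n : ℤ} {a : A.carrier} {z : P.carrier} (ha : A.Deg m a) (hz : P.Deg n z) :
    signedFlip P (tm 𝕜 a z) = ((-1 : 𝕜) ^ (m * n)) • tm 𝕜 z a := by
  rw [← Bimod.koszul_sign]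
  simp only [signedFlip, add_apply, sub_apply, smul_apply, ContinuousLinearMap.comp_apply, ctMap_tm,
    ContinuousLinearMap.id_apply, ha.sgn, hz.sgn, tm_smul_left, tm_smul_right, ctComm_tm,
    tm_add_right, tm_sub_right]
  module

/-- The map `(a ⊗ z) ⊗ b ↦ (-1)^(|a||z|) (z ⊗ 1) ⊗ (a ⊗ b)`. -/
def envLift : CT 𝕜 (CT 𝕜 A.carrier P.carrier) A.carrier →L[𝕜]
    CT 𝕜 (CT 𝕜 P.carrier A.carrier) (CT 𝕜 A.carrier A.carrier) :=
  ctMap (tmR P.carrier A.one) (ContinuousLinearMap.id 𝕜 _) ∘L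
    ctAssoc 𝕜 P.carrier A.carrier A.carrier ∘L
      ctMap (signedFlip P) (ContinuousLinearMap.id 𝕜 A.carrier)

variable {P}

theorem envLift_tm {m n : ℤ} {a b : A.carrier} {z : P.carrier} (ha : A.Deg m a) (hz : P.Deg n z) :
    envLift P (tm 𝕜 (tm 𝕜 a z) b) =
      ((-1 : 𝕜) ^ (m * n)) • tm 𝕜 (tm 𝕜 z A.one) (tm 𝕜 a b) := by
  simp [envLift, signedFlip_tm ha hz]

theorem envLift_ext {Z : Type*} [AddCommGroup Z] [Module 𝕜 Z] [TopologicalSpace Z] [T2Space Z]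
    (f g : CT 𝕜 (CT 𝕜 A.carrier P.carrier) A.carrier →L[𝕜] Z)
    (h : ∀ i j k a z b, A.Deg i a → P.Deg j z → A.Deg k b →
      f (tm 𝕜 (tm 𝕜 a z) b) = g (tm 𝕜 (tm 𝕜 a z) b)) (t) : f t = g t :=
  ct_ext_apply f g (fun s b => homog_ext_apply (V := A.toGrSp) (f ∘L tmL _ s) (g ∘L tmL _ s)
    (fun k b hb => tens_ext_apply (V := A.toGrSp) (W := P.toGrSp) (f ∘L tmR _ b) (g ∘L tmR _ b)
      (fun i j a z ha hz => h i j k a z b ha hz hb) s) b) t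

theorem envLift_deg : GrSp.HasDeg (V := GrSp.tens (GrSp.tens A.toGrSp P.toGrSp) A.toGrSp)
    (W := GrSp.tens (GrSp.tens P.toGrSp A.toGrSp) (GrSp.tens A.toGrSp A.toGrSp)) 0 (envLift P) :=
  GrSp.tens_hasDeg (V := GrSp.tens A.toGrSp P.toGrSp) (W := A.toGrSp) fun m n t b ht hb => by
    have h : GrSp.HasDeg (V := GrSp.tens A.toGrSp P.toGrSp)
        (W := GrSp.tens (GrSp.tens P.toGrSp A.toGrSp) (GrSp.tens A.toGrSp A.toGrSp)) n
        (envLift P ∘L tmR _ b) := GrSp.tens_hasDeg fun i j a z ha hz => by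
      have h := ((hz.tm A.one_deg).tm (ha.tm hb)).smul ((-1 : 𝕜) ^ (i * j))
      rw [show j + 0 + (i + n) = i + j + n by ring, ← envLift_tm ha hz] at h
      exact h
    rw [add_zero]
    exact h m t ht

theorem envAct_envLift (t : CT 𝕜 (CT 𝕜 A.carrier P.carrier) A.carrier) :
    (Bimod.ofLMod P).envAct (envLift P t) = ctMap P.L (ContinuousLinearMap.id 𝕜 A.carrier) t :=
  envLift_ext ((Bimod.ofLMod P).envAct ∘L envLift P) (ctMap P.L (ContinuousLinearMap.id 𝕜 A.carrier))
    (fun i j k a z b ha hz hb => by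
      have h := (Bimod.ofLMod P).envAct_tm (b := b) ha (hz.tm A.one_deg)
      rw [add_zero] at h
      rw [ContinuousLinearMap.comp_apply, envLift_tm ha hz, map_smul, h, smul_smul,
        GrSp.neg_one_zpow_mul_self, one_smul]
      simp [A.one_mul]) t

/-- Right multiplication on `Aᵉ`. -/
def envMulR (s : CT 𝕜 A.carrier A.carrier) :
    CT 𝕜 A.carrier A.carrier →L[𝕜] CT 𝕜 A.carrier A.carrier :=
  (Bimod.ofLMod (LMod.self A)).envAct ∘L tmR (CT 𝕜 A.carrier A.carrier) s

theorem envMulR_tm {i j k : ℤ} {a b c : A.carrier} (e : A.carrier) (ha : A.Deg i a) (hb : A.Deg j b)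
    (hc : A.Deg k c) : envMulR (tm 𝕜 c e) (tm 𝕜 a b) =
      ((-1 : 𝕜) ^ (k * (i + j))) • tm 𝕜 (A.mul (tm 𝕜 c a)) (A.mul (tm 𝕜 b e)) := by
  refine (Bimod.envAct_tm (Bimod.ofLMod (LMod.self A)) (b := e) hc (ha.tm hb)).trans ?_
  simp

theorem envLift_linear {m n k : ℤ} {t : CT 𝕜 A.carrier P.carrier} {b c : A.carrier} (e : A.carrier)
    (ht : (GrSp.tens A.toGrSp P.toGrSp).Deg n t) (hb : A.Deg k b) (hc : A.Deg m c) :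
    ((-1 : 𝕜) ^ (m * (n + k))) • envLift P (tm 𝕜
      (ctMap (A.mul ∘L tmL _ c) (ContinuousLinearMap.id 𝕜 P.carrier) t) (A.mul (tm 𝕜 b e))) =
    ctMap (ContinuousLinearMap.id 𝕜 (CT 𝕜 P.carrier A.carrier)) (envMulR (tm 𝕜 c e))
      (envLift P (tm 𝕜 t b)) := by
  have h := tens_ext_apply (V := A.toGrSp) (W := P.toGrSp)
    (((-1 : 𝕜) ^ (m * (n + k))) • (envLift P ∘L tmR _ (A.mul (tm 𝕜 b e)) ∘L
      ctMap (A.mul ∘L tmL _ c) (ContinuousLinearMap.id 𝕜 P.carrier) ∘L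
        GrSp.tensProj A.toGrSp P.toGrSp n))
    (ctMap (ContinuousLinearMap.id 𝕜 (CT 𝕜 P.carrier A.carrier)) (envMulR (tm 𝕜 c e)) ∘L
      envLift P ∘L tmR _ b ∘L GrSp.tensProj A.toGrSp P.toGrSp n) (fun i j a z ha hz => by
      simp only [smul_apply, ContinuousLinearMap.comp_apply, GrSp.tensProj_tm ha hz]
      split_ifs with hn
      · subst hn
        simp only [ctMap_tm, ContinuousLinearMap.comp_apply, tmL_apply, tmR_apply,
          ContinuousLinearMap.id_apply, envLift_tm ha hz, envLift_tm (A.mul_deg m i c a hc ha) hz,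
          map_smul, envMulR_tm e ha hb hc, tm_smul_right, smul_smul,
          ← zpow_add₀ (show (-1 : 𝕜) ≠ 0 by simp)]
        congr 1
        exact Bimod.neg_one_zpow_congr ⟨m * j, by ring⟩
      · simp) t
  have ht' : GrSp.tensProj A.toGrSp P.toGrSp n t = t := ht
  simpa only [ht', smul_apply, ContinuousLinearMap.comp_apply, tmR_apply] using h

theorem LeftSection.actSection {τ : P.carrier →L[𝕜] CT 𝕜 A.carrier P.carrier}
    (h : LeftSection P τ) : ActSection (Bimod.ofLMod P).toMod
      (envLift P ∘L ctMap τ (ContinuousLinearMap.id 𝕜 A.carrier)) where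
  deg n x hx := by
    have h1 := ctMap_hasDeg (Y := A.toGrSp) h.deg n x hx
    have h2 := envLift_deg _ _ h1
    rw [add_zero] at h2
    exact h2
  act x := (envAct_envLift _).trans (ct_ext_apply
    (ctMap P.L (ContinuousLinearMap.id 𝕜 A.carrier) ∘L ctMap τ (ContinuousLinearMap.id 𝕜 A.carrier))
    (ContinuousLinearMap.id 𝕜 _) (fun y b => by simp [h.act]) x)
  linear x s := by
    rw [rmul_eq]
    refine tens_ext_apply (V := A.toGrSp) (W := A.toGrSp)
      ((envLift P ∘L ctMap τ (ContinuousLinearMap.id 𝕜 A.carrier)) ∘L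
        (Bimod.ofLMod P).envAct ∘L tmL _ x)
      (ctMap (ContinuousLinearMap.id 𝕜 (CT 𝕜 P.carrier A.carrier)) (env A).mul ∘L
        ctAssoc 𝕜 (CT 𝕜 P.carrier A.carrier) (CT 𝕜 A.carrier A.carrier) (CT 𝕜 A.carrier A.carrier) ∘L
          tmL _ (envLift P (ctMap τ (ContinuousLinearMap.id 𝕜 A.carrier) x)))
      (fun m _ c e hc _ => ?_) s
    refine Eq.trans ?_ (rmul_eq (Bimod.ofLMod P).toMod (tm 𝕜 c e)
      (envLift P (ctMap τ (ContinuousLinearMap.id 𝕜 A.carrier) x)))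
    refine tens_ext_apply (V := P.toGrSp) (W := A.toGrSp)
      ((envLift P ∘L ctMap τ (ContinuousLinearMap.id 𝕜 A.carrier)) ∘L
        (Bimod.ofLMod P).envAct ∘L tmR _ (tm 𝕜 c e))
      (ctMap (ContinuousLinearMap.id 𝕜 (CT 𝕜 P.carrier A.carrier)) (envMulR (tm 𝕜 c e)) ∘L
        envLift P ∘L ctMap τ (ContinuousLinearMap.id 𝕜 A.carrier)) (fun n k y b hy hb => ?_) x
    have h1 := (Bimod.ofLMod P).envAct_tm (b := e) hc (hy.tm hb)
    have h2 := h.deg n y hy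
    rw [add_zero] at h2
    have h3 := envLift_linear e h2 hb hc
    simp only [ContinuousLinearMap.comp_apply, tmR_apply, ctMap_tm, ContinuousLinearMap.id_apply]
    rw [← h3, h1]
    simp [h.linear]

end InducedModules

section BarProjective

variable {𝕜 : Type} [RCLike 𝕜] (A : DGAlg.{u} 𝕜)

theorem exists_leftSection : ∀ n, ∃ τ, LeftSection (step A n).P τ
  | 0 => ⟨_, leftSection_self A⟩
  | n + 1 => by
    obtain ⟨τ, h⟩ := exists_leftSection n
    exact ⟨_, h.tens (susp A)⟩

theorem exists_actSection (n : ℕ) : ∃ σ, ActSection (barTerm A n) σ := by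
  obtain ⟨τ, h⟩ := exists_leftSection A n
  exact ⟨_, h.actSection⟩

/-- A linear section of the action on the `n`-th term of the bar construction. -/
def barTermSection (n : ℕ) :
    (barTerm A n).carrier →L[𝕜] CT 𝕜 (barTerm A n).carrier (env A).carrier :=
  (exists_actSection A n).choose

theorem barTermSection_spec (n : ℕ) : ActSection (barTerm A n) (barTermSection A n) :=
  (exists_actSection A n).choose_spec

/-- The part of the section on the bar construction that comes from the `n`-th term. -/
def barSectionPart (n : ℕ) : (Bar A).carrier →L[𝕜] CT 𝕜 (Bar A).carrier (env A).carrier :=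
  ctMap (barIncl A n) (ContinuousLinearMap.id 𝕜 (env A).carrier) ∘L barTermSection A n ∘L barProj A n

theorem barSectionPart_apply (n : ℕ) (x : (Bar A).carrier) : barSectionPart A n x =
    ctMap (barIncl A n) (ContinuousLinearMap.id 𝕜 (env A).carrier)
      (barTermSection A n (barProj A n x)) := rfl

theorem barSectionPart_small : Small (barSectionPart A) := by
  rw [small_iff]
  intro r hr
  obtain ⟨p, q, hp, hq, hb⟩ := bilin_bound (tmₗ 𝕜 (V := (Bar A).carrier) (W := (env A).carrier))
    tm_continuous r hr
  have hU := barIncl_small (A := A) (ball_mem_nhds hp one_pos)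
  rw [Filter.eventually_cofinite] at hU
  refine ⟨hU.toFinset, fun n hn x => GrSp.ct_seminorm_zero
    (V := (barTerm A n).toGrSp) (W := (env A).toGrSp)
    (ctMap (barIncl A n) (ContinuousLinearMap.id 𝕜 (env A).carrier)) r hr (fun y b => ?_) _⟩
  rw [Set.Finite.mem_toFinset, Set.mem_ofPred_eq, not_not] at hn
  have h0 : p (barIncl A n y) = 0 := seminorm_eq_zero p (barIncl A n).toLinearMap hn y
  rw [ctMap_tm]
  refine le_antisymm ((hb _ _).trans_eq ?_) (apply_nonneg _ _)
  rw [h0, zero_mul]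

theorem relProj_bar : RelProj (Bar A) := by
  refine ActSection.relProj (σ := sumCLM (barSectionPart A) (barSectionPart_small A))
    ⟨fun k x hx => ?_, fun x => ?_, fun x b => ?_⟩
  · refine GrSp.Deg.of_tendsto (V := GrSp.tens (Bar A).toGrSp (env A).toGrSp)
      (sumCLM_hasSum _ (barSectionPart_small A) x) fun n => ?_
    have h1 := (barTermSection_spec A n).deg k _ (bar_deg.1 hx n)
    rw [add_zero] at h1 ⊢
    rw [barSectionPart_apply]
    simpa using ctMap_hasDeg (Y := (env A).toGrSp) (barIncl_mem A n).1 _ _ h1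
  · have h1 := (sumCLM_hasSum _ (barSectionPart_small A) x).mapL (Bar A).act
    refine h1.unique ?_
    convert hasSum_barIncl x using 2 with n
    rw [barSectionPart_apply]
    exact (act_ctMap (barIncl_mem A n) _).trans
      (congrArg (barIncl A n) ((barTermSection_spec A n).act (barProj A n x)))
  · have h1 := (sumCLM_hasSum _ (barSectionPart_small A) x).mapL (rmul (Bar A) b)
    refine (sumCLM_hasSum _ (barSectionPart_small A) _).unique ?_
    convert h1 using 2 with n
    rw [barSectionPart_apply, barSectionPart_apply, barProj_act, (barTermSection_spec A n).linear, ctMap_rmul]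

end BarProjective

section Cohomology

variable {𝕜 : Type} [RCLike 𝕜] {B : DGAlg.{u} 𝕜} (M N : DGMod B) (n : ℤ)

/-- A cocycle, as a map in the homotopy category. -/
def cocycleMap : HomZ M N n →ₗ[𝕜] ((toH0 B).obj (Sh M n) ⟶ (toH0 B).obj N) where
  toFun f := (toH0 B).map (ofCocycle f)
  map_add' _ _ := rfl
  map_smul' _ _ := rfl

theorem cocycleMap_surjective : Function.Surjective (cocycleMap M N n) := fun g => by
  obtain ⟨g, rfl⟩ := (toH0 B).map_surjective g
  refine ⟨⟨g.1, mem_HomZ.2 ⟨⟨fun k x hx => ?_, (hom_mem g).2⟩, fun x => ?_⟩⟩, rfl⟩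
  · have h := (hom_mem g).1 (k + n) x (by
      change M.Deg (k + n - n) x
      rwa [add_sub_cancel_right])
    rwa [add_zero] at h
  · exact (closed_zero g x).trans (map_smul g.1 _ _)

theorem ker_cocycleMap :
    LinearMap.ker (cocycleMap M N n) = (HomB M N n).submoduleOf (HomZ M N n) := by
  ext f
  change cocycleMap M N n f = 0 ↔ f.1 ∈ HomB M N n
  have h0 : cocycleMap M N n f = 0 ↔ _ :=
    toH0_map_eq_iff (f := (ofCocycle f : Sh M n ⟶ N)) (g := 0)
  rw [h0]
  have hs : -((-1 : 𝕜) ^ (n - 1)) = (-1) ^ n := by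
    rw [zpow_sub_one₀ (by simp)]; simp
  constructor
  · rintro ⟨h, hh, e⟩
    have hh' : h ∈ HomDeg M N (n - 1) := ⟨fun k x hx => by
      have h1 := hh.1 (k + n) x (by
        change M.Deg (k + n - n) x
        rwa [add_sub_cancel_right])
      rwa [show k + n + -1 = k + (n - 1) by ring] at h1, hh.2⟩
    refine ⟨homD M N (n - 1) ⟨h, hh'⟩, ⟨_, rfl⟩, ContinuousLinearMap.ext fun x => ?_⟩
    have e1 : f.1 x - 0 = N.d (h x) + h (((-1 : 𝕜) ^ n) • M.d x) := e x
    rw [sub_zero, map_smul, ← hs, neg_smul, ← sub_eq_add_neg] at e1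
    exact e1.symm
  · rintro ⟨_, ⟨h, rfl⟩, e⟩
    refine ⟨h.1, ⟨fun k x hx => ?_, h.2.2⟩, fun x => ?_⟩
    · have h1 := h.2.1 (k - n) x hx
      rwa [show k - n + (n - 1) = k + -1 by ring] at h1
    · have e1 : N.d (h.1 x) - ((-1 : 𝕜) ^ (n - 1)) • h.1 (M.d x) = f.1 x :=
        congrArg (fun F : M.carrier →L[𝕜] N.carrier => F x) e
      have e2 : f.1 x - 0 = N.d (h.1 x) + h.1 (((-1 : 𝕜) ^ n) • M.d x) := by
        rw [sub_zero, map_smul, ← hs, neg_smul, ← sub_eq_add_neg, e1]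
      exact e2

/-- Cohomology classes are maps in the homotopy category. -/
def cohomologyEquiv : HomH M N n ≃ₗ[𝕜] ((toH0 B).obj (Sh M n) ⟶ (toH0 B).obj N) :=
  (Submodule.quotEquivOfEq _ _ (ker_cocycleMap M N n).symm).trans
    ((cocycleMap M N n).quotKerEquivOfSurjective (cocycleMap_surjective M N n))

instance : Linear 𝕜 (Dctr B) := Localization.linear 𝕜 (contraIso B).Q (contraIso B)

instance : (contraIso B).Q.Linear 𝕜 := Localization.functor_linear 𝕜 (contraIso B).Q (contraIso B)

variable {M N}

theorem isIso_toDctr_map {f : M ⟶ N} (hf : Contraacyclic (cone f)) : IsIso ((toDctr B).map f) :=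
  Localization.inverts (contraIso B).Q (contraIso B) _ (contraIso_map hf)

variable {P : DGMod B}

theorem exists_cohomology_equiv {n : ℤ} (hP : RelProj P) {f : P ⟶ M} (hf : Contraacyclic (cone f)) :
    ∃ e : HomH P N n ≃ₗ[𝕜] ((toDctr B).obj (M.shift n) ⟶ (toDctr B).obj N),
      ∀ c : HomZ P N n, (toDctr B).map (shiftMap f n) ≫ e (Submodule.Quotient.mk c) =
        (toDctr B).map (ofCocycle c) := by
  have hi : IsIso ((toDctr B).map (shMap f n)) := isIso_toDctr_map (hf.cone_shMap n)
  let i : (contraIso B).Q.obj ((toH0 B).obj (Sh P n)) ≅ (contraIso B).Q.obj ((toH0 B).obj (Sh M n)) :=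
    asIso ((toDctr B).map (shMap f n))
  refine ⟨((cohomologyEquiv P N n).trans (LinearEquiv.ofBijective
    ((contraIso B).Q.mapLinearMap 𝕜) ((hP.sh n).toDctr_bijective N))).trans
      (Linear.homCongr 𝕜 i (Iso.refl _)), fun c => ?_⟩
  change i.hom ≫ (i.inv ≫ (contraIso B).Q.map ((toH0 B).map (ofCocycle c))) ≫ 𝟙 _ = _
  rw [Category.comp_id, i.hom_inv_id_assoc]
  rfl

end Cohomology

end CtrHoch

end

theorem mainTheorem3 {𝕜 : Type} [RCLike 𝕜] (A : DGAlg 𝕜) :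
    (∃ (bS : BInf 𝕜 (HCSum A)) (bC : BInf 𝕜 (HCCont A)) (bP : BInf 𝕜 (HCPi A))
        (j : ∀ N, HCSum A N →ₗ[𝕜] HCCont A N),
      (∀ N (f : HCSum A N), (hcIncl A N (j N f)).1 = f.1) ∧
      (∀ N, Function.Injective (j N)) ∧
      (∀ N, Function.Injective (hcIncl A N)) ∧
      IsBraceStructure bP ∧
      BInf.IsHom bS bC j ∧
      BInf.IsHom bC bP (hcIncl A) ∧
      (∀ N (f : HCCont A N), bC.d (TS.of 𝕜 (V := HCCont A) f) =
        DirectSum.lof 𝕜 ℤ (HCCont A) (N + 1) (hcD A N f)) ∧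
      ∃ g : DGLie 𝕜 (HCCont A), (∀ N, g.d N = hcD A N) ∧
        ∀ (m n : ℤ) (x : HCCont A m) (y : HCCont A n),
          DirectSum.lof 𝕜 ℤ (HCCont A) (m + n) (g.brk m n x y) =
            bC.m (TS.of 𝕜 (V := HCCont A) x) (TS.of 𝕜 (V := HCCont A) y) -
              ((-1 : 𝕜) ^ (m * n)) •
                bC.m (TS.of 𝕜 (V := HCCont A) y) (TS.of 𝕜 (V := HCCont A) x)) ∧
    ∃ (_ : Preadditive (Dctr (env A))) (_ : Linear 𝕜 (Dctr (env A))),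
      (contraIso (env A)).Q.Additive ∧ (contraIso (env A)).Q.Linear 𝕜 ∧
      IsIso ((toDctr (env A)).map (aug A)) ∧
      ∀ N : ℤ, ∃ e : hcH A N ≃ₗ[𝕜]
          ((toDctr (env A)).obj ((selfMod A).shift (N + 1)) ⟶ (toDctr (env A)).obj (selfMod A)),
        ∀ f : HomZ (Bar A) (selfMod A) (N + 1),
          (toDctr (env A)).map (shiftMap (aug A) (N + 1)) ≫ e (Submodule.Quotient.mk f) =
            (toDctr (env A)).map (ofCocycle f) := ⟨exists_hochschild_structures A, inferInstance, inferInstance, inferInstance, inferInstance,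
    isIso_toDctr_map (contraacyclic_cone_aug A), fun _ =>
      exists_cohomology_equiv (relProj_bar A) (contraacyclic_cone_aug A)⟩
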